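/- For $f\in L^1(\mathbb R)$ let $\hat f(\xi)=\int_{\mathbb R}e^{-i\xi y}f(y)\,dy$, fix a sign $\pm$, and consider the equation $$iu_t+u_{xx}\pm\Big(|u|^2-\frac{a^2}{t}\Big)u=0.\qquad(17)$$ For $a>0$ and a function $u_+$ put $$u_a(t,x)=a\,\frac{e^{i\frac{x^2}{4t}}}{\sqrt t},\qquad u_1(t,x)=u_a(t,x)+\frac{e^{\pm ia^2\log t}}{\sqrt{4\pi i}}\;\hat u_+\!\Big(-\frac x2\Big).$$ **Corollary 1.3.** Let $\tilde t_0>0$. There exist constants $a_0>0$ and $\delta>0$ such that for all $0<a<a_0$ and all $u_+\in L^1(\mathbb R)\cap L^2(\mathbb R)\cap L^2(\mathbb R,x^4dx)$ with $\|u_+\|_{L^1}+\|u_+\|_{L^2}<\delta$, equation (17) on $(0,\tilde t_0]\times\mathbb R$ has a weak solution $u$ with $$u-u_1\in C((0,\tilde t_0],L^2(\mathbb R))\cap L^4((0,\tilde t_0],L^\infty(\mathbb R))$$ which satisfies, as $t\to0^+$, $$\|u(t)-u_1(t)\|_{L^2}+\|u-u_1\|_{L^4((0,t),L^\infty)}=\mathcal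 O(t^{\frac14}),\qquad(22)$$ and $u$ is the unique weak solution in this class that satisfies (22). Here $u$ is a weak solution if for every $\psi\in C_c^\infty(\mathbb R)$ and all $0<s\le t\le\tilde t_0$, $$i\Big(\int u(t)\psi\,dx-\int u(s)\psi\,dx\Big)+\int_s^t\Big(\int u(\tau)\psi''\,dx\pm\int\Big(|u(\tau)|^2-\frac{a^2}{\tau}\Big)u(\tau)\psi\,dx\Big)d\tau=0 .$$ Moreover, as $t\to0^+$, $$\Big\|\,|u(t)-u_a(t)|^2-\frac1{4\pi}\Big|\hat u_+\Big(-\frac{\cdot}{2}\Big)\Big|^2\Big\|_{L^1}=\mathcal O(t^{\frac14}),\qquad \|u(t)-u_a(t)\|_{L^2}=\mathcal O(1),$$ but, unless $u_+=0$ almost everywhere, $u(t)-u_a(t)$ has no limit in $L^2(\mathbb R)$ as $t\to0^+$. -/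

import Mathlib

open MeasureTheory Filter Topology Set
open scoped ENNReal NNReal ContDiff FourierTransform

noncomputable section

namespace NLSDelta

/-- The Fourier transform `û(ξ) = ∫ e^{-iξy} u(y) dy`, expressed through Mathlib's `𝓕`
(which has kernel `e^{-2πi y w}`). -/
def hat (f : ℝ → ℂ) (ξ : ℝ) : ℂ := 𝓕 f (ξ / (2 * Real.pi))

theorem hat_eq (f : ℝ → ℂ) (ξ : ℝ) :
    hat f ξ = ∫ y : ℝ, Complex.exp (-(Complex.I * ξ * y)) * f y := by
  unfold hat
  rw [Real.fourier_eq']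
  refine integral_congr_ae (Eventually.of_forall fun y => ?_)
  have h : (2 * Real.pi : ℂ) ≠ 0 := by
    exact_mod_cast (by positivity : (2 * Real.pi : ℝ) ≠ 0)
  have hp : (Real.pi : ℂ) ≠ 0 := by exact_mod_cast Real.pi_ne_zero
  simp only [smul_eq_mul, RCLike.inner_apply, conj_trivial]
  congr 2
  push_cast
  field_simp

/-- The selfsimilar solution `u_a(t,x) = a e^{ix²/4t} / √t`. -/
def uSelf (a t x : ℝ) : ℂ :=
  a * (Complex.exp (Complex.I * ((x ^ 2 / (4 * t) : ℝ) : ℂ)) / ((Real.sqrt t : ℝ) : ℂ))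

/-- The profile
`u₁(t,x) = a e^{ix²/4t} / √t + e^{σ i a² log t} / √(4πi) · û₊(-x/2)`, where `σ = ±1` is the sign in
the equation and `√(4πi)` is the principal square root. -/
def uProfile (σ a : ℝ) (uP : ℝ → ℂ) (t x : ℝ) : ℂ :=
  uSelf a t x
    + Complex.exp (Complex.I * ((σ * a ^ 2 * Real.log t : ℝ) : ℂ))
        / ((4 * (Real.pi : ℂ) * Complex.I) ^ (1 / 2 : ℂ)) * hat uP (-x / 2)

/-- The nonlinear term `(|u|² - a²/t) u` at time `t`, for a function `f = u(t)` of `x`. -/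
def nonlin (a t : ℝ) (f : ℝ → ℂ) (x : ℝ) : ℂ :=
  ((‖f x‖ ^ 2 - a ^ 2 / t : ℝ) : ℂ) * f x

/-- `u` is a weak solution on `(0,T] × ℝ` of `i u_t + u_xx + σ (|u|² - a²/t) u = 0`:
for every test function `ψ ∈ C_c^∞(ℝ)` and `0 < s ≤ t ≤ T`,
`i (∫ u(t) ψ - ∫ u(s) ψ) + ∫_s^t (∫ u(τ) ψ'' + σ ∫ (|u(τ)|² - a²/τ) u(τ) ψ) dτ = 0`,
where all the integrals are required to converge absolutely. -/
def IsWeakSolution (σ a T : ℝ) (u : ℝ → ℝ → ℂ) : Prop :=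
  (∀ t ∈ Ioc 0 T, LocallyIntegrable (u t) volume) ∧
  (∀ᵐ t ∂volume.restrict (Ioc 0 T), LocallyIntegrable (nonlin a t (u t)) volume) ∧
  ∀ ψ : ℝ → ℂ, ContDiff ℝ ∞ ψ → HasCompactSupport ψ →
    ∀ s t : ℝ, 0 < s → s ≤ t → t ≤ T →
      IntervalIntegrable (fun τ => (∫ x, u τ x * iteratedDeriv 2 ψ x)
        + σ * ∫ x, nonlin a τ (u τ) x * ψ x) volume s t ∧
      Complex.I * ((∫ x, u t x * ψ x) - ∫ x, u s x * ψ x)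
        + (∫ τ in s..t, ((∫ x, u τ x * iteratedDeriv 2 ψ x)
            + σ * ∫ x, nonlin a τ (u τ) x * ψ x)) = 0

/-- `w ∈ C((0,T], L²(ℝ))`. -/
def MemCL2 (T : ℝ) (w : ℝ → ℝ → ℂ) : Prop :=
  (∀ t ∈ Ioc 0 T, MemLp (w t) 2 volume) ∧
  ∀ t₀ ∈ Ioc 0 T,
    Tendsto (fun t => eLpNorm (w t - w t₀) 2 volume) (𝓝[Ioc 0 T] t₀) (𝓝 0)

/-- The norm of `w` in `L⁴(I, L^∞(ℝ))`. -/
def normL4Linf (I : Set ℝ) (w : ℝ → ℝ → ℂ) : ℝ≥0∞ :=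
  (∫⁻ t in I, (eLpNorm (w t) ⊤ volume) ^ 4) ^ (1 / 4 : ℝ)

/-- `f(t) = O(t^r)` as `t → 0⁺`, for a quantity `f(t) ∈ [0,∞]`. -/
def IsBigOZero (f : ℝ → ℝ≥0∞) (r : ℝ) : Prop :=
  ∃ C : ℝ≥0, ∀ᶠ t in 𝓝[>] (0 : ℝ), f t ≤ C * ENNReal.ofReal (t ^ r)

/-- `u` solves `i u_t + u_xx + σ (|u|² - a²/t) u = 0` on `(0,T] × ℝ`, with
`u - u₁ ∈ C((0,T], L²) ∩ L⁴((0,T], L^∞)`, and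
`‖u(t) - u₁(t)‖_{L²} + ‖u - u₁‖_{L⁴((0,t), L^∞)} = O(t^{1/4})` as `t → 0⁺`. -/
structure IsAsymptoticSolution (σ a T : ℝ) (uP : ℝ → ℂ) (u : ℝ → ℝ → ℂ) : Prop where
  solves : IsWeakSolution σ a T u
  memCL2 : MemCL2 T (u - uProfile σ a uP)
  memL4Linf : normL4Linf (Ioc 0 T) (u - uProfile σ a uP) < ⊤
  decay : IsBigOZero (fun t => eLpNorm (u t - uProfile σ a uP t) 2 volume
    + normL4Linf (Ioo 0 t) (u - uProfile σ a uP)) (1 / 4)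

end NLSDelta

end

/-!
Write `u = u_a + W`. The perturbation solves `iW_t + W_xx + σN(W) = 0`, where
`N(W) = (|u_a + W|² - a²/t)(u_a + W)` (`nlin`) has the linear part `(a²/t) W + u_a² W̄`, whose size
`a²/t` is not integrable at `t = 0`. Both linear terms can still be dealt with explicitly.

* The term `(a²/t) W` only rotates the phase: with `P = û₊(-x/2)/√(4πi)`, the function
  `freeW = e^{iσa² log t} e^{it∂²} P` solves `iW_t + W_xx + σ(a²/t)W = 0` exactly (`mildOn_freeW`).
* The term `u_a² W̄`, evaluated at `freeW`, oscillates. By the pseudo-conformal identity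
  `schr_chirp_conj`, pulling it back by `e^{-it∂²}` gives a constant times
  `t^{-1-iσa²} e^{-ix²/2t} g(x)`, where `g` is bounded. The integral of this from time `0` converges
  conditionally and is `O(t^{1/4})` in `L²` (`norm_integral_respDeriv_le`); its free evolution is
  bounded in `x` (`supAv_schr_chirp_fourierInv_le`). This yields the response `Z` of
  `exists_response`.

With `W = freeW + z`, what remains is `z = Z + ∫₀ᵗ e^{i(t-s)∂²} (iσ · source) ds`. At `z = 0` the
source is at least quadratic in `freeW` (`norm_nlin_sub_linear_le`), hence integrable in time. Its
dependence on `z` has the coefficient `7a²/s` plus integrable terms, and against the weight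
`s^{1/4}` this costs only the factor `∫₀ᵗ (7a²/s) s^{1/4} ds = 28a² t^{1/4}`, which is small for
small `a` although `a²/s` is not integrable. A contraction in the norm `sup_t t^{-1/4} ‖z(t)‖₂`
therefore gives `z` (`exists_correction`), and the same computation followed by a Gronwall argument
gives uniqueness (`eqOn_of_mildOn`). The space `L⁴L^∞` is reached by the Strichartz estimate from
`L¹L²` (`strichartz`), which follows from the dispersive estimate, the Hardy–Littlewood–Sobolev
inequality on the line and duality. In these arguments `‖·‖_∞` is written as a countable supremum
of moduli of averages (`supAv`), that is, of continuous linear functionals on `L²`; this makes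
measurability, semicontinuity and linearisation elementary.

Continuous weak solutions are the same as mild ones (`WeakOn.mildOn`, `isWeakSolution_iff`), and the
weight `x⁴` on `u₊` makes `e^{it∂²}P - P` of order `t` in `L²`, so that the stated profile may be
exchanged for the free evolution `freeW` (`isAsymptoticSolution_iff`). Finally
`u - u_a = e^{iσa² log t} P + O(t^{1/4})` in `L²`: the modulus converges, but the phase changes sign
under `t ↦ e^{π/(σa²)} t`, so that there is no limit unless `P = 0`
(`eq_zero_of_tendsto_logPhase_smul`).
-/

noncomputable section

namespace NLSDelta

/-! ### Functions as elements of `L²(ℝ)` -/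

/-- The Hilbert space `L²(ℝ)` of complex functions. -/
abbrev L2C := Lp ℂ 2 (volume : Measure ℝ)

/-- The class in `L²(ℝ)` of a function, with the value `0` if it is not square integrable. -/
def toL2 (f : ℝ → ℂ) : L2C := open Classical in if h : MemLp f 2 volume then h.toLp f else 0

theorem toL2_eq {f : ℝ → ℂ} (h : MemLp f 2 volume) : toL2 f = h.toLp f := by
  unfold toL2; rw [dif_pos h]

theorem coeFn_toL2 {f : ℝ → ℂ} (h : MemLp f 2 volume) : toL2 f =ᵐ[volume] f := by
  rw [toL2_eq h]; exact h.coeFn_toLp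

theorem toL2_coe (f : L2C) : toL2 f = f := by
  rw [toL2_eq (Lp.memLp f)]; exact Lp.toLp_coeFn f (Lp.memLp f)

theorem toL2_congr {f g : ℝ → ℂ} (h : f =ᵐ[volume] g) : toL2 f = toL2 g := by
  by_cases hf : MemLp f 2 volume
  · rw [toL2_eq hf, toL2_eq ((memLp_congr_ae h).1 hf)]
    exact (MemLp.toLp_eq_toLp_iff _ _).2 h
  · unfold toL2
    rw [dif_neg hf, dif_neg (fun hg => hf ((memLp_congr_ae h).2 hg))]

theorem eq_toL2 {f : L2C} {g : ℝ → ℂ} (h : f =ᵐ[volume] g) : f = toL2 g := by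
  rw [← toL2_congr h, toL2_coe]

theorem enorm_toL2 {f : ℝ → ℂ} (h : MemLp f 2 volume) : ‖toL2 f‖ₑ = eLpNorm f 2 volume := by
  rw [toL2_eq h, Lp.enorm_toLp]

theorem enorm_coe (f : L2C) : eLpNorm f 2 volume = ‖f‖ₑ := by
  rw [Lp.enorm_def]

theorem toL2_sub {f g : ℝ → ℂ} (hf : MemLp f 2 volume) (hg : MemLp g 2 volume) :
    toL2 (f - g) = toL2 f - toL2 g := by
  rw [toL2_eq hf, toL2_eq hg, toL2_eq (hf.sub hg), MemLp.toLp_sub]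

theorem toL2_add {f g : ℝ → ℂ} (hf : MemLp f 2 volume) (hg : MemLp g 2 volume) :
    toL2 (f + g) = toL2 f + toL2 g := by
  rw [toL2_eq hf, toL2_eq hg, toL2_eq (hf.add hg), MemLp.toLp_add]

theorem toL2_const_mul {f : ℝ → ℂ} (hf : MemLp f 2 volume) (c : ℂ) :
    toL2 (fun x => c * f x) = c • toL2 f := by
  rw [toL2_eq hf, toL2_eq (hf.const_mul c), ← MemLp.toLp_const_smul]
  rfl

theorem inner_eq_integral (f g : L2C) : inner ℂ f g = ∫ x, starRingEnd ℂ (f x) * g x := by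
  rw [L2.inner_def]
  refine integral_congr_ae (Eventually.of_forall fun x => ?_)
  simp [RCLike.inner_apply, mul_comm]

theorem integrable_conj_mul {f g : ℝ → ℂ} (hf : MemLp f 2 volume) (hg : MemLp g 2 volume) :
    Integrable (fun x => starRingEnd ℂ (f x) * g x) volume := by
  have h2 : MemLp (fun x => starRingEnd ℂ (f x)) 2 volume := hf.star
  exact MemLp.integrable_mul h2 hg

theorem inner_toL2_toL2 {f g : ℝ → ℂ} (hf : MemLp f 2 volume) (hg : MemLp g 2 volume) :
    inner ℂ (toL2 f) (toL2 g) = ∫ x, starRingEnd ℂ (f x) * g x := by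
  rw [inner_eq_integral]
  refine integral_congr_ae ?_
  filter_upwards [coeFn_toL2 hf, coeFn_toL2 hg] with x h1 h2
  rw [h1, h2]

theorem memLp_of_bound {f : ℝ → ℂ} {G : ℝ → ℝ} (hf : AEStronglyMeasurable f volume)
    (hG : MemLp G 2 volume) (h : ∀ᵐ x, ‖f x‖ ≤ G x) : MemLp f 2 volume :=
  hG.of_le hf (h.mono fun _ hx => hx.trans (Real.le_norm_self _))

theorem norm_toL2_le {f : ℝ → ℂ} {g : L2C} {c : ℝ} (hf : AEStronglyMeasurable f volume)
    (h : ∀ᵐ x, ‖f x‖ ≤ c * ‖g x‖) : MemLp f 2 volume ∧ ‖toL2 f‖ ≤ c * ‖g‖ := by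
  have hm : MemLp f 2 volume := MemLp.of_le_mul (Lp.memLp g) hf h
  refine ⟨hm, Lp.norm_le_mul_norm_of_ae_le_mul ?_⟩
  filter_upwards [coeFn_toL2 hm, h] with x h1 h2
  rwa [h1]

theorem eLpNorm_two_sq (f : ℝ → ℂ) : eLpNorm f 2 volume ^ 2 = ∫⁻ x, ‖f x‖ₑ ^ 2 := by
  have := eLpNorm_nnreal_pow_eq_lintegral (f := f) (μ := volume) (p := 2) (by norm_num)
  simpa using this

/-- Dominated convergence in `L²(ℝ)`. -/
theorem tendsto_toL2_of_dominated {ι : Type*} {l : Filter ι} [l.IsCountablyGenerated]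
    {f : ι → ℝ → ℂ} {g : ℝ → ℂ} {G : ℝ → ℝ}
    (hf : ∀ᶠ n in l, AEStronglyMeasurable (f n) volume) (hG : MemLp G 2 volume)
    (hb : ∀ᶠ n in l, ∀ᵐ x, ‖f n x‖ ≤ G x) (hg : MemLp g 2 volume)
    (hlim : ∀ᵐ x, Tendsto (fun n => f n x) l (𝓝 (g x))) :
    Tendsto (fun n => toL2 (f n)) l (𝓝 (toL2 g)) := by
  rw [tendsto_iff_edist_tendsto_0]
  have hS : MemLp (fun x => G x + ‖g x‖) 2 volume := hG.add hg.norm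
  have hfin : ∫⁻ x, ‖G x + ‖g x‖‖ₑ ^ 2 ≠ ⊤ := by
    have h1 := eLpNorm_nnreal_pow_eq_lintegral (f := fun x => G x + ‖g x‖) (μ := volume)
      (p := 2) (by norm_num)
    have h2 : ∫⁻ x, ‖G x + ‖g x‖‖ₑ ^ 2 = eLpNorm (fun x => G x + ‖g x‖) 2 volume ^ 2 := by
      simpa using h1.symm
    rw [h2]
    exact ENNReal.pow_ne_top hS.eLpNorm_ne_top
  have key : Tendsto (fun n => ∫⁻ x, ‖f n x - g x‖ₑ ^ 2) l (𝓝 (∫⁻ _ : ℝ, (0 : ℝ≥0∞))) := by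
    refine tendsto_lintegral_filter_of_dominated_convergence' (fun x => ‖G x + ‖g x‖‖ₑ ^ 2)
      ?_ ?_ hfin ?_
    · filter_upwards [hf] with n hn
      exact (hn.sub hg.1).enorm.pow_const 2
    · filter_upwards [hb] with n hn
      filter_upwards [hn] with x hx
      gcongr
      rw [enorm_le_iff_norm_le]
      calc ‖f n x - g x‖ ≤ ‖f n x‖ + ‖g x‖ := norm_sub_le _ _
        _ ≤ G x + ‖g x‖ := by gcongr
        _ ≤ _ := Real.le_norm_self _
    · filter_upwards [hlim] with x hx
      have h0 : Tendsto (fun n => ‖f n x - g x‖ₑ ^ 2) l (𝓝 (‖g x - g x‖ₑ ^ 2)) :=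
        ((ENNReal.continuous_pow 2).tendsto _).comp
          ((continuous_enorm.tendsto _).comp (hx.sub_const (g x)))
      simpa using h0
  simp only [lintegral_zero] at key
  have key2 : Tendsto (fun n => (∫⁻ x, ‖f n x - g x‖ₑ ^ 2) ^ (1 / 2 : ℝ)) l (𝓝 0) := by
    have := (ENNReal.continuous_rpow_const (y := (1 / 2 : ℝ))).tendsto 0 |>.comp key
    simpa [Function.comp_def] using this
  refine key2.congr' ?_
  filter_upwards [hf, hb] with n hn hbn
  have hm := memLp_of_bound hn hG hbn
  rw [edist_eq_enorm_sub, ← toL2_sub hm hg, enorm_toL2 (hm.sub hg)]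
  have h2 := eLpNorm_two_sq (f n - g)
  have h3 : (∫⁻ x, ‖f n x - g x‖ₑ ^ 2) = eLpNorm (f n - g) 2 volume ^ 2 := by
    rw [h2]; rfl
  rw [h3, ← ENNReal.rpow_natCast, ← ENNReal.rpow_mul]
  norm_num

/-- If a sequence converges in `L²(ℝ)` and also converges pointwise almost everywhere, then the
limits agree. -/
theorem coeFn_eq_of_tendsto {f : ℕ → L2C} {g : L2C} {φ : ℕ → ℝ → ℂ} {ψ : ℝ → ℂ}
    (h : Tendsto f atTop (𝓝 g)) (hφ : ∀ n, f n =ᵐ[volume] φ n)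
    (hlim : ∀ᵐ x, Tendsto (fun n => φ n x) atTop (𝓝 (ψ x))) : g =ᵐ[volume] ψ := by
  have h1 : Tendsto (fun n => eLpNorm (fun x => f n x - g x) 2 volume) atTop (𝓝 0) :=
    (Lp.tendsto_Lp_iff_tendsto_eLpNorm' f g).1 h
  have h2 := tendstoInMeasure_of_tendsto_eLpNorm (p := 2) (by norm_num)
    (fun n => (Lp.memLp (f n)).1) (Lp.memLp g).1 h1
  obtain ⟨ns, hns, h3⟩ := h2.exists_seq_tendsto_ae
  filter_upwards [h3, hlim, ae_all_iff.2 hφ] with x hx1 hx2 hx3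
  have h4 := hx2.comp hns.tendsto_atTop
  refine tendsto_nhds_unique hx1 (h4.congr fun n => ?_)
  exact (hx3 _).symm

/-- Differentiation in `L²(ℝ)` under a dominated pointwise derivative. -/
theorem hasDerivAt_toL2 {f f' : ℝ → ℝ → ℂ} {G : ℝ → ℝ} {t₀ ε : ℝ} (hε : 0 < ε)
    (hf : ∀ t ∈ Metric.ball t₀ ε, MemLp (f t) 2 volume) (hG : MemLp G 2 volume)
    (hf' : AEStronglyMeasurable (f' t₀) volume)
    (hb : ∀ᵐ x, ∀ t ∈ Metric.ball t₀ ε, ‖f' t x‖ ≤ G x)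
    (hd : ∀ᵐ x, ∀ t ∈ Metric.ball t₀ ε, HasDerivAt (fun s => f s x) (f' t x) t) :
    HasDerivAt (fun t => toL2 (f t)) (toL2 (f' t₀)) t₀ := by
  have hmem0 := Metric.mem_ball_self (x := t₀) hε
  have hm' : MemLp (f' t₀) 2 volume :=
    memLp_of_bound hf' hG (hb.mono fun _ hx => hx t₀ hmem0)
  rw [hasDerivAt_iff_tendsto_slope]
  have hev : ∀ᶠ t in 𝓝[≠] t₀, t ∈ Metric.ball t₀ ε :=
    nhdsWithin_le_nhds (Metric.ball_mem_nhds _ hε)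
  have key : Tendsto (fun t => toL2 (fun x => slope (fun s => f s x) t₀ t)) (𝓝[≠] t₀)
      (𝓝 (toL2 (f' t₀))) := by
    refine tendsto_toL2_of_dominated (G := G) ?_ hG ?_ hm' ?_
    · filter_upwards [hev] with t ht
      simp only [slope, vsub_eq_sub]
      exact ((hf t ht).1.sub (hf t₀ hmem0).1).const_smul _
    · filter_upwards [hev, self_mem_nhdsWithin] with t ht hne
      filter_upwards [hb, hd] with x hx1 hx2
      have := (convex_ball t₀ ε).norm_image_sub_le_of_norm_hasDerivWithin_le
        (fun s hs => (hx2 s hs).hasDerivWithinAt) hx1 hmem0 ht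
      rw [slope_def_module, norm_smul, norm_inv]
      have h0 : 0 < ‖t - t₀‖ := norm_pos_iff.2 (sub_ne_zero.2 hne)
      rw [inv_mul_le_iff₀ h0, mul_comm]
      exact this
    · filter_upwards [hd] with x hx
      exact hasDerivAt_iff_tendsto_slope.1 (hx t₀ hmem0)
  refine key.congr' ?_
  filter_upwards [hev] with t ht
  rw [slope_def_module, ← toL2_sub (hf t ht) (hf t₀ hmem0)]
  have h1 : ((t - t₀)⁻¹ • toL2 (f t - f t₀) : L2C) =
      (((t - t₀)⁻¹ : ℝ) : ℂ) • toL2 (f t - f t₀) := (RCLike.real_smul_eq_coe_smul _ _)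
  rw [h1, ← toL2_const_mul ((hf t ht).sub (hf t₀ hmem0))]
  congr 1

/-! ### Multiplication by quadratic phases -/

/-- The quadratic phase `e^{iβx²}`. -/
def phase (β x : ℝ) : ℂ := Complex.exp (Complex.I * ((β * x ^ 2 : ℝ) : ℂ))

theorem norm_phase (β x : ℝ) : ‖phase β x‖ = 1 := by
  unfold phase; rw [mul_comm]; exact Complex.norm_exp_ofReal_mul_I _

theorem phase_add (β γ x : ℝ) : phase (β + γ) x = phase β x * phase γ x := by
  unfold phase; rw [← Complex.exp_add]; congr 1; push_cast; ring

theorem phase_zero (x : ℝ) : phase 0 x = 1 := by simp [phase]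

theorem continuous_phase₂ : Continuous (fun p : ℝ × ℝ => phase p.1 p.2) := by
  unfold phase; fun_prop

theorem continuous_phase (β : ℝ) : Continuous (phase β) := by
  unfold phase; fun_prop

theorem conj_phase (β x : ℝ) : starRingEnd ℂ (phase β x) = phase (-β) x := by
  unfold phase
  rw [← Complex.exp_conj]
  congr 1
  rw [map_mul, Complex.conj_I, Complex.conj_ofReal]
  push_cast
  ring

theorem memLp_phase_mul (β : ℝ) {f : ℝ → ℂ} (hf : MemLp f 2 volume) :
    MemLp (fun x => phase β x * f x) 2 volume :=
  hf.of_le ((continuous_phase β).aestronglyMeasurable.mul hf.1)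
    (Eventually.of_forall fun x => by simp [norm_phase])

theorem phase_mul_phase_neg (β : ℝ) (f : L2C) :
    toL2 (fun x => phase β x * (toL2 (fun y => phase (-β) y * f y)) x) = f := by
  symm
  refine eq_toL2 ?_
  filter_upwards [coeFn_toL2 (memLp_phase_mul (-β) (Lp.memLp f))] with x hx
  rw [hx, ← mul_assoc, ← phase_add]
  simp [phase_zero]

/-- Multiplication by the phase `e^{iβx²}` as a unitary operator on `L²(ℝ)`. -/
def chirp (β : ℝ) : L2C ≃ₗᵢ[ℂ] L2C where
  toFun f := toL2 (fun x => phase β x * f x)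
  invFun f := toL2 (fun x => phase (-β) x * f x)
  map_add' f g := by
    rw [← toL2_add (memLp_phase_mul β (Lp.memLp f)) (memLp_phase_mul β (Lp.memLp g))]
    refine toL2_congr ?_
    filter_upwards [Lp.coeFn_add f g] with x hx
    simp only [hx, Pi.add_apply, mul_add]
  map_smul' c f := by
    rw [RingHom.id_apply, ← toL2_const_mul (memLp_phase_mul β (Lp.memLp f))]
    refine toL2_congr ?_
    filter_upwards [Lp.coeFn_smul c f] with x hx
    simp only [hx, Pi.smul_apply, smul_eq_mul]
    ring
  left_inv f := by simpa using phase_mul_phase_neg (-β) f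
  right_inv f := by simpa using phase_mul_phase_neg β f
  norm_map' f := by
    change ‖toL2 (fun x => phase β x * f x)‖ = ‖f‖
    rw [toL2_eq (memLp_phase_mul β (Lp.memLp f)), Lp.norm_toLp, Lp.norm_def]
    congr 1
    refine eLpNorm_congr_norm_ae (Eventually.of_forall fun x => ?_)
    simp [norm_phase]

theorem chirp_apply (β : ℝ) (f : L2C) : chirp β f = toL2 (fun x => phase β x * f x) := rfl

theorem coeFn_chirp (β : ℝ) (f : L2C) : chirp β f =ᵐ[volume] fun x => phase β x * f x :=
  coeFn_toL2 (memLp_phase_mul β (Lp.memLp f))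

theorem chirp_toL2 (β : ℝ) {f : ℝ → ℂ} (hf : MemLp f 2 volume) :
    chirp β (toL2 f) = toL2 (fun x => phase β x * f x) := by
  rw [chirp_apply]
  refine toL2_congr ?_
  filter_upwards [coeFn_toL2 hf] with x hx
  rw [hx]

theorem chirp_chirp (β γ : ℝ) (f : L2C) : chirp β (chirp γ f) = chirp (β + γ) f := by
  rw [chirp_apply γ, chirp_toL2 β (memLp_phase_mul γ (Lp.memLp f)), chirp_apply]
  congr 1
  ext x
  rw [phase_add]; ring

theorem chirp_zero (f : L2C) : chirp 0 f = f := by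
  rw [chirp_apply]
  simp only [phase_zero, one_mul]
  exact toL2_coe f

theorem continuous_chirp (f : L2C) : Continuous (fun β => chirp β f) := by
  rw [continuous_iff_continuousAt]
  intro β
  refine tendsto_toL2_of_dominated (G := fun x => ‖f x‖) ?_ (Lp.memLp f).norm ?_
    (memLp_phase_mul β (Lp.memLp f)) ?_
  · exact Eventually.of_forall fun γ =>
      (continuous_phase γ).aestronglyMeasurable.mul (Lp.memLp f).1
  · exact Eventually.of_forall fun γ => Eventually.of_forall fun x => by simp [norm_phase]
  · refine Eventually.of_forall fun x => ?_
    have : Continuous (fun γ => phase γ x * f x) :=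
      (continuous_phase₂.comp (continuous_id.prodMk continuous_const)).mul continuous_const
    exact this.tendsto β

/-- A strongly continuous family of isometries is jointly continuous. -/
theorem continuous_isometry_family {X : Type*} [TopologicalSpace X] {A : X → L2C ≃ₗᵢ[ℂ] L2C}
    (hA : ∀ f, Continuous fun t => A t f) : Continuous fun p : X × L2C => A p.1 p.2 := by
  rw [continuous_iff_continuousAt]
  rintro ⟨t, f⟩
  unfold ContinuousAt
  rw [tendsto_iff_norm_sub_tendsto_zero]
  have h1 : Tendsto (fun p : X × L2C => ‖p.2 - f‖ + ‖A p.1 f - A t f‖) (𝓝 (t, f)) (𝓝 0) := by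
    have h2 : Continuous fun p : X × L2C => ‖p.2 - f‖ + ‖A p.1 f - A t f‖ :=
      ((continuous_snd.sub continuous_const).norm).add
        ((((hA f).comp continuous_fst).sub continuous_const).norm)
    have := h2.tendsto (t, f)
    simpa using this
  refine squeeze_zero (fun _ => norm_nonneg _) (fun p => ?_) h1
  calc ‖A p.1 p.2 - A t f‖ = ‖A p.1 (p.2 - f) + (A p.1 f - A t f)‖ := by
        rw [map_sub]; congr 1; abel
    _ ≤ ‖A p.1 (p.2 - f)‖ + ‖A p.1 f - A t f‖ := norm_add_le _ _
    _ = _ := by rw [LinearIsometryEquiv.norm_map]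

theorem coeFn_star_eq (f : L2C) : (star f : L2C) =ᵐ[volume] fun x => starRingEnd ℂ (f x) := by
  filter_upwards [Lp.coeFn_star f] with x hx
  rw [hx]; rfl

/-! ### The essential supremum as a countable supremum of averages -/

/-- The indicator function of the interval `(i.1, i.2)`, divided by its length; it is zero if the
interval is empty. -/
def probe (i : ℚ × ℚ) : L2C :=
  (((i.2 - i.1 : ℝ) : ℂ)⁻¹) •
    indicatorConstLp 2 (measurableSet_Ioo (a := (i.1 : ℝ)) (b := i.2)) (by simp) 1

theorem inner_probe (i : ℚ × ℚ) (f : L2C) :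
    inner ℂ (probe i) f = ((i.2 - i.1 : ℝ) : ℂ)⁻¹ * ∫ x in Ioo (i.1 : ℝ) i.2, f x := by
  unfold probe
  rw [inner_smul_left, L2.inner_indicatorConstLp_one, map_inv₀, Complex.conj_ofReal]

/-- The supremum of the moduli of all averages over rational intervals; it is the essential
supremum (`eLpNorm_top_eq`), and its form makes semicontinuity in `f` evident. -/
def supAv (f : L2C) : ℝ≥0∞ := ⨆ i : ℚ × ℚ, ‖(inner ℂ (probe i) f : ℂ)‖ₑ

theorem enorm_inner_probe_le (i : ℚ × ℚ) (f : L2C) :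
    ‖(inner ℂ (probe i) f : ℂ)‖ₑ ≤ eLpNorm f ⊤ volume := by
  by_cases hM : eLpNorm f ⊤ volume = ⊤
  · rw [hM]; exact le_top
  obtain ⟨M, hM⟩ := WithTop.ne_top_iff_exists.1 hM
  replace hM : (M : ℝ≥0∞) = eLpNorm f ⊤ volume := hM
  rw [← hM]
  have hae : ∀ᵐ x, ‖f x‖ ≤ M := by
    have := ae_le_eLpNormEssSup (f := f) (μ := volume)
    rw [← eLpNorm_exponent_top, ← hM] at this
    filter_upwards [this] with x hx
    exact_mod_cast enorm_le_coe.1 hx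
  rw [enorm_le_coe, ← NNReal.coe_le_coe, coe_nnnorm, inner_probe, norm_mul, norm_inv,
    Complex.norm_real, Real.norm_eq_abs]
  rcases le_or_gt (i.2 : ℝ) i.1 with h | h
  · rw [Ioo_eq_empty (not_lt.2 h)]; simp
  · have hpos : (0 : ℝ) < i.2 - i.1 := sub_pos.2 h
    have h1 : ‖∫ x in Ioo (i.1 : ℝ) i.2, f x‖ ≤ M * (volume : Measure ℝ).real (Ioo (i.1 : ℝ) i.2) :=
      norm_setIntegral_le_of_norm_le_const_ae (by simp) (ae_restrict_of_ae hae)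
    rw [Real.volume_real_Ioo_of_le h.le] at h1
    rw [abs_of_pos hpos, inv_mul_le_iff₀ hpos, mul_comm]
    exact h1

/-- By Lebesgue differentiation almost every value is a limit of averages over rational intervals. -/
theorem eLpNorm_top_eq (f : L2C) : eLpNorm f ⊤ volume = supAv f := by
  refine le_antisymm ?_ (iSup_le fun i => enorm_inner_probe_le i f)
  by_cases hM : supAv f = ⊤
  · rw [hM]; exact le_top
  obtain ⟨M, hM'⟩ := WithTop.ne_top_iff_exists.1 hM
  replace hM' : (M : ℝ≥0∞) = supAv f := hM'
  have hM1 : ∀ i : ℚ × ℚ, ‖(inner ℂ (probe i) f : ℂ)‖ ≤ M := by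
    intro i
    have : ‖(inner ℂ (probe i) f : ℂ)‖ₑ ≤ M := by
      rw [hM']; exact le_iSup (fun i : ℚ × ℚ => ‖(inner ℂ (probe i) f : ℂ)‖ₑ) i
    exact_mod_cast enorm_le_coe.1 this
  rw [eLpNorm_exponent_top, ← hM']
  refine eLpNormEssSup_le_of_ae_enorm_bound ?_
  have hloc : LocallyIntegrable f volume := (Lp.memLp f).locallyIntegrable (by norm_num)
  filter_upwards [IsUnifLocDoublingMeasure.ae_tendsto_average volume hloc 1] with x hx
  have hδ : ∀ n : ℕ, (0 : ℚ) < 1 / ((n : ℚ) + 1) := fun n => by positivity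
  -- the intervals have rational centres near `x`, which is allowed in the differentiation theorem for
  -- doubling measures as long as they contain `x`
  have hq : ∀ n : ℕ, ∃ q : ℚ, |x - q| < ((1 / ((n : ℚ) + 1) : ℚ) : ℝ) := fun n => by
    have h0 : (0 : ℝ) < ((1 / ((n : ℚ) + 1) : ℚ) : ℝ) := by exact_mod_cast hδ n
    obtain ⟨q, h1, h2⟩ := exists_rat_btwn (show x - ((1 / ((n : ℚ) + 1) : ℚ) : ℝ) < x by linarith)
    exact ⟨q, by rw [abs_lt]; constructor <;> linarith⟩
  choose q hq using hq
  have hlim := @hx ℕ atTop (fun n => (q n : ℝ)) (fun n => ((1 / ((n : ℚ) + 1) : ℚ) : ℝ)) ?_ ?_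
  · have hbd : ∀ n : ℕ, ‖⨍ y in Metric.closedBall (q n : ℝ) ((1 / ((n : ℚ) + 1) : ℚ) : ℝ), f y‖
        ≤ M := by
      intro n
      have h2 := hM1 (q n - 1 / ((n : ℚ) + 1), q n + 1 / ((n : ℚ) + 1))
      rw [inner_probe] at h2
      refine le_trans (le_of_eq ?_) h2
      congr 1
      rw [setAverage_eq, Real.closedBall_eq_Icc, integral_Icc_eq_integral_Ioo,
        Real.volume_real_Icc_of_le (by have : (0:ℝ) < ((1 / ((n : ℚ) + 1) : ℚ) : ℝ) := by
                                        exact_mod_cast hδ n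
                                       linarith)]
      rw [Complex.real_smul]
      push_cast
      rfl
    have h3 := le_of_tendsto hlim.norm (Eventually.of_forall hbd)
    rw [enorm_le_coe]
    exact_mod_cast h3
  · refine tendsto_nhdsWithin_iff.2 ⟨?_, Eventually.of_forall fun n => ?_⟩
    · have := tendsto_one_div_add_atTop_nhds_zero_nat (𝕜 := ℝ)
      refine this.congr fun n => ?_
      push_cast; rfl
    · have := hδ n
      show (0 : ℝ) < _
      exact_mod_cast this
  · refine Eventually.of_forall fun n => ?_
    rw [Metric.mem_closedBall, Real.dist_eq, one_mul]
    exact (hq n).le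

theorem aemeasurable_supAv {μ : Measure ℝ} {y : ℝ → L2C} (hy : AEStronglyMeasurable y μ) :
    AEMeasurable (fun t => supAv (y t)) μ := by
  unfold supAv
  refine AEMeasurable.iSup fun i => ?_
  exact (AEStronglyMeasurable.inner aestronglyMeasurable_const hy).enorm

theorem lowerSemicontinuous_supAv : LowerSemicontinuous supAv := by
  unfold supAv
  refine lowerSemicontinuous_iSup fun i => ?_
  exact (continuous_enorm.comp (continuous_const.inner continuous_id)).lowerSemicontinuous

theorem supAv_le_of_tendsto {ι : Type*} {l : Filter ι} [l.NeBot] {f : ι → L2C} {g : L2C}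
    {M : ℝ≥0∞} (h : Tendsto f l (𝓝 g)) (hM : ∀ᶠ n in l, supAv (f n) ≤ M) : supAv g ≤ M := by
  refine iSup_le fun i => ?_
  have h1 : Tendsto (fun n => ‖(inner ℂ (probe i) (f n) : ℂ)‖ₑ) l
      (𝓝 ‖(inner ℂ (probe i) g : ℂ)‖ₑ) :=
    (continuous_enorm.tendsto _).comp
      (((continuous_const.inner continuous_id).tendsto g).comp h)
  refine le_of_tendsto h1 (hM.mono fun n hn => ?_)
  exact (le_iSup (fun i : ℚ × ℚ => ‖(inner ℂ (probe i) (f n) : ℂ)‖ₑ) i).trans hn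

theorem supAv_integral_le {α : Type*} [MeasurableSpace α] {μ : Measure α} {f : α → L2C}
    (hf : Integrable f μ) : supAv (∫ a, f a ∂μ) ≤ ∫⁻ a, supAv (f a) ∂μ := by
  refine iSup_le fun i => ?_
  rw [← integral_inner hf]
  refine (enorm_integral_le_lintegral_enorm _).trans (lintegral_mono fun a => ?_)
  exact le_iSup (fun i : ℚ × ℚ => ‖(inner ℂ (probe i) (f a) : ℂ)‖ₑ) i

theorem supAv_le_of_ae {f : L2C} {M : ℝ≥0∞} (h : ∀ᵐ x, ‖f x‖ₑ ≤ M) : supAv f ≤ M := by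
  rw [← eLpNorm_top_eq, eLpNorm_exponent_top]
  exact eLpNormEssSup_le_of_ae_enorm_bound h

theorem ae_le_supAv (f : L2C) : ∀ᵐ x, ‖f x‖ₑ ≤ supAv f := by
  rw [← eLpNorm_top_eq, eLpNorm_exponent_top]
  exact ae_le_eLpNormEssSup

theorem supAv_add_le (f g : L2C) : supAv (f + g) ≤ supAv f + supAv g := by
  refine supAv_le_of_ae ?_
  filter_upwards [ae_le_supAv f, ae_le_supAv g, Lp.coeFn_add f g] with x h1 h2 h3
  rw [h3, Pi.add_apply]
  exact (enorm_add_le _ _).trans (add_le_add h1 h2)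

theorem supAv_smul_of_norm_one {c : ℂ} (hc : ‖c‖ = 1) (f : L2C) : supAv (c • f) = supAv f := by
  unfold supAv
  congr 1
  ext i
  rw [inner_smul_right, enorm_mul]
  have : ‖c‖ₑ = 1 := by rw [← ofReal_norm, hc]; simp
  rw [this, one_mul]

/-! ### Interchanging integrals over a triangle -/

/-- Integration by parts for two integrable functions with values in a Hilbert space, in the form
of Fubini's theorem on a triangle. -/
theorem integral_inner_primitive {A B : ℝ → L2C} {a b : ℝ} (hab : a ≤ b)
    (hA : IntegrableOn A (Ioc a b) volume) (hB : IntegrableOn B (Ioc a b) volume) :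
    ∫ t in a..b, (inner ℂ (A t) (∫ s in a..t, B s) : ℂ)
      = ∫ s in a..b, (inner ℂ (∫ t in s..b, A t) (B s) : ℂ) := by
  rw [intervalIntegral.integral_of_le hab, intervalIntegral.integral_of_le hab]
  let μ : Measure ℝ := volume.restrict (Ioc a b)
  let f : ℝ → ℝ → ℂ := fun t s => indicator {p : ℝ × ℝ | p.2 ≤ p.1} (fun p => inner ℂ (A p.1) (B p.2)) (t, s)
  have hf : Integrable (Function.uncurry f) (μ.prod μ) := by
    have h1 : Integrable (fun p : ℝ × ℝ => ‖A p.1‖ * ‖B p.2‖) (μ.prod μ) :=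
      hA.norm.mul_prod hB.norm
    have h2 : AEStronglyMeasurable (fun p : ℝ × ℝ => (inner ℂ (A p.1) (B p.2) : ℂ)) (μ.prod μ) :=
      hA.1.comp_fst.inner hB.1.comp_snd
    have h3 : MeasurableSet {p : ℝ × ℝ | p.2 ≤ p.1} := measurableSet_le measurable_snd measurable_fst
    refine h1.mono (h2.indicator h3) (Eventually.of_forall fun p => ?_)
    refine (norm_indicator_le_norm_self (fun p : ℝ × ℝ => (inner ℂ (A p.1) (B p.2) : ℂ)) p).trans ?_
    rw [norm_mul, norm_norm, norm_norm]
    exact norm_inner_le_norm _ _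
  have hL : ∫ t in Ioc a b, (inner ℂ (A t) (∫ s in a..t, B s) : ℂ) = ∫ t, ∫ s, f t s ∂μ ∂μ := by
    refine setIntegral_congr_fun measurableSet_Ioc fun t ht => ?_
    have h1 : (fun s => f t s) = indicator (Iic t) (fun s => inner ℂ (A t) (B s)) := by
      ext s; simp only [f, indicator]; congr 1
    rw [h1, integral_indicator measurableSet_Iic, intervalIntegral.integral_of_le ht.1.le,
      Measure.restrict_restrict measurableSet_Iic]
    have h2 : Iic t ∩ Ioc a b = Ioc a t := by
      ext s; simp only [mem_inter_iff, mem_Iic, mem_Ioc]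
      constructor
      · rintro ⟨h1, h2, h3⟩; exact ⟨h2, h1⟩
      · rintro ⟨h1, h2⟩; exact ⟨h2, h1, h2.trans ht.2⟩
    rw [h2, integral_inner (hB.mono_set (Ioc_subset_Ioc_right ht.2))]
  have hR : ∫ s in Ioc a b, (inner ℂ (∫ t in s..b, A t) (B s) : ℂ) = ∫ s, ∫ t, f t s ∂μ ∂μ := by
    refine setIntegral_congr_fun measurableSet_Ioc fun s hs => ?_
    have h1 : (fun t => f t s) = indicator (Ici s) (fun t => inner ℂ (A t) (B s)) := by
      ext t; simp only [f, indicator]; congr 1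
    rw [h1, integral_indicator measurableSet_Ici, intervalIntegral.integral_of_le hs.2,
      Measure.restrict_restrict measurableSet_Ici]
    have h2 : Ici s ∩ Ioc a b = Icc s b := by
      ext t; simp only [mem_inter_iff, mem_Ici, mem_Ioc, mem_Icc]
      constructor
      · rintro ⟨h1, h2, h3⟩; exact ⟨h1, h3⟩
      · rintro ⟨h1, h2⟩; exact ⟨h1, hs.1.trans_le h1, h2⟩
    have hA' := hA.mono_set (Ioc_subset_Ioc_left hs.1.le : Ioc s b ⊆ Ioc a b)
    rw [h2, integral_Icc_eq_integral_Ioc, ← inner_conj_symm, ← integral_inner hA', ← integral_conj]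
    refine integral_congr_ae (Eventually.of_forall fun t => ?_)
    simp only [inner_conj_symm]
  rw [hL, hR]
  exact integral_integral_swap hf

/-! ### The Hardy–Littlewood–Sobolev inequality -/

/-- The kernel `|t|^{-1/2}`, with the value `⊤` at `t = 0`. -/
def rieszKer (t : ℝ) : ℝ≥0∞ := (‖t‖ₑ) ^ (-(1 / 2) : ℝ)

theorem measurable_rieszKer : Measurable rieszKer := by unfold rieszKer; fun_prop

theorem rieszKer_neg (t : ℝ) : rieszKer (-t) = rieszKer t := by unfold rieszKer; rw [enorm_neg]

theorem rieszKer_sub_comm (t s : ℝ) : rieszKer (t - s) = rieszKer (s - t) := by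
  rw [← rieszKer_neg, neg_sub]

theorem lintegral_even {g : ℝ → ℝ≥0∞} (hg : ∀ x, g (-x) = g x) :
    ∫⁻ x, g x = 2 * ∫⁻ x in Ioi 0, g x := by
  rw [← lintegral_add_compl g measurableSet_Ioi (A := Ioi (0 : ℝ)), compl_Ioi, two_mul]
  congr 1
  have h1 : ∫⁻ x in Iic (0 : ℝ), g x = ∫⁻ x in Iio (0 : ℝ), g x :=
    setLIntegral_congr Iio_ae_eq_Iic.symm
  have h2 := (Measure.measurePreserving_neg (volume : Measure ℝ)).setLIntegral_comp_emb
    (MeasurableEquiv.neg ℝ).measurableEmbedding g (Ioi (0 : ℝ))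
  rw [h1]
  simp only [hg] at h2
  simpa using h2.symm

theorem rieszKer_of_pos {x : ℝ} (hx : 0 < x) :
    rieszKer x = ENNReal.ofReal (x ^ (-(1 / 2) : ℝ)) := by
  unfold rieszKer
  rw [Real.enorm_of_nonneg hx.le, ENNReal.ofReal_rpow_of_pos hx]

/-- The near part of the kernel is integrable. -/
theorem lintegral_rieszKer_near {r : ℝ} (hr : 0 < r) (t : ℝ) :
    ∫⁻ s, indicator {s | |s| ≤ r} rieszKer (t - s) = ENNReal.ofReal (4 * r ^ (1 / 2 : ℝ)) := by
  rw [lintegral_sub_left_eq_self (indicator {s | |s| ≤ r} rieszKer) t]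
  rw [lintegral_even (fun x => by simp [indicator, abs_neg, rieszKer_neg])]
  have h1 : ∫⁻ x in Ioi (0 : ℝ), indicator {s | |s| ≤ r} rieszKer x
      = ∫⁻ x in Ioc 0 r, ENNReal.ofReal (x ^ (-(1 / 2) : ℝ)) := by
    rw [lintegral_indicator (measurableSet_le measurable_abs measurable_const),
      Measure.restrict_restrict (measurableSet_le measurable_abs measurable_const)]
    have : {s : ℝ | |s| ≤ r} ∩ Ioi 0 = Ioc 0 r := by
      ext s; simp only [mem_inter_iff, mem_ofPred_eq, mem_Ioi, mem_Ioc]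
      constructor
      · rintro ⟨h1, h2⟩; exact ⟨h2, (abs_of_pos h2) ▸ h1⟩
      · rintro ⟨h1, h2⟩; exact ⟨(abs_of_pos h1).symm ▸ h2, h1⟩
    rw [this]
    exact setLIntegral_congr_fun measurableSet_Ioc fun x hx => rieszKer_of_pos hx.1
  have hint : IntervalIntegrable (fun x : ℝ => x ^ (-(1 / 2) : ℝ)) volume 0 r :=
    intervalIntegral.intervalIntegrable_rpow' (by norm_num)
  rw [h1, ← ofReal_integral_eq_lintegral_ofReal
    ((intervalIntegrable_iff_integrableOn_Ioc_of_le hr.le).1 hint)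
    ((ae_restrict_iff' measurableSet_Ioc).2 (Eventually.of_forall fun x hx =>
      Real.rpow_nonneg hx.1.le _)),
    ← intervalIntegral.integral_of_le hr.le, integral_rpow (Or.inl (by norm_num))]
  rw [show (2 : ℝ≥0∞) = ENNReal.ofReal 2 by simp, ← ENNReal.ofReal_mul (by norm_num)]
  congr 1
  rw [Real.zero_rpow (by norm_num)]
  norm_num
  ring

/-- The far part of the kernel lies in `L⁴`, the dual exponent of `4/3`. -/
theorem lintegral_rieszKer_far {r : ℝ} (hr : 0 < r) (t : ℝ) :
    ∫⁻ s, (indicator {s | r < |s|} rieszKer (t - s)) ^ (4 : ℝ) = ENNReal.ofReal (2 / r) := by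
  have hms : MeasurableSet {s : ℝ | r < |s|} := measurableSet_lt measurable_const measurable_abs
  rw [lintegral_sub_left_eq_self (fun s => (indicator {s | r < |s|} rieszKer s) ^ (4 : ℝ)) t]
  rw [lintegral_even (fun x => by simp [indicator, abs_neg, rieszKer_neg])]
  have h1 : ∫⁻ x in Ioi (0 : ℝ), (indicator {s | r < |s|} rieszKer x) ^ (4 : ℝ)
      = ∫⁻ x in Ioi r, ENNReal.ofReal (x ^ (-2 : ℝ)) := by
    have h0 : (fun x => (indicator {s : ℝ | r < |s|} rieszKer x) ^ (4 : ℝ))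
        = indicator {s | r < |s|} (fun x => rieszKer x ^ (4 : ℝ)) := by
      ext x; by_cases h : r < |x| <;> simp [indicator, h]
    rw [h0, lintegral_indicator hms, Measure.restrict_restrict hms]
    have : {s : ℝ | r < |s|} ∩ Ioi 0 = Ioi r := by
      ext s; simp only [mem_inter_iff, mem_ofPred_eq, mem_Ioi]
      constructor
      · rintro ⟨h1, h2⟩; exact (abs_of_pos h2) ▸ h1
      · intro h1; exact ⟨(abs_of_pos (hr.trans h1)).symm ▸ h1, hr.trans h1⟩
    rw [this]
    refine setLIntegral_congr_fun measurableSet_Ioi fun x hx => ?_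
    have hx0 : 0 < x := hr.trans hx
    rw [rieszKer_of_pos hx0, ENNReal.ofReal_rpow_of_pos (Real.rpow_pos_of_pos hx0 _),
      ← Real.rpow_mul hx0.le]
    norm_num
  rw [h1, ← ofReal_integral_eq_lintegral_ofReal (integrableOn_Ioi_rpow_of_lt (by norm_num) hr)
    ((ae_restrict_iff' measurableSet_Ioi).2 (Eventually.of_forall fun x hx =>
      Real.rpow_nonneg (hr.trans hx).le _)), integral_Ioi_rpow_of_lt (by norm_num) hr]
  rw [show (2 : ℝ≥0∞) = ENNReal.ofReal 2 by simp, ← ENNReal.ofReal_mul (by norm_num)]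
  congr 1
  norm_num
  rw [Real.rpow_neg_one, div_eq_mul_inv]

/-- The part of a function where it is at most `l` has a Riesz potential that is controlled
pointwise; the radius in the splitting of the kernel balances the two contributions. -/
theorem lintegral_rieszKer_truncated {p : ℝ → ℝ≥0∞} (hp : Measurable p) {l N : ℝ} (hl : 0 < l)
    (hN : 0 < N) (hpN : ∫⁻ s, p s ^ (4 / 3 : ℝ) = ENNReal.ofReal (N ^ (4 / 3 : ℝ))) (t : ℝ) :
    ∫⁻ s in {s | p s ≤ ENNReal.ofReal l}, rieszKer (t - s) * p s
      ≤ ENNReal.ofReal (6 * l ^ (1 / 3 : ℝ) * N ^ (2 / 3 : ℝ)) := by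
  -- the radius at which the near part, `r^{1/2} l`, equals the far part, `r^{-1/4} N`
  set r : ℝ := (N / l) ^ (4 / 3 : ℝ) with hr
  have hr0 : 0 < r := Real.rpow_pos_of_pos (div_pos hN hl) _
  have hmn : MeasurableSet {s : ℝ | |s| ≤ r} := measurableSet_le measurable_abs measurable_const
  have hmf : MeasurableSet {s : ℝ | r < |s|} := measurableSet_lt measurable_const measurable_abs
  have hmp : MeasurableSet {s | p s ≤ ENNReal.ofReal l} := measurableSet_le hp measurable_const
  have hker : ∀ {A : Set ℝ}, MeasurableSet A →
      Measurable (fun s => indicator A rieszKer (t - s)) := fun hA =>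
    (measurable_rieszKer.indicator hA).comp (measurable_const.sub measurable_id)
  have hsplit : ∀ s, rieszKer (t - s) = indicator {s | |s| ≤ r} rieszKer (t - s)
      + indicator {s | r < |s|} rieszKer (t - s) := by
    intro s
    by_cases h : |t - s| ≤ r
    · simp [indicator, h, not_lt.2 h]
    · simp [indicator, h, not_le.1 h]
  have h1 : ∫⁻ s in {s | p s ≤ ENNReal.ofReal l}, indicator {s | |s| ≤ r} rieszKer (t - s) * p s
      ≤ ENNReal.ofReal (4 * r ^ (1 / 2 : ℝ)) * ENNReal.ofReal l := by
    calc _ ≤ ∫⁻ s in {s | p s ≤ ENNReal.ofReal l},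
          indicator {s | |s| ≤ r} rieszKer (t - s) * ENNReal.ofReal l := by
          refine setLIntegral_mono' hmp fun s hs => ?_
          gcongr
          exact hs
      _ ≤ ∫⁻ s, indicator {s | |s| ≤ r} rieszKer (t - s) * ENNReal.ofReal l :=
          setLIntegral_le_lintegral _ _
      _ = _ := by rw [lintegral_mul_const _ (hker hmn), lintegral_rieszKer_near hr0]
  have h2 : ∫⁻ s in {s | p s ≤ ENNReal.ofReal l}, indicator {s | r < |s|} rieszKer (t - s) * p s
      ≤ ENNReal.ofReal (2 / r) ^ (1 / 4 : ℝ) * ENNReal.ofReal N := by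
    refine (setLIntegral_le_lintegral _ _).trans ?_
    have hh := ENNReal.lintegral_mul_le_Lp_mul_Lq volume
      (p := 4) (q := 4 / 3) (by constructor <;> norm_num)
      (hker hmf).aemeasurable hp.aemeasurable
    refine hh.trans (le_of_eq ?_)
    rw [lintegral_rieszKer_far hr0, hpN, ENNReal.ofReal_rpow_of_pos (Real.rpow_pos_of_pos hN _),
      ← Real.rpow_mul hN.le]
    norm_num
  calc _ = ∫⁻ s in {s | p s ≤ ENNReal.ofReal l}, (indicator {s | |s| ≤ r} rieszKer (t - s) * p s
          + indicator {s | r < |s|} rieszKer (t - s) * p s) := by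
        refine lintegral_congr fun s => ?_
        rw [← add_mul, ← hsplit]
    _ ≤ ENNReal.ofReal (4 * r ^ (1 / 2 : ℝ)) * ENNReal.ofReal l
          + ENNReal.ofReal (2 / r) ^ (1 / 4 : ℝ) * ENNReal.ofReal N := by
        rw [lintegral_add_left (f := fun s => indicator {s | |s| ≤ r} rieszKer (t - s) * p s)
          ((hker hmn).mul hp)]
        exact add_le_add h1 h2
    _ ≤ _ := by
        rw [ENNReal.ofReal_rpow_of_pos (by positivity), ← ENNReal.ofReal_mul (by positivity),
          ← ENNReal.ofReal_mul (by positivity), ← ENNReal.ofReal_add (by positivity) (by positivity)]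
        apply ENNReal.ofReal_le_ofReal
        have e1 : r ^ (1 / 2 : ℝ) * l = l ^ (1 / 3 : ℝ) * N ^ (2 / 3 : ℝ) := by
          rw [hr, ← Real.rpow_mul (by positivity), Real.div_rpow hN.le hl.le]
          norm_num
          rw [div_mul_eq_mul_div, mul_comm, mul_comm (l ^ (1 / 3 : ℝ)), div_eq_iff (by positivity)]
          rw [mul_assoc, ← Real.rpow_add hl]
          norm_num
          ring
        have e2 : (2 / r) ^ (1 / 4 : ℝ) * N = 2 ^ (1 / 4 : ℝ) * (l ^ (1 / 3 : ℝ) * N ^ (2 / 3 : ℝ)) := by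
          rw [Real.div_rpow (by norm_num) hr0.le, hr, ← Real.rpow_mul (by positivity),
            Real.div_rpow hN.le hl.le]
          norm_num
          have : N = N ^ (1 / 3 : ℝ) * N ^ (2 / 3 : ℝ) := by
            rw [← Real.rpow_add hN]; norm_num
          field_simp
          nth_rw 1 [this]
        have e3 : (2 : ℝ) ^ (1 / 4 : ℝ) ≤ 2 := by
          calc (2 : ℝ) ^ (1 / 4 : ℝ) ≤ 2 ^ (1 : ℝ) :=
                Real.rpow_le_rpow_of_exponent_le (by norm_num) (by norm_num)
            _ = 2 := Real.rpow_one _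
        have e4 : 0 ≤ l ^ (1 / 3 : ℝ) * N ^ (2 / 3 : ℝ) := by positivity
        rw [mul_assoc 4, e1, e2]
        nlinarith

/-- The Hardy–Littlewood–Sobolev inequality for the kernel `|t - s|^{-1/2}` on the line, on the
diagonal: by symmetry it is enough to integrate over `p s ≤ p t`. -/
theorem hardy_littlewood_sobolev {p : ℝ → ℝ≥0∞} (hp : Measurable p) (hfin : ∀ t, p t ≠ ⊤) :
    ∫⁻ t, ∫⁻ s, rieszKer (t - s) * p s * p t ≤ 12 * (∫⁻ s, p s ^ (4 / 3 : ℝ)) ^ (3 / 2 : ℝ) := by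
  rcases eq_or_ne (∫⁻ s, p s ^ (4 / 3 : ℝ)) ⊤ with htop | htop
  · rw [htop]; simp
  rcases eq_or_ne (∫⁻ s, p s ^ (4 / 3 : ℝ)) 0 with h0 | h0
  · rw [lintegral_eq_zero_iff (hp.pow_const _)] at h0
    have h1 : ∀ᵐ s, p s = 0 := by
      filter_upwards [h0] with s hs
      simpa [show ¬ ((4 : ℝ) / 3 < 0) by norm_num] using hs
    have h2 : ∫⁻ t, ∫⁻ s, rieszKer (t - s) * p s * p t = ∫⁻ _ : ℝ, (0 : ℝ≥0∞) := by
      refine lintegral_congr_ae ?_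
      filter_upwards [h1] with t ht
      simp [ht]
    rw [h2]; simp
  set N : ℝ := (∫⁻ s, p s ^ (4 / 3 : ℝ)).toReal ^ (3 / 4 : ℝ) with hNdef
  have hI : 0 < (∫⁻ s, p s ^ (4 / 3 : ℝ)).toReal := ENNReal.toReal_pos h0 htop
  have hN : 0 < N := Real.rpow_pos_of_pos hI _
  have hpN : ∫⁻ s, p s ^ (4 / 3 : ℝ) = ENNReal.ofReal (N ^ (4 / 3 : ℝ)) := by
    rw [hNdef, ← Real.rpow_mul hI.le]
    norm_num
    rw [ENNReal.ofReal_toReal htop]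
  have hmeas : Measurable (fun q : ℝ × ℝ => rieszKer (q.1 - q.2) * p q.2 * p q.1) :=
    ((measurable_rieszKer.comp (measurable_fst.sub measurable_snd)).mul
      (hp.comp measurable_snd)).mul (hp.comp measurable_fst)
  -- on `A` the inner integrand is truncated at the level `l = p t`
  let A : Set (ℝ × ℝ) := {q | p q.2 ≤ p q.1}
  let A' : Set (ℝ × ℝ) := {q | p q.1 ≤ p q.2}
  have hA : MeasurableSet A := measurableSet_le (hp.comp measurable_snd) (hp.comp measurable_fst)
  have hA' : MeasurableSet A' := measurableSet_le (hp.comp measurable_fst) (hp.comp measurable_snd)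
  let k : ℝ × ℝ → ℝ≥0∞ := fun q => rieszKer (q.1 - q.2) * p q.2 * p q.1
  have hhalf : ∫⁻ t, ∫⁻ s, indicator A k (t, s) ≤ 6 * (∫⁻ s, p s ^ (4 / 3 : ℝ)) ^ (3 / 2 : ℝ) := by
    have hpt : ∀ t, ∫⁻ s, indicator A k (t, s)
        ≤ ENNReal.ofReal (6 * N ^ (2 / 3 : ℝ)) * p t ^ (4 / 3 : ℝ) := by
      intro t
      rcases eq_or_ne (p t) 0 with hz | hz
      · have : ∀ s, indicator A k (t, s) = 0 := fun s => by simp [indicator, k, hz]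
        simp [this]
      have hl : 0 < (p t).toReal := ENNReal.toReal_pos hz (hfin t)
      have hpt : p t = ENNReal.ofReal (p t).toReal := (ENNReal.ofReal_toReal (hfin t)).symm
      have h1 := lintegral_rieszKer_truncated hp hl hN hpN t
      rw [← hpt] at h1
      have hmp : MeasurableSet {s | p s ≤ p t} := measurableSet_le hp measurable_const
      have h2 : ∫⁻ s, indicator A k (t, s)
          = (∫⁻ s in {s | p s ≤ p t}, rieszKer (t - s) * p s) * p t := by
        rw [← lintegral_mul_const' _ _ (hfin t), ← lintegral_indicator hmp]
        rfl
      rw [h2]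
      calc _ ≤ ENNReal.ofReal (6 * (p t).toReal ^ (1 / 3 : ℝ) * N ^ (2 / 3 : ℝ)) * p t := by gcongr
        _ = _ := by
          rw [hpt, ENNReal.ofReal_rpow_of_pos hl, ← ENNReal.ofReal_mul (by positivity),
            ← ENNReal.ofReal_mul (by positivity), ENNReal.toReal_ofReal hl.le]
          congr 1
          have : (p t).toReal ^ (4 / 3 : ℝ) = (p t).toReal ^ (1 / 3 : ℝ) * (p t).toReal := by
            nth_rw 3 [← Real.rpow_one (p t).toReal]
            rw [← Real.rpow_add hl]; norm_num
          rw [this]; ring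
    calc _ ≤ ∫⁻ t, ENNReal.ofReal (6 * N ^ (2 / 3 : ℝ)) * p t ^ (4 / 3 : ℝ) := lintegral_mono hpt
      _ = ENNReal.ofReal (6 * N ^ (2 / 3 : ℝ)) * ENNReal.ofReal (N ^ (4 / 3 : ℝ)) := by
        rw [lintegral_const_mul _ (hp.pow_const _), hpN]
      _ = _ := by
        rw [hpN, ENNReal.ofReal_rpow_of_pos (by positivity), ← ENNReal.ofReal_mul (by positivity),
          show (6 : ℝ≥0∞) = ENNReal.ofReal 6 by simp, ← ENNReal.ofReal_mul (by norm_num),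
          mul_assoc, ← Real.rpow_add hN, ← Real.rpow_mul hN.le]
        norm_num
  have hsymm : ∫⁻ t, ∫⁻ s, indicator A' k (t, s) = ∫⁻ t, ∫⁻ s, indicator A k (t, s) := by
    rw [lintegral_lintegral_swap (f := fun t s => indicator A' k (t, s))
      (hmeas.indicator hA').aemeasurable]
    refine lintegral_congr fun t => lintegral_congr fun s => ?_
    simp only [indicator, A, A', k, mem_ofPred_eq]
    rw [rieszKer_sub_comm, mul_right_comm]
  calc _ ≤ ∫⁻ t, ∫⁻ s, (indicator A k (t, s) + indicator A' k (t, s)) := by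
        refine lintegral_mono fun t => lintegral_mono fun s => ?_
        rcases le_total (p s) (p t) with h | h
        · have : indicator A k (t, s) = k (t, s) := indicator_of_mem (s := A) (a := (t, s)) h k
          rw [this]; exact le_self_add
        · have : indicator A' k (t, s) = k (t, s) := indicator_of_mem (s := A') (a := (t, s)) h k
          rw [this]; exact le_add_self
    _ = ∫⁻ t, ((∫⁻ s, indicator A k (t, s)) + ∫⁻ s, indicator A' k (t, s)) := by
        refine lintegral_congr fun t => ?_
        rw [lintegral_add_left]
        exact (hmeas.indicator hA).comp measurable_prodMk_left
    _ = (∫⁻ t, ∫⁻ s, indicator A k (t, s)) + ∫⁻ t, ∫⁻ s, indicator A' k (t, s) := by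
        rw [lintegral_add_left]
        exact (hmeas.indicator hA).lintegral_prod_right'
    _ ≤ 6 * (∫⁻ s, p s ^ (4 / 3 : ℝ)) ^ (3 / 2 : ℝ) + 6 * (∫⁻ s, p s ^ (4 / 3 : ℝ)) ^ (3 / 2 : ℝ) := by
        rw [hsymm]; exact add_le_add hhalf hhalf
    _ = _ := by rw [← add_mul]; norm_num

theorem measurable_select {a : ℕ → ℝ → ℝ≥0∞} (ha : ∀ j, Measurable (a j)) {J : ℝ → ℕ}
    (hJ : Measurable J) : Measurable fun t => a (J t) t := by
  have h1 : Measurable fun q : ℕ × ℝ => a q.1 q.2 :=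
    measurable_from_prod_countable_right fun j => ha j
  exact h1.comp (hJ.prodMk measurable_id)

/-- Measurable choice of an index that maximises finitely many measurable quantities. -/
theorem exists_measurable_argmax {a : ℕ → ℝ → ℝ≥0∞} (ha : ∀ j, Measurable (a j)) (n : ℕ) :
    ∃ J : ℝ → ℕ, Measurable J ∧ (∀ t, J t ≤ n) ∧ ∀ t, ∀ j ≤ n, a j t ≤ a (J t) t := by
  induction n with
  | zero => exact ⟨fun _ => 0, measurable_const, fun _ => le_rfl, fun t j hj => by
      rw [Nat.le_zero.1 hj]⟩
  | succ n ih =>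
    obtain ⟨J, hJ, hJn, hmax⟩ := ih
    have hm : Measurable fun t => a (J t) t := measurable_select ha hJ
    classical
    refine ⟨fun t => if a (J t) t < a (n + 1) t then n + 1 else J t,
      Measurable.ite (measurableSet_lt hm (ha _)) measurable_const hJ, fun t => ?_, fun t j hj => ?_⟩
    · beta_reduce
      split_ifs
      · exact le_rfl
      · exact (hJn t).trans (Nat.le_succ n)
    · beta_reduce
      split_ifs with h
      · rcases Nat.le_succ_iff.1 hj with h' | h'
        · exact (hmax t j h').trans h.le
        · rw [h']
      · rcases Nat.le_succ_iff.1 hj with h' | h'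
        · exact hmax t j h'
        · rw [h']; exact not_lt.1 h

/-! ### The Fourier transform on `L¹ ∩ L²` -/

theorem integral_fourier_mul {f g : ℝ → ℂ} (hf : Integrable f) (hg : Integrable g) :
    ∫ x, 𝓕 f x * g x = ∫ x, f x * 𝓕 g x := by
  have := VectorFourier.integral_fourierIntegral_smul_eq_flip (μ := volume) (ν := volume)
    (L := innerₗ ℝ) Real.continuous_fourierChar continuous_inner hf hg
  rw [flip_innerₗ] at this
  exact this

theorem integral_fourierInv_mul {f g : ℝ → ℂ} (hf : Integrable f) (hg : Integrable g) :
    ∫ x, 𝓕⁻ f x * g x = ∫ x, f x * 𝓕⁻ g x := by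
  have := VectorFourier.integral_fourierIntegral_smul_eq_flip (μ := volume) (ν := volume)
    (L := -innerₗ ℝ) Real.continuous_fourierChar
    (continuous_inner (𝕜 := ℝ) (E := ℝ)).neg hf hg
  have h2 : (-innerₗ ℝ : ℝ →ₗ[ℝ] ℝ →ₗ[ℝ] ℝ).flip = -innerₗ ℝ := by
    ext; simp
  rw [h2] at this
  exact this

theorem norm_fourier_le (f : ℝ → ℂ) (x : ℝ) : ‖𝓕 f x‖ ≤ ∫ y, ‖f y‖ :=
  VectorFourier.norm_fourierIntegral_le_integral_norm _ _ _ _ _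

theorem norm_fourierInv_le (f : ℝ → ℂ) (x : ℝ) : ‖𝓕⁻ f x‖ ≤ ∫ y, ‖f y‖ :=
  VectorFourier.norm_fourierIntegral_le_integral_norm _ _ _ _ _

theorem continuous_fourier {f : ℝ → ℂ} (hf : Integrable f) : Continuous (𝓕 f) :=
  VectorFourier.fourierIntegral_continuous Real.continuous_fourierChar continuous_inner hf

theorem continuous_fourierInv {f : ℝ → ℂ} (hf : Integrable f) : Continuous (𝓕⁻ f) :=
  VectorFourier.fourierIntegral_continuous (L := -innerₗ ℝ) Real.continuous_fourierChar
    (continuous_inner (𝕜 := ℝ) (E := ℝ)).neg hf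

/-- On `L¹ ∩ L²` the Fourier transform of `L²` is given by the integral. -/
theorem coeFn_fourier_toL2 {f : ℝ → ℂ} (h1 : Integrable f) (h2 : MemLp f 2 volume) :
    (𝓕 (toL2 f) : L2C) =ᵐ[volume] 𝓕 f := by
  refine ae_eq_of_integral_contDiff_smul_eq
    ((Lp.memLp _).locallyIntegrable (by norm_num)) (continuous_fourier h1).locallyIntegrable ?_
  intro g hg hgc
  have hg' : ContDiff ℝ ∞ (fun x => ((g x : ℝ) : ℂ)) := Complex.ofRealCLM.contDiff.comp hg
  have hgc' : HasCompactSupport (fun x => ((g x : ℝ) : ℂ)) :=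
    hgc.comp_left (g := fun r : ℝ => (r : ℂ)) Complex.ofReal_zero
  let G : SchwartzMap ℝ ℂ := hgc'.toSchwartzMap hg'
  have e1 := congrArg (fun T => T G) (Lp.fourier_toTemperedDistribution_eq (toL2 f))
  simp only [TemperedDistribution.fourier_apply] at e1
  erw [Lp.toTemperedDistribution_apply, Lp.toTemperedDistribution_apply] at e1
  have hGi : Integrable (G : ℝ → ℂ) := G.integrable
  calc ∫ x, g x • (𝓕 (toL2 f) : L2C) x = ∫ x, G x • (𝓕 (toL2 f) : L2C) x := by
        refine integral_congr_ae (Eventually.of_forall fun x => ?_)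
        change g x • _ = ((g x : ℝ) : ℂ) • _
        simp
    _ = ∫ x, (𝓕 G) x • (toL2 f) x := e1.symm
    _ = ∫ x, f x * 𝓕 (G : ℝ → ℂ) x := by
        refine integral_congr_ae ?_
        filter_upwards [coeFn_toL2 h2] with x hx
        rw [hx, smul_eq_mul, mul_comm, SchwartzMap.fourier_coe]
    _ = ∫ x, 𝓕 f x * G x := (integral_fourier_mul h1 hGi).symm
    _ = _ := by
        refine integral_congr_ae (Eventually.of_forall fun x => ?_)
        change _ * ((g x : ℝ) : ℂ) = g x • _
        rw [Complex.real_smul, mul_comm]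

/-- On `L¹ ∩ L²` the inverse Fourier transform of `L²` is given by the integral. -/
theorem coeFn_fourierInv_toL2 {f : ℝ → ℂ} (h1 : Integrable f) (h2 : MemLp f 2 volume) :
    (𝓕⁻ (toL2 f) : L2C) =ᵐ[volume] 𝓕⁻ f := by
  refine ae_eq_of_integral_contDiff_smul_eq
    ((Lp.memLp _).locallyIntegrable (by norm_num)) (continuous_fourierInv h1).locallyIntegrable ?_
  intro g hg hgc
  have hg' : ContDiff ℝ ∞ (fun x => ((g x : ℝ) : ℂ)) := Complex.ofRealCLM.contDiff.comp hg
  have hgc' : HasCompactSupport (fun x => ((g x : ℝ) : ℂ)) :=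
    hgc.comp_left (g := fun r : ℝ => (r : ℂ)) Complex.ofReal_zero
  let G : SchwartzMap ℝ ℂ := hgc'.toSchwartzMap hg'
  have e1 := congrArg (fun T => T G) (Lp.fourierInv_toTemperedDistribution_eq (toL2 f))
  simp only [TemperedDistribution.fourierInv_apply] at e1
  erw [Lp.toTemperedDistribution_apply, Lp.toTemperedDistribution_apply] at e1
  have hGi : Integrable (G : ℝ → ℂ) := G.integrable
  calc ∫ x, g x • (𝓕⁻ (toL2 f) : L2C) x = ∫ x, G x • (𝓕⁻ (toL2 f) : L2C) x := by
        refine integral_congr_ae (Eventually.of_forall fun x => ?_)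
        change g x • _ = ((g x : ℝ) : ℂ) • _
        simp
    _ = ∫ x, (𝓕⁻ G) x • (toL2 f) x := e1.symm
    _ = ∫ x, f x * 𝓕⁻ (G : ℝ → ℂ) x := by
        refine integral_congr_ae ?_
        filter_upwards [coeFn_toL2 h2] with x hx
        rw [hx, smul_eq_mul, mul_comm, SchwartzMap.fourierInv_coe]
    _ = ∫ x, 𝓕⁻ f x * G x := (integral_fourierInv_mul h1 hGi).symm
    _ = _ := by
        refine integral_congr_ae (Eventually.of_forall fun x => ?_)
        change _ * ((g x : ℝ) : ℂ) = g x • _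
        rw [Complex.real_smul, mul_comm]

/-! ### The Schrödinger group -/

/-- The unitary group `e^{it∂²}` on `L²(ℝ)`: multiplication by `e^{-4π²itξ²}` on the Fourier
side. -/
def schr (t : ℝ) : L2C ≃ₗᵢ[ℂ] L2C :=
  ((Lp.fourierTransformₗᵢ ℝ ℂ).trans (chirp (-(4 * Real.pi ^ 2 * t)))).trans
    (Lp.fourierTransformₗᵢ ℝ ℂ).symm

theorem schr_apply (t : ℝ) (f : L2C) :
    schr t f = 𝓕⁻ (chirp (-(4 * Real.pi ^ 2 * t)) (𝓕 f)) := rfl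

theorem fourier_schr (t : ℝ) (f : L2C) :
    𝓕 (schr t f) = chirp (-(4 * Real.pi ^ 2 * t)) (𝓕 f) := by
  rw [schr_apply]; exact FourierTransform.fourier_fourierInv_eq _

theorem schr_schr (s t : ℝ) (f : L2C) : schr s (schr t f) = schr (s + t) f := by
  rw [schr_apply s, fourier_schr, chirp_chirp, schr_apply]
  congr 3; ring

theorem schr_zero (f : L2C) : schr 0 f = f := by
  rw [schr_apply, mul_zero, neg_zero, chirp_zero]
  exact FourierTransform.fourierInv_fourier_eq _

theorem schr_neg_schr (t : ℝ) (f : L2C) : schr (-t) (schr t f) = f := by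
  rw [schr_schr, neg_add_cancel, schr_zero]

theorem schr_schr_neg (t : ℝ) (f : L2C) : schr t (schr (-t) f) = f := by
  rw [schr_schr, add_neg_cancel, schr_zero]

theorem inner_schr (t : ℝ) (f g : L2C) :
    (inner ℂ f (schr t g) : ℂ) = inner ℂ (schr (-t) f) g := by
  rw [← (schr t).inner_map_map (schr (-t) f) g, schr_schr_neg]

theorem continuous_schr (f : L2C) : Continuous fun t => schr t f := by
  refine (Lp.fourierTransformₗᵢ ℝ ℂ).symm.continuous.comp ?_
  exact (continuous_chirp _).comp (by fun_prop)

theorem continuous_schr₂ : Continuous fun p : ℝ × L2C => schr p.1 p.2 :=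
  continuous_isometry_family continuous_schr

/-! ### Explicit kernels -/

/-- The Fourier transform of the Gaussian `e^{-bξ²}`. -/
def gaussKer (b : ℂ) (x : ℝ) : ℂ :=
  ((Real.pi : ℂ) / b) ^ (1 / 2 : ℂ) * Complex.exp (-((Real.pi : ℂ) ^ 2 * (x : ℂ) ^ 2 / b))

theorem norm_gaussKer_le {b : ℂ} (hb : 0 ≤ b.re) (hb0 : b ≠ 0) (x : ℝ) :
    ‖gaussKer b x‖ ≤ (Real.pi / ‖b‖) ^ (1 / 2 : ℝ) := by
  unfold gaussKer
  rw [norm_mul]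
  have h1 : ‖((Real.pi : ℂ) / b) ^ (1 / 2 : ℂ)‖ = (Real.pi / ‖b‖) ^ (1 / 2 : ℝ) := by
    have : (1 / 2 : ℂ) = ((1 / 2 : ℝ) : ℂ) := by push_cast; rfl
    rw [this, Complex.norm_cpow_real, norm_div, Complex.norm_real, Real.norm_eq_abs,
      abs_of_pos Real.pi_pos]
  rw [h1]
  refine mul_le_of_le_one_right (by positivity) ?_
  rw [Complex.norm_exp, Real.exp_le_one_iff, Complex.neg_re, neg_nonpos]
  have : ((Real.pi : ℂ) ^ 2 * (x : ℂ) ^ 2 / b) = ((Real.pi ^ 2 * x ^ 2 : ℝ) : ℂ) * b⁻¹ := by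
    push_cast; rw [div_eq_mul_inv]
  rw [this, Complex.re_ofReal_mul, Complex.inv_re]
  exact mul_nonneg (by positivity) (div_nonneg hb (Complex.normSq_nonneg b))

theorem norm_gaussKer_le_of_im {b : ℂ} (hb : 0 ≤ b.re) (hb0 : b.im ≠ 0) (x : ℝ) :
    ‖gaussKer b x‖ ≤ (Real.pi / |b.im|) ^ (1 / 2 : ℝ) := by
  refine (norm_gaussKer_le hb (fun h => hb0 (by rw [h]; rfl)) x).trans ?_
  have := Complex.abs_im_le_norm b
  have h0 : 0 < |b.im| := abs_pos.2 hb0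
  have hpi := Real.pi_pos
  gcongr

theorem continuous_gaussKer (b : ℂ) : Continuous (gaussKer b) := by
  unfold gaussKer; fun_prop

theorem tendsto_gaussKer {b : ℂ} (hb0 : b.im ≠ 0) (x : ℝ) {ι : Type*}
    {l : Filter ι} {c : ι → ℂ} (hc : Tendsto c l (𝓝 b)) :
    Tendsto (fun n => gaussKer (c n) x) l (𝓝 (gaussKer b x)) := by
  have hne : b ≠ 0 := fun h => hb0 (by rw [h]; rfl)
  have hcont : ContinuousAt (fun z : ℂ => gaussKer z x) b := by
    unfold gaussKer
    have h1 : ContinuousAt (fun z : ℂ => (Real.pi : ℂ) / z) b :=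
      continuousAt_const.div continuousAt_id hne
    refine ContinuousAt.mul ?_ ?_
    · refine h1.cpow continuousAt_const ?_
      right
      rw [Complex.div_im]
      simp only [Complex.ofReal_im, Complex.ofReal_re, zero_mul, zero_div, zero_sub]
      have h2 : Complex.normSq b ≠ 0 := by simpa using hne
      have h3 := Real.pi_ne_zero
      simp [hb0, h2, h3]
    · exact (continuousAt_const.div continuousAt_id hne).neg.cexp
  exact hcont.tendsto.comp hc

theorem integral_gaussian_phase {b : ℂ} (hb : 0 < b.re) (x : ℝ) :
    ∫ ξ : ℝ, Complex.exp (-b * ξ ^ 2 + (2 * Real.pi * Complex.I * x) * ξ) = gaussKer b x := by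
  have h := integral_cexp_quadratic (b := -b) (by simpa using hb) (2 * Real.pi * Complex.I * x) 0
  simp only [add_zero] at h
  rw [h, gaussKer, neg_neg]
  congr 2
  have hb0 : b ≠ 0 := fun h => by rw [h] at hb; simp at hb
  field_simp
  rw [Complex.I_sq]
  ring

theorem integrable_gaussian_phase {b : ℂ} (hb : 0 < b.re) (c : ℂ) :
    Integrable (fun ξ : ℝ => Complex.exp (-b * ξ ^ 2 + c * ξ)) := by
  have := integrable_cexp_quadratic hb c 0
  simpa using this

theorem norm_exp_neg_mul_sq {b : ℂ} (hb : 0 ≤ b.re) (x : ℝ) : ‖Complex.exp (-b * (x : ℂ) ^ 2)‖ ≤ 1 := by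
  rw [Complex.norm_exp, Real.exp_le_one_iff, ← Complex.ofReal_pow, Complex.re_mul_ofReal,
    Complex.neg_re]
  nlinarith [sq_nonneg x, mul_nonneg hb (sq_nonneg x)]

theorem tendsto_one_div_add_ofReal (b : ℂ) :
    Tendsto (fun n : ℕ => ((1 / ((n : ℝ) + 1) : ℝ) : ℂ) + b) atTop (𝓝 b) := by
  have h1 := tendsto_one_div_add_atTop_nhds_zero_nat (𝕜 := ℝ)
  have h2 := ((Complex.continuous_ofReal.tendsto _).comp h1).add_const b
  simpa [Function.comp_def] using h2

theorem tendsto_gaussKer_integral {b : ℂ} (hb : 0 ≤ b.re) (hb0 : b.im ≠ 0) {w : ℝ → ℂ}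
    (hw : Integrable w) {q : ℝ → ℝ} (hq : Continuous q) :
    Tendsto (fun n : ℕ => ∫ y, gaussKer (((1 / ((n : ℝ) + 1) : ℝ) : ℂ) + b) (q y) * w y) atTop
      (𝓝 (∫ y, gaussKer b (q y) * w y)) := by
  refine tendsto_integral_of_dominated_convergence
    (fun y => (Real.pi / |b.im|) ^ (1 / 2 : ℝ) * ‖w y‖) (fun n => ?_) (hw.norm.const_mul _)
    (fun n => Eventually.of_forall fun y => ?_) (Eventually.of_forall fun y => ?_)
  · exact ((continuous_gaussKer _).comp hq).aestronglyMeasurable.mul hw.1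
  · rw [norm_mul]
    have h1 := norm_gaussKer_le_of_im (b := ((1 / ((n : ℝ) + 1) : ℝ) : ℂ) + b)
      (by rw [Complex.add_re, Complex.ofReal_re]; positivity)
      (by rw [Complex.add_im, Complex.ofReal_im, zero_add]; exact hb0) (q y)
    rw [Complex.add_im, Complex.ofReal_im, zero_add] at h1
    gcongr
  · exact (tendsto_gaussKer hb0 _ (tendsto_one_div_add_ofReal b)).mul_const _

/-- The Schrödinger group on `L¹ ∩ L²` is convolution with the kernel
`(4πit)^{-1/2} e^{ix²/4t}`. -/
theorem coeFn_schr_toL2 {t : ℝ} (ht : t ≠ 0) {f : ℝ → ℂ} (h1 : Integrable f)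
    (h2 : MemLp f 2 volume) :
    schr t (toL2 f) =ᵐ[volume]
      fun x => ∫ y, gaussKer (((4 * Real.pi ^ 2 * t : ℝ) : ℂ) * Complex.I) (x - y) * f y := by
  set b : ℂ := ((4 * Real.pi ^ 2 * t : ℝ) : ℂ) * Complex.I with hb
  have hbre : b.re = 0 := by rw [hb, Complex.re_ofReal_mul]; simp
  have hbim : b.im = 4 * Real.pi ^ 2 * t := by rw [hb, Complex.im_ofReal_mul]; simp
  have hbim0 : b.im ≠ 0 := by rw [hbim]; have := Real.pi_ne_zero; positivity
  -- damping by `e^{-ξ²/(n+1)}` makes the multiplier integrable, so that Fubini applies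
  let c : ℕ → ℂ := fun n => ((1 / ((n : ℝ) + 1) : ℝ) : ℂ) + b
  have hcre : ∀ n, 0 < (c n).re := fun n => by
    simp only [c, Complex.add_re, Complex.ofReal_re, hbre]; positivity
  let F : ℕ → ℝ → ℂ := fun n ξ => Complex.exp (-c n * (ξ : ℂ) ^ 2) * 𝓕 f ξ
  have hFc : Continuous (𝓕 f) := continuous_fourier h1
  have hF2 : MemLp (𝓕 f) 2 volume := (memLp_congr_ae (coeFn_fourier_toL2 h1 h2)).1 (Lp.memLp _)
  have hFm : ∀ n, Continuous (F n) := fun n => by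
    simp only [F]; fun_prop
  have hFn2 : ∀ n, MemLp (F n) 2 volume := fun n =>
    memLp_of_bound (hFm n).aestronglyMeasurable hF2.norm (Eventually.of_forall fun ξ => by
      rw [norm_mul]
      exact mul_le_of_le_one_left (norm_nonneg _) (norm_exp_neg_mul_sq (hcre n).le ξ))
  have hFn1 : ∀ n, Integrable (F n) := fun n => by
    have hg := integrable_gaussian_phase (hcre n) 0
    simp only [zero_mul, add_zero] at hg
    refine hg.mul_bdd (c := ∫ y, ‖f y‖) hFc.aestronglyMeasurable
      (Eventually.of_forall fun ξ => norm_fourier_le f ξ)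
  have hlim : Tendsto (fun n => (𝓕⁻ (toL2 (F n)) : L2C)) atTop (𝓝 (schr t (toL2 f))) := by
    have h3 : chirp (-(4 * Real.pi ^ 2 * t)) (𝓕 (toL2 f))
        = toL2 (fun ξ => phase (-(4 * Real.pi ^ 2 * t)) ξ * 𝓕 f ξ) := by
      rw [chirp_apply]
      refine toL2_congr ?_
      filter_upwards [coeFn_fourier_toL2 h1 h2] with x hx
      rw [hx]
    rw [schr_apply, h3]
    refine ((Lp.fourierTransformₗᵢ ℝ ℂ).symm.continuous.tendsto _).comp ?_
    refine tendsto_toL2_of_dominated (G := fun ξ => ‖𝓕 f ξ‖)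
      (Eventually.of_forall fun n => (hFm n).aestronglyMeasurable) hF2.norm ?_
      (memLp_phase_mul _ hF2) (Eventually.of_forall fun ξ => ?_)
    · refine Eventually.of_forall fun n => Eventually.of_forall fun ξ => ?_
      rw [norm_mul]
      exact mul_le_of_le_one_left (norm_nonneg _) (norm_exp_neg_mul_sq (hcre n).le ξ)
    · refine Tendsto.mul_const _ ?_
      have h4 : phase (-(4 * Real.pi ^ 2 * t)) ξ = Complex.exp (-b * (ξ : ℂ) ^ 2) := by
        unfold phase; congr 1; rw [hb]; push_cast; ring
      rw [h4]
      have h5 : Continuous fun z : ℂ => Complex.exp (-z * (ξ : ℂ) ^ 2) := by fun_prop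
      exact (h5.tendsto b).comp (tendsto_one_div_add_ofReal b)
  refine coeFn_eq_of_tendsto hlim (φ := fun n x => ∫ y, gaussKer (c n) (x - y) * f y) (fun n => ?_)
    (Eventually.of_forall fun x => tendsto_gaussKer_integral hbre.ge hbim0 h1 (by fun_prop))
  refine (coeFn_fourierInv_toL2 (hFn1 n) (hFn2 n)).trans (Eventually.of_forall fun x => ?_)
  let h : ℝ → ℂ := fun ξ => Complex.exp (-c n * (ξ : ℂ) ^ 2 + (2 * Real.pi * Complex.I * x) * ξ)
  have hh : Integrable h := integrable_gaussian_phase (hcre n) _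
  have e1 : 𝓕⁻ (F n) x = ∫ ξ, 𝓕 f ξ * h ξ := by
    rw [Real.fourierInv_eq']
    refine integral_congr_ae (Eventually.of_forall fun ξ => ?_)
    simp only [F, h, smul_eq_mul]
    rw [Complex.exp_add]
    simp only [RCLike.inner_apply, conj_trivial]
    push_cast
    ring_nf
  have e2 : ∀ y, 𝓕 h y = gaussKer (c n) (x - y) := fun y => by
    rw [← integral_gaussian_phase (hcre n), Real.fourier_eq']
    refine integral_congr_ae (Eventually.of_forall fun ξ => ?_)
    simp only [h, smul_eq_mul]
    rw [← Complex.exp_add]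
    congr 1
    simp only [RCLike.inner_apply, conj_trivial]
    push_cast
    ring
  rw [e1, integral_fourier_mul h1 hh]
  refine integral_congr_ae (Eventually.of_forall fun y => ?_)
  simp only [e2, mul_comm]

/-! ### The dispersive estimate and the Strichartz estimate -/

/-- The dispersive estimate `‖e^{it∂²}f‖_∞ ≤ |t|^{-1/2} ‖f‖₁`; the sharp constant is not needed. -/
theorem supAv_schr_le {t : ℝ} {f : ℝ → ℂ} (h1 : Integrable f) (h2 : MemLp f 2 volume) :
    supAv (schr t (toL2 f)) ≤ rieszKer t * ∫⁻ y, ‖f y‖ₑ := by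
  rcases eq_or_ne t 0 with rfl | ht
  · rcases eq_or_ne (∫⁻ y, ‖f y‖ₑ) 0 with h0 | h0
    · rw [lintegral_eq_zero_iff' h1.1.enorm] at h0
      refine supAv_le_of_ae ?_
      rw [schr_zero]
      filter_upwards [h0, coeFn_toL2 h2] with x hx hx2
      rw [hx2, hx]; exact zero_le
    · have : rieszKer 0 = ⊤ := by simp [rieszKer]
      rw [this, ENNReal.top_mul h0]; exact le_top
  refine supAv_le_of_ae ?_
  filter_upwards [coeFn_schr_toL2 ht h1 h2] with x hx
  rw [hx]
  refine (enorm_integral_le_lintegral_enorm _).trans ?_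
  rw [← lintegral_const_mul'' _ h1.1.enorm]
  refine lintegral_mono fun y => ?_
  rw [enorm_mul]
  gcongr
  have him : (((4 * Real.pi ^ 2 * t : ℝ) : ℂ) * Complex.I).im = 4 * Real.pi ^ 2 * t := by
    rw [Complex.im_ofReal_mul]; simp
  have hre : (((4 * Real.pi ^ 2 * t : ℝ) : ℂ) * Complex.I).re = 0 := by
    rw [Complex.re_ofReal_mul]; simp
  have hpi := Real.pi_pos
  have h3 := norm_gaussKer_le_of_im hre.ge (by rw [him]; positivity) (x - y)
  rw [him] at h3
  have ht0 : 0 < |t| := abs_pos.2 ht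
  have h4 : rieszKer t = ENNReal.ofReal (|t| ^ (-(1 / 2) : ℝ)) := by
    rw [← rieszKer_of_pos ht0]; unfold rieszKer; rw [← ofReal_norm, ← ofReal_norm, Real.norm_eq_abs, Real.norm_eq_abs, abs_abs]
  rw [h4, ← ofReal_norm]
  refine ENNReal.ofReal_le_ofReal (h3.trans ?_)
  rw [Real.rpow_neg ht0.le, ← Real.inv_rpow ht0.le]
  refine Real.rpow_le_rpow (by positivity) ?_ (by norm_num)
  rw [abs_mul, abs_of_pos (by positivity : 0 < 4 * Real.pi ^ 2), div_le_iff₀ (by positivity)]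
  have : |t|⁻¹ * (4 * Real.pi ^ 2 * |t|) = 4 * Real.pi ^ 2 := by field_simp
  rw [this]
  nlinarith [Real.pi_gt_three]

/-- The dispersive estimate tested with probe functions, which have `L¹`-norm at most one. -/
theorem enorm_inner_probe_schr_probe_le (i j : ℚ × ℚ) (t : ℝ) :
    ‖(inner ℂ (probe i) (schr t (probe j)) : ℂ)‖ₑ ≤ rieszKer t := by
  have h0 : ‖(inner ℂ (probe i) (schr t (probe j)) : ℂ)‖ₑ ≤ supAv (schr t (probe j)) :=
    le_iSup (fun i : ℚ × ℚ => ‖(inner ℂ (probe i) (schr t (probe j)) : ℂ)‖ₑ) i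
  refine h0.trans ?_
  let φ : ℝ → ℂ := indicator (Ioo (j.1 : ℝ) j.2) fun _ => ((j.2 - j.1 : ℝ) : ℂ)⁻¹
  have hms : MeasurableSet (Ioo (j.1 : ℝ) j.2) := measurableSet_Ioo
  have hφ : probe j = toL2 φ := by
    refine eq_toL2 ?_
    unfold probe
    filter_upwards [Lp.coeFn_smul (((j.2 - j.1 : ℝ) : ℂ)⁻¹)
      (indicatorConstLp (E := ℂ) 2 (μ := volume) hms (by simp) 1),
      indicatorConstLp_coeFn (p := 2) (μ := volume) (hs := hms) (hμs := by simp) (c := (1 : ℂ))]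
      with x hx1 hx2
    rw [hx1, Pi.smul_apply, hx2]
    simp only [φ, indicator]
    split_ifs <;> simp
  have hφ2 : MemLp φ 2 volume := memLp_indicator_const 2 hms _ (Or.inr (by simp))
  have hφ1 : Integrable φ := (integrable_indicator_iff hms).2 (integrableOn_const (by simp))
  rw [hφ]
  refine (supAv_schr_le hφ1 hφ2).trans ?_
  have h1 : ∫⁻ y, ‖φ y‖ₑ ≤ 1 := by
    have : (fun y => ‖φ y‖ₑ) = indicator (Ioo (j.1 : ℝ) j.2) fun _ => ‖((j.2 - j.1 : ℝ) : ℂ)⁻¹‖ₑ := by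
      ext y; simp only [φ, indicator]; split_ifs <;> simp
    rw [this, lintegral_indicator_const hms, Real.volume_Ioo]
    rcases le_or_gt (j.2 : ℝ) j.1 with h | h
    · rw [ENNReal.ofReal_of_nonpos (by linarith), mul_zero]; exact zero_le
    · have hpos : (0 : ℝ) < j.2 - j.1 := sub_pos.2 h
      rw [← ofReal_norm, ← ENNReal.ofReal_mul (norm_nonneg _), norm_inv, Complex.norm_real,
        Real.norm_eq_abs, abs_of_pos hpos, inv_mul_cancel₀ hpos.ne']
      simp
  calc _ ≤ rieszKer t * 1 := by gcongr
    _ = _ := mul_one _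

/-- The dual Strichartz estimate, for superpositions of evolved probe functions: the square of the
norm is a double integral, to which the dispersive estimate and the Hardy–Littlewood–Sobolev
inequality apply. -/
theorem enorm_integral_schr_probe_le {J : ℝ → ℚ × ℚ} {c : ℝ → ℂ} (hc : Measurable c) {E : Set ℝ}
    (hE : MeasurableSet E)
    (hA : IntegrableOn (fun t => c t • schr (-t) (probe (J t))) E volume) :
    ‖∫ t in E, c t • schr (-t) (probe (J t))‖ₑ
      ≤ 4 * (∫⁻ t in E, ‖c t‖ₑ ^ (4 / 3 : ℝ)) ^ (3 / 4 : ℝ) := by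
  set A : ℝ → L2C := fun t => c t • schr (-t) (probe (J t)) with hAdef
  set x := ∫ t in E, A t with hx
  have h1 : ‖x‖ₑ ^ 2 ≤ ∫⁻ t in E, ∫⁻ s in E, ‖(inner ℂ (A s) (A t) : ℂ)‖ₑ := by
    have e1 : (inner ℂ x x : ℂ) = ∫ t in E, inner ℂ x (A t) := by
      rw [integral_inner hA]
    have e2 : ∀ t, (inner ℂ x (A t) : ℂ) = starRingEnd ℂ (∫ s in E, inner ℂ (A t) (A s)) := by
      intro t
      rw [integral_inner hA, inner_conj_symm]
    have e3 : ‖x‖ₑ ^ 2 = ‖(inner ℂ x x : ℂ)‖ₑ := by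
      rw [inner_self_eq_norm_sq_to_K, enorm_pow]
      congr 1
      rw [← ofReal_norm, ← ofReal_norm]
      simp
    rw [e3, e1]
    refine (enorm_integral_le_lintegral_enorm _).trans (lintegral_mono fun t => ?_)
    rw [e2, RCLike.enorm_conj]
    refine (enorm_integral_le_lintegral_enorm _).trans (lintegral_mono fun s => ?_)
    rw [← inner_conj_symm, RCLike.enorm_conj]
  let p : ℝ → ℝ≥0∞ := indicator E fun t => ‖c t‖ₑ
  have hp : Measurable p := hc.enorm.indicator hE
  have hpfin : ∀ t, p t ≠ ⊤ := fun t => by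
    simp only [p, indicator]; split_ifs <;> simp
  have h2 : ∫⁻ t in E, ∫⁻ s in E, ‖(inner ℂ (A s) (A t) : ℂ)‖ₑ
      ≤ ∫⁻ t, ∫⁻ s, rieszKer (t - s) * p s * p t := by
    rw [← lintegral_indicator hE]
    refine lintegral_mono fun t => ?_
    by_cases ht : t ∈ E
    · rw [indicator_of_mem ht, ← lintegral_indicator hE]
      refine lintegral_mono fun s => ?_
      by_cases hs : s ∈ E
      · rw [indicator_of_mem hs]
        simp only [p, indicator_of_mem ht, indicator_of_mem hs, hAdef]
        rw [inner_smul_left, inner_smul_right, inner_schr, neg_neg, schr_schr, ← inner_conj_symm,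
          enorm_mul, enorm_mul, RCLike.enorm_conj, RCLike.enorm_conj,
          mul_comm (rieszKer (t - s)), mul_assoc, mul_comm (rieszKer (t - s))]
        gcongr
        have := enorm_inner_probe_schr_probe_le (J t) (J s) (t + -s)
        rwa [← sub_eq_add_neg] at this
      · rw [indicator_of_notMem hs]; exact zero_le
    · rw [indicator_of_notMem ht]; exact zero_le
  have h3 := (h1.trans h2).trans (hardy_littlewood_sobolev hp hpfin)
  have h4 : ∫⁻ s, p s ^ (4 / 3 : ℝ) = ∫⁻ t in E, ‖c t‖ₑ ^ (4 / 3 : ℝ) := by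
    rw [← lintegral_indicator hE]
    refine lintegral_congr fun s => ?_
    by_cases hs : s ∈ E <;> simp [p, hs]
  rw [h4] at h3
  have h5 : ‖x‖ₑ ^ 2 ≤ (4 * (∫⁻ t in E, ‖c t‖ₑ ^ (4 / 3 : ℝ)) ^ (3 / 4 : ℝ)) ^ 2 := by
    refine h3.trans ?_
    rw [mul_pow, ← ENNReal.rpow_natCast ((∫⁻ t in E, ‖c t‖ₑ ^ (4 / 3 : ℝ)) ^ (3 / 4 : ℝ)),
      ← ENNReal.rpow_mul]
    norm_num
    gcongr
    norm_num
  exact (ENNReal.pow_le_pow_left_iff (by norm_num)).1 h5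

theorem aestronglyMeasurable_schr {G : ℝ → ℝ × L2C} {μ : Measure ℝ}
    (hG : AEStronglyMeasurable G μ) :
    AEStronglyMeasurable (fun s : ℝ => schr (G s).1 (G s).2) μ :=
  continuous_schr₂.comp_aestronglyMeasurable hG

theorem stronglyMeasurable_schr {G : ℝ → ℝ × L2C} (hG : StronglyMeasurable G) :
    StronglyMeasurable (fun s : ℝ => schr (G s).1 (G s).2) :=
  continuous_schr₂.comp_stronglyMeasurable hG

theorem continuous_schr_apply {f : ℝ → ℝ} {g : ℝ → L2C} (hf : Continuous f)
    (hg : Continuous g) : Continuous fun t => schr (f t) (g t) := by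
  have h : ∀ G : ℝ → ℝ × L2C, Continuous G → Continuous fun t => schr (G t).1 (G t).2 :=
    fun G hG => continuous_schr₂.comp hG
  exact h (fun t => (f t, g t)) (hf.prodMk hg)

theorem continuousOn_schr_apply {f : ℝ → ℝ} {g : ℝ → L2C} {s : Set ℝ} (hf : ContinuousOn f s)
    (hg : ContinuousOn g s) : ContinuousOn (fun t => schr (f t) (g t)) s := by
  have h : ∀ G : ℝ → ℝ × L2C, ContinuousOn G s →
      ContinuousOn (fun t => schr (G t).1 (G t).2) s :=
    fun G hG => continuous_schr₂.comp_continuousOn hG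
  exact h (fun t => (f t, g t)) (hf.prodMk hg)

theorem integrable_schr_neg {F : ℝ → L2C} {μ : Measure ℝ} (hF : Integrable F μ) :
    Integrable (fun s => schr (-s) (F s)) μ := by
  have h1 : AEStronglyMeasurable (fun s : ℝ => -s) μ := measurable_neg.aestronglyMeasurable
  have h2 : AEStronglyMeasurable (fun s : ℝ => (-s, F s)) μ := h1.prodMk hF.1
  refine hF.mono (aestronglyMeasurable_schr (G := fun s => (-s, F s)) h2) ?_
  exact Eventually.of_forall fun s => (LinearIsometryEquiv.norm_map _ _).le

/-- One linearised Strichartz estimate: the index `J t` selects an average at each time. Since `J`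
has finite range, the quantity to be estimated is known to be finite, and it may be estimated by
duality and divided out. -/
theorem lintegral_inner_probe_pow_le {F : ℝ → L2C} (hF : Integrable F) {J : ℝ → ℚ × ℚ}
    (hJ : Measurable J) (hJfin : (range J).Finite) {T : ℝ} (hT : 0 ≤ T) :
    ∫⁻ t in Ioc 0 T, ‖(inner ℂ (probe (J t)) (schr t (∫ s in 0..t, schr (-s) (F s))) : ℂ)‖ₑ ^ 4
      ≤ (4 * ∫⁻ t in Ioc 0 T, ‖F t‖ₑ) ^ 4 := by
  have hF' : Integrable fun s => schr (-s) (F s) := integrable_schr_neg hF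
  set Y : ℝ → L2C := fun t => ∫ s in 0..t, schr (-s) (F s) with hY
  have hYc : Continuous Y := intervalIntegral.continuous_primitive
    (fun a b => hF'.intervalIntegrable) 0
  have hg : StronglyMeasurable fun t => probe (J t) :=
    (StronglyMeasurable.of_discrete (f := probe)).comp_measurable hJ
  have hg' : StronglyMeasurable fun t => schr (-t) (probe (J t)) :=
    stronglyMeasurable_schr (G := fun t => (-t, probe (J t)))
      (measurable_neg.stronglyMeasurable.prodMk hg)
  let a : ℝ → ℂ := fun t => inner ℂ (probe (J t)) (schr t (Y t))
  have ha : ∀ t, a t = inner ℂ (schr (-t) (probe (J t))) (Y t) := fun t => inner_schr _ _ _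
  have ham : Measurable a := by
    have : StronglyMeasurable a := by
      simp only [funext ha]
      exact hg'.inner hYc.stronglyMeasurable
    exact this.measurable
  obtain ⟨G, hG⟩ : ∃ G : ℝ, ∀ t, ‖probe (J t)‖ ≤ G := by
    obtain ⟨G, hG⟩ := (hJfin.image fun i => ‖probe i‖).bddAbove
    exact ⟨G, fun t => hG ⟨J t, mem_range_self t, rfl⟩⟩
  obtain ⟨M, hM⟩ := (isCompact_Icc (a := (0 : ℝ)) (b := T)).exists_bound_of_continuousOn
    hYc.continuousOn
  have hG0 : 0 ≤ G := (norm_nonneg _).trans (hG 0)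
  have hab : ∀ t ∈ Ioc 0 T, ‖a t‖ ≤ G * M := fun t ht => by
    rw [ha]
    refine (norm_inner_le_norm _ _).trans ?_
    rw [LinearIsometryEquiv.norm_map]
    exact mul_le_mul (hG t) (hM t ⟨ht.1.le, ht.2⟩) (norm_nonneg _) hG0
  -- the extremal weight in the duality of `L⁴` and `L^{4/3}`: `⟨A, Y⟩ = |a|⁴` and `|c|^{4/3} = |a|⁴`
  let c : ℝ → ℂ := fun t => ((‖a t‖ ^ 2 : ℝ) : ℂ) * a t
  have hc : Measurable c := (Complex.measurable_ofReal.comp (ham.norm.pow_const 2)).mul ham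
  have hcn : ∀ t, ‖c t‖ = ‖a t‖ ^ 3 := fun t => by
    simp only [c, norm_mul, Complex.norm_real, norm_pow, norm_norm]; ring
  let A : ℝ → L2C := fun t => c t • schr (-t) (probe (J t))
  have hA : IntegrableOn A (Ioc 0 T) volume := by
    refine Measure.integrableOn_of_bounded (M := (G * M) ^ 3 * G) (by simp)
      (hc.stronglyMeasurable.smul hg').aestronglyMeasurable ?_
    refine (ae_restrict_iff' measurableSet_Ioc).2 (Eventually.of_forall fun t ht => ?_)
    simp only [A, norm_smul, hcn, LinearIsometryEquiv.norm_map]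
    have h0 := hab t ht
    have h00 : 0 ≤ G * M := (norm_nonneg _).trans h0
    gcongr
    exact hG t
  have hAY : ∀ t, (inner ℂ (A t) (Y t) : ℂ) = ((‖a t‖ ^ 4 : ℝ) : ℂ) := fun t => by
    simp only [A]
    rw [inner_smul_left, ← ha]
    simp only [c, map_mul, Complex.conj_ofReal]
    rw [mul_assoc, Complex.conj_mul']
    push_cast; ring
  set I : ℝ≥0∞ := ∫⁻ t in Ioc 0 T, ‖a t‖ₑ ^ 4 with hI
  have hIfin : I ≠ ⊤ := by
    have : I ≤ ∫⁻ _ in Ioc 0 T, ENNReal.ofReal (G * M) ^ 4 := by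
      refine setLIntegral_mono' measurableSet_Ioc fun t ht => ?_
      rw [← ofReal_norm]
      gcongr
      exact hab t ht
    refine ne_top_of_le_ne_top ?_ this
    rw [setLIntegral_const]
    exact ENNReal.mul_ne_top (by simp) (by simp)
  -- by Fubini the primitive moves to `A`, where the dual estimate bounds it
  have hkey : ∫ t in 0..T, (inner ℂ (A t) (Y t) : ℂ)
      = ∫ s in 0..T, (inner ℂ (∫ t in s..T, A t) (schr (-s) (F s)) : ℂ) :=
    integral_inner_primitive hT hA hF'.integrableOn
  have hI2 : I = ‖∫ t in 0..T, (inner ℂ (A t) (Y t) : ℂ)‖ₑ := by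
    have e1 : ∫ t in 0..T, (inner ℂ (A t) (Y t) : ℂ) = ((∫ t in Ioc 0 T, ‖a t‖ ^ 4 : ℝ) : ℂ) := by
      rw [intervalIntegral.integral_of_le hT, ← integral_complex_ofReal]
      exact integral_congr_ae (Eventually.of_forall fun t => hAY t)
    have e2 : IntegrableOn (fun t => ‖a t‖ ^ 4) (Ioc 0 T) volume := by
      refine Measure.integrableOn_of_bounded (M := (G * M) ^ 4) (by simp)
        (ham.norm.pow_const 4).aestronglyMeasurable ?_
      refine (ae_restrict_iff' measurableSet_Ioc).2 (Eventually.of_forall fun t ht => ?_)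
      rw [norm_pow, norm_norm]
      have := hab t ht
      gcongr
    rw [e1, ← ofReal_norm, Complex.norm_real, Real.norm_of_nonneg
      (integral_nonneg fun t => by positivity), ofReal_integral_eq_lintegral_ofReal e2
      (Eventually.of_forall fun t => by positivity), hI]
    refine lintegral_congr fun t => ?_
    rw [← ofReal_norm, ENNReal.ofReal_pow (norm_nonneg _)]
  have hbound : I ≤ 4 * (∫⁻ t in Ioc 0 T, ‖F t‖ₑ) * I ^ (3 / 4 : ℝ) := by
    refine (hI2.trans (by rw [hkey])).le.trans ?_
    rw [intervalIntegral.integral_of_le hT]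
    refine (enorm_integral_le_lintegral_enorm _).trans ?_
    calc _ ≤ ∫⁻ s in Ioc 0 T, 4 * I ^ (3 / 4 : ℝ) * ‖F s‖ₑ := by
          refine setLIntegral_mono' measurableSet_Ioc fun s hs => ?_
          have h1 : ‖∫ t in s..T, A t‖ₑ ≤ 4 * I ^ (3 / 4 : ℝ) := by
            rw [intervalIntegral.integral_of_le hs.2]
            refine (enorm_integral_schr_probe_le hc measurableSet_Ioc
              (hA.mono_set (Ioc_subset_Ioc_left hs.1.le))).trans ?_
            gcongr
            calc _ ≤ ∫⁻ t in Ioc 0 T, ‖c t‖ₑ ^ (4 / 3 : ℝ) :=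
                  lintegral_mono_set (Ioc_subset_Ioc_left hs.1.le)
              _ = I := by
                rw [hI]
                refine lintegral_congr fun t => ?_
                have : ‖c t‖ₑ = ‖a t‖ₑ ^ 3 := by
                  rw [← ofReal_norm, hcn, ENNReal.ofReal_pow (norm_nonneg _), ofReal_norm]
                rw [this, ← ENNReal.rpow_natCast, ← ENNReal.rpow_natCast, ← ENNReal.rpow_mul]
                norm_num
          have h2 : ‖(inner ℂ (∫ t in s..T, A t) (schr (-s) (F s)) : ℂ)‖ₑ
              ≤ ‖∫ t in s..T, A t‖ₑ * ‖F s‖ₑ := by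
            have := norm_inner_le_norm (𝕜 := ℂ) (∫ t in s..T, A t) (schr (-s) (F s))
            rw [LinearIsometryEquiv.norm_map] at this
            rw [← ofReal_norm, ← ofReal_norm (E := L2C), ← ofReal_norm (E := L2C),
              ← ENNReal.ofReal_mul (norm_nonneg _)]
            exact ENNReal.ofReal_le_ofReal this
          exact h2.trans (by gcongr)
      _ = _ := by
          rw [lintegral_const_mul'' _ hF.1.restrict.enorm]
          ring
  change I ≤ _
  rcases eq_or_ne I 0 with h0 | h0
  · rw [h0]; exact zero_le
  -- divide `I ≤ 4 ‖F‖₁ I^{3/4}` by `I^{3/4}`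
  have hsplit : I = I ^ (1 / 4 : ℝ) * I ^ (3 / 4 : ℝ) := by
    rw [← ENNReal.rpow_add _ _ h0 hIfin]; norm_num
  have h34 : I ^ (3 / 4 : ℝ) ≠ 0 := by simp [h0, hIfin]
  have h34' : I ^ (3 / 4 : ℝ) ≠ ⊤ := ENNReal.rpow_ne_top_of_nonneg (by norm_num) hIfin
  nth_rw 1 [hsplit] at hbound
  have h5 := (ENNReal.mul_le_mul_iff_left h34 h34').1 hbound
  calc I = (I ^ (1 / 4 : ℝ)) ^ 4 := by
        rw [← ENNReal.rpow_natCast, ← ENNReal.rpow_mul]; norm_num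
    _ ≤ _ := by gcongr

/-- The supremum over all averages may be linearised by a measurable choice of one of finitely
many averages at each time. -/
theorem lintegral_supAv_pow_le {y : ℝ → L2C} (hy : Continuous y) {S : Set ℝ} {B : ℝ≥0∞}
    (h : ∀ J : ℝ → ℚ × ℚ, Measurable J → (range J).Finite →
      ∫⁻ t in S, ‖(inner ℂ (probe (J t)) (y t) : ℂ)‖ₑ ^ 4 ≤ B) :
    ∫⁻ t in S, supAv (y t) ^ 4 ≤ B := by
  obtain ⟨e, he⟩ := exists_surjective_nat (ℚ × ℚ)
  let a : ℕ → ℝ → ℝ≥0∞ := fun j t => ‖(inner ℂ (probe (e j)) (y t) : ℂ)‖ₑ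
  have ha : ∀ j, Measurable (a j) := fun j =>
    (continuous_enorm.comp (continuous_const.inner hy)).measurable
  choose J hJm hJn hJmax using fun n => exists_measurable_argmax ha n
  have hm : ∀ n, Measurable fun t => a (J n t) t := fun n => measurable_select (a := a) ha (hJm n)
  have hsup : ∀ t, supAv (y t) ^ 4 = ⨆ n, a (J n t) t ^ 4 := fun t => by
    have h1 : supAv (y t) = ⨆ n, a (J n t) t := by
      unfold supAv
      rw [← he.iSup_comp]
      refine le_antisymm (iSup_mono fun n => hJmax n t n le_rfl) (iSup_le fun n => ?_)
      exact le_iSup (fun j => a j t) (J n t)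
    rw [h1]
    have hmono : Monotone fun x : ℝ≥0∞ => x ^ 4 := fun _ _ hx => pow_le_pow_left' hx 4
    exact hmono.map_iSup_of_continuousAt
      (ENNReal.continuous_pow 4).continuousAt (by simp)
  calc _ = ∫⁻ t in S, ⨆ n, a (J n t) t ^ 4 := lintegral_congr fun t => hsup t
    _ = ⨆ n, ∫⁻ t in S, a (J n t) t ^ 4 := by
        rw [lintegral_iSup (fun n => (hm n).pow_const 4)]
        intro n m hnm t
        have := hJmax m t (J n t) ((hJn n t).trans hnm)
        beta_reduce
        gcongr
    _ ≤ _ := iSup_le fun n => by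
        refine h (fun t => e (J n t)) (measurable_from_nat.comp (hJm n)) ?_
        refine ((finite_Iic n).image e).subset ?_
        rintro _ ⟨t, rfl⟩
        exact ⟨J n t, hJn n t, rfl⟩

/-- The inhomogeneous Strichartz estimate from `L¹L²` to `L⁴L^∞`. -/
theorem strichartz {F : ℝ → L2C} (hF : Integrable F) {T : ℝ} (hT : 0 ≤ T) :
    ∫⁻ t in Ioc 0 T, supAv (schr t (∫ s in 0..t, schr (-s) (F s))) ^ 4
      ≤ (4 * ∫⁻ t in Ioc 0 T, ‖F t‖ₑ) ^ 4 := by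
  have hF' : Integrable fun s => schr (-s) (F s) := integrable_schr_neg hF
  have hYc : Continuous fun t => ∫ s in 0..t, schr (-s) (F s) :=
    intervalIntegral.continuous_primitive (fun a b => hF'.intervalIntegrable) 0
  exact lintegral_supAv_pow_le (continuous_schr_apply continuous_id hYc)
    fun J hJ hJf => lintegral_inner_probe_pow_le hF hJ hJf hT

/-! ### The Schrödinger group applied to a quadratic phase -/

/-- The evolution of a chirp times an inverse Fourier transform is again a chirp times the
integral of a Gaussian. The two constants are Fresnel integrals, computed by damping. -/
theorem coeFn_schr_chirp_fourierInv {t β : ℝ} (ht : t ≠ 0) (hβ : β + 1 / (4 * t) ≠ 0) {w : ℝ → ℂ}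
    (h1 : Integrable w) (h2 : MemLp w 2 volume) :
    schr t (chirp β (𝓕⁻ (toL2 w))) =ᵐ[volume] fun x =>
      ((Real.pi : ℂ) / (((4 * Real.pi ^ 2 * t : ℝ) : ℂ) * Complex.I)) ^ (1 / 2 : ℂ)
        * phase (1 / (4 * t)) x
        * ∫ ξ, gaussKer (((-(β + 1 / (4 * t)) : ℝ) : ℂ) * Complex.I) (ξ - x / (4 * Real.pi * t))
            * w ξ := by
  set γ : ℝ := β + 1 / (4 * t) with hγ
  set b : ℂ := ((-γ : ℝ) : ℂ) * Complex.I with hb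
  have hbre : b.re = 0 := by rw [hb, Complex.re_ofReal_mul]; simp
  have hbim : b.im = -γ := by rw [hb, Complex.im_ofReal_mul]; simp
  have hbim0 : b.im ≠ 0 := by rw [hbim]; exact neg_ne_zero.2 hβ
  set C : ℂ := ((Real.pi : ℂ) / (((4 * Real.pi ^ 2 * t : ℝ) : ℂ) * Complex.I)) ^ (1 / 2 : ℂ) with hC
  -- damping by `e^{-y²/(n+1)}` makes the datum integrable, so that the kernel formula applies
  let c : ℕ → ℂ := fun n => ((1 / ((n : ℝ) + 1) : ℝ) : ℂ) + b
  let e : ℕ → ℂ := fun n => ((1 / ((n : ℝ) + 1) : ℝ) : ℂ)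
  have here : ∀ n, 0 < (e n).re := fun n => by simp only [e, Complex.ofReal_re]; positivity
  have hcre : ∀ n, 0 < (c n).re := fun n => by
    simp only [c, Complex.add_re, Complex.ofReal_re, hbre]; positivity
  have hWc : Continuous (𝓕⁻ w) := continuous_fourierInv h1
  have hW2 : MemLp (𝓕⁻ w) 2 volume := (memLp_congr_ae (coeFn_fourierInv_toL2 h1 h2)).1 (Lp.memLp _)
  let F : ℕ → ℝ → ℂ := fun n y => Complex.exp (-e n * (y : ℂ) ^ 2) * (phase β y * 𝓕⁻ w y)
  have hFm : ∀ n, Continuous (F n) := fun n => by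
    have := continuous_phase β
    simp only [F]; fun_prop
  have hFb : ∀ n y, ‖F n y‖ ≤ ‖𝓕⁻ w y‖ := fun n y => by
    simp only [F, norm_mul, norm_phase, one_mul]
    exact mul_le_of_le_one_left (norm_nonneg _) (norm_exp_neg_mul_sq (here n).le y)
  have hFn2 : ∀ n, MemLp (F n) 2 volume := fun n =>
    memLp_of_bound (hFm n).aestronglyMeasurable hW2.norm (Eventually.of_forall (hFb n))
  have hFn1 : ∀ n, Integrable (F n) := fun n => by
    have hg := integrable_gaussian_phase (here n) 0
    simp only [zero_mul, add_zero] at hg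
    refine hg.mul_bdd (c := ∫ y, ‖w y‖) ((continuous_phase β).mul hWc).aestronglyMeasurable
      (Eventually.of_forall fun ξ => ?_)
    rw [norm_mul, norm_phase, one_mul]
    exact norm_fourierInv_le w ξ
  have hlim : Tendsto (fun n => schr t (toL2 (F n))) atTop
      (𝓝 (schr t (chirp β (𝓕⁻ (toL2 w))))) := by
    have h3 : chirp β (𝓕⁻ (toL2 w)) = toL2 (fun y => phase β y * 𝓕⁻ w y) := by
      rw [chirp_apply]
      refine toL2_congr ?_
      filter_upwards [coeFn_fourierInv_toL2 h1 h2] with x hx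
      rw [hx]
    rw [h3]
    refine ((schr t).continuous.tendsto _).comp ?_
    refine tendsto_toL2_of_dominated (G := fun ξ => ‖𝓕⁻ w ξ‖)
      (Eventually.of_forall fun n => (hFm n).aestronglyMeasurable) hW2.norm
      (Eventually.of_forall fun n => Eventually.of_forall (hFb n))
      (memLp_phase_mul _ hW2) (Eventually.of_forall fun y => ?_)
    have h5 : Continuous fun z : ℂ => Complex.exp (-z * (y : ℂ) ^ 2) * (phase β y * 𝓕⁻ w y) := by
      fun_prop
    have h6 := tendsto_one_div_add_ofReal 0
    simp only [add_zero] at h6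
    have h7 := (h5.tendsto 0).comp h6
    have h8 : Tendsto (fun n => F n y) atTop
        (𝓝 (Complex.exp (-0 * (y : ℂ) ^ 2) * (phase β y * 𝓕⁻ w y))) := h7
    simpa only [neg_zero, zero_mul, Complex.exp_zero, one_mul] using h8
  refine coeFn_eq_of_tendsto hlim (φ := fun n x => C * phase (1 / (4 * t)) x *
    ∫ ξ, gaussKer (c n) (ξ - x / (4 * Real.pi * t)) * w ξ) (fun n => ?_)
    (Eventually.of_forall fun x =>
      (tendsto_gaussKer_integral hbre.ge hbim0 h1 (by fun_prop)).const_mul _)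
  refine (coeFn_schr_toL2 ht (hFn1 n) (hFn2 n)).trans (Eventually.of_forall fun x => ?_)
  let h : ℝ → ℂ := fun y => Complex.exp (-c n * (y : ℂ) ^ 2
    + (2 * Real.pi * Complex.I * ((-x / (4 * Real.pi * t) : ℝ) : ℂ)) * y)
  have hh : Integrable h := integrable_gaussian_phase (hcre n) _
  have e1 : ∀ y, gaussKer (((4 * Real.pi ^ 2 * t : ℝ) : ℂ) * Complex.I) (x - y) * F n y
      = C * phase (1 / (4 * t)) x * (𝓕⁻ w y * h y) := fun y => by
    -- the exponents agree after expanding `(x - y)²`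
    have e3 : Complex.exp (-((Real.pi : ℂ) ^ 2 * ((x - y : ℝ) : ℂ) ^ 2
          / (((4 * Real.pi ^ 2 * t : ℝ) : ℂ) * Complex.I)))
        * (Complex.exp (-e n * (y : ℂ) ^ 2) * phase β y) = phase (1 / (4 * t)) x * h y := by
      unfold phase
      simp only [h, ← Complex.exp_add]
      congr 1
      have ht' : (t : ℂ) ≠ 0 := by exact_mod_cast ht
      have hp' : (Real.pi : ℂ) ≠ 0 := by exact_mod_cast Real.pi_ne_zero
      simp only [c, e, hb, hγ]
      push_cast
      field_simp
      linear_combination (-((n : ℂ) + 1) * ((x : ℂ) - y) ^ 2) * Complex.I_sq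
    unfold gaussKer
    simp only [F]
    rw [← hC]
    linear_combination (C * 𝓕⁻ w y) * e3
  have e2 : ∀ ξ, 𝓕⁻ h ξ = gaussKer (c n) (ξ - x / (4 * Real.pi * t)) := fun ξ => by
    rw [← integral_gaussian_phase (hcre n), Real.fourierInv_eq']
    refine integral_congr_ae (Eventually.of_forall fun y => ?_)
    simp only [h, smul_eq_mul]
    rw [← Complex.exp_add]
    congr 1
    simp only [RCLike.inner_apply, conj_trivial]
    push_cast
    ring
  simp only [e1]
  rw [integral_const_mul, integral_fourierInv_mul h1 hh]
  congr 1
  refine integral_congr_ae (Eventually.of_forall fun ξ => ?_)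
  simp only [e2, mul_comm]

/-- The evolution of a chirp times an inverse Fourier transform is bounded, with a constant that
remains integrable against `ds/s`. -/
theorem supAv_schr_chirp_fourierInv_le {t s : ℝ} (hs : 0 < s) (hst : s ≤ t) {w : ℝ → ℂ}
    (h1 : Integrable w) (h2 : MemLp w 2 volume) :
    supAv (schr t (chirp (-(1 / (2 * s))) (𝓕⁻ (toL2 w))))
      ≤ ENNReal.ofReal ((s / t) ^ (1 / 2 : ℝ)) * ∫⁻ ξ, ‖w ξ‖ₑ := by
  have ht : 0 < t := hs.trans_le hst
  have hγ : -(1 / (2 * s)) + 1 / (4 * t) = -((2 * t - s) / (4 * s * t)) := by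
    field_simp; ring
  have hpos : 0 < (2 * t - s) / (4 * s * t) := by
    apply div_pos <;> nlinarith [mul_pos hs ht]
  refine supAv_le_of_ae ?_
  filter_upwards [coeFn_schr_chirp_fourierInv ht.ne' (by rw [hγ]; linarith) h1 h2] with x hx
  rw [hx, hγ, neg_neg, enorm_mul, enorm_mul]
  have e1 : ‖phase (1 / (4 * t)) x‖ₑ = 1 := by rw [← ofReal_norm, norm_phase]; simp
  have hpi := Real.pi_pos
  have e2 : ‖((Real.pi : ℂ) / (((4 * Real.pi ^ 2 * t : ℝ) : ℂ) * Complex.I)) ^ (1 / 2 : ℂ)‖ₑ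
      = ENNReal.ofReal ((Real.pi / (4 * Real.pi ^ 2 * t)) ^ (1 / 2 : ℝ)) := by
    rw [← ofReal_norm, show (1 / 2 : ℂ) = ((1 / 2 : ℝ) : ℂ) by push_cast; rfl,
      Complex.norm_cpow_real, norm_div, norm_mul, Complex.norm_real, Complex.norm_real,
      Complex.norm_I, mul_one, Real.norm_of_nonneg hpi.le, Real.norm_of_nonneg (by positivity)]
  rw [e1, e2, mul_one]
  have e3 : ‖∫ ξ, gaussKer ((((2 * t - s) / (4 * s * t) : ℝ) : ℂ) * Complex.I)
        (ξ - x / (4 * Real.pi * t)) * w ξ‖ₑ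
      ≤ ENNReal.ofReal ((Real.pi / ((2 * t - s) / (4 * s * t))) ^ (1 / 2 : ℝ)) * ∫⁻ ξ, ‖w ξ‖ₑ := by
    refine (enorm_integral_le_lintegral_enorm _).trans ?_
    rw [← lintegral_const_mul'' _ h1.1.enorm]
    refine lintegral_mono fun ξ => ?_
    rw [enorm_mul]
    gcongr
    rw [← ofReal_norm]
    refine ENNReal.ofReal_le_ofReal ?_
    have him : ((((2 * t - s) / (4 * s * t) : ℝ) : ℂ) * Complex.I).im = (2 * t - s) / (4 * s * t) := by
      rw [Complex.im_ofReal_mul]; simp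
    have hre : ((((2 * t - s) / (4 * s * t) : ℝ) : ℂ) * Complex.I).re = 0 := by
      rw [Complex.re_ofReal_mul]; simp
    have := norm_gaussKer_le_of_im hre.ge (by rw [him]; exact hpos.ne') (ξ - x / (4 * Real.pi * t))
    rwa [him, abs_of_pos hpos] at this
  refine (mul_le_mul_right e3 _).trans ?_
  rw [← mul_assoc, ← ENNReal.ofReal_mul (by positivity)]
  gcongr
  rw [← Real.mul_rpow (by positivity) (by positivity)]
  refine Real.rpow_le_rpow (by positivity) ?_ (by norm_num)
  have : Real.pi / (4 * Real.pi ^ 2 * t) * (Real.pi / ((2 * t - s) / (4 * s * t)))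
      = s / (2 * t - s) := by
    have h3 : 2 * t - s ≠ 0 := by linarith
    field_simp
  rw [this]
  exact div_le_div_of_nonneg_left hs.le ht (by linarith)

theorem schr_fourierInv {t : ℝ} (f : L2C) :
    schr t (𝓕⁻ f) = 𝓕⁻ (chirp (-(4 * Real.pi ^ 2 * t)) f) := by
  rw [schr_apply, FourierTransform.fourier_fourierInv_eq]

theorem coeFn_schr_fourierInv {t : ℝ} {v : ℝ → ℂ} (h1 : Integrable v) (h2 : MemLp v 2 volume) :
    schr t (𝓕⁻ (toL2 v)) =ᵐ[volume]
      𝓕⁻ (fun ξ => phase (-(4 * Real.pi ^ 2 * t)) ξ * v ξ) := by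
  rw [schr_fourierInv, chirp_toL2 _ h2]
  refine coeFn_fourierInv_toL2 ?_ (memLp_phase_mul _ h2)
  exact h1.bdd_mul (continuous_phase _).aestronglyMeasurable
    (Eventually.of_forall fun x => (norm_phase _ x).le)

theorem supAv_schr_fourierInv_le {t : ℝ} {v : ℝ → ℂ} (h1 : Integrable v) (h2 : MemLp v 2 volume) :
    supAv (schr t (𝓕⁻ (toL2 v))) ≤ ∫⁻ ξ, ‖v ξ‖ₑ := by
  refine supAv_le_of_ae ?_
  filter_upwards [coeFn_schr_fourierInv (t := t) h1 h2] with x hx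
  rw [hx, Real.fourierInv_eq']
  refine (enorm_integral_le_lintegral_enorm _).trans (lintegral_mono fun ξ => ?_)
  rw [enorm_smul, enorm_mul]
  have e1 : ‖phase (-(4 * Real.pi ^ 2 * t)) ξ‖ₑ = 1 := by rw [← ofReal_norm, norm_phase]; simp
  rw [e1, one_mul, ← ofReal_norm, Complex.norm_exp_ofReal_mul_I]
  simp

/-- The pseudo-conformal identity: `e^{ix²/2s}` times the conjugate of the free solution with datum
`v̌` is, up to the factor `-i`, the free evolution to time `s` of `e^{-ix²/2s}` times the inverse
Fourier transform of `v̄`. The first phase is that of the square of the selfsimilar solution. -/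
theorem schr_chirp_conj {s : ℝ} (hs : 0 < s) {v : ℝ → ℂ} (h1 : Integrable v)
    (h2 : MemLp v 2 volume) :
    schr s (chirp (-(1 / (2 * s))) (𝓕⁻ (toL2 fun ξ => starRingEnd ℂ (v ξ))))
      = (-Complex.I) • chirp (1 / (2 * s)) (star (schr s (𝓕⁻ (toL2 v)))) := by
  have h1' : Integrable fun ξ => starRingEnd ℂ (v ξ) :=
    (Complex.conjCLE.toContinuousLinearMap.integrable_comp h1 :)
  have h2' : MemLp (fun ξ => starRingEnd ℂ (v ξ)) 2 volume := h2.star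
  have hγ : -(1 / (2 * s)) + 1 / (4 * s) = -(1 / (4 * s)) := by field_simp; ring
  have hpos : 0 < 1 / (4 * s) := by positivity
  have hs' : (s : ℂ) ≠ 0 := by exact_mod_cast hs.ne'
  have hp' : (Real.pi : ℂ) ≠ 0 := by exact_mod_cast Real.pi_ne_zero
  have hpi := Real.pi_pos
  apply Lp.ext
  filter_upwards [coeFn_schr_chirp_fourierInv hs.ne' (by rw [hγ]; linarith) h1' h2',
    Lp.coeFn_smul (-Complex.I) (chirp (1 / (2 * s)) (star (schr s (𝓕⁻ (toL2 v))))),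
    coeFn_chirp (1 / (2 * s)) (star (schr s (𝓕⁻ (toL2 v)))),
    coeFn_star_eq (schr s (𝓕⁻ (toL2 v))), coeFn_schr_fourierInv (t := s) h1 h2]
    with x e1 e2 e3 e4 e5
  rw [e1, e2, Pi.smul_apply, e3, e4, e5, hγ, neg_neg]
  -- the two square roots have the same argument, so that their product is a square root squared
  have hroot : ((Real.pi : ℂ) / (((4 * Real.pi ^ 2 * s : ℝ) : ℂ) * Complex.I)) ^ (1 / 2 : ℂ)
      * ((Real.pi : ℂ) / (((1 / (4 * s) : ℝ) : ℂ) * Complex.I)) ^ (1 / 2 : ℂ) = -Complex.I := by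
    have r1 : (Real.pi : ℂ) / (((4 * Real.pi ^ 2 * s : ℝ) : ℂ) * Complex.I)
        = ((1 / (4 * Real.pi * s) : ℝ) : ℂ) * (-Complex.I) := by
      push_cast
      field_simp
      rw [Complex.I_sq]; ring
    have r2 : (Real.pi : ℂ) / (((1 / (4 * s) : ℝ) : ℂ) * Complex.I)
        = ((4 * Real.pi * s : ℝ) : ℂ) * (-Complex.I) := by
      push_cast
      field_simp
      rw [Complex.I_sq]; ring
    have key : ∀ r : ℝ, 0 < r → ((r : ℂ) * (-Complex.I)) ^ (1 / 2 : ℂ)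
        = (r : ℂ) ^ (1 / 2 : ℂ) * (-Complex.I) ^ (1 / 2 : ℂ) := fun r hr => by
      have hr' : (r : ℂ) ≠ 0 := by exact_mod_cast hr.ne'
      have hI : -Complex.I ≠ 0 := neg_ne_zero.2 Complex.I_ne_zero
      rw [Complex.cpow_def_of_ne_zero (mul_ne_zero hr' hI), Complex.cpow_def_of_ne_zero hr',
        Complex.cpow_def_of_ne_zero hI, Complex.log_ofReal_mul hr hI, Complex.ofReal_log hr.le,
        add_mul, Complex.exp_add]
    rw [r1, r2, key _ (by positivity), key _ (by positivity)]
    have r3 : (((1 / (4 * Real.pi * s) : ℝ) : ℂ)) ^ (1 / 2 : ℂ)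
        * (((4 * Real.pi * s : ℝ) : ℂ)) ^ (1 / 2 : ℂ) = 1 := by
      rw [← Complex.mul_cpow_ofReal_nonneg (by positivity) (by positivity), ← Complex.ofReal_mul]
      have : 1 / (4 * Real.pi * s) * (4 * Real.pi * s) = 1 := by field_simp
      rw [this]; simp
    have r4 : (-Complex.I) ^ (1 / 2 : ℂ) * (-Complex.I) ^ (1 / 2 : ℂ) = -Complex.I := by
      rw [← Complex.cpow_add _ _ (by simp)]
      norm_num
    linear_combination ((-Complex.I) ^ (1 / 2 : ℂ) * (-Complex.I) ^ (1 / 2 : ℂ)) * r3 + r4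
  rw [Real.fourierInv_eq', ← integral_conj, smul_eq_mul, ← integral_const_mul, ← integral_const_mul,
    ← integral_const_mul]
  refine integral_congr_ae (Eventually.of_forall fun ξ => ?_)
  unfold gaussKer
  simp only [smul_eq_mul, map_mul, conj_phase, neg_neg]
  have e6 : phase (1 / (4 * s)) x * Complex.exp (-((Real.pi : ℂ) ^ 2
        * ((ξ - x / (4 * Real.pi * s) : ℝ) : ℂ) ^ 2 / (((1 / (4 * s) : ℝ) : ℂ) * Complex.I)))
      = phase (1 / (2 * s)) x * (starRingEnd ℂ (Complex.exp (((2 * Real.pi * inner ℝ ξ x : ℝ) : ℂ)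
          * Complex.I)) * phase (4 * Real.pi ^ 2 * s) ξ) := by
    rw [← Complex.exp_conj]
    unfold phase
    simp only [← Complex.exp_add]
    congr 1
    simp only [RCLike.inner_apply, conj_trivial, map_mul, Complex.conj_ofReal, Complex.conj_I]
    push_cast
    field_simp
    rw [Complex.I_sq]
    ring
  linear_combination (starRingEnd ℂ (v ξ)) * (-Complex.I) * e6 + (starRingEnd ℂ (v ξ)) *
    (phase (1 / (4 * s)) x * Complex.exp (-((Real.pi : ℂ) ^ 2
        * ((ξ - x / (4 * Real.pi * s) : ℝ) : ℂ) ^ 2 / (((1 / (4 * s) : ℝ) : ℂ) * Complex.I)))) * hroot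

/-! ### The Schrödinger group on Schwartz functions -/

/-- The second derivative on Schwartz functions. -/
def schwartzD2 (f : SchwartzMap ℝ ℂ) : SchwartzMap ℝ ℂ :=
  SchwartzMap.derivCLM ℂ ℂ (SchwartzMap.derivCLM ℂ ℂ f)

theorem coe_schwartzD2 (f : SchwartzMap ℝ ℂ) : ⇑(schwartzD2 f) = iteratedDeriv 2 f := by
  ext x
  rw [iteratedDeriv_succ, iteratedDeriv_one]
  unfold schwartzD2
  rw [SchwartzMap.derivCLM_apply]
  congr 1

theorem memLp_schwartz (f : SchwartzMap ℝ ℂ) : MemLp f 2 volume := f.memLp 2 volume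

theorem fourier_schwartzD2 (f : SchwartzMap ℝ ℂ) (ξ : ℝ) :
    𝓕 (schwartzD2 f : ℝ → ℂ) ξ = -((4 * Real.pi ^ 2 * ξ ^ 2 : ℝ) : ℂ) * 𝓕 (f : ℝ → ℂ) ξ := by
  have key : ∀ g : SchwartzMap ℝ ℂ, 𝓕 (SchwartzMap.derivCLM ℂ ℂ g : ℝ → ℂ)
      = fun x : ℝ => (2 * Real.pi * Complex.I * x) • 𝓕 (g : ℝ → ℂ) x := fun g =>
    Real.fourier_deriv g.integrable g.differentiable (SchwartzMap.derivCLM ℂ ℂ g).integrable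
  unfold schwartzD2
  rw [key, key]
  simp only [smul_eq_mul]
  push_cast
  linear_combination (4 * (Real.pi : ℂ) ^ 2 * ξ ^ 2 * 𝓕 (f : ℝ → ℂ) ξ) * Complex.I_sq

theorem memLp_fourier_schwartz (f : SchwartzMap ℝ ℂ) : MemLp (𝓕 (f : ℝ → ℂ)) 2 volume := by
  rw [← SchwartzMap.fourier_coe]; exact memLp_schwartz _

theorem schr_schwartz (t : ℝ) (f : SchwartzMap ℝ ℂ) :
    schr t (toL2 f) = 𝓕⁻ (toL2 fun ξ => phase (-(4 * Real.pi ^ 2 * t)) ξ * 𝓕 (f : ℝ → ℂ) ξ) := by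
  rw [schr_apply, ← chirp_toL2 _ (memLp_fourier_schwartz f)]
  congr 2
  exact eq_toL2 (coeFn_fourier_toL2 f.integrable (memLp_schwartz f))

/-- The Schrödinger equation for Schwartz data. -/
theorem hasDerivAt_schr (f : SchwartzMap ℝ ℂ) (t : ℝ) :
    HasDerivAt (fun s => schr s (toL2 f)) (Complex.I • schr t (toL2 (schwartzD2 f))) t := by
  have h1 : HasDerivAt
      (fun s => toL2 fun ξ => phase (-(4 * Real.pi ^ 2 * s)) ξ * 𝓕 (f : ℝ → ℂ) ξ)
      (toL2 fun ξ => Complex.I * (phase (-(4 * Real.pi ^ 2 * t)) ξ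
        * 𝓕 (schwartzD2 f : ℝ → ℂ) ξ)) t := by
    refine hasDerivAt_toL2 (ε := 1) one_pos (f' := fun s ξ => Complex.I *
      (phase (-(4 * Real.pi ^ 2 * s)) ξ * 𝓕 (schwartzD2 f : ℝ → ℂ) ξ))
      (fun s _ => memLp_phase_mul _ (memLp_fourier_schwartz f))
      (memLp_fourier_schwartz (schwartzD2 f)).norm ?_ ?_ ?_
    · exact ((memLp_phase_mul _ (memLp_fourier_schwartz _)).const_mul _).1
    · exact Eventually.of_forall fun ξ s _ => by simp [norm_phase]
    · refine Eventually.of_forall fun ξ s _ => ?_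
      rw [fourier_schwartzD2]
      have h2 : HasDerivAt (fun s : ℝ => phase (-(4 * Real.pi ^ 2 * s)) ξ)
          (phase (-(4 * Real.pi ^ 2 * s)) ξ
            * (Complex.I * ((-(4 * Real.pi ^ 2) * ξ ^ 2 : ℝ) : ℂ))) s := by
        unfold phase
        have h3 : HasDerivAt (fun s : ℝ => -(4 * Real.pi ^ 2 * s) * ξ ^ 2)
            (-(4 * Real.pi ^ 2) * ξ ^ 2) s := by
          have := ((hasDerivAt_id s).const_mul (4 * Real.pi ^ 2)).neg.mul_const (ξ ^ 2)
          simpa using this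
        exact (h3.ofReal_comp.const_mul Complex.I).cexp
      have h4 := h2.mul_const (𝓕 (f : ℝ → ℂ) ξ)
      refine h4.congr_deriv ?_
      push_cast; ring
  have h2 := ((Lp.fourierTransformₗᵢ ℝ ℂ).symm.toContinuousLinearEquiv.toContinuousLinearMap.restrictScalars
    ℝ).hasFDerivAt.comp_hasDerivAt t h1
  have h3 : Complex.I • schr t (toL2 (schwartzD2 f)) = 𝓕⁻ (toL2 fun ξ => Complex.I *
      (phase (-(4 * Real.pi ^ 2 * t)) ξ * 𝓕 (schwartzD2 f : ℝ → ℂ) ξ)) := by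
    rw [schr_schwartz, toL2_const_mul (memLp_phase_mul _ (memLp_fourier_schwartz _))]
    exact ((Lp.fourierTransformₗᵢ ℝ ℂ).symm.map_smul _ _).symm
  rw [h3]
  simp only [schr_schwartz]
  exact h2

/-! ### Mild and weak solutions -/

/-- `W` solves `iW_t + W_xx + σN = 0` on `[a, b]` in the sense of Duhamel's formula. -/
def MildOn (σ a b : ℝ) (N W : ℝ → L2C) : Prop :=
  ∀ t ∈ Icc a b, schr (-t) (W t)
    = schr (-a) (W a) + (Complex.I * σ) • ∫ τ in a..t, schr (-τ) (N τ)

/-- `W` solves `iW_t + W_xx + σN = 0` on `[a, b]` in the sense of distributions. The test functions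
enter through the inner product, that is, with a complex conjugation. -/
def WeakOn (σ a b : ℝ) (N W : ℝ → L2C) : Prop :=
  ∀ ψ : ℝ → ℂ, ContDiff ℝ ∞ ψ → HasCompactSupport ψ → ∀ t ∈ Icc a b,
    Complex.I * (inner ℂ (toL2 ψ) (W t) - inner ℂ (toL2 ψ) (W a))
      + ∫ τ in a..t, ((inner ℂ (toL2 (iteratedDeriv 2 ψ)) (W τ) : ℂ)
          + σ * inner ℂ (toL2 ψ) (N τ)) = 0

theorem MildOn.continuousOn {σ a b : ℝ} {N W : ℝ → L2C} (hN : IntegrableOn N (Ioc a b) volume)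
    (h : MildOn σ a b N W) : ContinuousOn W (Icc a b) := by
  rcases lt_or_ge b a with hba | hab
  · rw [Icc_eq_empty (not_le.2 hba)]; exact continuousOn_empty _
  have h1 : ContinuousOn (fun t => schr (-a) (W a)
      + (Complex.I * σ) • ∫ τ in a..t, schr (-τ) (N τ)) (Icc a b) := by
    have h2 : IntegrableOn (fun τ => schr (-τ) (N τ)) (uIcc a b) volume := by
      rw [uIcc_of_le hab, integrableOn_Icc_iff_integrableOn_Ioc]
      exact integrable_schr_neg hN
    have h3 := intervalIntegral.continuousOn_primitive_interval h2
    rw [uIcc_of_le hab] at h3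
    exact continuousOn_const.add (h3.const_smul (Complex.I * (σ : ℂ)))
  refine (continuousOn_schr_apply continuousOn_id h1).congr fun t ht => ?_
  simp only [id]
  rw [← h t ht, schr_schr_neg]

theorem continuous_inner_left {f : L2C} {g : ℝ → L2C} {s : Set ℝ} (hg : ContinuousOn g s) :
    ContinuousOn (fun t => (inner ℂ f (g t) : ℂ)) s := by
  have h : Continuous fun x : L2C => (inner ℂ f x : ℂ) := continuous_const.inner continuous_id
  exact h.comp_continuousOn hg

/-- Duhamel's formula gives a weak solution. -/
theorem MildOn.weakOn {σ a b : ℝ} {N W : ℝ → L2C} (hN : IntegrableOn N (Ioc a b) volume)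
    (h : MildOn σ a b N W) : WeakOn σ a b N W := by
  intro ψ hψ hψc t ht
  let f : SchwartzMap ℝ ℂ := hψc.toSchwartzMap hψ
  have hf : ⇑f = ψ := rfl
  have hf2 : iteratedDeriv 2 ψ = ⇑(schwartzD2 f) := by rw [coe_schwartzD2, hf]
  have hWc := (h.continuousOn hN).mono (Icc_subset_Icc_right ht.2)
  rw [hf2, ← hf]
  have hab := ht.1
  set A : ℝ → L2C := fun τ => schr (-τ) (toL2 f) with hA
  set A' : ℝ → L2C := fun τ => (-Complex.I) • schr (-τ) (toL2 (schwartzD2 f)) with hA'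
  set Y : ℝ → L2C := fun τ => schr (-τ) (W τ) with hY
  set B : ℝ → L2C := fun τ => schr (-τ) (N τ) with hB
  have hAd : ∀ τ, HasDerivAt A (A' τ) τ := fun τ => by
    have h1 := (hasDerivAt_schr f (-τ)).scomp τ (hasDerivAt_neg τ)
    refine h1.congr_deriv ?_
    simp only [hA', neg_smul, one_smul]
  have hA'c : Continuous A' :=
    (continuous_schr_apply continuous_neg continuous_const).const_smul (-Complex.I)
  have hAc : Continuous A := continuous_schr_apply continuous_neg continuous_const
  have hBi : IntegrableOn B (Ioc a t) volume :=
    (integrable_schr_neg hN).mono_measure (Measure.restrict_mono (Ioc_subset_Ioc_right ht.2) le_rfl)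
  have hBii : IntervalIntegrable B volume a t := (intervalIntegrable_iff_integrableOn_Ioc_of_le hab).2 hBi
  have hYt : ∀ τ ∈ Icc a t, Y τ = Y a + (Complex.I * σ) • ∫ r in a..τ, B r := fun τ hτ =>
    h τ ⟨hτ.1, hτ.2.trans ht.2⟩
  have hFTC : ∀ r, ∫ τ in r..t, A' τ = A t - A r := fun r =>
    intervalIntegral.integral_eq_sub_of_hasDerivAt (fun τ _ => hAd τ) (hA'c.intervalIntegrable _ _)
  have hfub := integral_inner_primitive hab (A := A') (B := B)
    (hA'c.integrableOn_Icc.mono_set Ioc_subset_Icc_self) hBi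
  have hi1 : IntervalIntegrable (fun τ => (inner ℂ (A' τ) (Y a) : ℂ)) volume a t :=
    (hA'c.inner continuous_const).intervalIntegrable _ _
  have hprim : ContinuousOn (fun τ => ∫ r in a..τ, B r) (Icc a t) := by
    have h2 : IntegrableOn B (uIcc a t) volume := by
      rw [uIcc_of_le hab, integrableOn_Icc_iff_integrableOn_Ioc]; exact hBi
    have := intervalIntegral.continuousOn_primitive_interval h2
    rwa [uIcc_of_le hab] at this
  have hi2 : IntervalIntegrable (fun τ => (inner ℂ (A' τ) (∫ r in a..τ, B r) : ℂ)) volume a t := by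
    refine ContinuousOn.intervalIntegrable ?_
    rw [uIcc_of_le hab]
    exact hA'c.continuousOn.inner hprim
  have hi3 : IntervalIntegrable (fun τ => (inner ℂ (A τ) (B τ) : ℂ)) volume a t := by
    rw [intervalIntegrable_iff_integrableOn_Ioc_of_le hab]
    have hn : ∀ τ, ‖A τ‖ = ‖toL2 f‖ := fun τ => LinearIsometryEquiv.norm_map _ _
    refine (hBi.norm.const_mul ‖toL2 f‖).mono (hAc.aestronglyMeasurable.inner hBi.1) ?_
    refine Eventually.of_forall fun τ => ?_
    rw [norm_mul, norm_norm, norm_norm, ← hn τ]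
    exact norm_inner_le_norm _ _
  have hi4 : IntervalIntegrable (fun τ => (inner ℂ (A t) (B τ) : ℂ)) volume a t := by
    rw [intervalIntegrable_iff_integrableOn_Ioc_of_le hab]
    exact hBi.const_inner _
  -- integration by parts, with the primitive of `B` in place of an absolutely continuous function
  have key : ∫ τ in a..t, (inner ℂ (A' τ) (Y τ) : ℂ)
      = inner ℂ (A t) (Y t) - inner ℂ (A a) (Y a)
        - (Complex.I * σ) * ∫ τ in a..t, (inner ℂ (A τ) (B τ) : ℂ) := by
    have e1 : ∫ τ in a..t, (inner ℂ (A' τ) (Y τ) : ℂ)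
        = ∫ τ in a..t, ((inner ℂ (A' τ) (Y a) : ℂ)
          + (Complex.I * σ) * inner ℂ (A' τ) (∫ r in a..τ, B r)) := by
      refine intervalIntegral.integral_congr fun τ hτ => ?_
      rw [uIcc_of_le hab] at hτ
      rw [hYt τ hτ, inner_add_right, inner_smul_right]
    have e2 : ∫ τ in a..t, (inner ℂ (A' τ) (Y a) : ℂ) = inner ℂ (A t) (Y a) - inner ℂ (A a) (Y a) := by
      have h5 : ∀ τ, HasDerivAt (fun τ => (inner ℂ (A τ) (Y a) : ℂ)) (inner ℂ (A' τ) (Y a)) τ := by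
        intro τ
        have := (hAd τ).inner ℂ (hasDerivAt_const τ (Y a))
        simpa using this
      exact intervalIntegral.integral_eq_sub_of_hasDerivAt (fun τ _ => h5 τ) hi1
    have e3 : ∫ r in a..t, (inner ℂ (∫ τ in r..t, A' τ) (B r) : ℂ)
        = inner ℂ (A t) (∫ r in a..t, B r) - ∫ r in a..t, (inner ℂ (A r) (B r) : ℂ) := by
      simp only [hFTC, inner_sub_left]
      rw [intervalIntegral.integral_sub hi4 hi3]
      congr 1
      rw [intervalIntegral.integral_of_le hab, intervalIntegral.integral_of_le hab]
      exact integral_inner hBi _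
    rw [e1, intervalIntegral.integral_add hi1 (hi2.const_mul _), intervalIntegral.integral_const_mul,
      hfub, e2, e3, hYt t ⟨hab, le_rfl⟩, inner_add_right, inner_smul_right]
    ring
  have hc1 : ∀ τ, (inner ℂ (toL2 (schwartzD2 f)) (W τ) : ℂ) = -Complex.I * inner ℂ (A' τ) (Y τ) := by
    intro τ
    simp only [hA', hY]
    rw [inner_smul_left, LinearIsometryEquiv.inner_map_map]
    simp only [map_neg, Complex.conj_I, neg_neg]
    linear_combination (inner ℂ (toL2 (schwartzD2 f)) (W τ) : ℂ) * Complex.I_sq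
  have hc2 : ∀ τ, (inner ℂ (toL2 f) (N τ) : ℂ) = inner ℂ (A τ) (B τ) := fun τ => by
    simp only [hA, hB, LinearIsometryEquiv.inner_map_map]
  have hc3 : ∀ τ, (inner ℂ (toL2 f) (W τ) : ℂ) = inner ℂ (A τ) (Y τ) := fun τ => by
    simp only [hA, hY, LinearIsometryEquiv.inner_map_map]
  have hi5 : IntervalIntegrable (fun τ => (inner ℂ (A' τ) (Y τ) : ℂ)) volume a t := by
    refine ContinuousOn.intervalIntegrable ?_
    rw [uIcc_of_le hab]
    exact hA'c.continuousOn.inner (continuousOn_schr_apply continuousOn_id.neg hWc)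
  simp only [hc1, hc2, hc3]
  rw [intervalIntegral.integral_add (hi5.const_mul _) (hi3.const_mul _),
    intervalIntegral.integral_const_mul, intervalIntegral.integral_const_mul, key]
  linear_combination ((σ : ℂ) * ∫ τ in a..t, (inner ℂ (A τ) (B τ) : ℂ)) * Complex.I_sq

/-- Schwartz functions are limits of smooth compactly supported functions, together with their
second derivatives. -/
theorem exists_cutoff (f : SchwartzMap ℝ ℂ) : ∃ ψ : ℕ → ℝ → ℂ,
    (∀ n, ContDiff ℝ ∞ (ψ n)) ∧ (∀ n, HasCompactSupport (ψ n)) ∧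
    Tendsto (fun n => toL2 (ψ n)) atTop (𝓝 (toL2 f)) ∧
    Tendsto (fun n => toL2 (iteratedDeriv 2 (ψ n))) atTop (𝓝 (toL2 (schwartzD2 f))) := by
  let χ : ContDiffBump (0 : ℝ) := ⟨1, 2, one_pos, one_lt_two⟩
  have hχ : ContDiff ℝ ∞ χ := χ.contDiff
  have hχc : HasCompactSupport χ := χ.hasCompactSupport
  have hχ1 : ContDiff ℝ ∞ (deriv χ) := (contDiff_infty_iff_deriv.1 hχ).2
  have hχ2 : ContDiff ℝ ∞ (deriv (deriv χ)) := (contDiff_infty_iff_deriv.1 hχ1).2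
  obtain ⟨K1, hK1⟩ := hχc.deriv.exists_bound_of_continuous hχ1.continuous
  obtain ⟨K2, hK2⟩ := hχc.deriv.deriv.exists_bound_of_continuous hχ2.continuous
  have hK10 : 0 ≤ K1 := (norm_nonneg _).trans (hK1 0)
  have hK20 : 0 ≤ K2 := (norm_nonneg _).trans (hK2 0)
  let ε : ℕ → ℝ := fun n => 1 / ((n : ℝ) + 1)
  have hε0 : ∀ n, 0 < ε n := fun n => by simp only [ε]; positivity
  have hε1 : ∀ n, ε n ≤ 1 := fun n => by
    simp only [ε]; rw [div_le_one (by positivity)]; linarith [(Nat.cast_nonneg n : (0 : ℝ) ≤ n)]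
  have hεlim : Tendsto ε atTop (𝓝 0) := tendsto_one_div_add_atTop_nhds_zero_nat
  set f1 := SchwartzMap.derivCLM ℂ ℂ f with hf1
  let ψ : ℕ → ℝ → ℂ := fun n x => ((χ (ε n * x) : ℝ) : ℂ) * f x
  have hd0 : ∀ n x, HasDerivAt (fun x : ℝ => ((χ (ε n * x) : ℝ) : ℂ))
      ((ε n * deriv χ (ε n * x) : ℝ) : ℂ) x := fun n x => by
    have h1 : HasDerivAt χ (deriv χ (ε n * x)) (ε n * x) :=
      (hχ.differentiable (by norm_num)).differentiableAt.hasDerivAt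
    have h2 : HasDerivAt (fun x : ℝ => ε n * x) (ε n) x := by
      simpa using (hasDerivAt_id x).const_mul (ε n)
    have h3 := (h1.comp x h2).ofReal_comp
    refine h3.congr_deriv ?_
    rw [mul_comm]
  have hd1 : ∀ n x, HasDerivAt (fun x : ℝ => ((ε n * deriv χ (ε n * x) : ℝ) : ℂ))
      ((ε n * (ε n * deriv (deriv χ) (ε n * x)) : ℝ) : ℂ) x := fun n x => by
    have h1 : HasDerivAt (deriv χ) (deriv (deriv χ) (ε n * x)) (ε n * x) :=
      (hχ1.differentiable (by norm_num)).differentiableAt.hasDerivAt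
    have h2 : HasDerivAt (fun x : ℝ => ε n * x) (ε n) x := by
      simpa using (hasDerivAt_id x).const_mul (ε n)
    have h3 := ((h1.comp x h2).const_mul (ε n)).ofReal_comp
    refine h3.congr_deriv ?_
    rw [mul_comm (deriv (deriv χ) (ε n * x))]
  have hdf : ∀ x, HasDerivAt f (f1 x) x := fun x => f.hasDerivAt x
  have hdf1 : ∀ x, HasDerivAt f1 (schwartzD2 f x) x := fun x => f1.hasDerivAt x
  have hψ1 : ∀ n, deriv (ψ n) = fun x => ((ε n * deriv χ (ε n * x) : ℝ) : ℂ) * f x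
      + ((χ (ε n * x) : ℝ) : ℂ) * f1 x := fun n => by
    ext x; exact ((hd0 n x).mul (hdf x)).deriv
  have hψ2 : ∀ n, iteratedDeriv 2 (ψ n) = fun x =>
      ((ε n * (ε n * deriv (deriv χ) (ε n * x)) : ℝ) : ℂ) * f x
      + ((ε n * deriv χ (ε n * x) : ℝ) : ℂ) * f1 x
      + (((ε n * deriv χ (ε n * x) : ℝ) : ℂ) * f1 x
      + ((χ (ε n * x) : ℝ) : ℂ) * schwartzD2 f x) := fun n => by
    rw [iteratedDeriv_succ, iteratedDeriv_one, hψ1]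
    ext x; exact (((hd1 n x).mul (hdf x)).add ((hd0 n x).mul (hdf1 x))).deriv
  have hχle : ∀ y, ‖((χ y : ℝ) : ℂ)‖ ≤ 1 := fun y => by
    rw [Complex.norm_real, Real.norm_of_nonneg χ.nonneg]; exact χ.le_one
  have hχlim : ∀ x : ℝ, Tendsto (fun n => ((χ (ε n * x) : ℝ) : ℂ)) atTop (𝓝 1) := fun x => by
    have h1 : Continuous fun r : ℝ => ((χ (r * x) : ℝ) : ℂ) := by
      have := hχ.continuous; fun_prop
    have h2 := (h1.tendsto 0).comp hεlim
    have h3 : χ (0 * x) = 1 := by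
      rw [zero_mul]; exact χ.one_of_mem_closedBall (by simp [χ])
    rw [h3] at h2
    simpa [Function.comp_def] using h2
  have hψs : ∀ n, ContDiff ℝ ∞ (ψ n) := fun n => by
    have h1 : ContDiff ℝ ∞ fun x : ℝ => χ (ε n * x) := hχ.comp (contDiff_const.mul contDiff_id)
    exact (Complex.ofRealCLM.contDiff.comp h1).mul f.smooth'
  refine ⟨ψ, hψs, fun n => ?_, ?_, ?_⟩
  · have h1 : HasCompactSupport fun x : ℝ => χ (ε n * x) := by
      have := hχc.comp_homeomorph (Homeomorph.mulLeft₀ (ε n) (hε0 n).ne')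
      exact this
    have h2 : HasCompactSupport fun x : ℝ => ((χ (ε n * x) : ℝ) : ℂ) :=
      h1.comp_left (g := fun r : ℝ => (r : ℂ)) Complex.ofReal_zero
    exact h2.mul_right
  · refine tendsto_toL2_of_dominated (G := fun x => ‖f x‖)
      (Eventually.of_forall fun n => (hψs n).continuous.aestronglyMeasurable)
      (memLp_schwartz f).norm (Eventually.of_forall fun n => Eventually.of_forall fun x => ?_)
      (memLp_schwartz f) (Eventually.of_forall fun x => ?_)
    · simp only [ψ, norm_mul]
      exact mul_le_of_le_one_left (norm_nonneg _) (hχle _)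
    · simpa using (hχlim x).mul_const (f x)
  · refine tendsto_toL2_of_dominated
      (G := fun x => K2 * ‖f x‖ + K1 * ‖f1 x‖ + (K1 * ‖f1 x‖ + ‖schwartzD2 f x‖))
      (Eventually.of_forall fun n => ?_) ?_
      (Eventually.of_forall fun n => Eventually.of_forall fun x => ?_)
      (memLp_schwartz _) (Eventually.of_forall fun x => ?_)
    · exact ((hψs n).continuous_iteratedDeriv 2 (by norm_cast)).aestronglyMeasurable
    · exact (((memLp_schwartz f).norm.const_mul K2).add ((memLp_schwartz f1).norm.const_mul K1)).add
        (((memLp_schwartz f1).norm.const_mul K1).add (memLp_schwartz _).norm)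
    · rw [hψ2]
      have b1 : ‖((ε n * deriv χ (ε n * x) : ℝ) : ℂ)‖ ≤ K1 := by
        rw [Complex.norm_real, norm_mul, Real.norm_of_nonneg (hε0 n).le]
        calc _ ≤ 1 * K1 := mul_le_mul (hε1 n) (hK1 _) (norm_nonneg _) zero_le_one
          _ = K1 := one_mul _
      have b2 : ‖((ε n * (ε n * deriv (deriv χ) (ε n * x)) : ℝ) : ℂ)‖ ≤ K2 := by
        rw [Complex.norm_real, norm_mul, norm_mul, Real.norm_of_nonneg (hε0 n).le, ← mul_assoc]
        calc _ ≤ 1 * K2 := mul_le_mul (mul_le_one₀ (hε1 n) (hε0 n).le (hε1 n)) (hK2 _)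
              (norm_nonneg _) zero_le_one
          _ = K2 := one_mul _
      refine (norm_add_le _ _).trans (add_le_add ((norm_add_le _ _).trans (add_le_add ?_ ?_))
        ((norm_add_le _ _).trans (add_le_add ?_ ?_))) <;> rw [norm_mul]
      · gcongr
      · gcongr
      · gcongr
      · exact mul_le_of_le_one_left (norm_nonneg _) (hχle _)
    · simp only [hψ2]
      have l1 : Tendsto (fun n => ((ε n * deriv χ (ε n * x) : ℝ) : ℂ)) atTop (𝓝 0) := by
        have h1 : Continuous fun r : ℝ => ((r * deriv χ (r * x) : ℝ) : ℂ) := by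
          have := hχ1.continuous; fun_prop
        have h2 := (h1.tendsto 0).comp hεlim
        simpa [Function.comp_def] using h2
      have l2 : Tendsto (fun n => ((ε n * (ε n * deriv (deriv χ) (ε n * x)) : ℝ) : ℂ)) atTop
          (𝓝 0) := by
        have h1 : Continuous fun r : ℝ => ((r * (r * deriv (deriv χ) (r * x)) : ℝ) : ℂ) := by
          have := hχ2.continuous; fun_prop
        have h2 := (h1.tendsto 0).comp hεlim
        simpa [Function.comp_def] using h2
      have := ((l2.mul_const (f x)).add (l1.mul_const (f1 x))).add
        ((l1.mul_const (f1 x)).add ((hχlim x).mul_const (schwartzD2 f x)))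
      simpa using this

/-! ### Weak solutions are mild -/

/-- The Schrödinger group maps data with smooth and compactly supported Fourier transform to
Schwartz functions. -/
theorem exists_schwartz_schr {η : ℝ → ℂ} (hη : ContDiff ℝ ∞ η) (hηc : HasCompactSupport η) (t : ℝ) :
    ∃ g : SchwartzMap ℝ ℂ, toL2 g = schr t (𝓕⁻ (toL2 η)) ∧
      toL2 (schwartzD2 g) = schr t (𝓕⁻ (toL2 fun ξ => -((4 * Real.pi ^ 2 * ξ ^ 2 : ℝ) : ℂ) * η ξ)) := by
  have hηL : MemLp η 2 volume := hη.continuous.memLp_of_hasCompactSupport hηc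
  have hη2c : HasCompactSupport fun ξ : ℝ => -((4 * Real.pi ^ 2 * ξ ^ 2 : ℝ) : ℂ) * η ξ :=
    hηc.mul_left
  have hη2L : MemLp (fun ξ : ℝ => -((4 * Real.pi ^ 2 * ξ ^ 2 : ℝ) : ℂ) * η ξ) 2 volume := by
    refine Continuous.memLp_of_hasCompactSupport ?_ hη2c
    have := hη.continuous
    fun_prop
  have hph : ContDiff ℝ ∞ (phase (-(4 * Real.pi ^ 2 * t))) := by
    unfold phase
    refine Complex.contDiff_exp.comp (contDiff_const.mul (Complex.ofRealCLM.contDiff.comp ?_))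
    exact contDiff_const.mul (contDiff_id.pow 2)
  have hζ : ContDiff ℝ ∞ fun ξ => phase (-(4 * Real.pi ^ 2 * t)) ξ * η ξ := hph.mul hη
  have hζc : HasCompactSupport fun ξ => phase (-(4 * Real.pi ^ 2 * t)) ξ * η ξ := hηc.mul_left
  let ζ : SchwartzMap ℝ ℂ := hζc.toSchwartzMap hζ
  have hζe : ⇑ζ = fun ξ => phase (-(4 * Real.pi ^ 2 * t)) ξ * η ξ := rfl
  let g : SchwartzMap ℝ ℂ := 𝓕⁻ ζ
  have hFg : 𝓕 (g : ℝ → ℂ) = ζ := by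
    rw [← SchwartzMap.fourier_coe]; simp [g]
  have key : ∀ h : SchwartzMap ℝ ℂ, toL2 h = 𝓕⁻ (toL2 (𝓕 (h : ℝ → ℂ))) := fun h => by
    rw [← eq_toL2 (coeFn_fourier_toL2 h.integrable (memLp_schwartz h))]
    exact (FourierTransform.fourierInv_fourier_eq _).symm
  have hs : ∀ f : L2C, schr t (𝓕⁻ f) = 𝓕⁻ (chirp (-(4 * Real.pi ^ 2 * t)) f) := fun f => by
    rw [schr_apply]; congr 2; exact FourierTransform.fourier_fourierInv_eq _
  refine ⟨g, ?_, ?_⟩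
  · rw [key, hFg, hs, chirp_toL2 _ hηL, hζe]
  · rw [key, hs, chirp_toL2 _ hη2L]
    congr 2
    ext ξ
    rw [fourier_schwartzD2, hFg, hζe]
    ring

/-- The functions with smooth and compactly supported Fourier transform are dense in `L²`. -/
theorem eq_zero_of_inner_fourierInv {x : L2C} (h : ∀ η : ℝ → ℂ, ContDiff ℝ ∞ η →
    HasCompactSupport η → (inner ℂ (𝓕⁻ (toL2 η)) x : ℂ) = 0) : x = 0 := by
  have h1 : (𝓕 x : L2C) = 0 := by
    refine (Lp.dense_hasCompactSupport_contDiff (E := ℝ) (F := ℂ) (μ := volume) (p := 2)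
      (by norm_num)).eq_zero_of_inner_right ℂ ?_
    rintro v ⟨g, hvg, hgc, hg⟩
    rw [eq_toL2 hvg]
    have h2 := h g hg hgc
    have h3 := (Lp.fourierTransformₗᵢ ℝ ℂ).inner_map_map (𝓕⁻ (toL2 g)) x
    have h4 : (𝓕 (𝓕⁻ (toL2 g) : L2C) : L2C) = toL2 g := FourierTransform.fourier_fourierInv_eq _
    change inner ℂ (𝓕 (𝓕⁻ (toL2 g) : L2C) : L2C) (𝓕 x : L2C) = _ at h3
    rw [h4] at h3
    exact h3.trans h2
  exact (Lp.fourierTransformₗᵢ ℝ ℂ).map_eq_zero_iff.1 h1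

/-- The only weak solution of the free Schrödinger equation with initial value zero is zero. The
proof tests the equation with free solutions; it works with the primitive `E` of the solution in
time, which is differentiable in `L²`, unlike the solution itself. -/
theorem eq_zero_of_weakOn {a b : ℝ} {e : ℝ → L2C} (he : ContinuousOn e (Icc a b))
    (hea : e a = 0) (h : WeakOn 0 a b 0 e) : ∀ t ∈ Icc a b, e t = 0 := by
  rcases lt_or_ge b a with hba | hab
  · rw [Icc_eq_empty (not_le.2 hba)]; simp
  set e1 : ℝ → L2C := IccExtend hab (fun x : Icc a b => e x) with he1
  have he1c : Continuous e1 := (continuousOn_iff_continuous_domRestrict.1 he).Icc_extend'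
  have hee : ∀ t ∈ Icc a b, e1 t = e t := fun t ht => IccExtend_of_mem hab _ ht
  set E : ℝ → L2C := fun t => ∫ τ in a..t, e1 τ with hE
  have hEd : ∀ t, HasDerivAt E (e1 t) t := fun t =>
    (he1c.integral_hasStrictDerivAt a t).hasDerivAt
  -- the weak equation, first for test functions, then for Schwartz functions
  have h1 : ∀ f : SchwartzMap ℝ ℂ, ∀ t ∈ Icc a b,
      Complex.I * inner ℂ (toL2 f) (e1 t) + inner ℂ (toL2 (schwartzD2 f)) (E t) = 0 := by
    intro f t ht
    obtain ⟨ψ, hψ, hψc, l1, l2⟩ := exists_cutoff f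
    have h2 : Tendsto (fun n => Complex.I * (inner ℂ (toL2 (ψ n)) (e1 t) : ℂ)
        + inner ℂ (toL2 (iteratedDeriv 2 (ψ n))) (E t)) atTop
        (𝓝 (Complex.I * inner ℂ (toL2 f) (e1 t) + inner ℂ (toL2 (schwartzD2 f)) (E t))) :=
      ((l1.inner tendsto_const_nhds).const_mul _).add (l2.inner tendsto_const_nhds)
    refine tendsto_nhds_unique h2 (tendsto_const_nhds.congr fun n => ?_)
    have h3 := h (ψ n) (hψ n) (hψc n) t ht
    rw [hea, inner_zero_right, sub_zero] at h3
    rw [← h3, hee t ht, hE]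
    congr 1
    simp only
    rw [intervalIntegral.integral_of_le ht.1, intervalIntegral.integral_of_le ht.1,
      ← integral_inner (he1c.integrableOn_Icc.mono_set Ioc_subset_Icc_self)]
    refine setIntegral_congr_fun measurableSet_Ioc fun τ hτ => ?_
    simp [hee τ ⟨hτ.1.le, hτ.2.trans ht.2⟩]
  have h4 : ∀ t ∈ Icc a b, E t = 0 := by
    intro t ht
    rw [← schr_schr_neg t (E t), ← map_zero (schr t)]
    congr 1
    refine eq_zero_of_inner_fourierInv fun η hη hηc => ?_
    obtain ⟨f, hf, hf2⟩ := exists_schwartz_schr hη hηc 0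
    rw [schr_zero] at hf hf2
    -- `⟨U(τ)f, E(τ)⟩` is constant, by the Schrödinger equation for `U(τ)f`
    have hd : ∀ τ ∈ Icc a b, HasDerivAt (fun τ => (inner ℂ (schr τ (toL2 f)) (E τ) : ℂ)) 0 τ := by
      intro τ hτ
      have h5 := (hasDerivAt_schr f τ).inner ℂ (hEd τ)
      refine h5.congr_deriv ?_
      obtain ⟨g, hg1, hg2⟩ := exists_schwartz_schr hη hηc τ
      have h6 := h1 g τ hτ
      rw [hf2, ← hg2, hf, ← hg1, inner_smul_left, Complex.conj_I]
      linear_combination (-Complex.I) * h6 + (inner ℂ (toL2 g) (e1 τ) : ℂ) * Complex.I_sq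
    have h7 := constant_of_has_deriv_right_zero (a := a) (b := b)
      (fun τ hτ => (hd τ hτ).continuousAt.continuousWithinAt)
      (fun τ hτ => (hd τ (Ico_subset_Icc_self hτ)).hasDerivWithinAt) t ht
    have h8 : E a = 0 := intervalIntegral.integral_same
    rw [h8, inner_zero_right] at h7
    rw [← hf, ← LinearIsometryEquiv.inner_map_map (schr t), schr_schr_neg]
    exact h7
  intro t ht
  rw [← hee t ht]
  refine eq_zero_of_inner_fourierInv fun η hη hηc => ?_
  obtain ⟨g, hg, -⟩ := exists_schwartz_schr hη hηc 0
  rw [schr_zero] at hg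
  have h5 := h1 g t ht
  rw [h4 t ht, inner_zero_right, add_zero, hg] at h5
  exact (mul_eq_zero.1 h5).resolve_left Complex.I_ne_zero

theorem integral_inner_sub_of_weakOn {a b : ℝ} {N W : ℝ → L2C} {t : ℝ} (ht : t ∈ Icc a b)
    (hN : IntegrableOn N (Ioc a b) volume) (hW : ContinuousOn W (Icc a b)) (f g : L2C) (σ : ℝ) :
    ∫ τ in a..t, ((inner ℂ g (W τ) : ℂ) + σ * inner ℂ f (N τ))
      = (∫ τ in a..t, (inner ℂ g (W τ) : ℂ)) + σ * ∫ τ in a..t, (inner ℂ f (N τ) : ℂ) := by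
  rw [intervalIntegral.integral_add, intervalIntegral.integral_const_mul]
  · refine ContinuousOn.intervalIntegrable ?_
    rw [uIcc_of_le ht.1]
    exact continuous_inner_left (hW.mono (Icc_subset_Icc_right ht.2))
  · refine IntervalIntegrable.const_mul ?_ _
    rw [intervalIntegrable_iff_integrableOn_Ioc_of_le ht.1]
    exact (hN.mono_set (Ioc_subset_Ioc_right ht.2)).const_inner _

/-- A continuous weak solution satisfies Duhamel's formula. -/
theorem WeakOn.mildOn {σ a b : ℝ} {N W : ℝ → L2C} (hN : IntegrableOn N (Ioc a b) volume)
    (hW : ContinuousOn W (Icc a b)) (h : WeakOn σ a b N W) : MildOn σ a b N W := by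
  set V : ℝ → L2C := fun t => schr t (schr (-a) (W a)
    + (Complex.I * σ) • ∫ τ in a..t, schr (-τ) (N τ)) with hV
  have hVa : V a = W a := by simp [hV, schr_schr_neg]
  have hVm : MildOn σ a b N V := fun t _ => by
    rw [hVa]; simp only [hV, schr_neg_schr]
  have hVw := hVm.weakOn hN
  have hVc := hVm.continuousOn hN
  have hz : ∀ t ∈ Icc a b, (W t - V t) = 0 := by
    refine eq_zero_of_weakOn (hW.sub hVc) (by simp [hVa]) fun ψ hψ hψc t ht => ?_
    have h1 := h ψ hψ hψc t ht
    have h2 := hVw ψ hψ hψc t ht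
    rw [integral_inner_sub_of_weakOn ht hN hW] at h1
    rw [integral_inner_sub_of_weakOn ht hN hVc] at h2
    simp only [Complex.ofReal_zero, zero_mul, add_zero, inner_sub_right]
    rw [intervalIntegral.integral_sub]
    · linear_combination h1 - h2
    · refine ContinuousOn.intervalIntegrable ?_
      rw [uIcc_of_le ht.1]
      exact continuous_inner_left (hW.mono (Icc_subset_Icc_right ht.2))
    · refine ContinuousOn.intervalIntegrable ?_
      rw [uIcc_of_le ht.1]
      exact continuous_inner_left (hVc.mono (Icc_subset_Icc_right ht.2))
  intro t ht
  rw [sub_eq_zero.1 (hz t ht), hVm t ht, hVa]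

/-! ### The selfsimilar solution -/

theorem uSelf_eq (a t x : ℝ) : uSelf a t x = (a / (Real.sqrt t : ℝ) : ℂ) * phase (1 / (4 * t)) x := by
  unfold uSelf phase
  rw [show x ^ 2 / (4 * t) = 1 / (4 * t) * x ^ 2 by ring]
  ring

theorem norm_uSelf {a t : ℝ} (ha : 0 ≤ a) (x : ℝ) : ‖uSelf a t x‖ = a / Real.sqrt t := by
  rw [uSelf_eq, norm_mul, norm_phase, mul_one, norm_div, Complex.norm_real, Complex.norm_real,
    Real.norm_of_nonneg ha, Real.norm_of_nonneg (Real.sqrt_nonneg t)]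

theorem continuous_uSelf (a t : ℝ) : Continuous (uSelf a t) := by
  have : uSelf a t = fun x => (a / (Real.sqrt t : ℝ) : ℂ) * phase (1 / (4 * t)) x :=
    funext (uSelf_eq a t)
  rw [this]
  exact continuous_const.mul (continuous_phase _)

theorem hasDerivAt_uSelf_time (a : ℝ) {t : ℝ} (ht : 0 < t) (x : ℝ) :
    HasDerivAt (fun t => uSelf a t x)
      (uSelf a t x * (-(1 / (2 * t)) - Complex.I * (x ^ 2 / (4 * t ^ 2)))) t := by
  have h1 : HasDerivAt (fun t : ℝ => x ^ 2 / (4 * t)) (-(x ^ 2 / (4 * t ^ 2))) t := by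
    have h := ((hasDerivAt_id t).const_mul 4).fun_inv (by simp [ht.ne']) |>.const_mul (x ^ 2)
    refine (h.congr_deriv ?_).congr_of_eventuallyEq (Eventually.of_forall fun s => ?_)
    · simp only [id]; field_simp
    · simp only [id]; rw [div_eq_mul_inv]
  have h2 := (h1.ofReal_comp.const_mul Complex.I).cexp
  have hs : 0 < Real.sqrt t := Real.sqrt_pos.2 ht
  have h3 := ((h2.fun_div (Real.hasDerivAt_sqrt ht.ne').ofReal_comp
    (by exact_mod_cast hs.ne'))).const_mul (a : ℂ)
  refine h3.congr_deriv ?_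
  unfold uSelf
  have hs' : ((Real.sqrt t : ℝ) : ℂ) ≠ 0 := by exact_mod_cast hs.ne'
  have hsq : ((Real.sqrt t : ℝ) : ℂ) ^ 2 = t := by exact_mod_cast Real.sq_sqrt ht.le
  have ht' : (t : ℂ) ≠ 0 := by exact_mod_cast ht.ne'
  push_cast
  rw [← hsq]
  field_simp
  ring

theorem hasDerivAt_uSelf_space (a : ℝ) (t x : ℝ) :
    HasDerivAt (uSelf a t) (uSelf a t x * (Complex.I * (x / (2 * t)))) x := by
  have h1 : HasDerivAt (fun x : ℝ => x ^ 2 / (4 * t)) (x / (2 * t)) x := by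
    have h := (hasDerivAt_pow 2 x).div_const (4 * t)
    refine h.congr_deriv ?_
    norm_num
    rw [show 4 * t = 2 * (2 * t) by ring, mul_div_mul_left _ _ two_ne_zero]
  have h2 := (((h1.ofReal_comp.const_mul Complex.I).cexp).div_const
    ((Real.sqrt t : ℝ) : ℂ)).const_mul (a : ℂ)
  refine h2.congr_deriv ?_
  unfold uSelf
  push_cast
  ring

theorem hasDerivAt_uSelf_space' (a : ℝ) (t x : ℝ) :
    HasDerivAt (fun x => uSelf a t x * (Complex.I * (x / (2 * t))))
      (uSelf a t x * (-(x ^ 2 / (4 * t ^ 2)) + Complex.I / (2 * t))) x := by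
  have h1 : HasDerivAt (fun x : ℝ => Complex.I * ((x : ℂ) / (2 * t))) (Complex.I * (1 / (2 * t))) x :=
    (((hasDerivAt_id x).ofReal_comp).div_const (2 * (t : ℂ))).const_mul Complex.I
  refine ((hasDerivAt_uSelf_space a t x).mul h1).congr_deriv ?_
  rw [show (x : ℂ) ^ 2 / (4 * (t : ℂ) ^ 2) = ((x : ℂ) / (2 * t)) ^ 2 by rw [div_pow]; ring]
  linear_combination (uSelf a t x * ((x : ℂ) / (2 * t)) ^ 2) * Complex.I_sq

theorem hasDerivAt_integral_uSelf (a : ℝ) {ψ : ℝ → ℂ} (hψ : Continuous ψ)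
    (hψc : HasCompactSupport ψ) {t : ℝ} (ht : 0 < t) :
    HasDerivAt (fun t => ∫ x, uSelf a t x * ψ x)
      (∫ x, uSelf a t x * (-(1 / (2 * t)) - Complex.I * (x ^ 2 / (4 * t ^ 2))) * ψ x) t := by
  have hint : ∀ s, Integrable fun x => uSelf a s x * ψ x := fun s =>
    ((continuous_uSelf a s).mul hψ).integrable_of_hasCompactSupport hψc.mul_left
  have hb : Continuous fun x : ℝ => |a| / Real.sqrt (t / 2) * (1 / t + x ^ 2 / t ^ 2) * ‖ψ x‖ := by
    fun_prop
  refine (hasDerivAt_integral_of_dominated_loc_of_deriv_le (Ioi_mem_nhds (half_lt_self ht))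
    (bound := fun x : ℝ => |a| / Real.sqrt (t / 2) * (1 / t + x ^ 2 / t ^ 2) * ‖ψ x‖)
    (F' := fun t x => uSelf a t x * (-(1 / (2 * t)) - Complex.I * (x ^ 2 / (4 * t ^ 2))) * ψ x)
    (Eventually.of_forall fun s => (hint s).1) (hint t) ?_ ?_ ?_ ?_).2
  · have := continuous_uSelf a t
    exact Continuous.aestronglyMeasurable (by fun_prop)
  · refine Eventually.of_forall fun x s hs => ?_
    have hs : t / 2 < s := hs
    have ht2 : 0 < t / 2 := by positivity
    have hs0 : 0 < s := ht2.trans hs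
    rw [norm_mul, norm_mul]
    refine mul_le_mul_of_nonneg_right (mul_le_mul ?_ ?_ (norm_nonneg _) (by positivity))
      (norm_nonneg _)
    · rw [uSelf_eq, norm_mul, norm_phase, mul_one, norm_div, Complex.norm_real, Complex.norm_real,
        Real.norm_of_nonneg (Real.sqrt_nonneg s), Real.norm_eq_abs]
      exact div_le_div_of_nonneg_left (abs_nonneg a) (Real.sqrt_pos.2 ht2) (Real.sqrt_le_sqrt hs.le)
    · refine (norm_sub_le _ _).trans (add_le_add ?_ ?_)
      · have e : (-(1 / (2 * (s : ℂ)))) = ((-(1 / (2 * s)) : ℝ) : ℂ) := by push_cast; ring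
        rw [e, Complex.norm_real, norm_neg, Real.norm_of_nonneg (by positivity)]
        exact one_div_le_one_div_of_le ht (by linarith)
      · have e : Complex.I * ((x : ℂ) ^ 2 / (4 * (s : ℂ) ^ 2))
            = Complex.I * ((x ^ 2 / (4 * s ^ 2) : ℝ) : ℂ) := by push_cast; ring
        rw [e, norm_mul, Complex.norm_I, one_mul, Complex.norm_real,
          Real.norm_of_nonneg (by positivity)]
        refine div_le_div_of_nonneg_left (sq_nonneg x) (by positivity) ?_
        nlinarith
  · refine hb.integrable_of_hasCompactSupport ?_
    exact hψc.norm.mul_left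
  · refine Eventually.of_forall fun x s hs => ?_
    have hs : t / 2 < s := hs
    exact (hasDerivAt_uSelf_time a ((by positivity : 0 < t / 2).trans hs) x).mul_const _

theorem integral_uSelf_mul_deriv2 (a t : ℝ) {ψ : ℝ → ℂ} (hψ : ContDiff ℝ ∞ ψ)
    (hψc : HasCompactSupport ψ) :
    ∫ x, uSelf a t x * iteratedDeriv 2 ψ x
      = ∫ x, uSelf a t x * (-(x ^ 2 / (4 * t ^ 2)) + Complex.I / (2 * t)) * ψ x := by
  have hψ1 : ContDiff ℝ ∞ (deriv ψ) := (contDiff_infty_iff_deriv.1 hψ).2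
  have hψ2 : ContDiff ℝ ∞ (deriv (deriv ψ)) := (contDiff_infty_iff_deriv.1 hψ1).2
  have c0 := continuous_uSelf a t
  have c1 : Continuous fun x : ℝ => uSelf a t x * (Complex.I * (x / (2 * t))) := by fun_prop
  have c2 : Continuous fun x : ℝ => uSelf a t x * (-(x ^ 2 / (4 * t ^ 2)) + Complex.I / (2 * t)) := by
    fun_prop
  have int : ∀ {f g : ℝ → ℂ}, Continuous f → Continuous g → HasCompactSupport g →
      Integrable (f * g) := fun hf hg hgc =>
    (hf.mul hg).integrable_of_hasCompactSupport hgc.mul_left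
  have e1 := integral_mul_deriv_eq_deriv_mul_of_integrable (u := uSelf a t)
    (v := deriv ψ) (v' := deriv (deriv ψ)) (fun x _ => hasDerivAt_uSelf_space a t x)
    (fun x _ => (hψ1.differentiable (by norm_num)).differentiableAt.hasDerivAt)
    (int c0 hψ2.continuous hψc.deriv.deriv) (int c1 hψ1.continuous hψc.deriv)
    (int c0 hψ1.continuous hψc.deriv)
  have e2 := integral_mul_deriv_eq_deriv_mul_of_integrable
    (u := fun x : ℝ => uSelf a t x * (Complex.I * (x / (2 * t))))
    (v := ψ) (v' := deriv ψ) (fun x _ => hasDerivAt_uSelf_space' a t x)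
    (fun x _ => (hψ.differentiable (by norm_num)).differentiableAt.hasDerivAt)
    (int c1 hψ1.continuous hψc.deriv) (int c2 hψ.continuous hψc) (int c1 hψ.continuous hψc)
  simp only [iteratedDeriv_succ, iteratedDeriv_zero]
  rw [e1, e2, neg_neg]

theorem continuousOn_integral_uSelf (a : ℝ) {ψ : ℝ → ℂ} (hψ : Continuous ψ)
    (hψc : HasCompactSupport ψ) : ContinuousOn (fun t => ∫ x, uSelf a t x * ψ x) (Ioi 0) :=
  fun _ ht => (hasDerivAt_integral_uSelf a hψ hψc ht).continuousAt.continuousWithinAt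

/-- `u_a` solves the free Schrödinger equation. -/
theorem uSelf_weak (a : ℝ) {ψ : ℝ → ℂ} (hψ : ContDiff ℝ ∞ ψ) (hψc : HasCompactSupport ψ)
    {s t : ℝ} (hs : 0 < s) (hst : s ≤ t) :
    IntervalIntegrable (fun τ => ∫ x, uSelf a τ x * iteratedDeriv 2 ψ x) volume s t ∧
    Complex.I * ((∫ x, uSelf a t x * ψ x) - ∫ x, uSelf a s x * ψ x)
      + ∫ τ in s..t, ∫ x, uSelf a τ x * iteratedDeriv 2 ψ x = 0 := by
  have hsub : uIcc s t ⊆ Ioi 0 := by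
    rw [uIcc_of_le hst]; exact fun x hx => hs.trans_le hx.1
  have hψ2 : Continuous (iteratedDeriv 2 ψ) := hψ.continuous_iteratedDeriv 2 (by norm_cast)
  have hψ2c : HasCompactSupport (iteratedDeriv 2 ψ) := by
    simp only [iteratedDeriv_succ, iteratedDeriv_zero]; exact hψc.deriv.deriv
  have hi : IntervalIntegrable (fun τ => ∫ x, uSelf a τ x * iteratedDeriv 2 ψ x) volume s t :=
    ((continuousOn_integral_uSelf a hψ2 hψ2c).mono hsub).intervalIntegrable
  refine ⟨hi, ?_⟩
  have h := intervalIntegral.integral_eq_sub_of_hasDerivAt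
    (f := fun t => ∫ x, uSelf a t x * ψ x)
    (f' := fun τ => Complex.I * ∫ x, uSelf a τ x * iteratedDeriv 2 ψ x) (a := s) (b := t)
    (fun τ hτ => ?_) (hi.const_mul _)
  · rw [intervalIntegral.integral_const_mul] at h
    rw [← h]
    linear_combination (∫ τ in s..t, ∫ x, uSelf a τ x * iteratedDeriv 2 ψ x) * Complex.I_sq
  · have hτ0 : 0 < τ := hsub hτ
    refine (hasDerivAt_integral_uSelf a hψ.continuous hψc hτ0).congr_deriv ?_
    rw [integral_uSelf_mul_deriv2 a τ hψ hψc, ← integral_const_mul]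
    refine integral_congr_ae (Eventually.of_forall fun x => ?_)
    simp only
    linear_combination (-(uSelf a τ x * ψ x) / (2 * τ)) * Complex.I_sq

/-! ### The equation for the perturbation of the selfsimilar solution -/

theorem hasCompactSupport_conj {ψ : ℝ → ℂ} (hψc : HasCompactSupport ψ) :
    HasCompactSupport fun x => starRingEnd ℂ (ψ x) :=
  hψc.comp_left (g := fun z : ℂ => starRingEnd ℂ z) (map_zero _)

theorem contDiff_conj {ψ : ℝ → ℂ} (hψ : ContDiff ℝ ∞ ψ) :
    ContDiff ℝ ∞ fun x => starRingEnd ℂ (ψ x) :=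
  (Complex.conjCLE : ℂ →L[ℝ] ℂ).contDiff.comp hψ

theorem deriv_conj (ψ : ℝ → ℂ) :
    deriv (fun x => starRingEnd ℂ (ψ x)) = fun x => starRingEnd ℂ (deriv ψ x) := by
  ext x
  exact deriv.star (f := ψ)

theorem iteratedDeriv_two_conj (ψ : ℝ → ℂ) :
    iteratedDeriv 2 (fun x => starRingEnd ℂ (ψ x)) = fun x => starRingEnd ℂ (iteratedDeriv 2 ψ x) := by
  simp only [iteratedDeriv_succ, iteratedDeriv_zero, deriv_conj]

theorem inner_toL2_conj {ψ w : ℝ → ℂ} (hψ : Continuous ψ) (hψc : HasCompactSupport ψ)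
    (hw : MemLp w 2 volume) :
    Integrable (fun x => w x * ψ x) ∧
      (inner ℂ (toL2 fun x => starRingEnd ℂ (ψ x)) (toL2 w) : ℂ) = ∫ x, w x * ψ x := by
  have h1 : MemLp (fun x => starRingEnd ℂ (ψ x)) 2 volume :=
    (Complex.continuous_conj.comp hψ).memLp_of_hasCompactSupport (hasCompactSupport_conj hψc)
  have h2 := integrable_conj_mul h1 hw
  have h3 := inner_toL2_toL2 h1 hw
  simp only [Complex.conj_conj] at h2 h3
  exact ⟨h2.congr (Eventually.of_forall fun x => mul_comm _ _), by rw [h3]; simp only [mul_comm]⟩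

theorem integral_perturbation {a : ℝ} {ψ : ℝ → ℂ} {u : ℝ → ℝ → ℂ} {t : ℝ} (hψ : Continuous ψ)
    (hψc : HasCompactSupport ψ) (hw : MemLp (u t - uSelf a t) 2 volume) :
    ∫ x, u t x * ψ x = (∫ x, uSelf a t x * ψ x)
      + inner ℂ (toL2 fun x => starRingEnd ℂ (ψ x)) (toL2 (u t - uSelf a t)) := by
  obtain ⟨h1, h2⟩ := inner_toL2_conj hψ hψc hw
  rw [h2, ← integral_add _ h1]
  · refine integral_congr_ae (Eventually.of_forall fun x => ?_)
    simp only [Pi.sub_apply]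
    ring
  · exact ((continuous_uSelf a t).mul hψ).integrable_of_hasCompactSupport hψc.mul_left

/-- A function `u` with `u - u_a ∈ C((0,T], L²)` is a weak solution exactly if its perturbation
`u - u_a` is one, as an `L²`-valued function. -/
theorem isWeakSolution_iff {σ a T : ℝ} {u : ℝ → ℝ → ℂ}
    (hw : ∀ t ∈ Ioc 0 T, MemLp (u t - uSelf a t) 2 volume)
    (hWc : ContinuousOn (fun t => toL2 (u t - uSelf a t)) (Ioc 0 T))
    (hN : ∀ᵐ t ∂volume.restrict (Ioc 0 T), MemLp (nonlin a t (u t)) 2 volume)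
    (hNi : ∀ s ∈ Ioc 0 T, IntegrableOn (fun t => toL2 (nonlin a t (u t))) (Ioc s T) volume) :
    IsWeakSolution σ a T u ↔ ∀ s ∈ Ioc 0 T, WeakOn σ s T (fun t => toL2 (nonlin a t (u t)))
      (fun t => toL2 (u t - uSelf a t)) := by
  set W : ℝ → L2C := fun t => toL2 (u t - uSelf a t) with hW
  set N : ℝ → L2C := fun t => toL2 (nonlin a t (u t)) with hNdef
  -- the contribution of `u_a` vanishes by `uSelf_weak`; test functions are conjugated because the inner
  -- product of `L²` is conjugate linear in its first argument
  have key : ∀ ψ : ℝ → ℂ, ContDiff ℝ ∞ ψ → HasCompactSupport ψ →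
      ∀ s t : ℝ, 0 < s → s ≤ t → t ≤ T →
      IntervalIntegrable (fun τ => (∫ x, u τ x * iteratedDeriv 2 ψ x)
        + σ * ∫ x, nonlin a τ (u τ) x * ψ x) volume s t ∧
      Complex.I * ((∫ x, u t x * ψ x) - ∫ x, u s x * ψ x)
        + (∫ τ in s..t, ((∫ x, u τ x * iteratedDeriv 2 ψ x)
            + σ * ∫ x, nonlin a τ (u τ) x * ψ x))
      = Complex.I * (inner ℂ (toL2 fun x => starRingEnd ℂ (ψ x)) (W t)
          - inner ℂ (toL2 fun x => starRingEnd ℂ (ψ x)) (W s))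
        + ∫ τ in s..t, ((inner ℂ (toL2 (iteratedDeriv 2 fun x => starRingEnd ℂ (ψ x))) (W τ) : ℂ)
          + σ * inner ℂ (toL2 fun x => starRingEnd ℂ (ψ x)) (N τ)) := by
    intro ψ hψ hψc s t hs hst htT
    have hψ2 : Continuous (iteratedDeriv 2 ψ) := hψ.continuous_iteratedDeriv 2 (by norm_cast)
    have hψ2c : HasCompactSupport (iteratedDeriv 2 ψ) := by
      simp only [iteratedDeriv_succ, iteratedDeriv_zero]; exact hψc.deriv.deriv
    obtain ⟨ia, ea⟩ := uSelf_weak a hψ hψc hs hst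
    have hcongr : ∀ᵐ τ ∂volume.restrict (Ioc s t), (∫ x, u τ x * iteratedDeriv 2 ψ x)
        + σ * ∫ x, nonlin a τ (u τ) x * ψ x = (∫ x, uSelf a τ x * iteratedDeriv 2 ψ x)
        + ((inner ℂ (toL2 (iteratedDeriv 2 fun x => starRingEnd ℂ (ψ x))) (W τ) : ℂ)
          + σ * inner ℂ (toL2 fun x => starRingEnd ℂ (ψ x)) (N τ)) := by
      filter_upwards [ae_restrict_mem measurableSet_Ioc, ae_restrict_of_ae_restrict_of_subset
        (Ioc_subset_Ioc hs.le htT) hN] with τ hτ hNτ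
      rw [integral_perturbation hψ2 hψ2c (hw τ ⟨hs.trans hτ.1, hτ.2.trans htT⟩),
        ← (inner_toL2_conj hψ.continuous hψc hNτ).2, iteratedDeriv_two_conj, add_assoc]
    have iw : IntervalIntegrable (fun τ =>
        ((inner ℂ (toL2 (iteratedDeriv 2 fun x => starRingEnd ℂ (ψ x))) (W τ) : ℂ)
          + σ * inner ℂ (toL2 fun x => starRingEnd ℂ (ψ x)) (N τ))) volume s t := by
      refine IntervalIntegrable.add ?_ (IntervalIntegrable.const_mul ?_ _)
      · refine ContinuousOn.intervalIntegrable ?_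
        rw [uIcc_of_le hst]
        exact continuous_inner_left (hWc.mono fun x hx => ⟨hs.trans_le hx.1, hx.2.trans htT⟩)
      · rw [intervalIntegrable_iff_integrableOn_Ioc_of_le hst]
        exact ((hNi s ⟨hs, hst.trans htT⟩).mono_set (Ioc_subset_Ioc_right htT)).const_inner _
    constructor
    · refine (ia.add iw).congr_ae ?_
      rw [uIoc_of_le hst]
      filter_upwards [hcongr] with τ hτ using hτ.symm
    · rw [intervalIntegral.integral_congr_ae_restrict (g := fun τ =>
        (∫ x, uSelf a τ x * iteratedDeriv 2 ψ x)
        + ((inner ℂ (toL2 (iteratedDeriv 2 fun x => starRingEnd ℂ (ψ x))) (W τ) : ℂ)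
          + σ * inner ℂ (toL2 fun x => starRingEnd ℂ (ψ x)) (N τ))) (by rwa [uIoc_of_le hst]),
        intervalIntegral.integral_add ia iw,
        integral_perturbation hψ.continuous hψc (hw t ⟨hs.trans_le hst, htT⟩),
        integral_perturbation hψ.continuous hψc (hw s ⟨hs, hst.trans htT⟩)]
      linear_combination ea
  constructor
  · rintro ⟨-, -, h⟩ s hs ψ hψ hψc t ht
    have h1 := (key _ (contDiff_conj hψ) (hasCompactSupport_conj hψc) s t hs.1 ht.1 ht.2).2
    rw [(h _ (contDiff_conj hψ) (hasCompactSupport_conj hψc) s t hs.1 ht.1 ht.2).2] at h1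
    simp only [Complex.conj_conj] at h1
    exact h1.symm
  · intro h
    refine ⟨fun t ht => ?_, ?_, fun ψ hψ hψc s t hs hst htT => ?_⟩
    · have h1 : LocallyIntegrable (u t - uSelf a t) volume :=
        (hw t ht).locallyIntegrable (by norm_num)
      have h2 := h1.add (continuous_uSelf a t).locallyIntegrable
      rwa [sub_add_cancel] at h2
    · filter_upwards [hN] with t ht using ht.locallyIntegrable (by norm_num)
    · obtain ⟨k1, k2⟩ := key ψ hψ hψc s t hs hst htT
      exact ⟨k1, k2.trans (h s ⟨hs, hst.trans htT⟩ _ (contDiff_conj hψ)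
        (hasCompactSupport_conj hψc) t ⟨hst, htT⟩)⟩

/-! ### Estimates for the nonlinearity -/

/-- The nonlinearity `(|u|² - |e|²)u` at `u = e + w`, as a function of the perturbation `w`. -/
def cubic (e w : ℂ) : ℂ := ((‖e + w‖ ^ 2 - ‖e‖ ^ 2 : ℝ) : ℂ) * (e + w)

theorem cubic_zero (e : ℂ) : cubic e 0 = 0 := by simp [cubic]

theorem continuous_cubic : Continuous fun p : ℂ × ℂ => cubic p.1 p.2 := by
  unfold cubic; fun_prop

theorem norm_cubic_sub_le (e w w' : ℂ) : ‖cubic e w - cubic e w'‖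
    ≤ (7 * ‖e‖ ^ 2 + 3 * ‖w‖ ^ 2 + 3 * ‖w'‖ ^ 2) * ‖w - w'‖ := by
  have h1 : cubic e w - cubic e w' = ((‖e + w‖ ^ 2 - ‖e‖ ^ 2 : ℝ) : ℂ) * (w - w')
      + ((‖e + w‖ ^ 2 - ‖e + w'‖ ^ 2 : ℝ) : ℂ) * (e + w') := by
    unfold cubic; push_cast; ring
  have hp : ‖e + w‖ ≤ ‖e‖ + ‖w‖ := norm_add_le _ _
  have hq : ‖e + w'‖ ≤ ‖e‖ + ‖w'‖ := norm_add_le _ _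
  have hd : |‖e + w‖ - ‖e + w'‖| ≤ ‖w - w'‖ := by
    have := abs_norm_sub_norm_le (e + w) (e + w')
    rwa [add_sub_add_left_eq_sub] at this
  set p := ‖e + w‖
  set q := ‖e + w'‖
  have hp0 : 0 ≤ p := norm_nonneg _
  have hq0 : 0 ≤ q := norm_nonneg _
  have h2 : |p ^ 2 - q ^ 2| ≤ (p + q) * ‖w - w'‖ := by
    rw [sq_sub_sq, abs_mul, abs_of_nonneg (add_nonneg hp0 hq0)]
    gcongr
  have h3 : |p ^ 2 - ‖e‖ ^ 2| ≤ p ^ 2 + ‖e‖ ^ 2 := by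
    rw [abs_le]; constructor <;> nlinarith [sq_nonneg p, sq_nonneg ‖e‖]
  have hp2 : p ^ 2 ≤ 2 * ‖e‖ ^ 2 + 2 * ‖w‖ ^ 2 := by
    nlinarith [sq_nonneg (‖e‖ - ‖w‖), norm_nonneg e, norm_nonneg w]
  have hq2 : q ^ 2 ≤ 2 * ‖e‖ ^ 2 + 2 * ‖w'‖ ^ 2 := by
    nlinarith [sq_nonneg (‖e‖ - ‖w'‖), norm_nonneg e, norm_nonneg w']
  rw [h1]
  refine (norm_add_le _ _).trans ?_
  rw [norm_mul, norm_mul, Complex.norm_real, Complex.norm_real, Real.norm_eq_abs, Real.norm_eq_abs]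
  calc |p ^ 2 - ‖e‖ ^ 2| * ‖w - w'‖ + |p ^ 2 - q ^ 2| * q
      ≤ (p ^ 2 + ‖e‖ ^ 2) * ‖w - w'‖ + (p + q) * ‖w - w'‖ * q := by gcongr
    _ = (p ^ 2 + ‖e‖ ^ 2 + p * q + q ^ 2) * ‖w - w'‖ := by ring
    _ ≤ _ := by
        refine mul_le_mul_of_nonneg_right ?_ (norm_nonneg _)
        nlinarith [sq_nonneg (p - q)]

theorem norm_cubic_le (e w : ℂ) : ‖cubic e w‖ ≤ (7 * ‖e‖ ^ 2 + 3 * ‖w‖ ^ 2) * ‖w‖ := by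
  have := norm_cubic_sub_le e w 0
  simpa [cubic_zero] using this

/-- The linear part of `cubic e` at zero is `|e|² w + e² w̄`; the rest is at least quadratic. -/
theorem norm_cubic_sub_linear_le (e w : ℂ) :
    ‖cubic e w - (((‖e‖ ^ 2 : ℝ) : ℂ) * w + e ^ 2 * starRingEnd ℂ w)‖
      ≤ (3 * ‖e‖ * ‖w‖ + ‖w‖ ^ 2) * ‖w‖ := by
  have h0 : cubic e w - (((‖e‖ ^ 2 : ℝ) : ℂ) * w + e ^ 2 * starRingEnd ℂ w)
      = starRingEnd ℂ e * w ^ 2 + 2 * e * ((‖w‖ ^ 2 : ℝ) : ℂ) + ((‖w‖ ^ 2 : ℝ) : ℂ) * w := by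
    have hn : ∀ z : ℂ, ((‖z‖ ^ 2 : ℝ) : ℂ) = z * starRingEnd ℂ z := fun z => by
      rw [Complex.mul_conj, Complex.normSq_eq_norm_sq]
    unfold cubic
    rw [Complex.ofReal_sub, hn, hn, hn, map_add]
    ring
  have h2 : ‖(2 : ℂ)‖ = 2 := by simp
  rw [h0]
  refine (norm_add₃_le).trans ?_
  simp only [norm_mul, norm_pow, RCLike.norm_conj, Complex.norm_real, Real.norm_eq_abs, h2,
    abs_norm]
  exact le_of_eq (by ring)

theorem norm_uSelf_sq {a s : ℝ} (hs : 0 < s) (x : ℝ) : ‖uSelf a s x‖ ^ 2 = a ^ 2 / s := by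
  rw [uSelf_eq, norm_mul, norm_phase, mul_one, norm_div, Complex.norm_real, Complex.norm_real,
    div_pow, Real.norm_eq_abs, Real.norm_eq_abs, sq_abs, sq_abs, Real.sq_sqrt hs.le]

theorem nonlin_uSelf_add {a s : ℝ} (hs : 0 < s) (w : ℝ → ℂ) :
    nonlin a s (uSelf a s + w) = fun x => cubic (uSelf a s x) (w x) := by
  ext x
  unfold nonlin cubic
  rw [norm_uSelf_sq hs, Pi.add_apply]

/-- The nonlinear term at time `s`, as a function of the perturbation `W` of the selfsimilar
solution. -/
def nlin (a s : ℝ) (W : L2C) : L2C := toL2 (nonlin a s (uSelf a s + W))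

theorem ae_norm_le_supAv {W : L2C} (hW : supAv W ≠ ⊤) : ∀ᵐ x, ‖W x‖ ≤ (supAv W).toReal := by
  filter_upwards [ae_le_supAv W] with x hx
  rw [← toReal_enorm]
  exact ENNReal.toReal_mono hW hx

theorem aestronglyMeasurable_cubic (a s : ℝ) {w : ℝ → ℂ} (hw : AEStronglyMeasurable w volume) :
    AEStronglyMeasurable (fun x => cubic (uSelf a s x) (w x)) volume :=
  Continuous.comp_aestronglyMeasurable (g := fun p : ℂ × ℂ => cubic p.1 p.2)
    (f := fun x => (uSelf a s x, w x)) continuous_cubic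
    ((continuous_uSelf a s).aestronglyMeasurable.prodMk hw)

theorem memLp_nonlin {a s : ℝ} (hs : 0 < s) {W : L2C} (hW : supAv W ≠ ⊤) :
    MemLp (nonlin a s (uSelf a s + W)) 2 volume := by
  rw [nonlin_uSelf_add hs]
  refine (norm_toL2_le (g := W) (c := 7 * (a ^ 2 / s) + 3 * (supAv W).toReal ^ 2)
    (aestronglyMeasurable_cubic a s (Lp.aestronglyMeasurable W)) ?_).1
  filter_upwards [ae_norm_le_supAv hW] with x hx
  refine (norm_cubic_le _ _).trans ?_
  rw [norm_uSelf_sq hs]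
  gcongr

theorem norm_nlin_sub_le {a s : ℝ} (hs : 0 < s) {W W' : L2C} (hW : supAv W ≠ ⊤)
    (hW' : supAv W' ≠ ⊤) : ‖nlin a s W - nlin a s W'‖
      ≤ (7 * (a ^ 2 / s) + 3 * (supAv W).toReal ^ 2 + 3 * (supAv W').toReal ^ 2) * ‖W - W'‖ := by
  unfold nlin
  rw [← toL2_sub (memLp_nonlin hs hW) (memLp_nonlin hs hW')]
  refine (norm_toL2_le ((memLp_nonlin hs hW).sub (memLp_nonlin hs hW')).1 ?_).2
  filter_upwards [ae_norm_le_supAv hW, ae_norm_le_supAv hW', Lp.coeFn_sub W W'] with x h1 h2 h3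
  rw [nonlin_uSelf_add hs, nonlin_uSelf_add hs, Pi.sub_apply, h3, Pi.sub_apply]
  refine (norm_cubic_sub_le _ _ _).trans ?_
  rw [norm_uSelf_sq hs]
  gcongr

theorem nlin_zero {a s : ℝ} (hs : 0 < s) : nlin a s 0 = 0 := by
  unfold nlin
  symm
  refine eq_toL2 ?_
  filter_upwards [Lp.coeFn_zero ℂ 2 (volume : Measure ℝ)] with x hx
  rw [hx, nonlin_uSelf_add hs]
  simp [cubic_zero]

/-- The term of the linearization of the nonlinearity at `u_a` that contains the complex conjugate:
`u_a² W̄`, written with the phase of `u_a²`. -/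
def conjTerm (a s : ℝ) (W : L2C) : L2C := ((a ^ 2 / s : ℝ) : ℂ) • chirp (1 / (2 * s)) (star W)

theorem uSelf_sq {a s : ℝ} (hs : 0 < s) (x : ℝ) :
    uSelf a s x ^ 2 = ((a ^ 2 / s : ℝ) : ℂ) * phase (1 / (2 * s)) x := by
  rw [uSelf_eq, mul_pow, div_pow, sq (phase _ _), ← phase_add]
  have h1 : 1 / (4 * s) + 1 / (4 * s) = 1 / (2 * s) := by field_simp; norm_num
  have h2 : ((Real.sqrt s : ℝ) : ℂ) ^ 2 = s := by exact_mod_cast Real.sq_sqrt hs.le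
  rw [h1, h2]
  push_cast
  ring

/-- The nonlinearity is quadratically close to its linearization at `u_a`. -/
theorem norm_nlin_sub_linear_le {a s : ℝ} (ha : 0 ≤ a) (hs : 0 < s) {W : L2C} (hW : supAv W ≠ ⊤) :
    ‖nlin a s W - ((a ^ 2 / s : ℝ) : ℂ) • W - conjTerm a s W‖
      ≤ (3 * (a / Real.sqrt s) * (supAv W).toReal + (supAv W).toReal ^ 2) * ‖W‖ := by
  refine Lp.norm_le_mul_norm_of_ae_le_mul ?_
  filter_upwards [ae_norm_le_supAv hW, coeFn_toL2 (memLp_nonlin (a := a) hs hW),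
    Lp.coeFn_sub (nlin a s W - ((a ^ 2 / s : ℝ) : ℂ) • W) (conjTerm a s W),
    Lp.coeFn_sub (nlin a s W) (((a ^ 2 / s : ℝ) : ℂ) • W), Lp.coeFn_smul ((a ^ 2 / s : ℝ) : ℂ) W,
    Lp.coeFn_smul ((a ^ 2 / s : ℝ) : ℂ) (chirp (1 / (2 * s)) (star W)),
    coeFn_chirp (1 / (2 * s)) (star W), coeFn_star_eq W] with x h1 h2 h3 h4 h5 h6 h7 h8
  have h9 : conjTerm a s W x = uSelf a s x ^ 2 * starRingEnd ℂ (W x) := by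
    unfold conjTerm
    rw [h6, Pi.smul_apply, h7, h8, uSelf_sq hs, smul_eq_mul, mul_assoc]
  have h10 : nlin a s W x = cubic (uSelf a s x) (W x) := by
    unfold nlin
    rw [h2, nonlin_uSelf_add hs]
  rw [h3, Pi.sub_apply, h4, Pi.sub_apply, h5, Pi.smul_apply, h9, h10, smul_eq_mul, sub_sub,
    ← norm_uSelf_sq hs x]
  refine (norm_cubic_sub_linear_le _ _).trans ?_
  rw [norm_uSelf ha]
  have : 0 ≤ a / Real.sqrt s := by positivity
  gcongr

/-! ### Measurability of the nonlinearity in time -/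

/-- A bounded Lipschitz map that approximates the identity as `n → ∞`. -/
def soft (n : ℕ) (w : ℂ) : ℂ := (((1 + ‖w‖ / (n + 1))⁻¹ : ℝ) : ℂ) * w

theorem norm_soft (n : ℕ) (w : ℂ) : ‖soft n w‖ = (1 + ‖w‖ / (n + 1))⁻¹ * ‖w‖ := by
  unfold soft
  rw [norm_mul, Complex.norm_real, Real.norm_of_nonneg (by positivity)]

theorem norm_soft_le_norm (n : ℕ) (w : ℂ) : ‖soft n w‖ ≤ ‖w‖ := by
  rw [norm_soft]
  refine mul_le_of_le_one_left (norm_nonneg _) (inv_le_one_of_one_le₀ ?_)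
  have : 0 ≤ ‖w‖ / ((n : ℝ) + 1) := by positivity
  linarith

theorem norm_soft_le (n : ℕ) (w : ℂ) : ‖soft n w‖ ≤ n + 1 := by
  rw [norm_soft, inv_mul_le_iff₀ (by positivity)]
  have hn : (0 : ℝ) < n + 1 := by positivity
  have : (1 + ‖w‖ / ((n : ℝ) + 1)) * (n + 1) = n + 1 + ‖w‖ := by field_simp
  rw [this]; linarith

theorem norm_soft_sub_le (n : ℕ) (w w' : ℂ) : ‖soft n w - soft n w'‖ ≤ 2 * ‖w - w'‖ := by
  have hn : (0 : ℝ) < n + 1 := by positivity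
  set k : ℝ := 1 + ‖w‖ / (n + 1) with hk
  set k' : ℝ := 1 + ‖w'‖ / (n + 1) with hk'
  have hk1 : 1 ≤ k := by rw [hk]; linarith [show 0 ≤ ‖w‖ / ((n : ℝ) + 1) by positivity]
  have hk1' : 1 ≤ k' := by rw [hk']; linarith [show 0 ≤ ‖w'‖ / ((n : ℝ) + 1) by positivity]
  have e1 : soft n w - soft n w' = ((k⁻¹ : ℝ) : ℂ) * (w - w') + ((k⁻¹ - k'⁻¹ : ℝ) : ℂ) * w' := by
    simp only [soft, ← hk, ← hk']; push_cast; ring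
  have e2 : k⁻¹ - k'⁻¹ = k⁻¹ * ((‖w'‖ - ‖w‖) / (n + 1)) * k'⁻¹ := by
    have h1 : k ≠ 0 := by positivity
    have h2 : k' ≠ 0 := by positivity
    have h3 : (‖w'‖ - ‖w‖) / ((n : ℝ) + 1) = k' - k := by rw [hk, hk']; ring
    rw [h3]; field_simp
  have e3 : k'⁻¹ * ‖w'‖ ≤ n + 1 := by rw [hk', ← norm_soft]; exact norm_soft_le n w'
  have e4 : |‖w'‖ - ‖w‖| ≤ ‖w - w'‖ := by rw [norm_sub_rev]; exact abs_norm_sub_norm_le _ _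
  have hki : k⁻¹ ≤ 1 := inv_le_one_of_one_le₀ hk1
  rw [e1]
  refine (norm_add_le _ _).trans ?_
  rw [norm_mul, norm_mul, Complex.norm_real, Complex.norm_real, Real.norm_of_nonneg (by positivity),
    e2, norm_mul, norm_mul, norm_div, Real.norm_of_nonneg (by positivity : 0 ≤ k⁻¹),
    Real.norm_of_nonneg (by positivity : 0 ≤ k'⁻¹), Real.norm_of_nonneg hn.le, Real.norm_eq_abs]
  calc k⁻¹ * ‖w - w'‖ + k⁻¹ * (|‖w'‖ - ‖w‖| / (n + 1)) * k'⁻¹ * ‖w'‖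
      = k⁻¹ * ‖w - w'‖ + k⁻¹ * (|‖w'‖ - ‖w‖| / (n + 1)) * (k'⁻¹ * ‖w'‖) := by ring
    _ ≤ 1 * ‖w - w'‖ + 1 * (‖w - w'‖ / (n + 1)) * (n + 1) := by gcongr
    _ = 2 * ‖w - w'‖ := by field_simp; norm_num

theorem continuous_soft (n : ℕ) : Continuous (soft n) := by
  have : ∀ w : ℂ, 1 + ‖w‖ / ((n : ℝ) + 1) ≠ 0 := fun w => by positivity
  unfold soft
  fun_prop (disch := assumption)

theorem tendsto_soft (w : ℂ) : Tendsto (fun n => soft n w) atTop (𝓝 w) := by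
  unfold soft
  have h1 : Tendsto (fun n : ℕ => (1 + ‖w‖ * (1 / ((n : ℝ) + 1)))⁻¹) atTop (𝓝 (1 + ‖w‖ * 0)⁻¹) :=
    ((tendsto_one_div_add_atTop_nhds_zero_nat.const_mul _).const_add 1).inv₀ (by simp)
  have h2 := ((Complex.continuous_ofReal.tendsto _).comp h1).mul_const w
  simp only [mul_zero, add_zero, inv_one, Complex.ofReal_one, one_mul] at h2
  refine h2.congr fun n => ?_
  simp only [Function.comp_apply, mul_one_div]

theorem memLp_cubic_soft {a s : ℝ} (hs : 0 < s) (n : ℕ) (W : L2C) :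
    MemLp (fun x => cubic (uSelf a s x) (soft n (W x))) 2 volume := by
  refine (norm_toL2_le (g := W) (c := 7 * (a ^ 2 / s) + 3 * ((n : ℝ) + 1) ^ 2)
    (aestronglyMeasurable_cubic a s
      ((continuous_soft n).comp_aestronglyMeasurable (Lp.aestronglyMeasurable W))) ?_).1
  refine Eventually.of_forall fun x => (norm_cubic_le _ _).trans ?_
  rw [norm_uSelf_sq hs]
  have h1 := norm_soft_le n (W x)
  have h2 := norm_soft_le_norm n (W x)
  gcongr

theorem tendsto_cubic_uSelf (a : ℝ) {s : ℝ} (hs : 0 < s) (x : ℝ) (w : ℂ) :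
    Tendsto (fun r => cubic (uSelf a r x) w) (𝓝 s) (𝓝 (cubic (uSelf a s x) w)) := by
  have h : Continuous fun e : ℂ => cubic e w := by unfold cubic; fun_prop
  have hc : Tendsto (fun r => uSelf a r x) (𝓝 s) (𝓝 (uSelf a s x)) :=
    (hasDerivAt_uSelf_time a hs x).continuousAt
  exact (h.tendsto _).comp hc

theorem continuousOn_cubic_soft {a T : ℝ} (n : ℕ) {W : ℝ → L2C} (hW : ContinuousOn W (Ioc 0 T)) :
    ContinuousOn (fun s => toL2 fun x => cubic (uSelf a s x) (soft n (W s x))) (Ioc 0 T) := by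
  intro s₀ hs₀
  have hs0 : 0 < s₀ := hs₀.1
  have hev : ∀ᶠ s in 𝓝 s₀, s₀ / 2 < s := Ioi_mem_nhds (half_lt_self hs0)
  have l1 : Tendsto (fun s => toL2 fun x => cubic (uSelf a s x) (soft n (W s₀ x))) (𝓝 s₀)
      (𝓝 (toL2 fun x => cubic (uSelf a s₀ x) (soft n (W s₀ x)))) := by
    refine tendsto_toL2_of_dominated
      (G := fun x => (7 * (a ^ 2 / (s₀ / 2)) + 3 * ((n : ℝ) + 1) ^ 2) * ‖W s₀ x‖)
      ?_ ((Lp.memLp (W s₀)).norm.const_mul _) ?_ (memLp_cubic_soft hs0 n _) ?_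
    · filter_upwards [hev] with s hs
      exact (memLp_cubic_soft ((half_pos hs0).trans hs) n _).1
    · filter_upwards [hev] with s hs
      have hs' : 0 < s := (half_pos hs0).trans hs
      refine Eventually.of_forall fun x => (norm_cubic_le _ _).trans ?_
      rw [norm_uSelf_sq hs']
      have h1 := norm_soft_le n (W s₀ x)
      have h2 := norm_soft_le_norm n (W s₀ x)
      have h3 : 0 < s₀ / 2 := half_pos hs0
      gcongr
    · refine Eventually.of_forall fun x => ?_
      exact tendsto_cubic_uSelf a hs0 x _
  have l2 : Tendsto (fun s => (toL2 fun x => cubic (uSelf a s x) (soft n (W s x)))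
      - toL2 fun x => cubic (uSelf a s x) (soft n (W s₀ x))) (𝓝[Ioc 0 T] s₀) (𝓝 0) := by
    have h1 : Tendsto (fun s => (7 * (a ^ 2 / (s₀ / 2)) + 6 * ((n : ℝ) + 1) ^ 2)
        * (2 * ‖W s - W s₀‖)) (𝓝[Ioc 0 T] s₀) (𝓝 0) := by
      have := ((tendsto_iff_norm_sub_tendsto_zero.1 (hW s₀ hs₀)).const_mul 2).const_mul
        (7 * (a ^ 2 / (s₀ / 2)) + 6 * ((n : ℝ) + 1) ^ 2)
      simpa using this
    refine squeeze_zero_norm' ?_ h1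
    filter_upwards [mem_nhdsWithin_of_mem_nhds hev] with s hs
    have hs' : 0 < s := (half_pos hs0).trans hs
    rw [← toL2_sub (memLp_cubic_soft hs' n _) (memLp_cubic_soft hs' n _), ← mul_assoc]
    refine (norm_toL2_le ((memLp_cubic_soft hs' n _).sub (memLp_cubic_soft hs' n _)).1 ?_).2
    filter_upwards [Lp.coeFn_sub (W s) (W s₀)] with x hx
    rw [Pi.sub_apply, hx, Pi.sub_apply]
    refine (norm_cubic_sub_le _ _ _).trans ?_
    rw [norm_uSelf_sq hs', mul_assoc]
    have h1 := norm_soft_le n (W s x)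
    have h2 := norm_soft_le n (W s₀ x)
    have h3 := norm_soft_sub_le n (W s x) (W s₀ x)
    have h4 : 0 < s₀ / 2 := half_pos hs0
    have h5 : 7 * (a ^ 2 / s) + 3 * ‖soft n (W s x)‖ ^ 2 + 3 * ‖soft n (W s₀ x)‖ ^ 2
        ≤ 7 * (a ^ 2 / (s₀ / 2)) + 3 * ((n : ℝ) + 1) ^ 2 + 3 * ((n : ℝ) + 1) ^ 2 := by gcongr
    refine mul_le_mul (h5.trans (le_of_eq (by ring))) h3 (norm_nonneg _) (by positivity)
  have l3 := l2.add (l1.mono_left nhdsWithin_le_nhds)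
  simp only [sub_add_cancel, zero_add] at l3
  exact l3

/-- The nonlinearity is not continuous on `L²`; it becomes so when `W` is truncated softly, and the
truncations converge in `L²` at every time at which `W` is bounded. -/
theorem aestronglyMeasurable_nlin {a T : ℝ} {W : ℝ → L2C} (hW : ContinuousOn W (Ioc 0 T))
    (hfin : ∀ᵐ s ∂volume.restrict (Ioc 0 T), supAv (W s) ≠ ⊤) :
    AEStronglyMeasurable (fun s => nlin a s (W s)) (volume.restrict (Ioc 0 T)) := by
  refine aestronglyMeasurable_of_tendsto_ae atTop (fun n : ℕ =>
    (continuousOn_cubic_soft (a := a) n hW).aestronglyMeasurable measurableSet_Ioc) ?_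
  filter_upwards [hfin, ae_restrict_mem measurableSet_Ioc] with s hs hs0
  have hs0 : 0 < s := hs0.1
  unfold nlin
  have hm := memLp_nonlin (a := a) hs0 hs
  rw [nonlin_uSelf_add hs0] at hm ⊢
  refine tendsto_toL2_of_dominated
    (G := fun x => (7 * (a ^ 2 / s) + 3 * (supAv (W s)).toReal ^ 2) * ‖W s x‖)
    (Eventually.of_forall fun n => (memLp_cubic_soft hs0 n _).1)
    ((Lp.memLp (W s)).norm.const_mul _) (Eventually.of_forall fun n => ?_) hm
    (Eventually.of_forall fun x => ?_)
  · filter_upwards [ae_norm_le_supAv hs] with x hx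
    refine (norm_cubic_le _ _).trans ?_
    rw [norm_uSelf_sq hs0]
    have h2 := norm_soft_le_norm n (W s x)
    have h3 := h2.trans hx
    gcongr
  · exact ((continuous_cubic.comp (Continuous.prodMk_right (uSelf a s x))).tendsto _).comp
      (tendsto_soft (W s x))

/-! ### The linear response to the asymptotic state -/

theorem supAv_smul (c : ℂ) (f : L2C) : supAv (c • f) = ‖c‖ₑ * supAv f := by
  unfold supAv
  rw [ENNReal.mul_iSup]
  congr 1
  ext i
  rw [inner_smul_right, enorm_mul]

/-- The logarithmic phase `e^{iα log t}`. -/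
def logPhase (α t : ℝ) : ℂ := Complex.exp (Complex.I * ((α * Real.log t : ℝ) : ℂ))

theorem norm_logPhase (α t : ℝ) : ‖logPhase α t‖ = 1 := by
  unfold logPhase; rw [mul_comm]; exact Complex.norm_exp_ofReal_mul_I _

theorem conj_logPhase (α t : ℝ) : starRingEnd ℂ (logPhase α t) = logPhase (-α) t := by
  unfold logPhase
  rw [← Complex.exp_conj, map_mul, Complex.conj_I, Complex.conj_ofReal]
  push_cast
  ring_nf

theorem hasDerivAt_logPhase (α : ℝ) {t : ℝ} (ht : 0 < t) :
    HasDerivAt (logPhase α) (Complex.I * α * (logPhase α t / t)) t := by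
  have h1 : HasDerivAt (fun t : ℝ => α * Real.log t) (α * t⁻¹) t :=
    (Real.hasDerivAt_log ht.ne').const_mul α
  refine ((h1.ofReal_comp.const_mul Complex.I).cexp).congr_deriv ?_
  unfold logPhase
  push_cast
  ring

theorem continuousOn_logPhase (α : ℝ) : ContinuousOn (logPhase α) (Ioi 0) := fun _ ht =>
  (hasDerivAt_logPhase α ht).continuousAt.continuousWithinAt

/-- Differentiation of the chirp in its parameter. -/
theorem hasDerivAt_chirp {g : ℝ → ℂ} (hg : MemLp g 2 volume)
    (hg2 : MemLp (fun x => ((x ^ 2 : ℝ) : ℂ) * g x) 2 volume) (β : ℝ) :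
    HasDerivAt (fun β => chirp β (toL2 g))
      (Complex.I • chirp β (toL2 fun x => ((x ^ 2 : ℝ) : ℂ) * g x)) β := by
  rw [chirp_toL2 _ hg2, ← toL2_const_mul (memLp_phase_mul _ hg2)]
  have e : (fun β => chirp β (toL2 g)) = fun β => toL2 fun x => phase β x * g x :=
    funext fun β => chirp_toL2 β hg
  rw [e]
  refine hasDerivAt_toL2 (ε := 1) one_pos (f' := fun s x => Complex.I *
    (phase s x * (((x ^ 2 : ℝ) : ℂ) * g x))) (fun s _ => memLp_phase_mul _ hg) hg2.norm ?_ ?_ ?_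
  · exact ((memLp_phase_mul _ hg2).const_mul _).1
  · refine Eventually.of_forall fun x s _ => ?_
    rw [norm_mul, norm_mul _ (_ * _), norm_phase, Complex.norm_I, one_mul, one_mul]
  · refine Eventually.of_forall fun x s _ => ?_
    have h3 : HasDerivAt (fun s : ℝ => s * x ^ 2) (x ^ 2) s := by
      simpa using (hasDerivAt_id s).mul_const (x ^ 2)
    have h4 := ((h3.ofReal_comp.const_mul Complex.I).cexp).mul_const (g x)
    refine h4.congr_deriv ?_
    unfold phase
    ring

/-- The integrand of the linear response of the selfsimilar solution, after pulling back by the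
Schrödinger group. -/
def respDeriv (α : ℝ) (g : L2C) (τ : ℝ) : L2C :=
  (logPhase (-α) τ / τ) • chirp (-(1 / (2 * τ))) g

theorem continuousOn_chirp_inv (g : L2C) :
    ContinuousOn (fun τ : ℝ => chirp (-(1 / (2 * τ))) g) (Ioi 0) := by
  refine (continuous_chirp g).comp_continuousOn ?_
  refine ContinuousOn.neg (continuousOn_const.div (by fun_prop) fun x hx => ?_)
  have : (0 : ℝ) < x := hx
  positivity

theorem continuousOn_respDeriv (α : ℝ) (g : L2C) : ContinuousOn (respDeriv α g) (Ioi 0) := by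
  refine ContinuousOn.smul ((continuousOn_logPhase _).div (by fun_prop) fun x hx => ?_)
    (continuousOn_chirp_inv g)
  have : (0 : ℝ) < x := hx
  exact_mod_cast this.ne'

theorem uIcc_subset_Ioi {s t : ℝ} (hs : 0 < s) (hst : s ≤ t) : uIcc s t ⊆ Ioi 0 := by
  rw [uIcc_of_le hst]; exact fun x hx => hs.trans_le hx.1

theorem intervalIntegrable_respDeriv (α : ℝ) (g : L2C) {s t : ℝ} (hs : 0 < s) (hst : s ≤ t) :
    IntervalIntegrable (respDeriv α g) volume s t :=
  ((continuousOn_respDeriv α g).mono (uIcc_subset_Ioi hs hst)).intervalIntegrable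

theorem norm_respDeriv (α : ℝ) (g : L2C) {τ : ℝ} (hτ : 0 < τ) :
    ‖respDeriv α g τ‖ = τ⁻¹ * ‖g‖ := by
  unfold respDeriv
  rw [norm_smul, LinearIsometryEquiv.norm_map, norm_div, norm_logPhase, Complex.norm_real,
    Real.norm_of_nonneg hτ.le, one_div]

theorem integral_smul_add_smul {f g : ℝ → L2C} {s t : ℝ} (hf : IntervalIntegrable f volume s t)
    (hg : IntervalIntegrable g volume s t) (c d : ℂ) :
    ∫ τ in s..t, (c • f τ + d • g τ) = c • (∫ τ in s..t, f τ) + d • ∫ τ in s..t, g τ := by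
  rw [← intervalIntegral.integral_smul, ← intervalIntegral.integral_smul]
  exact intervalIntegral.integral_add (hf.smul c) (hg.smul d)

/-- Integration by parts in the oscillatory integral `∫ τ^{-1-iα} e^{-ix²/2τ} dτ`: a factor `x²` is
worth a factor `t`, since `(x²/2τ²) e^{-ix²/2τ}` is a derivative in `τ`, up to the factor `i`. -/
theorem norm_integral_respDeriv_sq_le (α : ℝ) {g : ℝ → ℂ} (hg : MemLp g 2 volume)
    (hg2 : MemLp (fun x => ((x ^ 2 : ℝ) : ℂ) * g x) 2 volume) {s t : ℝ} (hs : 0 < s) (hst : s ≤ t) :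
    ‖∫ τ in s..t, respDeriv α (toL2 fun x => ((x ^ 2 : ℝ) : ℂ) * g x) τ‖
      ≤ 2 * (3 + |α|) * t * ‖toL2 g‖ := by
  have ht : 0 < t := hs.trans_le hst
  set G := toL2 g with hG
  set G2 := toL2 fun x => ((x ^ 2 : ℝ) : ℂ) * g x with hG2
  set c : ℂ := 1 - Complex.I * α with hc
  -- `h = τ^{1-iα} e^{-ix²/2τ} g` is a primitive of the integrand up to the bounded term `c • r`
  let h : ℝ → L2C := fun τ => ((τ : ℂ) * logPhase (-α) τ) • chirp (-(1 / (2 * τ))) G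
  let r : ℝ → L2C := fun τ => logPhase (-α) τ • chirp (-(1 / (2 * τ))) G
  have hr : ContinuousOn r (Ioi 0) := (continuousOn_logPhase _).smul (continuousOn_chirp_inv G)
  have hri : IntervalIntegrable r volume s t :=
    (hr.mono (uIcc_subset_Ioi hs hst)).intervalIntegrable
  have hd : ∀ τ ∈ uIcc s t, HasDerivAt h (c • r τ + (Complex.I / 2) • respDeriv α G2 τ) τ := by
    intro τ hτ
    have hτ0 : 0 < τ := uIcc_subset_Ioi hs hst hτ
    have hτ' : (τ : ℂ) ≠ 0 := by exact_mod_cast hτ0.ne'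
    have h1 : HasDerivAt (fun τ : ℝ => -(1 / (2 * τ))) (1 / (2 * τ ^ 2)) τ := by
      have h := (((hasDerivAt_id τ).const_mul 2).fun_inv (by simp [hτ0.ne'])).neg
      refine (h.congr_deriv ?_).congr_of_eventuallyEq (Eventually.of_forall fun s => ?_)
      · simp only [id]; field_simp
      · simp only [id, Pi.neg_apply, one_div]
    have h2 : HasDerivAt (fun τ => chirp (-(1 / (2 * τ))) G)
        (((1 / (2 * τ ^ 2) : ℝ) : ℂ) • Complex.I • chirp (-(1 / (2 * τ))) G2) τ := by
      have h := (hasDerivAt_chirp hg hg2 (-(1 / (2 * τ)))).scomp τ h1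
      rw [RCLike.real_smul_eq_coe_smul (K := ℂ)] at h
      exact h
    have h3 : HasDerivAt (fun τ : ℝ => (τ : ℂ) * logPhase (-α) τ) (c * logPhase (-α) τ) τ := by
      refine ((hasDerivAt_id τ).ofReal_comp.mul (hasDerivAt_logPhase (-α) hτ0)).congr_deriv ?_
      simp only [id, hc]
      push_cast
      field_simp
      ring
    refine (h3.smul h2).congr_deriv ?_
    simp only [r, respDeriv]
    rw [add_comm]
    simp only [smul_smul]
    congr 2
    push_cast
    field_simp
  have hi2 := intervalIntegrable_respDeriv α G2 hs hst
  have hFTC := intervalIntegral.integral_eq_sub_of_hasDerivAt hd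
    ((hri.smul c).add (hi2.smul (Complex.I / 2)))
  rw [integral_smul_add_smul hri hi2] at hFTC
  have hnh : ∀ τ, 0 < τ → ‖h τ‖ = τ * ‖G‖ := fun τ hτ => by
    simp only [h]
    rw [norm_smul, LinearIsometryEquiv.norm_map, norm_mul, norm_logPhase, Complex.norm_real,
      Real.norm_of_nonneg hτ.le, mul_one]
  have hnr : ‖∫ τ in s..t, r τ‖ ≤ ‖G‖ * |t - s| :=
    intervalIntegral.norm_integral_le_of_norm_le_const fun τ _ => by
      simp only [r]
      rw [norm_smul, LinearIsometryEquiv.norm_map, norm_logPhase, one_mul]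
  rw [abs_of_nonneg (sub_nonneg.2 hst)] at hnr
  have hcn : ‖c‖ ≤ 1 + |α| := by
    refine (norm_sub_le _ _).trans ?_
    rw [norm_one, norm_mul, Complex.norm_I, one_mul, Complex.norm_real, Real.norm_eq_abs]
  have hJ : (Complex.I / 2) • (∫ τ in s..t, respDeriv α G2 τ) = h t - h s - c • ∫ τ in s..t, r τ := by
    rw [← hFTC]; abel
  have hJn := congrArg norm hJ
  rw [norm_smul, norm_div, Complex.norm_I] at hJn
  have h2 : ‖(2 : ℂ)‖ = 2 := by simp
  rw [h2] at hJn
  have hb : ‖h t - h s - c • ∫ τ in s..t, r τ‖ ≤ t * ‖G‖ + s * ‖G‖ + (1 + |α|) * (‖G‖ * (t - s)) := by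
    refine (norm_sub_le _ _).trans (add_le_add ((norm_sub_le _ _).trans ?_) ?_)
    · rw [hnh t ht, hnh s hs]
    · rw [norm_smul]; gcongr
  have hα : 0 ≤ |α| := abs_nonneg α
  have hG0 : 0 ≤ ‖G‖ := norm_nonneg G
  have e1 : t * ‖G‖ + s * ‖G‖ + (1 + |α|) * (‖G‖ * (t - s)) ≤ (3 + |α|) * t * ‖G‖ := by
    have : 0 ≤ ‖G‖ * s * |α| := by positivity
    have : ‖G‖ * s ≤ ‖G‖ * t := by gcongr
    nlinarith
  linarith

/-- The Lorentzian cut-off `(1 + x²/t)⁻¹` of a bounded function has `L²`-norm `O(t^{1/4})`, because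
`∫ (1 + x²/t)⁻¹ dx = π√t`, and it gains a factor `x²`. -/
theorem memLp_lorentz {q : ℝ → ℂ} (hq : MemLp q 2 volume) {M : ℝ} (hM : ∀ᵐ x, ‖q x‖ ≤ M)
    {t : ℝ} (ht : 0 < t) :
    MemLp (fun x => (((1 + x ^ 2 / t)⁻¹ : ℝ) : ℂ) * q x) 2 volume ∧
    MemLp (fun x => ((x ^ 2 : ℝ) : ℂ) * ((((1 + x ^ 2 / t)⁻¹ : ℝ) : ℂ) * q x)) 2 volume ∧
    ‖toL2 (fun x => (((1 + x ^ 2 / t)⁻¹ : ℝ) : ℂ) * q x)‖ ≤ 2 * M * t ^ (1 / 4 : ℝ) := by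
  set l : ℝ → ℝ := fun x => (1 + x ^ 2 / t)⁻¹ with hl
  have hden : ∀ x : ℝ, 1 ≤ 1 + x ^ 2 / t := fun x => by
    have : 0 ≤ x ^ 2 / t := by positivity
    linarith
  have hl0 : ∀ x, 0 ≤ l x := fun x => inv_nonneg.2 (zero_le_one.trans (hden x))
  have hl1 : ∀ x, l x ≤ 1 := fun x => inv_le_one_of_one_le₀ (hden x)
  have hlc : Continuous l := by
    have h : ∀ x : ℝ, 1 + x ^ 2 / t ≠ 0 := fun x => (zero_lt_one.trans_le (hden x)).ne'
    simp only [hl]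
    fun_prop (disch := assumption)
  have hm1 : MemLp (fun x => ((l x : ℝ) : ℂ) * q x) 2 volume := by
    refine memLp_of_bound ((Complex.continuous_ofReal.comp hlc).aestronglyMeasurable.mul hq.1)
      hq.norm (Eventually.of_forall fun x => ?_)
    rw [norm_mul, Complex.norm_real, Real.norm_of_nonneg (hl0 x)]
    exact mul_le_of_le_one_left (norm_nonneg _) (hl1 x)
  refine ⟨hm1, ?_, ?_⟩
  · refine memLp_of_bound (G := fun x => t * ‖q x‖) ?_ (hq.norm.const_mul t)
      (Eventually.of_forall fun x => ?_)
    · have : Continuous fun x : ℝ => ((x ^ 2 : ℝ) : ℂ) := by fun_prop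
      exact this.aestronglyMeasurable.mul hm1.1
    · rw [norm_mul, norm_mul, Complex.norm_real, Complex.norm_real, Real.norm_of_nonneg (hl0 x),
        Real.norm_of_nonneg (sq_nonneg x), ← mul_assoc]
      refine mul_le_mul_of_nonneg_right ?_ (norm_nonneg _)
      rw [← div_eq_mul_inv, div_le_iff₀ (zero_lt_one.trans_le (hden x)), mul_add,
        mul_div_cancel₀ _ ht.ne']
      linarith
  · have hM0 : 0 ≤ M := by
      obtain ⟨x, hx⟩ := hM.exists
      exact (norm_nonneg _).trans hx
    have hsq : ∀ x : ℝ, x ^ 2 / t = (x / Real.sqrt t) ^ 2 := fun x => by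
      rw [div_pow, Real.sq_sqrt ht.le]
    have hst : 0 < Real.sqrt t := Real.sqrt_pos.2 ht
    have hli : Integrable l := by
      simp only [hl, hsq]
      exact (integrable_inv_one_add_sq).comp_div hst.ne'
    have hlint : ∫ x, l x = Real.sqrt t * Real.pi := by
      simp only [hl, hsq]
      rw [Measure.integral_comp_div (fun y : ℝ => (1 + y ^ 2)⁻¹), integral_univ_inv_one_add_sq,
        abs_of_pos hst, smul_eq_mul]
    have h1 : ‖toL2 (fun x => ((l x : ℝ) : ℂ) * q x)‖ₑ ^ 2
        ≤ ENNReal.ofReal (M ^ 2 * (Real.sqrt t * Real.pi)) := by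
      rw [enorm_toL2 hm1, eLpNorm_two_sq, ← hlint, ← integral_const_mul,
        ofReal_integral_eq_lintegral_ofReal (hli.const_mul _)
          (Eventually.of_forall fun x => mul_nonneg (sq_nonneg M) (hl0 x))]
      refine lintegral_mono_ae ?_
      filter_upwards [hM] with x hx
      rw [← ofReal_norm, ← ENNReal.ofReal_pow (norm_nonneg _)]
      refine ENNReal.ofReal_le_ofReal ?_
      rw [norm_mul, Complex.norm_real, Real.norm_of_nonneg (hl0 x), mul_pow, mul_comm (M ^ 2)]
      have h2 : l x ^ 2 ≤ l x := by
        rw [sq]; exact mul_le_of_le_one_left (hl0 x) (hl1 x)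
      have h3 := hl0 x
      gcongr
    rw [← ofReal_norm, ← ENNReal.ofReal_pow (norm_nonneg _),
      ENNReal.ofReal_le_ofReal_iff (by positivity)] at h1
    have h4 : (t ^ (1 / 4 : ℝ)) ^ 2 = Real.sqrt t := by
      rw [← Real.rpow_natCast, ← Real.rpow_mul ht.le, Real.sqrt_eq_rpow]
      norm_num
    refine le_of_sq_le_sq ?_ (by positivity)
    refine h1.trans ?_
    rw [mul_pow, mul_pow, h4]
    have := Real.pi_lt_four
    nlinarith [mul_nonneg (sq_nonneg M) hst.le]

/-- The oscillatory integral over a dyadic time interval. With the cut-off `l = (1 + x²/t)⁻¹`, split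
`q = l q + t⁻¹ x² l q`; the first part is small, and the second is integrated by parts. -/
theorem norm_integral_respDeriv_dyadic_le {α : ℝ} (hα : |α| ≤ 1) {q : ℝ → ℂ} (hq : MemLp q 2 volume)
    {M : ℝ} (hM : ∀ᵐ x, ‖q x‖ ≤ M) {s t : ℝ} (hs : 0 < s) (hst : s ≤ t) (hts : t ≤ 2 * s) :
    ‖∫ τ in s..t, respDeriv α (toL2 q) τ‖ ≤ 18 * M * t ^ (1 / 4 : ℝ) := by
  have ht : 0 < t := hs.trans_le hst
  obtain ⟨hg, hg2, hgn⟩ := memLp_lorentz hq hM ht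
  set g : ℝ → ℂ := fun x => (((1 + x ^ 2 / t)⁻¹ : ℝ) : ℂ) * q x with hgdef
  have e1 : toL2 q = toL2 g + ((t⁻¹ : ℝ) : ℂ) • toL2 (fun x => ((x ^ 2 : ℝ) : ℂ) * g x) := by
    rw [← toL2_const_mul hg2, ← toL2_add hg (hg2.const_mul _)]
    congr 1
    ext x
    have h1 : (1 + x ^ 2 / t : ℝ) ≠ 0 := by positivity
    have h2 : ((1 + x ^ 2 / t)⁻¹ : ℝ) + t⁻¹ * (x ^ 2 * (1 + x ^ 2 / t)⁻¹) = 1 := by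
      field_simp
    have h3 := congrArg (fun r : ℝ => (r : ℂ)) h2
    simp only [hgdef, Pi.add_apply]
    push_cast at h3 ⊢
    linear_combination (-(q x)) * h3
  have e2 : ∀ τ, respDeriv α (toL2 q) τ = (1 : ℂ) • respDeriv α (toL2 g) τ
      + ((t⁻¹ : ℝ) : ℂ) • respDeriv α (toL2 fun x => ((x ^ 2 : ℝ) : ℂ) * g x) τ := fun τ => by
    unfold respDeriv
    rw [e1, map_add, map_smul, smul_add, smul_comm, one_smul]
  simp only [e2]
  rw [integral_smul_add_smul (intervalIntegrable_respDeriv α _ hs hst)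
    (intervalIntegrable_respDeriv α _ hs hst), one_smul]
  have b1 : ‖∫ τ in s..t, respDeriv α (toL2 g) τ‖ ≤ s⁻¹ * ‖toL2 g‖ * |t - s| := by
    refine intervalIntegral.norm_integral_le_of_norm_le_const fun τ hτ => ?_
    rw [uIoc_of_le hst] at hτ
    rw [norm_respDeriv α _ (hs.trans hτ.1)]
    have := hτ.1.le
    gcongr
  rw [abs_of_nonneg (sub_nonneg.2 hst)] at b1
  have b2 := norm_integral_respDeriv_sq_le α hg hg2 hs hst
  have b3 : s⁻¹ * (t - s) ≤ 1 := by rw [inv_mul_le_iff₀ hs]; linarith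
  have hg0 := norm_nonneg (toL2 g)
  refine (norm_add_le _ _).trans ?_
  rw [norm_smul, Complex.norm_real, Real.norm_of_nonneg (by positivity)]
  calc _ ≤ s⁻¹ * ‖toL2 g‖ * (t - s) + t⁻¹ * (2 * (3 + |α|) * t * ‖toL2 g‖) := by gcongr
    _ = (s⁻¹ * (t - s)) * ‖toL2 g‖ + 2 * (3 + |α|) * ‖toL2 g‖ := by field_simp
    _ ≤ 1 * ‖toL2 g‖ + 2 * (3 + 1) * ‖toL2 g‖ := by gcongr
    _ ≤ 9 * (2 * M * t ^ (1 / 4 : ℝ)) := by linarith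
    _ = _ := by ring

theorem half_rpow_quarter_le : ((1 : ℝ) / 2) ^ (1 / 4 : ℝ) ≤ 7 / 8 := by
  have h : ((7 / 8 : ℝ) ^ (4 : ℕ)) ^ (1 / 4 : ℝ) = 7 / 8 := by
    rw [show (1 / 4 : ℝ) = ((4 : ℕ) : ℝ)⁻¹ by norm_num]
    exact Real.pow_rpow_inv_natCast (by norm_num) (by norm_num)
  rw [← h]
  exact Real.rpow_le_rpow (by norm_num) (by norm_num) (by norm_num)

/-- The oscillatory integral over a general time interval, by summation over dyadic intervals. -/
theorem norm_integral_respDeriv_le {α : ℝ} (hα : |α| ≤ 1) {q : ℝ → ℂ} (hq : MemLp q 2 volume)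
    {M : ℝ} (hM0 : 0 ≤ M) (hM : ∀ᵐ x, ‖q x‖ ≤ M) {s t : ℝ} (hs : 0 < s) (hst : s ≤ t) :
    ‖∫ τ in s..t, respDeriv α (toL2 q) τ‖ ≤ 144 * M * t ^ (1 / 4 : ℝ) := by
  -- `144 = 18 / (1 - 7/8)` sums the geometric series of the dyadic contributions
  have key : ∀ n : ℕ, ∀ t, s ≤ t → t ≤ 2 ^ n * s →
      ‖∫ τ in s..t, respDeriv α (toL2 q) τ‖ ≤ 144 * M * t ^ (1 / 4 : ℝ) := by
    intro n
    induction n with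
    | zero =>
      intro t h1 h2
      have : t = s := le_antisymm (by simpa using h2) h1
      rw [this, intervalIntegral.integral_same, norm_zero]
      positivity
    | succ n ih =>
      intro t h1 h2
      have ht : 0 < t := hs.trans_le h1
      have hpos : 0 ≤ t ^ (1 / 4 : ℝ) := by positivity
      rcases le_or_gt t (2 * s) with h3 | h3
      · refine (norm_integral_respDeriv_dyadic_le hα hq hM hs h1 h3).trans ?_
        gcongr
        norm_num
      · have h4 : s ≤ t / 2 := by linarith
        have h5 : t / 2 ≤ t := by linarith
        have h6 := ih (t / 2) h4 (by rw [pow_succ] at h2; linarith)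
        have h7 := norm_integral_respDeriv_dyadic_le hα hq hM (hs.trans_le h4) h5 (by linarith)
        rw [← intervalIntegral.integral_add_adjacent_intervals
          (intervalIntegrable_respDeriv α _ hs h4)
          (intervalIntegrable_respDeriv α _ (hs.trans_le h4) h5)]
        have h8 : (t / 2) ^ (1 / 4 : ℝ) ≤ t ^ (1 / 4 : ℝ) * (7 / 8) := by
          rw [show t / 2 = t * (1 / 2) by ring, Real.mul_rpow ht.le (by norm_num)]
          gcongr
          exact half_rpow_quarter_le
        refine (norm_add_le _ _).trans ((add_le_add h6 h7).trans ?_)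
        calc _ ≤ 144 * M * (t ^ (1 / 4 : ℝ) * (7 / 8)) + 18 * M * t ^ (1 / 4 : ℝ) := by gcongr
          _ = _ := by ring
  obtain ⟨n, hn⟩ := pow_unbounded_of_one_lt (t / s) (one_lt_two (α := ℝ))
  exact key n t hst ((div_lt_iff₀ hs).1 hn).le

/-- A function on `(0,∞)` whose integrals over `[s,t]` are `O(t^{1/4})` has an improper primitive
from `0`. -/
theorem exists_improper_primitive {B : ℝ → L2C} (hB : ContinuousOn B (Ioi 0)) {C : ℝ}
    (hC : ∀ s t, 0 < s → s ≤ t → ‖∫ τ in s..t, B τ‖ ≤ C * t ^ (1 / 4 : ℝ)) :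
    ∃ Y : ℝ → L2C, (∀ t, 0 < t → ‖Y t‖ ≤ C * t ^ (1 / 4 : ℝ)) ∧
      (∀ s t, 0 < s → s ≤ t → Y t - Y s = ∫ τ in s..t, B τ) := by
  have hi : ∀ s t, 0 < s → 0 < t → IntervalIntegrable B volume s t := fun s t hs ht =>
    (hB.mono fun x hx => (lt_min hs ht).trans_le hx.1).intervalIntegrable
  set G : ℝ → L2C := fun t => ∫ τ in (1 : ℝ)..t, B τ with hG
  have hGs : ∀ s t, 0 < s → 0 < t → G t - G s = ∫ τ in s..t, B τ := fun s t hs ht =>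
    intervalIntegral.integral_interval_sub_left (hi _ _ one_pos ht) (hi _ _ one_pos hs)
  let ε : ℕ → ℝ := fun n => 1 / ((n : ℝ) + 1)
  have hε0 : ∀ n, 0 < ε n := fun n => by simp only [ε]; positivity
  have hεlim : Tendsto ε atTop (𝓝 0) := tendsto_one_div_add_atTop_nhds_zero_nat
  have hεanti : ∀ m n, n ≤ m → ε m ≤ ε n := fun m n h => Nat.one_div_le_one_div h
  have hlim : Tendsto (fun n => C * ε n ^ (1 / 4 : ℝ)) atTop (𝓝 0) := by
    have h1 : Continuous fun r : ℝ => C * r ^ (1 / 4 : ℝ) :=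
      continuous_const.mul (Real.continuous_rpow_const (by norm_num))
    have h2 := (h1.tendsto 0).comp hεlim
    rw [Real.zero_rpow (by norm_num), mul_zero] at h2
    exact h2
  -- the primitive from time `1` has a limit as the time tends to zero
  have hcau : CauchySeq fun n => G (ε n) := by
    refine cauchySeq_of_le_tendsto_0' (fun n => C * ε n ^ (1 / 4 : ℝ)) (fun n m hnm => ?_) hlim
    rw [dist_eq_norm, hGs _ _ (hε0 m) (hε0 n)]
    exact hC _ _ (hε0 m) (hεanti m n hnm)
  obtain ⟨G0, hG0⟩ := cauchySeq_tendsto_of_complete hcau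
  refine ⟨fun t => G t - G0, fun t ht => ?_, fun s t hs hst => ?_⟩
  · refine le_of_tendsto (hG0.const_sub (G t)).norm ?_
    filter_upwards [hεlim.eventually (Iio_mem_nhds ht)] with n hn
    rw [hGs _ _ (hε0 n) ht]
    exact hC _ _ (hε0 n) (le_of_lt hn)
  · rw [sub_sub_sub_cancel_right, hGs s t hs (hs.trans_le hst)]

/-- The free evolution of `P`, with the logarithmic phase correction caused by `u_a`. -/
def freeW (α : ℝ) (P : L2C) (t : ℝ) : L2C := logPhase α t • schr t P

theorem norm_freeW (α : ℝ) (P : L2C) (t : ℝ) : ‖freeW α P t‖ = ‖P‖ := by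
  unfold freeW
  rw [norm_smul, norm_logPhase, one_mul, LinearIsometryEquiv.norm_map]

theorem supAv_freeW_le {α : ℝ} {v : ℝ → ℂ} (h1 : Integrable v) (h2 : MemLp v 2 volume) (t : ℝ) :
    supAv (freeW α (𝓕⁻ (toL2 v)) t) ≤ ∫⁻ ξ, ‖v ξ‖ₑ := by
  unfold freeW
  rw [supAv_smul_of_norm_one (norm_logPhase α t)]
  exact supAv_schr_fourierInv_le h1 h2

theorem continuousOn_freeW (α : ℝ) (P : L2C) : ContinuousOn (freeW α P) (Ioi 0) :=
  (continuousOn_logPhase α).smul (continuous_schr P).continuousOn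

theorem continuousOn_ofReal_div (c : ℝ) : ContinuousOn (fun τ : ℝ => ((c / τ : ℝ) : ℂ)) (Ioi 0) := by
  refine Complex.continuous_ofReal.comp_continuousOn (continuousOn_const.div continuousOn_id ?_)
  exact fun x hx => (ne_of_gt hx)

/-- The free evolution with the logarithmic phase solves `iW_t + W_xx + σ(a²/t)W = 0`. -/
theorem mildOn_freeW (σ a : ℝ) (P : L2C) {s : ℝ} (hs : 0 < s) (T : ℝ) :
    MildOn σ s T (fun τ => ((a ^ 2 / τ : ℝ) : ℂ) • freeW (σ * a ^ 2) P τ)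
      (freeW (σ * a ^ 2) P) := by
  intro t ht
  have e1 : ∀ τ, schr (-τ) (freeW (σ * a ^ 2) P τ) = logPhase (σ * a ^ 2) τ • P := fun τ => by
    unfold freeW; rw [map_smul, schr_neg_schr]
  have e2 : ∀ τ, schr (-τ) (((a ^ 2 / τ : ℝ) : ℂ) • freeW (σ * a ^ 2) P τ)
      = (((a ^ 2 / τ : ℝ) : ℂ) * logPhase (σ * a ^ 2) τ) • P := fun τ => by
    rw [map_smul, e1, smul_smul]
  simp only [e2]
  rw [e1, e1, intervalIntegral.integral_smul_const, smul_smul, ← add_smul]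
  congr 1
  have hsub := uIcc_subset_Ioi hs ht.1
  have hi : IntervalIntegrable (fun τ => Complex.I * σ * (((a ^ 2 / τ : ℝ) : ℂ)
      * logPhase (σ * a ^ 2) τ)) volume s t :=
    ContinuousOn.intervalIntegrable (continuousOn_const.mul
      (((continuousOn_ofReal_div (a ^ 2)).mul (continuousOn_logPhase _)).mono hsub))
  have h := intervalIntegral.integral_eq_sub_of_hasDerivAt (f := logPhase (σ * a ^ 2))
    (f' := fun τ => Complex.I * σ * (((a ^ 2 / τ : ℝ) : ℂ) * logPhase (σ * a ^ 2) τ))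
    (fun τ hτ => (hasDerivAt_logPhase _ (hsub hτ)).congr_deriv (by push_cast; ring)) hi
  rw [intervalIntegral.integral_const_mul] at h
  rw [h]; ring

theorem star_smul_L2C (c : ℂ) (f : L2C) : star (c • f) = starRingEnd ℂ c • star f := by
  apply Lp.ext
  filter_upwards [coeFn_star_eq (c • f), Lp.coeFn_smul c f, coeFn_star_eq f,
    Lp.coeFn_smul (starRingEnd ℂ c) (star f)] with x e1 e2 e3 e4
  rw [e1, e2, e4, Pi.smul_apply, Pi.smul_apply, e3, smul_eq_mul, map_mul, smul_eq_mul]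

/-- The term with the complex conjugate, evaluated at the free evolution and pulled back by the
Schrödinger group. -/
theorem schr_neg_conjTerm {α a τ : ℝ} (hτ : 0 < τ) {v : ℝ → ℂ} (h1 : Integrable v)
    (h2 : MemLp v 2 volume) :
    schr (-τ) (conjTerm a τ (freeW α (𝓕⁻ (toL2 v)) τ))
      = (Complex.I * (a : ℂ) ^ 2) • respDeriv α (𝓕⁻ (toL2 fun ξ => starRingEnd ℂ (v ξ))) τ := by
  have e1 : chirp (1 / (2 * τ)) (star (schr τ (𝓕⁻ (toL2 v))))
      = Complex.I • schr τ (chirp (-(1 / (2 * τ))) (𝓕⁻ (toL2 fun ξ => starRingEnd ℂ (v ξ)))) := by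
    rw [schr_chirp_conj hτ h1 h2, smul_smul]
    simp
  unfold conjTerm freeW respDeriv
  rw [star_smul_L2C, conj_logPhase, map_smul, (chirp (1 / (2 * τ))).map_smul, e1]
  simp only [map_smul, schr_neg_schr, smul_smul]
  congr 1
  push_cast
  ring

theorem continuousOn_conjTerm (a α : ℝ) {v : ℝ → ℂ} (h1 : Integrable v) (h2 : MemLp v 2 volume) :
    ContinuousOn (fun τ => conjTerm a τ (freeW α (𝓕⁻ (toL2 v)) τ)) (Ioi 0) := by
  have h : ContinuousOn (fun τ => schr τ ((Complex.I * (a : ℂ) ^ 2) •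
      respDeriv α (𝓕⁻ (toL2 fun ξ => starRingEnd ℂ (v ξ))) τ)) (Ioi 0) :=
    continuousOn_schr_apply continuousOn_id
      ((continuousOn_respDeriv α _).const_smul (Complex.I * (a : ℂ) ^ 2))
  refine h.congr fun τ hτ => ?_
  beta_reduce
  rw [← schr_neg_conjTerm hτ h1 h2, schr_schr_neg]

theorem lintegral_inv_mul_sqrt {t : ℝ} (ht : 0 < t) :
    ∫⁻ τ in Ioc 0 t, ENNReal.ofReal (τ⁻¹ * (τ / t) ^ (1 / 2 : ℝ)) = 2 := by
  have e : ∀ τ ∈ Ioc 0 t, τ⁻¹ * (τ / t) ^ (1 / 2 : ℝ) = t ^ (-(1 / 2) : ℝ) * τ ^ (-(1 / 2) : ℝ) := by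
    intro τ hτ
    have h0 : 0 < τ := hτ.1
    rw [Real.div_rpow h0.le ht.le, Real.rpow_neg ht.le, ← Real.rpow_neg_one τ, ← mul_div_assoc,
      ← Real.rpow_add h0, div_eq_inv_mul]
    norm_num
  have hi : IntegrableOn (fun τ : ℝ => t ^ (-(1 / 2) : ℝ) * τ ^ (-(1 / 2) : ℝ)) (Ioc 0 t) := by
    have := (intervalIntegral.intervalIntegrable_rpow' (a := 0) (b := t)
      (by norm_num : (-1 : ℝ) < -(1 / 2))).const_mul (t ^ (-(1 / 2) : ℝ))
    rwa [intervalIntegrable_iff_integrableOn_Ioc_of_le ht.le] at this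
  rw [setLIntegral_congr_fun measurableSet_Ioc fun τ hτ => by rw [e τ hτ],
    ← ofReal_integral_eq_lintegral_ofReal hi]
  · rw [integral_const_mul, ← intervalIntegral.integral_of_le ht.le,
      integral_rpow (Or.inl (by norm_num))]
    have h3 : t ^ (-(1 / 2) : ℝ) * ((t ^ (-(1 / 2) + 1 : ℝ) - 0 ^ (-(1 / 2) + 1 : ℝ)) / (-(1 / 2) + 1))
        = 2 := by
      rw [Real.zero_rpow (by norm_num), sub_zero, ← mul_div_assoc, ← Real.rpow_add ht]
      norm_num
    rw [h3]; norm_num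
  · filter_upwards [ae_restrict_mem measurableSet_Ioc] with τ hτ
    have := hτ.1.le
    simp only [Pi.zero_apply]
    positivity

/-- The solution of the free equation with source `u_a²` times the conjugate of the free evolution
`freeW`, which vanishes at time zero. It is `O(t^{1/4})` in `L²`, and bounded. -/
theorem exists_response {σ a : ℝ} (hσ : |σ| = 1) (ha1 : a ^ 2 ≤ 1) {v : ℝ → ℂ}
    (h1 : Integrable v) (h2 : MemLp v 2 volume) : ∃ Z : ℝ → L2C,
      (∀ t, 0 < t → ‖Z t‖ ≤ 144 * a ^ 2 * (∫ ξ, ‖v ξ‖) * t ^ (1 / 4 : ℝ)) ∧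
      (∀ t, 0 < t → supAv (Z t) ≤ ENNReal.ofReal (2 * a ^ 2 * ∫ ξ, ‖v ξ‖)) ∧
      (∀ s T, 0 < s → MildOn σ s T
        (fun τ => conjTerm a τ (freeW (σ * a ^ 2) (𝓕⁻ (toL2 v)) τ)) Z) := by
  set M := ∫ ξ, ‖v ξ‖ with hM
  have hM0 : 0 ≤ M := integral_nonneg fun _ => norm_nonneg _
  set α := σ * a ^ 2 with hα
  have hα1 : |α| ≤ 1 := by rw [hα, abs_mul, hσ, one_mul, abs_of_nonneg (sq_nonneg a)]; exact ha1
  have h1' : Integrable fun ξ => starRingEnd ℂ (v ξ) :=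
    (Complex.conjCLE.toContinuousLinearMap.integrable_comp h1 :)
  have h2' : MemLp (fun ξ => starRingEnd ℂ (v ξ)) 2 volume := h2.star
  have hMe : ∫⁻ ξ, ‖starRingEnd ℂ (v ξ)‖ₑ = ENNReal.ofReal M := by
    rw [hM, ofReal_integral_norm_eq_lintegral_enorm h1]
    refine lintegral_congr fun ξ => ?_
    rw [← ofReal_norm, RCLike.norm_conj, ofReal_norm]
  set g : L2C := 𝓕⁻ (toL2 fun ξ => starRingEnd ℂ (v ξ)) with hg
  have hgq : ∀ᵐ x, ‖g x‖ ≤ M := by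
    filter_upwards [coeFn_fourierInv_toL2 h1' h2'] with x hx
    rw [hg, hx]
    refine (norm_fourierInv_le _ x).trans (le_of_eq ?_)
    simp only [RCLike.norm_conj, hM]
  have hcb : ∀ s t, 0 < s → s ≤ t →
      ‖∫ τ in s..t, respDeriv α g τ‖ ≤ 144 * M * t ^ (1 / 4 : ℝ) := fun s t hs hst => by
    have := norm_integral_respDeriv_le hα1 (Lp.memLp g) hM0 hgq hs hst
    rwa [toL2_coe] at this
  obtain ⟨Y, hY1, hY2⟩ := exists_improper_primitive (continuousOn_respDeriv α g) hcb
  set c : ℂ := Complex.I * σ * (Complex.I * (a : ℂ) ^ 2) with hc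
  have hcn : ‖c‖ = a ^ 2 := by
    rw [hc]
    simp only [norm_mul, norm_pow, Complex.norm_I, Complex.norm_real, one_mul, Real.norm_eq_abs, hσ,
      sq_abs]
  refine ⟨fun t => schr t (c • Y t), fun t ht => ?_, fun t ht => ?_, fun s T hs t ht => ?_⟩
  · rw [LinearIsometryEquiv.norm_map, norm_smul, hcn]
    calc a ^ 2 * ‖Y t‖ ≤ a ^ 2 * (144 * M * t ^ (1 / 4 : ℝ)) := by
          gcongr; exact hY1 t ht
      _ = _ := by ring
  · -- approximation by the integrals over `[s, t]`, to which the dispersive bound applies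
    have hlim0 : Tendsto Y (𝓝[>] 0) (𝓝 0) := by
      have h3 : Tendsto (fun s : ℝ => 144 * M * s ^ (1 / 4 : ℝ)) (𝓝[>] 0) (𝓝 0) := by
        have h4 : Continuous fun r : ℝ => 144 * M * r ^ (1 / 4 : ℝ) :=
          continuous_const.mul (Real.continuous_rpow_const (by norm_num))
        have h5 := h4.tendsto 0
        rw [Real.zero_rpow (by norm_num), mul_zero] at h5
        exact h5.mono_left nhdsWithin_le_nhds
      refine squeeze_zero_norm' ?_ h3
      filter_upwards [self_mem_nhdsWithin] with s hs using hY1 s hs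
    have hlim : Tendsto (fun s => schr t (c • (Y t - Y s))) (𝓝[>] 0) (𝓝 (schr t (c • Y t))) := by
      have h3 := ((schr t).continuous.tendsto _).comp ((hlim0.const_sub (Y t)).const_smul c)
      rw [sub_zero] at h3
      exact h3
    refine supAv_le_of_tendsto hlim ?_
    filter_upwards [Ioc_mem_nhdsGT ht] with s hs
    have hi : IntegrableOn (respDeriv α g) (Ioc s t) volume := by
      have := intervalIntegrable_respDeriv α g hs.1 hs.2
      rwa [intervalIntegrable_iff_integrableOn_Ioc_of_le hs.2] at this
    have hcomm : schr t (∫ τ in Ioc s t, respDeriv α g τ) = ∫ τ in Ioc s t, schr t (respDeriv α g τ) :=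
      ((schr t).toContinuousLinearEquiv.toContinuousLinearMap.integral_comp_comm hi).symm
    have hi' : IntegrableOn (fun τ => schr t (respDeriv α g τ)) (Ioc s t) volume :=
      (schr t).toContinuousLinearEquiv.toContinuousLinearMap.integrable_comp hi
    rw [hY2 s t hs.1 hs.2, map_smul, supAv_smul, intervalIntegral.integral_of_le hs.2, hcomm]
    have hcE : ‖c‖ₑ = ENNReal.ofReal (a ^ 2) := by rw [← ofReal_norm, hcn]
    have hbound : ∀ τ ∈ Ioc s t, supAv (schr t (respDeriv α g τ))
        ≤ ENNReal.ofReal (τ⁻¹ * (τ / t) ^ (1 / 2 : ℝ)) * ENNReal.ofReal M := by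
      intro τ hτ
      have hτ0 : 0 < τ := hs.1.trans hτ.1
      unfold respDeriv
      have hn : ‖logPhase (-α) τ / τ‖ₑ = ENNReal.ofReal τ⁻¹ := by
        rw [← ofReal_norm, norm_div, norm_logPhase, Complex.norm_real, Real.norm_of_nonneg hτ0.le,
          one_div]
      rw [map_smul, supAv_smul, hn, ENNReal.ofReal_mul (by positivity), mul_assoc, ← hMe]
      gcongr
      exact supAv_schr_chirp_fourierInv_le hτ0 hτ.2 h1' h2'
    calc ‖c‖ₑ * supAv (∫ τ in Ioc s t, schr t (respDeriv α g τ))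
        ≤ ‖c‖ₑ * ∫⁻ τ in Ioc s t, supAv (schr t (respDeriv α g τ)) := by
          gcongr; exact supAv_integral_le hi'
      _ ≤ ‖c‖ₑ * ∫⁻ τ in Ioc s t,
            ENNReal.ofReal (τ⁻¹ * (τ / t) ^ (1 / 2 : ℝ)) * ENNReal.ofReal M := by
          gcongr ‖c‖ₑ * ?_
          exact setLIntegral_mono' measurableSet_Ioc hbound
      _ = ‖c‖ₑ * ((∫⁻ τ in Ioc s t, ENNReal.ofReal (τ⁻¹ * (τ / t) ^ (1 / 2 : ℝ)))
            * ENNReal.ofReal M) := by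
          rw [lintegral_mul_const' _ _ ENNReal.ofReal_ne_top]
      _ ≤ ‖c‖ₑ * (2 * ENNReal.ofReal M) := by
          gcongr
          rw [← lintegral_inv_mul_sqrt ht]
          exact lintegral_mono_set (Ioc_subset_Ioc_left hs.1.le)
      _ = ENNReal.ofReal (2 * a ^ 2 * M) := by
          rw [hcE, ENNReal.ofReal_mul (by positivity), ENNReal.ofReal_mul (by positivity)]
          simp only [ENNReal.ofReal_ofNat]
          ring
  · have hst := ht.1
    have e1 : ∫ τ in s..t, schr (-τ) (conjTerm a τ (freeW α (𝓕⁻ (toL2 v)) τ))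
        = (Complex.I * (a : ℂ) ^ 2) • ∫ τ in s..t, respDeriv α g τ := by
      rw [← intervalIntegral.integral_smul]
      refine intervalIntegral.integral_congr fun τ hτ => ?_
      exact schr_neg_conjTerm (uIcc_subset_Ioi hs hst hτ) h1 h2
    rw [schr_neg_schr, schr_neg_schr, e1, ← hY2 s t hs hst, smul_smul, ← hc, ← smul_add]
    congr 1
    abel

/-! ### The fixed point argument -/

/-- A contraction principle in a weighted supremum norm, on a set closed under uniform limits. -/
theorem exists_fixedPoint_of_contraction {E : Type*} [NormedAddCommGroup E] [CompleteSpace E]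
    {I : Set ℝ} {w : ℝ → ℝ} {S : Set (ℝ → E)} {Φ : (ℝ → E) → ℝ → E} {z₀ : ℝ → E} (hz₀ : z₀ ∈ S)
    (hΦ : ∀ z ∈ S, Φ z ∈ S) {R : ℝ} (hR0 : 0 ≤ R) (hR : ∀ z ∈ S, ∀ t ∈ I, ‖z t‖ ≤ R * w t)
    (hcontr : ∀ z ∈ S, ∀ z' ∈ S, ∀ D : ℝ, 0 ≤ D → (∀ t ∈ I, ‖z t - z' t‖ ≤ D * w t) →
      ∀ t ∈ I, ‖Φ z t - Φ z' t‖ ≤ D / 2 * w t)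
    (hclosed : ∀ (u : ℕ → ℝ → E) (z : ℝ → E), (∀ n, u n ∈ S) →
      (∀ n, ∀ t ∈ I, ‖u n t - z t‖ ≤ 4 * R / 2 ^ n * w t) → z ∈ S) :
    ∃ z ∈ S, ∀ t ∈ I, Φ z t = z t := by
  let u : ℕ → ℝ → E := fun n => Φ^[n] z₀
  have hus : ∀ n, u (n + 1) = Φ (u n) := fun n => Function.iterate_succ_apply' Φ n z₀
  have hu : ∀ n, u n ∈ S := fun n => by
    induction n with
    | zero => exact hz₀
    | succ n ih => rw [hus]; exact hΦ _ ih
  have hstep : ∀ n, ∀ t ∈ I, ‖u n t - u (n + 1) t‖ ≤ 2 * R / 2 ^ n * w t := by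
    intro n
    induction n with
    | zero =>
      intro t ht
      have h1 := hR _ (hu 0) t ht
      have h2 := hR _ (hu 1) t ht
      refine (norm_sub_le _ _).trans ((add_le_add h1 h2).trans (le_of_eq ?_))
      rw [pow_zero]; ring
    | succ n ih =>
      intro t ht
      have h1 := hcontr _ (hu n) _ (hu (n + 1)) _ (by positivity) ih t ht
      rw [← hus, ← hus] at h1
      refine h1.trans (le_of_eq ?_)
      rw [pow_succ]; ring
  have hd : ∀ t ∈ I, ∀ n, dist (u n t) (u (n + 1) t) ≤ 4 * R * w t / 2 / 2 ^ n := fun t ht n => by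
    rw [dist_eq_norm]
    refine (hstep n t ht).trans (le_of_eq ?_)
    ring
  have hlim : ∀ t, ∃ z : E, t ∈ I → Tendsto (fun n => u n t) atTop (𝓝 z) := fun t => by
    by_cases ht : t ∈ I
    · obtain ⟨z, hz⟩ := cauchySeq_tendsto_of_complete (cauchySeq_of_le_geometric_two (hd t ht))
      exact ⟨z, fun _ => hz⟩
    · exact ⟨0, fun h => absurd h ht⟩
  choose z hz using hlim
  have hzn : ∀ n, ∀ t ∈ I, ‖u n t - z t‖ ≤ 4 * R / 2 ^ n * w t := fun n t ht => by
    rw [← dist_eq_norm]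
    refine (dist_le_of_le_geometric_two_of_tendsto (hd t ht) (hz t ht) n).trans (le_of_eq ?_)
    ring
  have hzS : z ∈ S := hclosed u z hu hzn
  refine ⟨z, hzS, fun t ht => ?_⟩
  have h1 : Tendsto (fun n => u (n + 1) t) atTop (𝓝 (Φ z t)) := by
    rw [tendsto_iff_norm_sub_tendsto_zero]
    have h2 : Tendsto (fun n : ℕ => (2 * R * w t) * (1 / 2 : ℝ) ^ n) atTop (𝓝 0) := by
      have := (tendsto_pow_atTop_nhds_zero_of_lt_one (by norm_num : (0 : ℝ) ≤ 1 / 2)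
        (by norm_num)).const_mul (2 * R * w t)
      simpa using this
    refine squeeze_zero (fun _ => norm_nonneg _) (fun n => ?_) h2
    rw [hus]
    refine (hcontr _ (hu n) _ hzS _ (by positivity) (hzn n) t ht).trans (le_of_eq ?_)
    rw [one_div, inv_pow]; ring
  exact tendsto_nhds_unique h1 ((tendsto_add_atTop_iff_nat 1).2 (hz t ht))

/-- The set in which the correction to the linear profile is sought: it is `O(t^{1/4})` both in
`L²` and in `L⁴((0,t), L^∞)`. -/
def decaySet (T R : ℝ) : Set (ℝ → L2C) :=
  {z | ContinuousOn z (Ioc 0 T) ∧ (∀ t ∈ Ioc 0 T, ‖z t‖ ≤ R * t ^ (1 / 4 : ℝ)) ∧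
    ∀ t ∈ Ioc 0 T, ∫⁻ s in Ioc 0 t, supAv (z s) ^ 4 ≤ ENNReal.ofReal (R ^ 4 * t)}

theorem supAv_zero : supAv 0 = 0 := by simp [supAv]

theorem zero_mem_decaySet (T : ℝ) {R : ℝ} (hR : 0 ≤ R) : (0 : ℝ → L2C) ∈ decaySet T R := by
  refine ⟨continuousOn_const, fun t ht => ?_, fun t ht => ?_⟩
  · have := ht.1.le
    rw [Pi.zero_apply, norm_zero]; positivity
  · simp [supAv_zero]

theorem lowerSemicontinuous_supAv_pow : LowerSemicontinuous fun f : L2C => supAv f ^ 4 :=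
  (ENNReal.continuous_pow 4).comp_lowerSemicontinuous lowerSemicontinuous_supAv
    (fun _ _ h => pow_le_pow_left₀ (zero_le) h 4)

theorem aemeasurable_supAv_of_continuousOn {z : ℝ → L2C} {T t : ℝ} (hz : ContinuousOn z (Ioc 0 T))
    (ht : t ≤ T) : AEMeasurable (fun s => supAv (z s)) (volume.restrict (Ioc 0 t)) :=
  aemeasurable_supAv ((hz.mono (Ioc_subset_Ioc_right ht)).aestronglyMeasurable measurableSet_Ioc)

/-- Closedness uses only convergence in `L²`: the bound in `L⁴L^∞` passes to the limit by
semicontinuity and the lemma of Fatou. -/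
theorem decaySet_closed {T R C : ℝ} {u : ℕ → ℝ → L2C} {z : ℝ → L2C}
    (hu : ∀ n, u n ∈ decaySet T R)
    (h : ∀ n, ∀ t ∈ Ioc 0 T, ‖u n t - z t‖ ≤ C / 2 ^ n * t ^ (1 / 4 : ℝ)) : z ∈ decaySet T R := by
  have hgeo : ∀ r : ℝ, Tendsto (fun n : ℕ => C / 2 ^ n * r) atTop (𝓝 0) := fun r => by
    have := (tendsto_pow_atTop_nhds_zero_of_lt_one (by norm_num : (0 : ℝ) ≤ 1 / 2)
        (by norm_num)).const_mul (C * r)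
    rw [mul_zero] at this
    refine this.congr fun n => ?_
    rw [one_div, inv_pow]; ring
  have hlim : ∀ t ∈ Ioc 0 T, Tendsto (fun n => u n t) atTop (𝓝 (z t)) := fun t ht =>
    tendsto_iff_norm_sub_tendsto_zero.2
      (squeeze_zero (fun _ => norm_nonneg _) (fun n => h n t ht) (hgeo _))
  refine ⟨?_, fun t ht => ?_, fun t ht => ?_⟩
  · refine TendstoUniformlyOn.continuousOn (F := u) (p := atTop) ?_
      (Eventually.of_forall fun n => (hu n).1).frequently
    rw [Metric.tendstoUniformlyOn_iff]
    intro ε hε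
    filter_upwards [((hgeo (T ^ (1 / 4 : ℝ))).eventually (Iio_mem_nhds hε))] with n hn t ht
    rw [dist_comm, dist_eq_norm]
    have ht0 : 0 < t ^ (1 / 4 : ℝ) := Real.rpow_pos_of_pos ht.1 _
    have h0 : 0 ≤ C / 2 ^ n := by
      have := (norm_nonneg _).trans (h n t ht)
      exact nonneg_of_mul_nonneg_left this ht0
    refine ((h n t ht).trans ?_).trans_lt hn
    exact mul_le_mul_of_nonneg_left (Real.rpow_le_rpow ht.1.le ht.2 (by norm_num)) h0
  · exact le_of_tendsto (hlim t ht).norm (Eventually.of_forall fun n => (hu n).2.1 t ht)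
  · calc ∫⁻ s in Ioc 0 t, supAv (z s) ^ 4
        ≤ ∫⁻ s in Ioc 0 t, liminf (fun n => supAv (u n s) ^ 4) atTop := by
          refine setLIntegral_mono' measurableSet_Ioc fun s hs => ?_
          have h1 := lowerSemicontinuousAt_iff_le_liminf.1 (lowerSemicontinuous_supAv_pow (z s))
          exact h1.trans (liminf_le_liminf_of_le (hlim s ⟨hs.1, hs.2.trans ht.2⟩))
      _ ≤ liminf (fun n => ∫⁻ s in Ioc 0 t, supAv (u n s) ^ 4) atTop :=
          lintegral_liminf_le' fun n =>
            (aemeasurable_supAv_of_continuousOn (hu n).1 ht.2).pow_const 4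
      _ ≤ liminf (fun _ : ℕ => ENNReal.ofReal (R ^ 4 * t)) atTop :=
          liminf_le_liminf (Eventually.of_forall fun n => (hu n).2.2 t ht)
      _ = _ := liminf_const _

theorem ae_supAv_ne_top {z : ℝ → L2C} {T : ℝ} (hz : ContinuousOn z (Ioc 0 T))
    (h : ∫⁻ s in Ioc 0 T, supAv (z s) ^ 4 ≠ ⊤) :
    ∀ᵐ s ∂volume.restrict (Ioc 0 T), supAv (z s) ≠ ⊤ := by
  filter_upwards [ae_lt_top' ((aemeasurable_supAv_of_continuousOn hz le_rfl).pow_const 4) h]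
    with s hs
  rintro h1
  simp [h1] at hs

/-- Hölder's inequality in time, in the form of Young's inequality. -/
theorem lintegral_supAv_sq_le {z : ℝ → L2C} {t R : ℝ} (hR : 0 < R) (ht : 0 ≤ t)
    (h : ∫⁻ s in Ioc 0 t, supAv (z s) ^ 4 ≤ ENNReal.ofReal (R ^ 4 * t)) :
    ∫⁻ s in Ioc 0 t, supAv (z s) ^ 2 ≤ ENNReal.ofReal (R ^ 2 * t) := by
  have hpt : ∀ x : ℝ≥0∞, x ^ 2 ≤ ENNReal.ofReal (R ^ 2 / 2) + ENNReal.ofReal (1 / (2 * R ^ 2)) * x ^ 4 := by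
    intro x
    rcases eq_or_ne x ⊤ with rfl | hx
    · have : ENNReal.ofReal (1 / (2 * R ^ 2)) ≠ 0 := by
        rw [Ne, ENNReal.ofReal_eq_zero, not_le]; positivity
      rw [ENNReal.top_pow (by norm_num), ENNReal.top_pow (by norm_num), ENNReal.mul_top this]
      simp
    · lift x to ℝ≥0 using hx
      rw [← ENNReal.ofReal_coe_nnreal, ← ENNReal.ofReal_pow (NNReal.coe_nonneg x),
        ← ENNReal.ofReal_pow (NNReal.coe_nonneg x),
        ← ENNReal.ofReal_mul (by positivity), ← ENNReal.ofReal_add (by positivity) (by positivity)]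
      refine ENNReal.ofReal_le_ofReal ?_
      have : R ^ 2 / 2 + 1 / (2 * R ^ 2) * (x : ℝ) ^ 4 - (x : ℝ) ^ 2
          = 1 / (2 * R ^ 2) * (R ^ 2 - (x : ℝ) ^ 2) ^ 2 := by field_simp; ring
      have h2 : 0 ≤ 1 / (2 * R ^ 2) * (R ^ 2 - (x : ℝ) ^ 2) ^ 2 := by positivity
      linarith
  calc ∫⁻ s in Ioc 0 t, supAv (z s) ^ 2
      ≤ ∫⁻ s in Ioc 0 t, (ENNReal.ofReal (R ^ 2 / 2)
          + ENNReal.ofReal (1 / (2 * R ^ 2)) * supAv (z s) ^ 4) := lintegral_mono fun s => hpt _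
    _ = ENNReal.ofReal (R ^ 2 / 2) * ENNReal.ofReal t
          + ENNReal.ofReal (1 / (2 * R ^ 2)) * ∫⁻ s in Ioc 0 t, supAv (z s) ^ 4 := by
        rw [lintegral_add_left measurable_const, lintegral_const_mul' _ _ ENNReal.ofReal_ne_top]
        simp
    _ ≤ ENNReal.ofReal (R ^ 2 / 2) * ENNReal.ofReal t
          + ENNReal.ofReal (1 / (2 * R ^ 2)) * ENNReal.ofReal (R ^ 4 * t) := by gcongr
    _ = ENNReal.ofReal (R ^ 2 * t) := by
        rw [← ENNReal.ofReal_mul (by positivity), ← ENNReal.ofReal_mul (by positivity),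
          ← ENNReal.ofReal_add (by positivity) (by positivity)]
        congr 1
        field_simp
        ring

theorem lintegral_rpow_le {t r C : ℝ} (ht : 0 < t) (hr : -1 < r) (hC : 0 ≤ C) :
    ∫⁻ s in Ioc 0 t, ENNReal.ofReal (C * s ^ r) = ENNReal.ofReal (C * (t ^ (r + 1) / (r + 1))) := by
  have hi : IntegrableOn (fun s : ℝ => C * s ^ r) (Ioc 0 t) := by
    have := (intervalIntegral.intervalIntegrable_rpow' (a := 0) (b := t) hr).const_mul C
    rwa [intervalIntegrable_iff_integrableOn_Ioc_of_le ht.le] at this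
  rw [← ofReal_integral_eq_lintegral_ofReal hi, ← intervalIntegral.integral_of_le ht.le,
    intervalIntegral.integral_const_mul, integral_rpow (Or.inl hr), Real.zero_rpow (by linarith),
    sub_zero]
  filter_upwards [ae_restrict_mem measurableSet_Ioc] with s hs
  have := hs.1.le
  simp only [Pi.zero_apply]
  positivity

/-- Integration of the coefficient `c/s + h(s)` against the weight `s^{1/4}`. Although `c/s` is not
integrable, its contribution is `4c` times the weight. -/
theorem lintegral_weight_le {c D t : ℝ} (hc : 0 ≤ c) (hD : 0 ≤ D) (ht : 0 < t) {h : ℝ → ℝ≥0∞}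
    {B : ℝ≥0∞} (hB : ∫⁻ s in Ioc 0 t, h s ≤ B) :
    ∫⁻ s in Ioc 0 t, (ENNReal.ofReal (c / s) + h s) * ENNReal.ofReal (D * s ^ (1 / 4 : ℝ))
      ≤ ENNReal.ofReal (D * t ^ (1 / 4 : ℝ)) * (ENNReal.ofReal (4 * c) + B) := by
  calc ∫⁻ s in Ioc 0 t, (ENNReal.ofReal (c / s) + h s) * ENNReal.ofReal (D * s ^ (1 / 4 : ℝ))
      ≤ ∫⁻ s in Ioc 0 t, (ENNReal.ofReal (c * D * s ^ (-(3 / 4) : ℝ))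
          + ENNReal.ofReal (D * t ^ (1 / 4 : ℝ)) * h s) := by
        refine setLIntegral_mono' measurableSet_Ioc fun s hs => ?_
        have hs0 : 0 < s := hs.1
        rw [add_mul]
        refine add_le_add (le_of_eq ?_) ?_
        · rw [← ENNReal.ofReal_mul (by positivity)]
          congr 1
          have : s ^ (1 / 4 : ℝ) = s * s ^ (-(3 / 4) : ℝ) := by
            nth_rewrite 2 [← Real.rpow_one s]
            rw [← Real.rpow_add hs0]; norm_num
          rw [this]; field_simp
        · rw [mul_comm]
          have := Real.rpow_le_rpow hs0.le hs.2 (by norm_num : (0 : ℝ) ≤ 1 / 4)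
          gcongr
    _ = ENNReal.ofReal (c * D * (t ^ (-(3 / 4) + 1 : ℝ) / (-(3 / 4) + 1)))
          + ENNReal.ofReal (D * t ^ (1 / 4 : ℝ)) * ∫⁻ s in Ioc 0 t, h s := by
        rw [lintegral_add_left (by fun_prop), lintegral_rpow_le ht (by norm_num) (by positivity),
          lintegral_const_mul' _ _ ENNReal.ofReal_ne_top]
    _ ≤ ENNReal.ofReal (c * D * (t ^ (-(3 / 4) + 1 : ℝ) / (-(3 / 4) + 1)))
          + ENNReal.ofReal (D * t ^ (1 / 4 : ℝ)) * B := by gcongr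
    _ = _ := by
        rw [mul_add, ← ENNReal.ofReal_mul (by positivity)]
        congr 2
        norm_num
        ring

/-- The Duhamel integral with source `F`. -/
def duhamel (σ : ℝ) (F : ℝ → L2C) (t : ℝ) : L2C :=
  schr t ((Complex.I * σ) • ∫ s in 0..t, schr (-s) (F s))

theorem norm_I_mul {σ : ℝ} (hσ : |σ| = 1) : ‖Complex.I * (σ : ℂ)‖ = 1 := by
  rw [norm_mul, Complex.norm_I, one_mul, Complex.norm_real, Real.norm_eq_abs, hσ]

theorem enorm_duhamel_le {σ : ℝ} (hσ : |σ| = 1) (F : ℝ → L2C) {t : ℝ} (ht : 0 ≤ t) :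
    ‖duhamel σ F t‖ₑ ≤ ∫⁻ s in Ioc 0 t, ‖F s‖ₑ := by
  unfold duhamel
  have e : ‖schr t ((Complex.I * σ) • ∫ s in 0..t, schr (-s) (F s))‖ₑ
      = ‖∫ s in 0..t, schr (-s) (F s)‖ₑ := by
    rw [← ofReal_norm, LinearIsometryEquiv.norm_map, norm_smul, norm_I_mul hσ, one_mul, ofReal_norm]
  rw [e, intervalIntegral.integral_of_le ht]
  refine (enorm_integral_le_lintegral_enorm _).trans (le_of_eq (lintegral_congr fun s => ?_))
  rw [← ofReal_norm, LinearIsometryEquiv.norm_map, ofReal_norm]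

theorem intervalIntegrable_schr_neg {F : ℝ → L2C} {T s t : ℝ} (hF : IntegrableOn F (Ioc 0 T) volume)
    (hs : s ∈ Icc 0 T) (ht : t ∈ Icc 0 T) :
    IntervalIntegrable (fun s => schr (-s) (F s)) volume s t := by
  have h : IntegrableOn (fun s => schr (-s) (F s)) (Ioc 0 T) volume := integrable_schr_neg hF
  rw [intervalIntegrable_iff]
  exact h.mono_set fun x hx => ⟨(le_min hs.1 ht.1).trans_lt hx.1, hx.2.trans (max_le hs.2 ht.2)⟩

theorem duhamel_sub {σ : ℝ} {F G : ℝ → L2C} {T t : ℝ} (hF : IntegrableOn F (Ioc 0 T) volume)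
    (hG : IntegrableOn G (Ioc 0 T) volume) (ht : t ∈ Icc 0 T) :
    duhamel σ F t - duhamel σ G t = duhamel σ (fun s => F s - G s) t := by
  have h0 : (0 : ℝ) ∈ Icc 0 T := ⟨le_rfl, ht.1.trans ht.2⟩
  unfold duhamel
  simp only [map_sub]
  rw [intervalIntegral.integral_sub (intervalIntegrable_schr_neg hF h0 ht)
    (intervalIntegrable_schr_neg hG h0 ht), smul_sub, map_sub]

theorem mildOn_duhamel (σ : ℝ) {F : ℝ → L2C} {T s : ℝ} (hF : IntegrableOn F (Ioc 0 T) volume)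
    (hs : 0 ≤ s) : MildOn σ s T F (duhamel σ F) := by
  intro t ht
  have h0 : (0 : ℝ) ∈ Icc 0 T := ⟨le_rfl, hs.trans (ht.1.trans ht.2)⟩
  have hs' : s ∈ Icc 0 T := ⟨hs, ht.1.trans ht.2⟩
  have ht' : t ∈ Icc 0 T := ⟨hs.trans ht.1, ht.2⟩
  unfold duhamel
  rw [schr_neg_schr, schr_neg_schr, ← smul_add, intervalIntegral.integral_add_adjacent_intervals
    (intervalIntegrable_schr_neg hF h0 hs') (intervalIntegrable_schr_neg hF hs' ht')]

theorem lintegral_supAv_duhamel_le {σ : ℝ} (hσ : |σ| = 1) {F : ℝ → L2C} {T t : ℝ}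
    (hF : IntegrableOn F (Ioc 0 T) volume) (ht : t ∈ Ioc 0 T) :
    ∫⁻ s in Ioc 0 t, supAv (duhamel σ F s) ^ 4 ≤ (4 * ∫⁻ s in Ioc 0 t, ‖F s‖ₑ) ^ 4 := by
  have h := strichartz ((integrable_indicator_iff measurableSet_Ioc).2 hF) ht.1.le
  have e1 : ∫⁻ s in Ioc 0 t, ‖(Ioc 0 T).indicator F s‖ₑ = ∫⁻ s in Ioc 0 t, ‖F s‖ₑ :=
    setLIntegral_congr_fun measurableSet_Ioc fun s hs => by
      rw [indicator_of_mem (show s ∈ Ioc 0 T from ⟨hs.1, hs.2.trans ht.2⟩)]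
  rw [e1] at h
  refine le_trans (le_of_eq (setLIntegral_congr_fun measurableSet_Ioc fun r hr => ?_)) h
  have e2 : ∫ s in 0..r, schr (-s) ((Ioc 0 T).indicator F s) = ∫ s in 0..r, schr (-s) (F s) := by
    rw [intervalIntegral.integral_of_le hr.1.le, intervalIntegral.integral_of_le hr.1.le]
    refine setIntegral_congr_fun measurableSet_Ioc fun s hs => ?_
    rw [indicator_of_mem (show s ∈ Ioc 0 T from ⟨hs.1, hs.2.trans (hr.2.trans ht.2)⟩)]
  unfold duhamel
  rw [e2, map_smul, supAv_smul_of_norm_one (norm_I_mul hσ)]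

/-- Difference of the nonlinearity at two perturbations of a bounded function. -/
theorem enorm_nlin_sub_le {a s M : ℝ} (hs : 0 < s) (hM : 0 ≤ M) {W z z' : L2C}
    (hW : supAv W ≤ ENNReal.ofReal M) (hz : supAv z ≠ ⊤) (hz' : supAv z' ≠ ⊤) :
    ‖nlin a s (W + z) - nlin a s (W + z')‖ₑ
      ≤ (ENNReal.ofReal (7 * a ^ 2 / s)
        + (ENNReal.ofReal (12 * M ^ 2) + 6 * supAv z ^ 2 + 6 * supAv z' ^ 2)) * ‖z - z'‖ₑ := by
  have key : ∀ y : L2C, supAv y ≠ ⊤ →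
      supAv (W + y) ≠ ⊤ ∧ (supAv (W + y)).toReal ≤ M + (supAv y).toReal := fun y hy => by
    have h1 : supAv (W + y) ≤ ENNReal.ofReal (M + (supAv y).toReal) := by
      rw [ENNReal.ofReal_add hM ENNReal.toReal_nonneg, ENNReal.ofReal_toReal hy]
      exact (supAv_add_le W y).trans (add_le_add_left hW _)
    refine ⟨ne_top_of_le_ne_top ENNReal.ofReal_ne_top h1, ?_⟩
    exact ENNReal.toReal_le_of_le_ofReal (add_nonneg hM ENNReal.toReal_nonneg) h1
  obtain ⟨k1, k2⟩ := key z hz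
  obtain ⟨k1', k2'⟩ := key z' hz'
  have h := norm_nlin_sub_le (a := a) hs k1 k1'
  rw [add_sub_add_left_eq_sub] at h
  have e : ENNReal.ofReal (7 * a ^ 2 / s)
        + (ENNReal.ofReal (12 * M ^ 2) + 6 * supAv z ^ 2 + 6 * supAv z' ^ 2)
      = ENNReal.ofReal (7 * a ^ 2 / s
        + (12 * M ^ 2 + 6 * (supAv z).toReal ^ 2 + 6 * (supAv z').toReal ^ 2)) := by
    rw [ENNReal.ofReal_add (by positivity) (by positivity),
      ENNReal.ofReal_add (by positivity) (by positivity),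
      ENNReal.ofReal_add (by positivity) (by positivity),
      ENNReal.ofReal_mul (p := 6) (q := (supAv z).toReal ^ 2) (by norm_num),
      ENNReal.ofReal_mul (p := 6) (q := (supAv z').toReal ^ 2) (by norm_num), ENNReal.ofReal_pow ENNReal.toReal_nonneg,
      ENNReal.ofReal_pow ENNReal.toReal_nonneg, ENNReal.ofReal_toReal hz, ENNReal.ofReal_toReal hz']
    simp
  rw [e, ← ofReal_norm, ← ofReal_norm, ← ENNReal.ofReal_mul (by positivity)]
  refine ENNReal.ofReal_le_ofReal (h.trans (mul_le_mul_of_nonneg_right ?_ (norm_nonneg _)))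
  have p0 : 0 ≤ (supAv (W + z)).toReal := ENNReal.toReal_nonneg
  have p0' : 0 ≤ (supAv (W + z')).toReal := ENNReal.toReal_nonneg
  have q1 : (supAv (W + z)).toReal ^ 2 ≤ (M + (supAv z).toReal) ^ 2 := by gcongr
  have q2 : (supAv (W + z')).toReal ^ 2 ≤ (M + (supAv z').toReal) ^ 2 := by gcongr
  have e2 : 7 * (a ^ 2 / s) = 7 * a ^ 2 / s := by ring
  rw [e2]
  nlinarith [sq_nonneg (M - (supAv z).toReal), sq_nonneg (M - (supAv z').toReal)]

/-- The contraction estimate for the nonlinearity. The factor is small if `a` and `t` are. -/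
theorem lintegral_nlin_sub_le {a M R D t : ℝ} (hM : 0 ≤ M) (hR : 0 < R) (hD : 0 ≤ D) (ht : 0 < t)
    {W z z' : ℝ → L2C} (hW : ∀ s, supAv (W s) ≤ ENNReal.ofReal M)
    (hz : ContinuousOn z (Ioc 0 t)) (hz' : ContinuousOn z' (Ioc 0 t))
    (hzR : ∫⁻ s in Ioc 0 t, supAv (z s) ^ 4 ≤ ENNReal.ofReal (R ^ 4 * t))
    (hzR' : ∫⁻ s in Ioc 0 t, supAv (z' s) ^ 4 ≤ ENNReal.ofReal (R ^ 4 * t))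
    (hzz : ∀ s ∈ Ioc 0 t, ‖z s - z' s‖ ≤ D * s ^ (1 / 4 : ℝ)) :
    ∫⁻ s in Ioc 0 t, ‖nlin a s (W s + z s) - nlin a s (W s + z' s)‖ₑ
      ≤ ENNReal.ofReal (D * t ^ (1 / 4 : ℝ) * (28 * a ^ 2 + 12 * M ^ 2 * t + 12 * R ^ 2 * t)) := by
  have hB : ∫⁻ s in Ioc 0 t, (ENNReal.ofReal (12 * M ^ 2) + 6 * supAv (z s) ^ 2
      + 6 * supAv (z' s) ^ 2) ≤ ENNReal.ofReal (12 * M ^ 2 * t + 12 * R ^ 2 * t) := by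
    have m1 := aemeasurable_supAv_of_continuousOn hz le_rfl
    rw [lintegral_add_left' (f := fun s => ENNReal.ofReal (12 * M ^ 2) + 6 * supAv (z s) ^ 2)
      (aemeasurable_const.add ((m1.pow_const 2).const_mul 6)),
      lintegral_add_left measurable_const, lintegral_const_mul' _ _ (by norm_num),
      lintegral_const_mul' _ _ (by norm_num)]
    calc _ ≤ ENNReal.ofReal (12 * M ^ 2) * ENNReal.ofReal t + 6 * ENNReal.ofReal (R ^ 2 * t)
          + 6 * ENNReal.ofReal (R ^ 2 * t) := by
          refine add_le_add (add_le_add (le_of_eq ?_) ?_) ?_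
          · simp
          · gcongr; exact lintegral_supAv_sq_le hR ht.le hzR
          · gcongr; exact lintegral_supAv_sq_le hR ht.le hzR'
      _ = ENNReal.ofReal (12 * M ^ 2 * t + 12 * R ^ 2 * t) := by
          rw [show 12 * M ^ 2 * t + 12 * R ^ 2 * t = 12 * M ^ 2 * t + 6 * (R ^ 2 * t) + 6 * (R ^ 2 * t)
            by ring, ENNReal.ofReal_add (by positivity) (by positivity),
            ENNReal.ofReal_add (by positivity) (by positivity),
            ENNReal.ofReal_mul (p := 12 * M ^ 2) (q := t) (by positivity),
            ENNReal.ofReal_mul (p := 6) (q := R ^ 2 * t) (by norm_num)]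
          simp
  have hfz := ae_supAv_ne_top hz (ne_top_of_le_ne_top ENNReal.ofReal_ne_top hzR)
  have hfz' := ae_supAv_ne_top hz' (ne_top_of_le_ne_top ENNReal.ofReal_ne_top hzR')
  refine (lintegral_mono_ae (g := fun s => (ENNReal.ofReal (7 * a ^ 2 / s)
    + (ENNReal.ofReal (12 * M ^ 2) + 6 * supAv (z s) ^ 2 + 6 * supAv (z' s) ^ 2))
      * ENNReal.ofReal (D * s ^ (1 / 4 : ℝ))) ?_).trans
    ((lintegral_weight_le (by positivity) hD ht hB).trans ?_)
  · filter_upwards [hfz, hfz', ae_restrict_mem measurableSet_Ioc] with s h1 h2 hs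
    refine (enorm_nlin_sub_le hs.1 hM (hW s) h1 h2).trans ?_
    gcongr
    rw [← ofReal_norm]
    exact ENNReal.ofReal_le_ofReal (hzz s hs)
  · rw [← ENNReal.ofReal_add (by positivity) (by positivity), ← ENNReal.ofReal_mul (by positivity)]
    exact ENNReal.ofReal_le_ofReal (le_of_eq (by ring))

/-- The source term in the equation for the correction `z` to the linear profile: the nonlinearity
minus its linear part at `u_a`, evaluated at the free solution. -/
def source (a : ℝ) (W : ℝ → L2C) (s : ℝ) (z : L2C) : L2C :=
  nlin a s (W s + z) - ((a ^ 2 / s : ℝ) : ℂ) • W s - conjTerm a s (W s)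

/-- At `z = 0` the source is at least quadratic in `W`, hence integrable in time. -/
theorem lintegral_source_zero_le {a M m t : ℝ} (ha : 0 ≤ a) (hM : 0 ≤ M) (ht : 0 < t)
    {W : ℝ → L2C} (hW : ∀ s, supAv (W s) ≤ ENNReal.ofReal M) (hWm : ∀ s, ‖W s‖ = m) :
    ∫⁻ s in Ioc 0 t, ‖source a W s 0‖ₑ
      ≤ ENNReal.ofReal (6 * a * M * m * t ^ (1 / 2 : ℝ) + M ^ 2 * m * t) := by
  have hm : 0 ≤ m := by rw [← hWm 0]; exact norm_nonneg _
  calc ∫⁻ s in Ioc 0 t, ‖source a W s 0‖ₑ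
      ≤ ∫⁻ s in Ioc 0 t, (ENNReal.ofReal (3 * a * M * m * s ^ (-(1 / 2) : ℝ))
          + ENNReal.ofReal (M ^ 2 * m)) := by
        refine setLIntegral_mono' measurableSet_Ioc fun s hs => ?_
        have hs0 : 0 < s := hs.1
        have hf := ne_top_of_le_ne_top ENNReal.ofReal_ne_top (hW s)
        have h1 := norm_nlin_sub_linear_le ha hs0 hf
        have h2 : (supAv (W s)).toReal ≤ M := ENNReal.toReal_le_of_le_ofReal hM (hW s)
        have h3 : 0 ≤ (supAv (W s)).toReal := ENNReal.toReal_nonneg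
        rw [← ENNReal.ofReal_add (by positivity) (by positivity), ← ofReal_norm]
        refine ENNReal.ofReal_le_ofReal ?_
        unfold source
        rw [add_zero]
        refine h1.trans ?_
        rw [hWm]
        have e : a / Real.sqrt s = a * s ^ (-(1 / 2) : ℝ) := by
          rw [Real.rpow_neg hs0.le, ← Real.sqrt_eq_rpow, div_eq_mul_inv]
        rw [e]
        calc _ ≤ (3 * (a * s ^ (-(1 / 2) : ℝ)) * M + M ^ 2) * m := by gcongr
          _ = _ := by ring
    _ = ENNReal.ofReal (3 * a * M * m * (t ^ (-(1 / 2) + 1 : ℝ) / (-(1 / 2) + 1)))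
          + ENNReal.ofReal (M ^ 2 * m) * ENNReal.ofReal t := by
        rw [lintegral_add_left (by fun_prop), lintegral_rpow_le ht (by norm_num) (by positivity)]
        simp
    _ = _ := by
        rw [← ENNReal.ofReal_mul (by positivity), ← ENNReal.ofReal_add (by positivity) (by positivity)]
        congr 2
        norm_num
        ring

theorem supAv_add_ne_top {f g : L2C} (hf : supAv f ≠ ⊤) (hg : supAv g ≠ ⊤) :
    supAv (f + g) ≠ ⊤ :=
  ne_top_of_le_ne_top (ENNReal.add_ne_top.2 ⟨hf, hg⟩) (supAv_add_le f g)

theorem aestronglyMeasurable_nlin_add {a M t : ℝ} {W z : ℝ → L2C}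
    (hW : ∀ s, supAv (W s) ≤ ENNReal.ofReal M) (hWc : ContinuousOn W (Ioi 0))
    (hz : ContinuousOn z (Ioc 0 t)) (hzf : ∀ᵐ s ∂volume.restrict (Ioc 0 t), supAv (z s) ≠ ⊤) :
    AEStronglyMeasurable (fun s => nlin a s (W s + z s)) (volume.restrict (Ioc 0 t)) := by
  refine aestronglyMeasurable_nlin ((hWc.mono fun s hs => hs.1).add hz) ?_
  filter_upwards [hzf] with s hs
  exact supAv_add_ne_top (ne_top_of_le_ne_top ENNReal.ofReal_ne_top (hW s)) hs

theorem ae_supAv_ne_top_of_mem {z : ℝ → L2C} {t R : ℝ} (ht : 0 < t) (hz : z ∈ decaySet t R) :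
    ∀ᵐ s ∂volume.restrict (Ioc 0 t), supAv (z s) ≠ ⊤ :=
  ae_supAv_ne_top hz.1 (ne_top_of_le_ne_top ENNReal.ofReal_ne_top (hz.2.2 t ⟨ht, le_rfl⟩))

theorem lintegral_source_le {a M m R t : ℝ} (ha : 0 ≤ a) (hM : 0 ≤ M) (hR : 0 < R) (ht : 0 < t)
    {W z : ℝ → L2C} (hW : ∀ s, supAv (W s) ≤ ENNReal.ofReal M) (hWm : ∀ s, ‖W s‖ = m)
    (hWc : ContinuousOn W (Ioi 0)) (hz : z ∈ decaySet t R) :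
    ∫⁻ s in Ioc 0 t, ‖source a W s (z s)‖ₑ
      ≤ ENNReal.ofReal (R * t ^ (1 / 4 : ℝ) * (28 * a ^ 2 + 12 * M ^ 2 * t + 12 * R ^ 2 * t)
        + (6 * a * M * m * t ^ (1 / 2 : ℝ) + M ^ 2 * m * t)) := by
  have hm : 0 ≤ m := by rw [← hWm 0]; exact norm_nonneg _
  have htt : t ∈ Ioc 0 t := ⟨ht, le_rfl⟩
  have h0 := zero_mem_decaySet t hR.le
  have m1 := aestronglyMeasurable_nlin_add (a := a) hW hWc hz.1 (ae_supAv_ne_top_of_mem ht hz)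
  have m2 := aestronglyMeasurable_nlin_add (a := a) hW hWc h0.1 (ae_supAv_ne_top_of_mem ht h0)
  have e : ∀ s, source a W s (z s)
      = (nlin a s (W s + z s) - nlin a s (W s + (0 : ℝ → L2C) s)) + source a W s 0 := fun s => by
    unfold source
    rw [Pi.zero_apply]
    abel
  calc ∫⁻ s in Ioc 0 t, ‖source a W s (z s)‖ₑ
      ≤ ∫⁻ s in Ioc 0 t, (‖nlin a s (W s + z s) - nlin a s (W s + (0 : ℝ → L2C) s)‖ₑ
          + ‖source a W s 0‖ₑ) := lintegral_mono fun s => by rw [e]; exact enorm_add_le _ _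
    _ = (∫⁻ s in Ioc 0 t, ‖nlin a s (W s + z s) - nlin a s (W s + (0 : ℝ → L2C) s)‖ₑ)
          + ∫⁻ s in Ioc 0 t, ‖source a W s 0‖ₑ := lintegral_add_left' (m1.sub m2).enorm _
    _ ≤ _ := by
        have ht0 := ht.le
        rw [ENNReal.ofReal_add (by positivity) (by positivity)]
        refine add_le_add (lintegral_nlin_sub_le hM hR hR.le ht hW hz.1 h0.1 (hz.2.2 t htt)
          (h0.2.2 t htt) fun s hs => ?_) (lintegral_source_zero_le ha hM ht hW hWm)
        rw [Pi.zero_apply, sub_zero]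
        exact hz.2.1 s hs

theorem decaySet_mono {T t R : ℝ} (ht : t ≤ T) {z : ℝ → L2C} (hz : z ∈ decaySet T R) :
    z ∈ decaySet t R :=
  ⟨hz.1.mono (Ioc_subset_Ioc_right ht), fun s hs => hz.2.1 s ⟨hs.1, hs.2.trans ht⟩,
    fun s hs => hz.2.2 s ⟨hs.1, hs.2.trans ht⟩⟩

theorem aestronglyMeasurable_source {a M t R : ℝ} (ht : 0 < t) {W z : ℝ → L2C}
    (hW : ∀ s, supAv (W s) ≤ ENNReal.ofReal M) (hWc : ContinuousOn W (Ioi 0))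
    (hcc : ContinuousOn (fun s => conjTerm a s (W s)) (Ioi 0)) (hz : z ∈ decaySet t R) :
    AEStronglyMeasurable (fun s => source a W s (z s)) (volume.restrict (Ioc 0 t)) := by
  have h1 := aestronglyMeasurable_nlin_add (a := a) hW hWc hz.1 (ae_supAv_ne_top_of_mem ht hz)
  have h2 : ContinuousOn (fun s => ((a ^ 2 / s : ℝ) : ℂ) • W s) (Ioi 0) :=
    (continuousOn_ofReal_div (a ^ 2)).smul hWc
  have hs : Ioc 0 t ⊆ Ioi 0 := fun s hs => hs.1
  exact (h1.sub ((h2.mono hs).aestronglyMeasurable measurableSet_Ioc)).sub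
    ((hcc.mono hs).aestronglyMeasurable measurableSet_Ioc)

theorem integrableOn_source {a M m R t : ℝ} (ha : 0 ≤ a) (hM : 0 ≤ M) (hR : 0 < R) (ht : 0 < t)
    {W z : ℝ → L2C} (hW : ∀ s, supAv (W s) ≤ ENNReal.ofReal M) (hWm : ∀ s, ‖W s‖ = m)
    (hWc : ContinuousOn W (Ioi 0)) (hcc : ContinuousOn (fun s => conjTerm a s (W s)) (Ioi 0))
    (hz : z ∈ decaySet t R) : IntegrableOn (fun s => source a W s (z s)) (Ioc 0 t) volume :=
  ⟨aestronglyMeasurable_source ht hW hWc hcc hz,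
    (lintegral_source_le ha hM hR ht hW hWm hWc hz).trans_lt ENNReal.ofReal_lt_top⟩

theorem add_pow_four_le (x y : ℝ≥0∞) : (x + y) ^ 4 ≤ 8 * (x ^ 4 + y ^ 4) := by
  have h := ENNReal.rpow_add_le_mul_rpow_add_rpow x y (p := 4) (by norm_num)
  have e : ∀ z : ℝ≥0∞, z ^ (4 : ℝ) = z ^ 4 := fun z => by
    rw [show (4 : ℝ) = ((4 : ℕ) : ℝ) by norm_num, ENNReal.rpow_natCast]
  rw [e, e, e] at h
  refine h.trans (le_of_eq ?_)
  congr 1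
  rw [show (4 - 1 : ℝ) = ((3 : ℕ) : ℝ) by norm_num, ENNReal.rpow_natCast]
  norm_num

/-- Existence of the correction to the linear profile, by a fixed point argument. The iteration is a
contraction only in the weighted `L²` norm; the bound in `L⁴L^∞`, from the Strichartz estimate, is
an invariant of the iteration. -/
theorem exists_correction {σ a M m R T : ℝ} (hσ : |σ| = 1) (ha : 0 ≤ a) (hM : 0 ≤ M) (hR : 0 < R)
    (hT : 0 < T) {W Z : ℝ → L2C} (hW : ∀ s, supAv (W s) ≤ ENNReal.ofReal M) (hWm : ∀ s, ‖W s‖ = m)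
    (hWc : ContinuousOn W (Ioi 0)) (hcc : ContinuousOn (fun s => conjTerm a s (W s)) (Ioi 0))
    (hZ1 : ∀ t, 0 < t → ‖Z t‖ ≤ R / 2 * t ^ (1 / 4 : ℝ))
    (hZ2 : ∀ t, 0 < t → supAv (Z t) ≤ ENNReal.ofReal (R / 2)) (hZc : ContinuousOn Z (Ioc 0 T))
    (hs1 : 28 * a ^ 2 + 12 * M ^ 2 * T + 12 * R ^ 2 * T ≤ 1 / 16)
    (hs2 : 6 * a * M * m * T ^ (1 / 4 : ℝ) + M ^ 2 * m * T ^ (3 / 4 : ℝ) ≤ R / 16) :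
    ∃ z ∈ decaySet T R, ∀ t ∈ Ioc 0 T, duhamel σ (fun s => source a W s (z s)) t + Z t = z t := by
  have hm : 0 ≤ m := by rw [← hWm 0]; exact norm_nonneg _
  have hint : ∀ z ∈ decaySet T R, IntegrableOn (fun s => source a W s (z s)) (Ioc 0 T) volume :=
    fun z hz => integrableOn_source ha hM hR hT hW hWm hWc hcc hz
  -- the Strichartz estimate loses a factor `4`, and `4 · R/8` is half of the radius; the other half is
  -- left for `Z`
  have hsrc : ∀ z ∈ decaySet T R, ∀ t ∈ Ioc 0 T,
      ∫⁻ s in Ioc 0 t, ‖source a W s (z s)‖ₑ ≤ ENNReal.ofReal (R / 8 * t ^ (1 / 4 : ℝ)) := by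
    intro z hz t ht
    have ht0 : 0 < t := ht.1
    refine (lintegral_source_le ha hM hR ht0 hW hWm hWc (decaySet_mono ht.2 hz)).trans
      (ENNReal.ofReal_le_ofReal ?_)
    have e1 : t ^ (1 / 2 : ℝ) = t ^ (1 / 4 : ℝ) * t ^ (1 / 4 : ℝ) := by
      rw [← Real.rpow_add ht0]; norm_num
    have e2 : t = t ^ (3 / 4 : ℝ) * t ^ (1 / 4 : ℝ) := by
      rw [← Real.rpow_add ht0]; norm_num
    have b1 : t ^ (1 / 4 : ℝ) ≤ T ^ (1 / 4 : ℝ) := Real.rpow_le_rpow ht0.le ht.2 (by norm_num)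
    have b2 : t ^ (3 / 4 : ℝ) ≤ T ^ (3 / 4 : ℝ) := Real.rpow_le_rpow ht0.le ht.2 (by norm_num)
    have b3 : 28 * a ^ 2 + 12 * M ^ 2 * t + 12 * R ^ 2 * t ≤ 1 / 16 := by
      refine le_trans ?_ hs1
      have := ht.2
      gcongr
    have b4 : 6 * a * M * m * t ^ (1 / 4 : ℝ) + M ^ 2 * m * t ^ (3 / 4 : ℝ) ≤ R / 16 := by
      refine le_trans ?_ hs2
      gcongr
    have hq : 0 ≤ t ^ (1 / 4 : ℝ) := by positivity
    calc R * t ^ (1 / 4 : ℝ) * (28 * a ^ 2 + 12 * M ^ 2 * t + 12 * R ^ 2 * t)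
          + (6 * a * M * m * t ^ (1 / 2 : ℝ) + M ^ 2 * m * t)
        = R * t ^ (1 / 4 : ℝ) * (28 * a ^ 2 + 12 * M ^ 2 * t + 12 * R ^ 2 * t)
          + (6 * a * M * m * t ^ (1 / 4 : ℝ) + M ^ 2 * m * t ^ (3 / 4 : ℝ)) * t ^ (1 / 4 : ℝ) := by
          rw [e1]; nth_rewrite 6 [e2]; ring
      _ ≤ R * t ^ (1 / 4 : ℝ) * (1 / 16) + R / 16 * t ^ (1 / 4 : ℝ) := by gcongr
      _ = R / 8 * t ^ (1 / 4 : ℝ) := by ring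
  refine exists_fixedPoint_of_contraction (I := Ioc 0 T) (w := fun t => t ^ (1 / 4 : ℝ))
    (S := decaySet T R) (Φ := fun z t => duhamel σ (fun s => source a W s (z s)) t + Z t)
    (zero_mem_decaySet T hR.le) ?_ hR.le (fun z hz => hz.2.1) ?_ (fun u z hu h => decaySet_closed hu h)
  · intro z hz
    have hdc : ContinuousOn (duhamel σ fun s => source a W s (z s)) (Ioc 0 T) :=
      ((mildOn_duhamel σ (hint z hz) le_rfl).continuousOn (hint z hz)).mono Ioc_subset_Icc_self
    refine ⟨hdc.add hZc, fun t ht => ?_, fun t ht => ?_⟩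
    · have h1 := (enorm_duhamel_le hσ (fun s => source a W s (z s)) ht.1.le).trans (hsrc z hz t ht)
      rw [← ofReal_norm, ENNReal.ofReal_le_ofReal_iff (by have := ht.1.le; positivity)] at h1
      have h2 := hZ1 t ht.1
      have h3 : 0 ≤ R * t ^ (1 / 4 : ℝ) := by have := ht.1.le; positivity
      refine (norm_add_le _ _).trans ?_
      linarith
    · have h1 := (lintegral_supAv_duhamel_le hσ (hint z hz) ht).trans
        (pow_le_pow_left₀ (zero_le) (mul_le_mul_right (hsrc z hz t ht) 4) 4)
      have ht0 : 0 < t := ht.1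
      have hm1 : AEMeasurable (fun s => supAv (duhamel σ (fun s => source a W s (z s)) s))
        (volume.restrict (Ioc 0 t)) := aemeasurable_supAv_of_continuousOn hdc ht.2
      have e4 : (t ^ (1 / 4 : ℝ)) ^ 4 = t := by
        rw [← Real.rpow_natCast, ← Real.rpow_mul ht0.le]; norm_num
      calc ∫⁻ s in Ioc 0 t, supAv (duhamel σ (fun s => source a W s (z s)) s + Z s) ^ 4
          ≤ ∫⁻ s in Ioc 0 t, 8 * (supAv (duhamel σ (fun s => source a W s (z s)) s) ^ 4
              + ENNReal.ofReal (R / 2) ^ 4) := by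
            refine setLIntegral_mono' measurableSet_Ioc fun s hs => ?_
            refine (pow_le_pow_left₀ (zero_le) (supAv_add_le _ _) 4).trans
              ((add_pow_four_le _ _).trans ?_)
            gcongr
            exact hZ2 s hs.1
        _ = 8 * ((∫⁻ s in Ioc 0 t, supAv (duhamel σ (fun s => source a W s (z s)) s) ^ 4)
              + ENNReal.ofReal (R / 2) ^ 4 * ENNReal.ofReal t) := by
            rw [lintegral_const_mul' _ _ (by norm_num), lintegral_add_left' (hm1.pow_const 4)]
            simp
        _ ≤ 8 * ((4 * ENNReal.ofReal (R / 8 * t ^ (1 / 4 : ℝ))) ^ 4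
              + ENNReal.ofReal (R / 2) ^ 4 * ENNReal.ofReal t) := by gcongr
        _ = ENNReal.ofReal (8 * ((4 * (R / 8 * t ^ (1 / 4 : ℝ))) ^ 4 + (R / 2) ^ 4 * t)) := by
            rw [ENNReal.ofReal_mul (p := 8) (by norm_num),
              ENNReal.ofReal_add (by positivity) (by positivity),
              ENNReal.ofReal_pow (p := 4 * (R / 8 * t ^ (1 / 4 : ℝ))) (by positivity),
              ENNReal.ofReal_mul (p := 4) (by norm_num),
              ENNReal.ofReal_mul (p := (R / 2) ^ 4) (q := t) (by positivity),
              ENNReal.ofReal_pow (by positivity)]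
            simp
        _ = ENNReal.ofReal (R ^ 4 * t) := by
            congr 1
            rw [mul_pow 4, mul_pow (R / 8), e4]
            ring
  · intro z hz z' hz' D hD hzz t ht
    have ht0 : 0 < t := ht.1
    have hz1 := decaySet_mono ht.2 hz
    have hz1' := decaySet_mono ht.2 hz'
    have htt : t ∈ Ioc 0 t := ⟨ht0, le_rfl⟩
    have h1 := lintegral_nlin_sub_le (a := a) hM hR hD ht0 hW hz1.1 hz1'.1 (hz1.2.2 t htt)
      (hz1'.2.2 t htt) fun s hs => hzz s ⟨hs.1, hs.2.trans ht.2⟩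
    have e : ∀ s, nlin a s (W s + z s) - nlin a s (W s + z' s)
        = source a W s (z s) - source a W s (z' s) := fun s => by unfold source; abel
    simp only [e] at h1
    have h2 := (enorm_duhamel_le hσ (fun s => source a W s (z s) - source a W s (z' s))
      ht0.le).trans h1
    rw [← duhamel_sub (hint z hz) (hint z' hz') ⟨ht0.le, ht.2⟩, ← ofReal_norm,
      ENNReal.ofReal_le_ofReal_iff (by positivity)] at h2
    rw [add_sub_add_right_eq_sub]
    refine h2.trans ?_
    have b3 : 28 * a ^ 2 + 12 * M ^ 2 * t + 12 * R ^ 2 * t ≤ 1 / 2 := by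
      refine le_trans ?_ (hs1.trans (by norm_num))
      have := ht.2
      gcongr
    calc D * t ^ (1 / 4 : ℝ) * (28 * a ^ 2 + 12 * M ^ 2 * t + 12 * R ^ 2 * t)
        ≤ D * t ^ (1 / 4 : ℝ) * (1 / 2) := by gcongr
      _ = _ := by ring

/-! ### The class of uniqueness -/

/-- Functions in `C((0,T], L²) ∩ L⁴((0,T], L^∞)` that are `O(t^{1/4})` as `t → 0⁺`, in `L²` and in
`L⁴((0,t), L^∞)`. -/
structure Decaying (T : ℝ) (g : ℝ → L2C) : Prop where
  cont : ContinuousOn g (Ioc 0 T)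
  fin : ∫⁻ s in Ioc 0 T, supAv (g s) ^ 4 < ⊤
  decay : ∃ C : ℝ, 0 < C ∧ ∃ t₀ : ℝ, 0 < t₀ ∧ t₀ ≤ T ∧ ∀ t ∈ Ioc 0 t₀,
    ‖g t‖ ≤ C * t ^ (1 / 4 : ℝ) ∧ ∫⁻ s in Ioc 0 t, supAv (g s) ^ 4 ≤ ENNReal.ofReal (C ^ 4 * t)

theorem Decaying.of_mem_decaySet {T R : ℝ} (hT : 0 < T) (hR : 0 < R) {z : ℝ → L2C}
    (hz : z ∈ decaySet T R) : Decaying T z :=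
  ⟨hz.1, (hz.2.2 T ⟨hT, le_rfl⟩).trans_lt ENNReal.ofReal_lt_top,
    R, hR, T, hT, le_rfl, fun t ht => ⟨hz.2.1 t ht, hz.2.2 t ht⟩⟩

theorem lintegral_supAv_add_le {T t : ℝ} {f g : ℝ → L2C} (hf : ContinuousOn f (Ioc 0 T))
    (ht : t ≤ T) : ∫⁻ s in Ioc 0 t, supAv (f s + g s) ^ 4
      ≤ 8 * ((∫⁻ s in Ioc 0 t, supAv (f s) ^ 4) + ∫⁻ s in Ioc 0 t, supAv (g s) ^ 4) := by
  rw [← lintegral_add_left' ((aemeasurable_supAv_of_continuousOn hf ht).pow_const 4),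
    ← lintegral_const_mul' _ _ (by norm_num)]
  exact lintegral_mono fun s => (pow_le_pow_left₀ (zero_le) (supAv_add_le _ _) 4).trans
    (add_pow_four_le _ _)

theorem Decaying.add {T : ℝ} {f g : ℝ → L2C} (hf : Decaying T f) (hg : Decaying T g) :
    Decaying T fun t => f t + g t := by
  refine ⟨hf.cont.add hg.cont, ?_, ?_⟩
  · refine (lintegral_supAv_add_le hf.cont le_rfl).trans_lt ?_
    exact ENNReal.mul_lt_top (by norm_num) (ENNReal.add_lt_top.2 ⟨hf.fin, hg.fin⟩)
  · obtain ⟨C, hC, t₀, ht₀, ht₀T, h⟩ := hf.decay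
    obtain ⟨C', hC', t₀', ht₀', ht₀T', h'⟩ := hg.decay
    refine ⟨2 * (C + C'), by positivity, min t₀ t₀', lt_min ht₀ ht₀', (min_le_left _ _).trans ht₀T,
      fun t ht => ?_⟩
    obtain ⟨a1, a2⟩ := h t ⟨ht.1, ht.2.trans (min_le_left _ _)⟩
    obtain ⟨b1, b2⟩ := h' t ⟨ht.1, ht.2.trans (min_le_right _ _)⟩
    have ht0 := ht.1.le
    have hq : 0 ≤ t ^ (1 / 4 : ℝ) := by positivity
    constructor
    · refine (norm_add_le _ _).trans ((add_le_add a1 b1).trans ?_)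
      rw [← add_mul]
      refine mul_le_mul_of_nonneg_right ?_ hq
      linarith
    · refine (lintegral_supAv_add_le hf.cont (ht.2.trans ((min_le_left _ _).trans ht₀T))).trans ?_
      calc _ ≤ 8 * (ENNReal.ofReal (C ^ 4 * t) + ENNReal.ofReal (C' ^ 4 * t)) := by gcongr
        _ = ENNReal.ofReal (8 * (C ^ 4 * t + C' ^ 4 * t)) := by
          rw [ENNReal.ofReal_mul (p := 8) (by norm_num),
            ENNReal.ofReal_add (by positivity) (by positivity)]
          simp
        _ ≤ _ := by
          refine ENNReal.ofReal_le_ofReal ?_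
          have h1 : C ^ 4 + C' ^ 4 ≤ (C + C') ^ 4 := by
            have : (C + C') ^ 4 = C ^ 4 + C' ^ 4
              + (4 * C ^ 3 * C' + 6 * C ^ 2 * C' ^ 2 + 4 * C * C' ^ 3) := by ring
            rw [this]
            have : 0 ≤ 4 * C ^ 3 * C' + 6 * C ^ 2 * C' ^ 2 + 4 * C * C' ^ 3 := by positivity
            linarith
          calc 8 * (C ^ 4 * t + C' ^ 4 * t) = 8 * (C ^ 4 + C' ^ 4) * t := by ring
            _ ≤ 16 * (C + C') ^ 4 * t := by
              have : 0 ≤ (C + C') ^ 4 := by positivity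
              gcongr
              norm_num
            _ = _ := by ring

theorem supAv_neg (f : L2C) : supAv (-f) = supAv f := by
  have := supAv_smul_of_norm_one (c := -1) (by simp) f
  rwa [neg_one_smul] at this

theorem Decaying.neg {T : ℝ} {f : ℝ → L2C} (hf : Decaying T f) : Decaying T fun t => -f t := by
  refine ⟨hf.cont.neg, ?_, ?_⟩
  · simp only [supAv_neg]; exact hf.fin
  · simp only [supAv_neg, norm_neg]; exact hf.decay

theorem Decaying.sub {T : ℝ} {f g : ℝ → L2C} (hf : Decaying T f) (hg : Decaying T g) :
    Decaying T fun t => f t - g t := by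
  simp only [sub_eq_add_neg]
  exact hf.add hg.neg

/-! ### Integrability of the nonlinearity away from time zero -/

theorem lintegral_coeff_lt_top {a M s T : ℝ} (hs : 0 < s) {z z' : ℝ → L2C}
    (hzc : ContinuousOn z (Ioc 0 T)) (hz : ∫⁻ s in Ioc 0 T, supAv (z s) ^ 4 < ⊤)
    (hz' : ∫⁻ s in Ioc 0 T, supAv (z' s) ^ 4 < ⊤) :
    ∫⁻ τ in Ioc s T, (ENNReal.ofReal (7 * a ^ 2 / τ)
      + (ENNReal.ofReal (12 * M ^ 2) + 6 * supAv (z τ) ^ 2 + 6 * supAv (z' τ) ^ 2)) < ⊤ := by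
  have hsq : ∀ x : ℝ≥0∞, x ^ 2 ≤ 1 + x ^ 4 := fun x => by
    rcases le_total x 1 with h | h
    · exact (pow_le_one₀ (zero_le) h).trans le_self_add
    · exact (pow_le_pow_right₀ h (by norm_num)).trans le_add_self
  have hsub : Ioc s T ⊆ Ioc 0 T := Ioc_subset_Ioc_left hs.le
  calc _ ≤ ∫⁻ τ in Ioc s T, ((ENNReal.ofReal (7 * a ^ 2 / s) + ENNReal.ofReal (12 * M ^ 2) + 12)
        + (6 * supAv (z τ) ^ 4 + 6 * supAv (z' τ) ^ 4)) := by
        refine setLIntegral_mono' measurableSet_Ioc fun τ hτ => ?_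
        have h1 : ENNReal.ofReal (7 * a ^ 2 / τ) ≤ ENNReal.ofReal (7 * a ^ 2 / s) :=
          ENNReal.ofReal_le_ofReal (div_le_div_of_nonneg_left (by positivity) hs hτ.1.le)
        calc _ ≤ ENNReal.ofReal (7 * a ^ 2 / s) + (ENNReal.ofReal (12 * M ^ 2)
              + 6 * (1 + supAv (z τ) ^ 4) + 6 * (1 + supAv (z' τ) ^ 4)) := by
              gcongr
              · exact hsq _
              · exact hsq _
          _ = _ := by ring
    _ = (ENNReal.ofReal (7 * a ^ 2 / s) + ENNReal.ofReal (12 * M ^ 2) + 12) * ENNReal.ofReal (T - s)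
        + (6 * (∫⁻ τ in Ioc s T, supAv (z τ) ^ 4) + 6 * ∫⁻ τ in Ioc s T, supAv (z' τ) ^ 4) := by
        have hm : AEMeasurable (fun τ => supAv (z τ)) (volume.restrict (Ioc s T)) :=
          aemeasurable_supAv ((hzc.mono hsub).aestronglyMeasurable measurableSet_Ioc)
        rw [lintegral_add_left measurable_const,
          lintegral_add_left' ((hm.pow_const 4).const_mul 6),
          lintegral_const_mul' _ _ (by norm_num), lintegral_const_mul' _ _ (by norm_num)]
        simp
    _ < ⊤ := by
        refine ENNReal.add_lt_top.2 ⟨ENNReal.mul_lt_top ?_ ENNReal.ofReal_lt_top,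
          ENNReal.add_lt_top.2 ⟨ENNReal.mul_lt_top (by norm_num) ?_,
            ENNReal.mul_lt_top (by norm_num) ?_⟩⟩
        · exact ENNReal.add_lt_top.2 ⟨ENNReal.add_lt_top.2
            ⟨ENNReal.ofReal_lt_top, ENNReal.ofReal_lt_top⟩, by norm_num⟩
        · exact (lintegral_mono_set hsub).trans_lt hz
        · exact (lintegral_mono_set hsub).trans_lt hz'

theorem integrableOn_nlin {a s T : ℝ} (hs : s ∈ Ioc 0 T) {W : ℝ → L2C}
    (hW : ContinuousOn W (Ioc 0 T)) (hfin : ∫⁻ s in Ioc 0 T, supAv (W s) ^ 4 < ⊤) :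
    IntegrableOn (fun τ => nlin a τ (W τ)) (Ioc s T) volume := by
  have hsub : Ioc s T ⊆ Ioc 0 T := Ioc_subset_Ioc_left hs.1.le
  have hae := ae_supAv_ne_top hW hfin.ne
  refine ⟨(aestronglyMeasurable_nlin hW hae).mono_measure (Measure.restrict_mono hsub le_rfl), ?_⟩
  obtain ⟨K, hK⟩ := isCompact_Icc.exists_bound_of_continuousOn
    (hW.mono (fun x hx => ⟨hs.1.trans_le hx.1, hx.2⟩ : Icc s T ⊆ Ioc 0 T))
  have h := lintegral_coeff_lt_top (a := a) (M := 0) hs.1 hW hfin hfin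
  refine (lintegral_mono_ae (g := fun τ => (ENNReal.ofReal (7 * a ^ 2 / τ)
      + (ENNReal.ofReal (12 * 0 ^ 2) + 6 * supAv (W τ) ^ 2 + 6 * supAv (W τ) ^ 2))
      * ENNReal.ofReal K) ?_).trans_lt ?_
  · filter_upwards [ae_restrict_of_ae_restrict_of_subset hsub hae, ae_restrict_mem measurableSet_Ioc]
      with τ h1 hτ
    have hτ0 : 0 < τ := hs.1.trans hτ.1
    have h2 := enorm_nlin_sub_le (a := a) hτ0 (M := 0) (W := 0) (z := W τ) (z' := 0) le_rfl
      (by simp [supAv_zero]) h1 (by simp [supAv_zero])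
    rw [zero_add, zero_add, nlin_zero hτ0, sub_zero, sub_zero] at h2
    refine h2.trans ?_
    have h3 : ‖W τ‖ₑ ≤ ENNReal.ofReal K := by
      rw [← ofReal_norm]; exact ENNReal.ofReal_le_ofReal (hK τ ⟨hτ.1.le, hτ.2⟩)
    gcongr
    rw [supAv_zero]
    exact zero_le
  · rw [lintegral_mul_const' _ _ ENNReal.ofReal_ne_top]
    exact ENNReal.mul_lt_top h ENNReal.ofReal_lt_top

theorem enorm_sub_le_of_mildOn {σ s t T : ℝ} (hσ : |σ| = 1) {N N' W W' : ℝ → L2C} (hst : s ≤ t)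
    (htT : t ≤ T) (hN : IntegrableOn N (Ioc s T) volume) (hN' : IntegrableOn N' (Ioc s T) volume)
    (h : MildOn σ s T N W) (h' : MildOn σ s T N' W') :
    ‖W t - W' t‖ₑ ≤ ‖W s - W' s‖ₑ + ∫⁻ τ in Ioc s t, ‖N τ - N' τ‖ₑ := by
  have hi : ∀ F : ℝ → L2C, IntegrableOn F (Ioc s T) volume →
      IntervalIntegrable (fun τ => schr (-τ) (F τ)) volume s t := fun F hF => by
    have h0 : IntegrableOn (fun s => schr (-s) (F s)) (Ioc s T) volume := integrable_schr_neg hF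
    rw [intervalIntegrable_iff_integrableOn_Ioc_of_le hst]
    exact h0.mono_set (Ioc_subset_Ioc_right htT)
  have e : schr (-t) (W t - W' t) = schr (-s) (W s - W' s)
      + (Complex.I * σ) • ∫ τ in s..t, schr (-τ) (N τ - N' τ) := by
    simp only [map_sub]
    rw [h t ⟨hst, htT⟩, h' t ⟨hst, htT⟩, intervalIntegral.integral_sub (hi N hN) (hi N' hN'),
      smul_sub]
    abel
  have e2 : ∀ (r : ℝ) (f : L2C), ‖schr r f‖ₑ = ‖f‖ₑ := fun r f => by
    rw [← ofReal_norm, LinearIsometryEquiv.norm_map, ofReal_norm]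
  rw [← e2 (-t), e, ← e2 (-s) (W s - W' s)]
  refine (enorm_add_le _ _).trans (add_le_add le_rfl ?_)
  have e3 : ‖(Complex.I * σ) • ∫ τ in s..t, schr (-τ) (N τ - N' τ)‖ₑ
      = ‖∫ τ in s..t, schr (-τ) (N τ - N' τ)‖ₑ := by
    rw [← ofReal_norm, norm_smul, norm_I_mul hσ, one_mul, ofReal_norm]
  rw [e3, intervalIntegral.integral_of_le hst]
  refine (enorm_integral_le_lintegral_enorm _).trans (le_of_eq (lintegral_congr fun τ => ?_))
  rw [e2]

/-! ### Uniqueness -/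

/-- Uniqueness of the correction to `Wf` in the class of decaying functions: for small times the
difference of two corrections is at most half of itself in the norm `sup_t t^{-1/4} ‖·‖`, hence zero,
and then Gronwall's argument continues the equality up to `T`. -/
theorem eqOn_of_mildOn {σ a M T : ℝ} (hσ : |σ| = 1) (hM : 0 ≤ M)
    (ha : 28 * a ^ 2 ≤ 1 / 16) {Wf z z' : ℝ → L2C} (hW : ∀ s, supAv (Wf s) ≤ ENNReal.ofReal M)
    (hWc : ContinuousOn Wf (Ioi 0)) (hz : Decaying T z) (hz' : Decaying T z')
    (h : ∀ s ∈ Ioc 0 T, MildOn σ s T (fun τ => nlin a τ (Wf τ + z τ)) fun τ => Wf τ + z τ)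
    (h' : ∀ s ∈ Ioc 0 T, MildOn σ s T (fun τ => nlin a τ (Wf τ + z' τ)) fun τ => Wf τ + z' τ) :
    ∀ t ∈ Ioc 0 T, z t = z' t := by
  have hWsub : ContinuousOn Wf (Ioc 0 T) := hWc.mono fun s hs => hs.1
  have hint : ∀ y : ℝ → L2C, Decaying T y → ∀ s ∈ Ioc 0 T,
      IntegrableOn (fun τ => nlin a τ (Wf τ + y τ)) (Ioc s T) volume := fun y hy s hs => by
    refine integrableOn_nlin hs (hWsub.add hy.cont) ?_
    refine (lintegral_supAv_add_le hWsub le_rfl).trans_lt ?_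
    refine ENNReal.mul_lt_top (by norm_num) (ENNReal.add_lt_top.2 ⟨?_, hy.fin⟩)
    calc ∫⁻ s in Ioc 0 T, supAv (Wf s) ^ 4 ≤ ∫⁻ _ in Ioc 0 T, ENNReal.ofReal M ^ 4 :=
          lintegral_mono fun s => pow_le_pow_left₀ (zero_le) (hW s) 4
      _ < ⊤ := by
          rw [setLIntegral_const]
          exact ENNReal.mul_lt_top (ENNReal.pow_lt_top ENNReal.ofReal_lt_top) (by simp)
  have hdiff : ∀ s t, 0 < s → s ≤ t → t ≤ T → ‖z t - z' t‖ₑ ≤ ‖z s - z' s‖ₑ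
      + ∫⁻ τ in Ioc s t, ‖nlin a τ (Wf τ + z τ) - nlin a τ (Wf τ + z' τ)‖ₑ := by
    intro s t hs hst htT
    have hsT : s ∈ Ioc 0 T := ⟨hs, hst.trans htT⟩
    have := enorm_sub_le_of_mildOn hσ hst htT (hint z hz s hsT) (hint z' hz' s hsT) (h s hsT)
      (h' s hsT)
    rwa [add_sub_add_left_eq_sub, add_sub_add_left_eq_sub] at this
  obtain ⟨C, hC, t₀, ht₀, ht₀T, hd⟩ := hz.decay
  obtain ⟨C', hC', t₀', ht₀', ht₀T', hd'⟩ := hz'.decay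
  -- a time up to which the contraction factor is at most one half
  set R : ℝ := max C C' with hR
  have hR0 : 0 < R := lt_max_of_lt_left hC
  set r : ℝ := 1 / (4 * (12 * M ^ 2 + 12 * R ^ 2)) with hr
  have hr0 : 0 < r := by positivity
  set t₁ : ℝ := min (min t₀ t₀') r with ht₁
  have ht₁0 : 0 < t₁ := lt_min (lt_min ht₀ ht₀') hr0
  have ht₁T : t₁ ≤ T := (min_le_left _ _).trans ((min_le_left _ _).trans ht₀T)
  have hCR : C ^ 4 ≤ R ^ 4 := pow_le_pow_left₀ hC.le (le_max_left _ _) 4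
  have hCR' : C' ^ 4 ≤ R ^ 4 := pow_le_pow_left₀ hC'.le (le_max_right _ _) 4
  have hstep : ∀ D : ℝ, 0 ≤ D → (∀ t ∈ Ioc 0 t₁, ‖z t - z' t‖ ≤ D * t ^ (1 / 4 : ℝ)) →
      ∀ t ∈ Ioc 0 t₁, ‖z t - z' t‖ ≤ D / 2 * t ^ (1 / 4 : ℝ) := by
    intro D hD hDt t ht
    have ht0 : 0 < t := ht.1
    have htT : t ≤ T := ht.2.trans ht₁T
    have m1 : t ∈ Ioc 0 t₀ := ⟨ht0, ht.2.trans ((min_le_left _ _).trans (min_le_left _ _))⟩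
    have m2 : t ∈ Ioc 0 t₀' := ⟨ht0, ht.2.trans ((min_le_left _ _).trans (min_le_right _ _))⟩
    have hsub : Ioc 0 t ⊆ Ioc 0 T := Ioc_subset_Ioc_right htT
    have hI := lintegral_nlin_sub_le (a := a) hM hR0 hD ht0 hW (hz.cont.mono hsub)
      (hz'.cont.mono hsub)
      ((hd t m1).2.trans (ENNReal.ofReal_le_ofReal (mul_le_mul_of_nonneg_right hCR ht0.le)))
      ((hd' t m2).2.trans (ENNReal.ofReal_le_ofReal (mul_le_mul_of_nonneg_right hCR' ht0.le)))
      (fun s hs => hDt s ⟨hs.1, hs.2.trans ht.2⟩)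
    have hfac : 28 * a ^ 2 + 12 * M ^ 2 * t + 12 * R ^ 2 * t ≤ 1 / 2 := by
      have h1 : (12 * M ^ 2 + 12 * R ^ 2) * t ≤ (12 * M ^ 2 + 12 * R ^ 2) * r := by
        have : t ≤ r := ht.2.trans (min_le_right _ _)
        gcongr
      have h2 : (12 * M ^ 2 + 12 * R ^ 2) * r = 1 / 4 := by
        rw [hr]; field_simp
      linarith
    have hq : 0 ≤ t ^ (1 / 4 : ℝ) := by positivity
    -- Duhamel from a time `s > 0`, which then tends to zero
    have hI2 : ∀ s ∈ Ioc 0 t, ‖z t - z' t‖ₑ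
        ≤ ENNReal.ofReal (D * s ^ (1 / 4 : ℝ)) + ENNReal.ofReal (D / 2 * t ^ (1 / 4 : ℝ)) := by
      intro s hs
      refine (hdiff s t hs.1 hs.2 htT).trans (add_le_add ?_ ?_)
      · rw [← ofReal_norm]
        exact ENNReal.ofReal_le_ofReal (hDt s ⟨hs.1, hs.2.trans ht.2⟩)
      · refine (lintegral_mono_set (Ioc_subset_Ioc_left hs.1.le)).trans (hI.trans
          (ENNReal.ofReal_le_ofReal ?_))
        calc _ ≤ D * t ^ (1 / 4 : ℝ) * (1 / 2) := by gcongr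
          _ = _ := by ring
    have hlim : Tendsto (fun s : ℝ => D * s ^ (1 / 4 : ℝ) + D / 2 * t ^ (1 / 4 : ℝ)) (𝓝[>] 0)
        (𝓝 (D / 2 * t ^ (1 / 4 : ℝ))) := by
      have h4 : Continuous fun s : ℝ => D * s ^ (1 / 4 : ℝ) + D / 2 * t ^ (1 / 4 : ℝ) :=
        (continuous_const.mul (Real.continuous_rpow_const (by norm_num))).add continuous_const
      have h5 := h4.tendsto 0
      rw [Real.zero_rpow (by norm_num), mul_zero, zero_add] at h5
      exact h5.mono_left nhdsWithin_le_nhds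
    refine ge_of_tendsto hlim ?_
    filter_upwards [Ioc_mem_nhdsGT ht0] with s hs
    have hs0 := hs.1.le
    have := hI2 s hs
    rwa [← ENNReal.ofReal_add (by positivity) (by positivity), ← ofReal_norm,
      ENNReal.ofReal_le_ofReal_iff (by positivity)] at this
  have hiter : ∀ n : ℕ, ∀ t ∈ Ioc 0 t₁, ‖z t - z' t‖ ≤ (C + C') / 2 ^ n * t ^ (1 / 4 : ℝ) := by
    intro n
    induction n with
    | zero =>
      intro t ht
      have m1 : t ∈ Ioc 0 t₀ := ⟨ht.1, ht.2.trans ((min_le_left _ _).trans (min_le_left _ _))⟩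
      have m2 : t ∈ Ioc 0 t₀' := ⟨ht.1, ht.2.trans ((min_le_left _ _).trans (min_le_right _ _))⟩
      refine (norm_sub_le _ _).trans ((add_le_add (hd t m1).1 (hd' t m2).1).trans (le_of_eq ?_))
      rw [pow_zero]; ring
    | succ n ih =>
      intro t ht
      refine (hstep _ (by positivity) ih t ht).trans (le_of_eq ?_)
      rw [pow_succ]; ring
  have hsmall : ∀ t ∈ Ioc 0 t₁, z t = z' t := by
    intro t ht
    have hlim : Tendsto (fun n : ℕ => (C + C') / 2 ^ n * t ^ (1 / 4 : ℝ)) atTop (𝓝 0) := by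
      have := (tendsto_pow_atTop_nhds_zero_of_lt_one (by norm_num : (0 : ℝ) ≤ 1 / 2)
        (by norm_num)).const_mul ((C + C') * t ^ (1 / 4 : ℝ))
      rw [mul_zero] at this
      refine this.congr fun n => ?_
      rw [div_pow, one_pow]; ring
    have h0 : ‖z t - z' t‖ ≤ 0 := ge_of_tendsto hlim (Eventually.of_forall fun n => hiter n t ht)
    exact sub_eq_zero.1 (norm_le_zero_iff.1 h0)
  -- continuation to the whole interval: the set of times at which `z` and `z'` agree is closed, and
  -- it extends to the right, because the integral of the coefficient over a short interval is
  -- below `1/2`, so that the maximum of the difference there is at most half of itself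
  have hcont : ContinuousOn (fun t => z t - z' t) (Icc t₁ T) :=
    (hz.cont.sub hz'.cont).mono fun t ht => ⟨ht₁0.trans_le ht.1, ht.2⟩
  have hcl : IsClosed ({t | z t - z' t = 0} ∩ Icc t₁ T) := by
    rw [inter_comm]
    exact hcont.preimage_isClosed_of_isClosed isClosed_Icc isClosed_singleton
  have hlarge : Icc t₁ T ⊆ {t | z t - z' t = 0} := by
    refine hcl.Icc_subset_of_forall_exists_gt
      (sub_eq_zero.2 (hsmall t₁ ⟨ht₁0, le_rfl⟩)) fun x hx y hy => ?_
    have hx0 : 0 < x := ht₁0.trans_le hx.2.1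
    have hxT : x < T := hx.2.2
    have hxy : x < y := hy
    have hk := lintegral_coeff_lt_top (a := a) (M := M) hx0 hz.cont hz.fin hz'.fin
    set k : ℝ → ℝ≥0∞ := fun τ => ENNReal.ofReal (7 * a ^ 2 / τ)
      + (ENNReal.ofReal (12 * M ^ 2) + 6 * supAv (z τ) ^ 2 + 6 * supAv (z' τ) ^ 2) with hkdef
    have hk0 : Tendsto (fun t' => ∫⁻ τ in Ioc x t', k τ ∂volume.restrict (Ioc x T)) (𝓝[>] x)
        (𝓝 0) := by
      refine tendsto_setLIntegral_zero hk.ne ?_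
      have h1 : Tendsto (fun t' : ℝ => ENNReal.ofReal (t' - x)) (𝓝[>] x) (𝓝 0) := by
        have h2 : Continuous fun t' : ℝ => ENNReal.ofReal (t' - x) :=
          ENNReal.continuous_ofReal.comp (continuous_id.sub continuous_const)
        have h3 := h2.tendsto x
        rw [sub_self, ENNReal.ofReal_zero] at h3
        exact h3.mono_left nhdsWithin_le_nhds
      refine tendsto_of_tendsto_of_tendsto_of_le_of_le tendsto_const_nhds h1
        (fun _ => zero_le) fun t' => ?_
      refine (Measure.restrict_apply_le _ _).trans ?_
      rw [Real.volume_Ioc]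
    obtain ⟨t', hkt, ht'⟩ := ((hk0.eventually (Iio_mem_nhds
      (show (0 : ℝ≥0∞) < 2⁻¹ by simp))).and (Ioc_mem_nhdsGT (lt_min hxy hxT))).exists
    have ht'T : t' ≤ T := ht'.2.trans (min_le_right _ _)
    have hkt' : ∫⁻ τ in Ioc x t', k τ ≤ 2⁻¹ := by
      have : (volume.restrict (Ioc x T)).restrict (Ioc x t') = volume.restrict (Ioc x t') := by
        rw [Measure.restrict_restrict measurableSet_Ioc,
          inter_eq_left.2 (Ioc_subset_Ioc_right ht'T)]
      rw [← this]; exact le_of_lt hkt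
    refine ⟨t', ?_, ht'.1, ht'.2.trans (min_le_left _ _)⟩
    have hsubx : Icc x t' ⊆ Icc t₁ T := Icc_subset_Icc hx.2.1 ht'T
    obtain ⟨τm, hτm, hmax⟩ := isCompact_Icc.exists_isMaxOn (nonempty_Icc.2 ht'.1.le)
      (hcont.mono hsubx).norm
    have hmax' : ∀ τ ∈ Icc x t', ‖z τ - z' τ‖ₑ ≤ ‖z τm - z' τm‖ₑ := fun τ hτ => by
      rw [← ofReal_norm, ← ofReal_norm]
      exact ENNReal.ofReal_le_ofReal (hmax hτ)
    have hx1 : z x - z' x = 0 := hx.1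
    have hae := ae_supAv_ne_top hz.cont hz.fin.ne
    have hae' := ae_supAv_ne_top hz'.cont hz'.fin.ne
    have hτmT : τm ≤ T := hτm.2.trans ht'T
    have hsub0 : Ioc x τm ⊆ Ioc 0 T := Ioc_subset_Ioc hx0.le hτmT
    have hhalf : ‖z τm - z' τm‖ₑ ≤ 2⁻¹ * ‖z τm - z' τm‖ₑ := by
      calc ‖z τm - z' τm‖ₑ ≤ ‖z x - z' x‖ₑ
            + ∫⁻ τ in Ioc x τm, ‖nlin a τ (Wf τ + z τ) - nlin a τ (Wf τ + z' τ)‖ₑ :=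
            hdiff x τm hx0 hτm.1 hτmT
        _ ≤ ∫⁻ τ in Ioc x τm, k τ * ‖z τm - z' τm‖ₑ := by
            rw [hx1, enorm_zero, zero_add]
            refine lintegral_mono_ae ?_
            filter_upwards [ae_restrict_of_ae_restrict_of_subset hsub0 hae,
              ae_restrict_of_ae_restrict_of_subset hsub0 hae', ae_restrict_mem measurableSet_Ioc]
              with τ h1 h2 hτ
            refine (enorm_nlin_sub_le (hx0.trans hτ.1) hM (hW τ) h1 h2).trans ?_
            exact mul_le_mul_right (hmax' τ ⟨hτ.1.le, hτ.2.trans hτm.2⟩) _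
        _ = (∫⁻ τ in Ioc x τm, k τ) * ‖z τm - z' τm‖ₑ :=
            lintegral_mul_const' _ _ enorm_ne_top
        _ ≤ 2⁻¹ * ‖z τm - z' τm‖ₑ := by
            refine mul_le_mul_left ?_ _
            exact (lintegral_mono_set (Ioc_subset_Ioc_right hτm.2)).trans hkt'
    have hzero : ‖z τm - z' τm‖ ≤ 0 := by
      rw [← ofReal_norm, show (2⁻¹ : ℝ≥0∞) = ENNReal.ofReal (2⁻¹) by
        rw [ENNReal.ofReal_inv_of_pos (by norm_num)]; simp,
        ← ENNReal.ofReal_mul (by norm_num), ENNReal.ofReal_le_ofReal_iff (by positivity)] at hhalf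
      linarith
    have h9 := hmax (right_mem_Icc.2 ht'.1.le)
    exact norm_le_zero_iff.1 (le_trans h9 hzero)
  intro t ht
  rcases le_total t t₁ with h1 | h1
  · exact hsmall t ⟨ht.1, h1⟩
  · exact sub_eq_zero.1 (hlarge ⟨h1, ht.2⟩)

/-! ### The class of uniqueness in terms of functions of `x` -/

theorem supAv_toL2 {f : ℝ → ℂ} (hf : MemLp f 2 volume) : supAv (toL2 f) = eLpNorm f ⊤ volume := by
  rw [← eLpNorm_top_eq]; exact eLpNorm_congr_ae (coeFn_toL2 hf)

theorem enorm_toL2_sub {f g : ℝ → ℂ} (hf : MemLp f 2 volume) (hg : MemLp g 2 volume) :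
    ‖toL2 f - toL2 g‖ₑ = eLpNorm (f - g) 2 volume := by
  rw [← toL2_sub hf hg, enorm_toL2 (hf.sub hg)]

theorem memCL2_iff {T : ℝ} {r : ℝ → ℝ → ℂ} (hr : ∀ t ∈ Ioc 0 T, MemLp (r t) 2 volume) :
    MemCL2 T r ↔ ContinuousOn (fun t => toL2 (r t)) (Ioc 0 T) := by
  have key : ∀ t₀ ∈ Ioc 0 T, Tendsto (fun t => eLpNorm (r t - r t₀) 2 volume) (𝓝[Ioc 0 T] t₀) (𝓝 0)
      ↔ ContinuousWithinAt (fun t => toL2 (r t)) (Ioc 0 T) t₀ := by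
    intro t₀ ht₀
    rw [ContinuousWithinAt, tendsto_iff_edist_tendsto_0]
    refine tendsto_congr' ?_
    filter_upwards [self_mem_nhdsWithin] with t ht
    rw [edist_eq_enorm_sub, enorm_toL2_sub (hr t ht) (hr t₀ ht₀)]
  exact ⟨fun h t ht => (key t ht).1 (h.2 t ht), fun h => ⟨hr, fun t ht => (key t ht).2 (h t ht)⟩⟩

theorem normL4Linf_Ioc {T t : ℝ} {r : ℝ → ℝ → ℂ} (hr : ∀ t ∈ Ioc 0 T, MemLp (r t) 2 volume)
    (ht : t ≤ T) : normL4Linf (Ioc 0 t) r = (∫⁻ s in Ioc 0 t, supAv (toL2 (r s)) ^ 4) ^ (1 / 4 : ℝ) := by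
  unfold normL4Linf
  congr 1
  refine setLIntegral_congr_fun measurableSet_Ioc fun s hs => ?_
  rw [supAv_toL2 (hr s ⟨hs.1, hs.2.trans ht⟩)]

theorem normL4Linf_Ioo (t : ℝ) (r : ℝ → ℝ → ℂ) : normL4Linf (Ioo 0 t) r = normL4Linf (Ioc 0 t) r := by
  unfold normL4Linf
  rw [restrict_Ioo_eq_restrict_Ioc]

theorem ofReal_rpow_quarter_pow {C t : ℝ} (hC : 0 ≤ C) (ht : 0 ≤ t) :
    ENNReal.ofReal (C ^ 4 * t) ^ (1 / 4 : ℝ) = ENNReal.ofReal (C * t ^ (1 / 4 : ℝ)) := by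
  rw [ENNReal.ofReal_rpow_of_nonneg (by positivity) (by norm_num),
    Real.mul_rpow (by positivity) ht, ← Real.rpow_natCast C 4, ← Real.rpow_mul hC]
  norm_num

theorem decaying_toL2 {T : ℝ} (hT : 0 < T) {r : ℝ → ℝ → ℂ} (hc : MemCL2 T r)
    (hfin : normL4Linf (Ioc 0 T) r < ⊤)
    (hd : IsBigOZero (fun t => eLpNorm (r t) 2 volume + normL4Linf (Ioo 0 t) r) (1 / 4)) :
    Decaying T fun t => toL2 (r t) := by
  refine ⟨(memCL2_iff hc.1).1 hc, ?_, ?_⟩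
  · rw [normL4Linf_Ioc hc.1 le_rfl] at hfin
    by_contra h
    rw [not_lt, top_le_iff] at h
    rw [h, ENNReal.top_rpow_of_pos (by norm_num)] at hfin
    exact lt_irrefl _ hfin
  · obtain ⟨C, hC⟩ := hd
    obtain ⟨t₀, ht₀, h⟩ := mem_nhdsGT_iff_exists_Ioc_subset.1 hC
    refine ⟨C + 1, by positivity, min t₀ T, lt_min ht₀ hT, min_le_right _ _, fun t ht => ?_⟩
    have htT : t ≤ T := ht.2.trans (min_le_right _ _)
    have ht0 : 0 < t := ht.1
    have hle : eLpNorm (r t) 2 volume + normL4Linf (Ioo 0 t) r ≤ C * ENNReal.ofReal (t ^ (1 / 4 : ℝ)) :=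
      h ⟨ht.1, ht.2.trans (min_le_left _ _)⟩
    have hCle : (C : ℝ≥0∞) * ENNReal.ofReal (t ^ (1 / 4 : ℝ))
        ≤ ENNReal.ofReal ((C + 1) * t ^ (1 / 4 : ℝ)) := by
      rw [ENNReal.ofReal_mul (by positivity)]
      gcongr
      rw [← ENNReal.ofReal_coe_nnreal]
      exact ENNReal.ofReal_le_ofReal (by linarith)
    constructor
    · have h1 := (le_self_add.trans hle).trans hCle
      rw [← enorm_toL2 (hc.1 t ⟨ht0, htT⟩), ← ofReal_norm,
        ENNReal.ofReal_le_ofReal_iff (by positivity)] at h1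
      exact h1
    · have h1 := (le_add_self.trans hle).trans hCle
      rw [normL4Linf_Ioo, normL4Linf_Ioc hc.1 htT, ← ofReal_rpow_quarter_pow (by positivity) ht0.le,
        ENNReal.rpow_le_rpow_iff (by norm_num)] at h1
      exact h1

theorem Decaying.isBigOZero_norm {T : ℝ} {g : ℝ → L2C} (h : Decaying T g) :
    ∃ C : ℝ≥0, ∀ᶠ t in 𝓝[>] (0 : ℝ), ‖g t‖ₑ ≤ C * ENNReal.ofReal (t ^ (1 / 4 : ℝ)) := by
  obtain ⟨C, hC, t₀, ht₀, -, h⟩ := h.decay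
  refine ⟨C.toNNReal, ?_⟩
  filter_upwards [Ioc_mem_nhdsGT ht₀] with t ht
  have := ENNReal.ofReal_le_ofReal (h t ht).1
  rwa [ofReal_norm, ENNReal.ofReal_mul hC.le] at this

theorem Decaying.of_toL2 {T : ℝ} {r : ℝ → ℝ → ℂ}
    (hr : ∀ t ∈ Ioc 0 T, MemLp (r t) 2 volume) (h : Decaying T fun t => toL2 (r t)) :
    MemCL2 T r ∧ normL4Linf (Ioc 0 T) r < ⊤ ∧
      IsBigOZero (fun t => eLpNorm (r t) 2 volume + normL4Linf (Ioo 0 t) r) (1 / 4) := by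
  refine ⟨(memCL2_iff hr).2 h.cont, ?_, ?_⟩
  · rw [normL4Linf_Ioc hr le_rfl]
    exact ENNReal.rpow_lt_top_of_nonneg (by norm_num) h.fin.ne
  · obtain ⟨C, hC, t₀, ht₀, ht₀T, hd⟩ := h.decay
    refine ⟨2 * C.toNNReal, ?_⟩
    filter_upwards [Ioc_mem_nhdsGT ht₀] with t ht
    have htT : t ≤ T := ht.2.trans ht₀T
    have ht0 : 0 < t := ht.1
    obtain ⟨h1, h2⟩ := hd t ht
    have e1 : eLpNorm (r t) 2 volume ≤ ENNReal.ofReal (C * t ^ (1 / 4 : ℝ)) := by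
      rw [← enorm_toL2 (hr t ⟨ht0, htT⟩), ← ofReal_norm]
      exact ENNReal.ofReal_le_ofReal h1
    have e2 : normL4Linf (Ioo 0 t) r ≤ ENNReal.ofReal (C * t ^ (1 / 4 : ℝ)) := by
      rw [normL4Linf_Ioo, normL4Linf_Ioc hr htT, ← ofReal_rpow_quarter_pow hC.le ht0.le]
      exact ENNReal.rpow_le_rpow h2 (by norm_num)
    refine (add_le_add e1 e2).trans (le_of_eq ?_)
    rw [← two_mul, ENNReal.ofReal_mul hC.le, ENNReal.coe_mul, mul_assoc]
    rfl

/-! ### The asymptotic state -/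

theorem eLpNorm_comp_mul_left {c : ℝ} (hc : c ≠ 0) {p : ℝ≥0∞} (hp : p ≠ ⊤) (f : ℝ → ℂ) :
    eLpNorm (fun x => f (c * x)) p volume
      = ENNReal.ofReal |c⁻¹| ^ (1 / p).toReal * eLpNorm f p volume := by
  have h := (Homeomorph.mulLeft₀ c hc).measurableEmbedding.eLpNorm_map_measure (g := f) (p := p)
    (μ := volume)
  have h2 : Measure.map (Homeomorph.mulLeft₀ c hc) volume = ENNReal.ofReal |c⁻¹| • volume :=
    Real.map_volume_mul_left hc
  rw [h2, eLpNorm_smul_measure_of_ne_top hp, smul_eq_mul] at h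
  exact h.symm

theorem aestronglyMeasurable_comp_mul_left {c : ℝ} (hc : c ≠ 0) {f : ℝ → ℂ}
    (hf : AEStronglyMeasurable f volume) :
    AEStronglyMeasurable (fun x => f (c * x)) volume := by
  refine hf.comp_quasiMeasurePreserving ⟨measurable_const_mul c, ?_⟩
  rw [Real.map_volume_mul_left hc]
  exact Measure.smul_absolutelyContinuous

/-- The constant `1 / √(4πi)`. -/
def profileConst : ℂ := 1 / (4 * (Real.pi : ℂ) * Complex.I) ^ (1 / 2 : ℂ)

theorem norm_profileConst : ‖profileConst‖ = (4 * Real.pi) ^ (-(1 / 2) : ℝ) := by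
  have h : ((1 / 2 : ℂ)) = ((1 / 2 : ℝ) : ℂ) := by push_cast; rfl
  have hp := Real.pi_pos
  unfold profileConst
  rw [norm_div, norm_one, h, Complex.norm_cpow_real, Real.rpow_neg (by positivity), one_div]
  congr 2
  simp [abs_of_pos hp]

theorem norm_profileConst_sq : ‖profileConst‖ ^ 2 = 1 / (4 * Real.pi) := by
  have hp := Real.pi_pos
  rw [norm_profileConst, ← Real.rpow_natCast, ← Real.rpow_mul (by positivity)]
  norm_num
  rw [Real.rpow_neg_one]; ring

theorem norm_profileConst_le : ‖profileConst‖ ≤ 1 := by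
  have h := norm_profileConst_sq
  have hp := Real.pi_gt_three
  have h1 : (1 : ℝ) / (4 * Real.pi) ≤ 1 := by
    rw [div_le_one (by positivity)]; linarith
  nlinarith [norm_nonneg profileConst]

/-- The Fourier transform of the spatial profile `û₊(-x/2) / √(4πi)`. -/
def profileFreq (uP : ℝ → ℂ) (ξ : ℝ) : ℂ :=
  (4 * Real.pi : ℝ) * profileConst * uP (4 * Real.pi * ξ)

theorem fourierInv_profileFreq (uP : ℝ → ℂ) (x : ℝ) :
    𝓕⁻ (profileFreq uP) x = profileConst * hat uP (-x / 2) := by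
  have hp := Real.pi_pos
  have hpc : (Real.pi : ℂ) ≠ 0 := by exact_mod_cast hp.ne'
  rw [hat_eq, Real.fourierInv_eq']
  have h := Measure.integral_comp_mul_left
    (fun y : ℝ => Complex.exp (-(Complex.I * ((-x / 2 : ℝ) : ℂ) * y)) * uP y) (4 * Real.pi)
  have e : ∀ ξ : ℝ, Complex.exp (((2 * Real.pi * inner ℝ ξ x : ℝ) : ℂ) * Complex.I) • profileFreq uP ξ
      = ((4 * Real.pi : ℝ) * profileConst)
        * (Complex.exp (-(Complex.I * ((-x / 2 : ℝ) : ℂ) * ((4 * Real.pi * ξ : ℝ) : ℂ)))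
          * uP (4 * Real.pi * ξ)) := by
    intro ξ
    have : ((2 * Real.pi * inner ℝ ξ x : ℝ) : ℂ) * Complex.I
        = -(Complex.I * ((-x / 2 : ℝ) : ℂ) * ((4 * Real.pi * ξ : ℝ) : ℂ)) := by
      simp only [RCLike.inner_apply, conj_trivial]
      push_cast; ring
    rw [this, smul_eq_mul, profileFreq]; ring
  simp only [e]
  rw [integral_const_mul, h, abs_of_pos (by positivity), RCLike.real_smul_eq_coe_mul (K := ℂ)]
  push_cast
  simp only [RCLike.ofReal_eq_complex_ofReal]
  field_simp

theorem eLpNorm_profileFreq_one_le (uP : ℝ → ℂ) :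
    eLpNorm (profileFreq uP) 1 volume ≤ eLpNorm uP 1 volume := by
  have hp := Real.pi_pos
  have h : profileFreq uP = ((4 * Real.pi : ℝ) * profileConst) • fun ξ => uP (4 * Real.pi * ξ) := rfl
  rw [h, eLpNorm_const_smul, eLpNorm_comp_mul_left (by positivity) (by norm_num), ← mul_assoc]
  refine mul_le_of_le_one_left (zero_le) ?_
  rw [← ofReal_norm, norm_mul, Complex.norm_real, Real.norm_of_nonneg (by positivity), div_one,
    ENNReal.toReal_one, ENNReal.rpow_one, ← ENNReal.ofReal_mul (by positivity), abs_of_pos (by positivity),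
    ← ENNReal.ofReal_one]
  refine ENNReal.ofReal_le_ofReal ?_
  calc 4 * Real.pi * ‖profileConst‖ * (4 * Real.pi)⁻¹ = ‖profileConst‖ := by field_simp
    _ ≤ 1 := norm_profileConst_le

theorem eLpNorm_profileFreq_two (uP : ℝ → ℂ) :
    eLpNorm (profileFreq uP) 2 volume = eLpNorm uP 2 volume := by
  have hp := Real.pi_pos
  have h : profileFreq uP = ((4 * Real.pi : ℝ) * profileConst) • fun ξ => uP (4 * Real.pi * ξ) := rfl
  rw [h, eLpNorm_const_smul, eLpNorm_comp_mul_left (by positivity) (by norm_num), ← mul_assoc]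
  have h2 : (1 / 2 : ℝ≥0∞).toReal = 1 / 2 := by simp
  rw [← ofReal_norm, norm_mul, Complex.norm_real, Real.norm_of_nonneg (by positivity), h2,
    ENNReal.ofReal_rpow_of_nonneg (by positivity) (by norm_num),
    ← ENNReal.ofReal_mul (by positivity), abs_of_pos (by positivity), norm_profileConst,
    ← Real.rpow_neg_one, ← Real.rpow_mul (by positivity)]
  have h3 : 4 * Real.pi * (4 * Real.pi) ^ (-(1 / 2) : ℝ) * (4 * Real.pi) ^ (-1 * (1 / 2) : ℝ) = 1 := by
    rw [mul_assoc, ← Real.rpow_add (by positivity)]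
    norm_num
    rw [Real.rpow_neg_one]
    field_simp
  rw [h3]; simp

theorem memLp_profileFreq {uP : ℝ → ℂ} {p : ℝ≥0∞} (hp : p ≠ ⊤) (h : MemLp uP p volume) :
    MemLp (profileFreq uP) p volume := by
  have hpi := Real.pi_pos
  refine MemLp.const_mul (f := fun ξ => uP (4 * Real.pi * ξ)) ⟨aestronglyMeasurable_comp_mul_left
    (by positivity) h.1, ?_⟩ _
  rw [eLpNorm_comp_mul_left (by positivity) hp]
  exact ENNReal.mul_lt_top (ENNReal.rpow_lt_top_of_nonneg (by positivity) ENNReal.ofReal_ne_top) h.2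

theorem memLp_sq_mul_profileFreq {uP : ℝ → ℂ}
    (h : MemLp (fun x : ℝ => ((x ^ 2 : ℝ) : ℂ) * uP x) 2 volume) :
    MemLp (fun ξ : ℝ => ((ξ ^ 2 : ℝ) : ℂ) * profileFreq uP ξ) 2 volume := by
  have hp : (Real.pi : ℂ) ≠ 0 := by exact_mod_cast Real.pi_ne_zero
  have h1 := (memLp_profileFreq (by norm_num) h).const_mul ((1 / (4 * Real.pi) ^ 2 : ℝ) : ℂ)
  refine (memLp_congr_ae (Eventually.of_forall fun ξ => ?_)).1 h1
  simp only [profileFreq]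
  push_cast
  field_simp

/-- Frequency weights `ξ²` measure the speed at which `e^{it∂²}` moves away from the identity. -/
theorem norm_schr_sub_le {v : ℝ → ℂ} (h2 : MemLp v 2 volume)
    (hw : MemLp (fun ξ : ℝ => ((ξ ^ 2 : ℝ) : ℂ) * v ξ) 2 volume) {t : ℝ} (ht : 0 ≤ t) :
    ‖schr t (𝓕⁻ (toL2 v)) - 𝓕⁻ (toL2 v)‖
      ≤ 4 * Real.pi ^ 2 * t * ‖toL2 (fun ξ : ℝ => ((ξ ^ 2 : ℝ) : ℂ) * v ξ)‖ := by
  have e : 𝓕 (𝓕⁻ (toL2 v)) = toL2 v := FourierTransform.fourier_fourierInv_eq _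
  rw [← Lp.norm_fourier_eq, sub_eq_add_neg, FourierTransform.fourier_add, FourierTransform.fourier_neg,
    ← sub_eq_add_neg, fourier_schr, e]
  refine Lp.norm_le_mul_norm_of_ae_le_mul ?_
  filter_upwards [Lp.coeFn_sub (chirp (-(4 * Real.pi ^ 2 * t)) (toL2 v)) (toL2 v),
    coeFn_chirp (-(4 * Real.pi ^ 2 * t)) (toL2 v), coeFn_toL2 h2, coeFn_toL2 hw] with ξ e1 e2 e3 e4
  rw [e1, Pi.sub_apply, e2, e3, e4]
  have h1 : phase (-(4 * Real.pi ^ 2 * t)) ξ * v ξ - v ξ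
      = (phase (-(4 * Real.pi ^ 2 * t)) ξ - 1) * v ξ := by ring
  rw [h1, norm_mul, norm_mul, ← mul_assoc]
  refine mul_le_mul_of_nonneg_right ?_ (norm_nonneg _)
  refine (Real.norm_exp_I_mul_ofReal_sub_one_le).trans (le_of_eq ?_)
  rw [norm_mul, norm_neg, Complex.norm_real, Real.norm_of_nonneg (by positivity),
    Real.norm_of_nonneg (by positivity)]

/-! ### Asymptotic solutions as corrections to the free evolution -/

/-- The spatial profile `û₊(-x/2) / √(4πi)`, as an element of `L²`. -/
def profileState (uP : ℝ → ℂ) : L2C := 𝓕⁻ (toL2 (profileFreq uP))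

theorem coeFn_profileState {uP : ℝ → ℂ} (h1 : MemLp uP 1 volume) (h2 : MemLp uP 2 volume) :
    profileState uP =ᵐ[volume] fun x => profileConst * hat uP (-x / 2) := by
  refine (coeFn_fourierInv_toL2 (memLp_one_iff_integrable.1 (memLp_profileFreq (by norm_num) h1))
    (memLp_profileFreq (by norm_num) h2)).trans (Eventually.of_forall fun x => ?_)
  exact fourierInv_profileFreq uP x

theorem enorm_profileState {uP : ℝ → ℂ} (h2 : MemLp uP 2 volume) :
    ‖profileState uP‖ₑ = eLpNorm uP 2 volume := by
  have h : ‖profileState uP‖ = ‖toL2 (profileFreq uP)‖ := by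
    rw [← Lp.norm_fourier_eq, profileState, FourierTransform.fourier_fourierInv_eq]
  rw [← ofReal_norm, h, ofReal_norm, enorm_toL2 (memLp_profileFreq (by norm_num) h2),
    eLpNorm_profileFreq_two]

theorem uProfile_sub_uSelf (σ a : ℝ) (uP : ℝ → ℂ) (t x : ℝ) :
    uProfile σ a uP t x - uSelf a t x
      = logPhase (σ * a ^ 2) t * (profileConst * hat uP (-x / 2)) := by
  unfold uProfile logPhase profileConst
  rw [add_sub_cancel_left]; ring

theorem coeFn_logPhase_smul_profileState {uP : ℝ → ℂ} (h1 : MemLp uP 1 volume)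
    (h2 : MemLp uP 2 volume) (σ a t : ℝ) :
    (logPhase (σ * a ^ 2) t • profileState uP : L2C) =ᵐ[volume] uProfile σ a uP t - uSelf a t := by
  filter_upwards [Lp.coeFn_smul (logPhase (σ * a ^ 2) t) (profileState uP),
    coeFn_profileState h1 h2] with x e1 e2
  rw [e1, Pi.smul_apply, e2, Pi.sub_apply, uProfile_sub_uSelf, smul_eq_mul]

theorem Decaying.congr {T : ℝ} {f g : ℝ → L2C} (hf : Decaying T f) (h : ∀ t ∈ Ioc 0 T, f t = g t) :
    Decaying T g := by
  obtain ⟨C, hC, t₀, ht₀, ht₀T, hd⟩ := hf.decay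
  have key : ∀ t ≤ T, ∫⁻ s in Ioc 0 t, supAv (g s) ^ 4 = ∫⁻ s in Ioc 0 t, supAv (f s) ^ 4 :=
    fun t ht => setLIntegral_congr_fun measurableSet_Ioc fun s hs => by
      rw [h s ⟨hs.1, hs.2.trans ht⟩]
  refine ⟨hf.cont.congr fun t ht => (h t ht).symm, by rw [key T le_rfl]; exact hf.fin,
    C, hC, t₀, ht₀, ht₀T, fun t ht => ?_⟩
  rw [key t (ht.2.trans ht₀T), ← h t ⟨ht.1, ht.2.trans ht₀T⟩]
  exact hd t ht

theorem MildOn.congr {σ s T : ℝ} {N N' W W' : ℝ → L2C} (h : MildOn σ s T N W)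
    (hN : ∀ τ ∈ Ioc s T, N τ = N' τ) (hW : ∀ τ ∈ Icc s T, W τ = W' τ) : MildOn σ s T N' W' := by
  intro t ht
  have h1 := h t ht
  rw [hW t ht, hW s ⟨le_rfl, ht.1.trans ht.2⟩] at h1
  rw [h1]
  congr 2
  refine intervalIntegral.integral_congr_ae (Eventually.of_forall fun τ hτ => ?_)
  rw [uIoc_of_le ht.1] at hτ
  rw [hN τ ⟨hτ.1, hτ.2.trans ht.2⟩]

/-- For a profile with frequency density in `L¹ ∩ L²(ξ⁴ dξ)`, the free evolution is at distance
`O(t^{1/4})` from the profile itself. -/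
theorem decaying_freeW_sub {T : ℝ} (hT : 0 < T) (α : ℝ) {v : ℝ → ℂ} (h1 : Integrable v)
    (h2 : MemLp v 2 volume) (hw : MemLp (fun ξ : ℝ => ((ξ ^ 2 : ℝ) : ℂ) * v ξ) 2 volume) :
    Decaying T fun t => freeW α (𝓕⁻ (toL2 v)) t - logPhase α t • 𝓕⁻ (toL2 v) := by
  set P : L2C := 𝓕⁻ (toL2 v) with hP
  set M : ℝ := ∫ ξ, ‖v ξ‖ with hM
  have hM0 : 0 ≤ M := integral_nonneg fun _ => norm_nonneg _
  have hMe : ∫⁻ ξ, ‖v ξ‖ₑ = ENNReal.ofReal M := (ofReal_integral_norm_eq_lintegral_enorm h1).symm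
  set K : ℝ := 4 * Real.pi ^ 2 * ‖toL2 (fun ξ : ℝ => ((ξ ^ 2 : ℝ) : ℂ) * v ξ)‖ with hK
  have hK0 : 0 ≤ K := by positivity
  have hsP : supAv P ≤ ENNReal.ofReal M := by
    have := supAv_schr_fourierInv_le (t := 0) h1 h2
    rwa [schr_zero, hMe] at this
  have hs : ∀ t, supAv (freeW α P t - logPhase α t • P) ≤ ENNReal.ofReal (2 * M) := by
    intro t
    rw [sub_eq_add_neg]
    refine (supAv_add_le _ _).trans ?_
    rw [supAv_neg, supAv_smul_of_norm_one (norm_logPhase α t), two_mul, ENNReal.ofReal_add hM0 hM0]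
    refine add_le_add ?_ hsP
    rw [← hMe]; exact supAv_freeW_le h1 h2 t
  have hs4 : ∀ t, 0 ≤ t → ∫⁻ s in Ioc 0 t, supAv (freeW α P s - logPhase α s • P) ^ 4
      ≤ ENNReal.ofReal ((2 * M) ^ 4 * t) := by
    intro t ht
    calc _ ≤ ∫⁻ _ in Ioc 0 t, ENNReal.ofReal (2 * M) ^ 4 :=
          lintegral_mono fun s => pow_le_pow_left₀ (zero_le) (hs s) 4
      _ = _ := by
          rw [setLIntegral_const, Real.volume_Ioc, sub_zero,
            ENNReal.ofReal_mul (p := (2 * M) ^ 4) (by positivity), ENNReal.ofReal_pow (by positivity)]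
  refine ⟨?_, (hs4 T hT.le).trans_lt ENNReal.ofReal_lt_top, K + 2 * M + 1, by positivity, min T 1,
    lt_min hT one_pos, min_le_left _ _, fun t ht => ⟨?_, ?_⟩⟩
  · exact ((continuousOn_freeW α P).sub ((continuousOn_logPhase α).smul continuousOn_const)).mono
      fun t ht => ht.1
  · have ht0 : 0 ≤ t := ht.1.le
    have hq : t ≤ t ^ (1 / 4 : ℝ) := by
      have := Real.rpow_le_rpow_of_exponent_ge ht.1 (ht.2.trans (min_le_right _ _))
        (by norm_num : (1 / 4 : ℝ) ≤ 1)
      rwa [Real.rpow_one] at this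
    have e : freeW α P t - logPhase α t • P = logPhase α t • (schr t P - P) := by
      rw [freeW, smul_sub]
    calc ‖freeW α P t - logPhase α t • P‖ = ‖schr t P - P‖ := by
          rw [e, norm_smul, norm_logPhase, one_mul]
      _ ≤ K * t := (norm_schr_sub_le h2 hw ht0).trans (le_of_eq (by rw [hK]; ring))
      _ ≤ (K + 2 * M + 1) * t ^ (1 / 4 : ℝ) := by
          gcongr
          linarith
  · have ht0 : 0 ≤ t := ht.1.le
    refine (hs4 t ht0).trans (ENNReal.ofReal_le_ofReal ?_)
    gcongr
    linarith

/-- An asymptotic solution is the same as a mild solution `W = u - u_a` of the perturbed equation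
whose distance to the free evolution of the profile is decaying. -/
theorem isAsymptoticSolution_iff {σ a T : ℝ} (hT : 0 < T) {uP : ℝ → ℂ} (h1 : MemLp uP 1 volume)
    (h2 : MemLp uP 2 volume) (hw : MemLp (fun x : ℝ => ((x ^ 2 : ℝ) : ℂ) * uP x) 2 volume)
    {u : ℝ → ℝ → ℂ} : IsAsymptoticSolution σ a T uP u ↔
      (∀ t ∈ Ioc 0 T, MemLp (u t - uSelf a t) 2 volume) ∧
      Decaying T (fun t => toL2 (u t - uSelf a t) - freeW (σ * a ^ 2) (profileState uP) t) ∧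
      ∀ s ∈ Ioc 0 T, MildOn σ s T (fun τ => nlin a τ (toL2 (u τ - uSelf a τ)))
        fun τ => toL2 (u τ - uSelf a τ) := by
  set P := profileState uP with hP
  set α := σ * a ^ 2 with hα
  have hv1 : Integrable (profileFreq uP) :=
    memLp_one_iff_integrable.1 (memLp_profileFreq (by norm_num) h1)
  have hv2 : MemLp (profileFreq uP) 2 volume := memLp_profileFreq (by norm_num) h2
  have he : Decaying T fun t => freeW α P t - logPhase α t • P :=
    decaying_freeW_sub hT α hv1 hv2 (memLp_sq_mul_profileFreq hw)
  have hprof : ∀ t, MemLp (uProfile σ a uP t - uSelf a t) 2 volume := fun t =>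
    (memLp_congr_ae (coeFn_logPhase_smul_profileState h1 h2 σ a t)).1 (Lp.memLp _)
  have hprofL : ∀ t, toL2 (uProfile σ a uP t - uSelf a t) = logPhase α t • P := fun t =>
    (eq_toL2 (coeFn_logPhase_smul_profileState h1 h2 σ a t)).symm
  have hsplit : ∀ t, u t - uSelf a t = (u t - uProfile σ a uP t) + (uProfile σ a uP t - uSelf a t) :=
    fun t => by abel
  have hmem : ∀ t, MemLp (u t - uProfile σ a uP t) 2 volume ↔ MemLp (u t - uSelf a t) 2 volume := by
    intro t
    refine ⟨fun h => by rw [hsplit]; exact h.add (hprof t), fun h => ?_⟩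
    have e : u t - uProfile σ a uP t = (u t - uSelf a t) - (uProfile σ a uP t - uSelf a t) := by abel
    rw [e]; exact h.sub (hprof t)
  have hval : ∀ t, MemLp (u t - uProfile σ a uP t) 2 volume →
      toL2 (u t - uSelf a t) = toL2 (u t - uProfile σ a uP t) + logPhase α t • P := fun t ht => by
    rw [hsplit, toL2_add ht (hprof t), hprofL]
  -- the equation in its weak and its mild form
  have heq : (∀ t ∈ Ioc 0 T, MemLp (u t - uSelf a t) 2 volume) →
      Decaying T (fun t => toL2 (u t - uSelf a t) - freeW α P t) →
      (IsWeakSolution σ a T u ↔ ∀ s ∈ Ioc 0 T, MildOn σ s T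
        (fun τ => nlin a τ (toL2 (u τ - uSelf a τ))) fun τ => toL2 (u τ - uSelf a τ)) := by
    intro hm hz
    have hWf : ContinuousOn (freeW α P) (Ioc 0 T) := (continuousOn_freeW α P).mono fun t ht => ht.1
    have hWc : ContinuousOn (fun t => toL2 (u t - uSelf a t)) (Ioc 0 T) :=
      (hWf.add hz.cont).congr fun t _ => (add_sub_cancel _ _).symm
    have hfin : ∫⁻ t in Ioc 0 T, supAv (toL2 (u t - uSelf a t)) ^ 4 < ⊤ := by
      have := lintegral_supAv_add_le (g := fun t => toL2 (u t - uSelf a t) - freeW α P t) hWf le_rfl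
      simp only [add_sub_cancel] at this
      refine this.trans_lt (ENNReal.mul_lt_top (by norm_num) (ENNReal.add_lt_top.2 ⟨?_, hz.fin⟩))
      calc ∫⁻ s in Ioc 0 T, supAv (freeW α P s) ^ 4
          ≤ ∫⁻ _ in Ioc 0 T, (∫⁻ ξ, ‖profileFreq uP ξ‖ₑ) ^ 4 :=
            lintegral_mono fun s => pow_le_pow_left₀ (zero_le) (supAv_freeW_le hv1 hv2 s) 4
        _ < ⊤ := by
            rw [setLIntegral_const]
            exact ENNReal.mul_lt_top (ENNReal.pow_lt_top hv1.2) (by simp)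
    have hae : ∀ t ∈ Ioc 0 T, nonlin a t (u t)
        =ᵐ[volume] nonlin a t (uSelf a t + ⇑(toL2 (u t - uSelf a t))) := by
      intro t ht
      filter_upwards [coeFn_toL2 (hm t ht)] with x hx
      unfold nonlin
      rw [Pi.add_apply, hx, Pi.sub_apply, add_sub_cancel]
    have hN : ∀ t ∈ Ioc 0 T, toL2 (nonlin a t (u t)) = nlin a t (toL2 (u t - uSelf a t)) :=
      fun t ht => toL2_congr (hae t ht)
    have hNi : ∀ s ∈ Ioc 0 T, IntegrableOn (fun t => toL2 (nonlin a t (u t))) (Ioc s T) := by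
      intro s hs
      refine (integrableOn_nlin (a := a) hs hWc hfin).congr_fun (fun t ht => ?_) measurableSet_Ioc
      exact (hN t ⟨hs.1.trans ht.1, ht.2⟩).symm
    have hNm : ∀ᵐ t ∂volume.restrict (Ioc 0 T), MemLp (nonlin a t (u t)) 2 volume := by
      filter_upwards [ae_supAv_ne_top hWc hfin.ne, ae_restrict_mem measurableSet_Ioc] with t h3 h4
      exact (memLp_congr_ae (hae t h4)).2 (memLp_nonlin h4.1 h3)
    rw [isWeakSolution_iff hm hWc hNm hNi]
    refine forall₂_congr fun s hs => ⟨fun h => ?_, fun h => ?_⟩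
    · refine (h.mildOn (hNi s hs) (hWc.mono fun t ht => ⟨hs.1.trans_le ht.1, ht.2⟩)).congr ?_
        fun _ _ => rfl
      exact fun t ht => hN t ⟨hs.1.trans ht.1, ht.2⟩
    · refine MildOn.weakOn (hNi s hs) (h.congr ?_ fun _ _ => rfl)
      exact fun t ht => (hN t ⟨hs.1.trans ht.1, ht.2⟩).symm
  constructor
  · intro h
    have hm : ∀ t ∈ Ioc 0 T, MemLp (u t - uSelf a t) 2 volume := fun t ht =>
      (hmem t).1 (h.memCL2.1 t ht)
    have hz : Decaying T fun t => toL2 (u t - uSelf a t) - freeW α P t := by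
      have hr : Decaying T fun t => toL2 (u t - uProfile σ a uP t) :=
        decaying_toL2 (r := u - uProfile σ a uP) hT h.memCL2 h.memL4Linf h.decay
      refine (hr.sub he).congr fun t ht => ?_
      rw [hval t (h.memCL2.1 t ht)]; abel
    exact ⟨hm, hz, (heq hm hz).1 h.solves⟩
  · rintro ⟨hm, hz, hmild⟩
    have hr : Decaying T fun t => toL2 ((u - uProfile σ a uP) t) := by
      refine (hz.add he).congr fun t ht => ?_
      rw [Pi.sub_apply, hval t ((hmem t).2 (hm t ht))]; abel
    obtain ⟨c1, c2, c3⟩ := hr.of_toL2 fun t ht => (hmem t).2 (hm t ht)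
    exact ⟨(heq hm hz).2 hmild, c1, c2, c3⟩

/-! ### Existence -/

theorem MildOn.add {σ s T : ℝ} {N N' W W' : ℝ → L2C} (hN : IntegrableOn N (Ioc s T) volume)
    (hN' : IntegrableOn N' (Ioc s T) volume) (h : MildOn σ s T N W) (h' : MildOn σ s T N' W') :
    MildOn σ s T (fun τ => N τ + N' τ) fun τ => W τ + W' τ := by
  intro t ht
  have hi : ∀ F : ℝ → L2C, IntegrableOn F (Ioc s T) volume →
      IntervalIntegrable (fun τ => schr (-τ) (F τ)) volume s t := fun F hF =>
    (intervalIntegrable_iff_integrableOn_Ioc_of_le ht.1).2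
      (integrable_schr_neg (hF.mono_set (Ioc_subset_Ioc_right ht.2)))
  simp only [map_add]
  rw [h t ht, h' t ht, intervalIntegral.integral_add (hi N hN) (hi N' hN'), smul_add]
  abel

theorem continuousOn_Ioc_of_Icc {T : ℝ} {Z : ℝ → L2C} (h : ∀ s, 0 < s → ContinuousOn Z (Icc s T)) :
    ContinuousOn Z (Ioc 0 T) := by
  intro t ht
  have h2 : 0 < t / 2 := half_pos ht.1
  refine ((h (t / 2) h2) t ⟨by linarith [ht.1], ht.2⟩).mono_of_mem_nhdsWithin ?_
  filter_upwards [mem_nhdsWithin_of_mem_nhds (Ioi_mem_nhds (half_lt_self ht.1)),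
    self_mem_nhdsWithin] with x hx hx'
  exact ⟨(mem_Ioi.1 hx).le, hx'.2⟩

theorem rpow_le_add_one {T r : ℝ} (hT : 0 < T) (hr : 0 ≤ r) (hr1 : r ≤ 1) : T ^ r ≤ T + 1 := by
  calc T ^ r ≤ (T + 1) ^ r := Real.rpow_le_rpow hT.le (by linarith) hr
    _ ≤ (T + 1) ^ (1 : ℝ) := Real.rpow_le_rpow_of_exponent_le (by linarith) hr1
    _ = T + 1 := Real.rpow_one _

/-- For a small profile there is a decaying correction to its free evolution that turns it into a
mild solution of the perturbed equation. The radius `R` is chosen such that `R (T + 1) = 1/24`, which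
makes the contraction factor small on `[0, T]`, and `δ` is small compared with `R`. -/
theorem exists_decaying_mildOn {σ a T R δ : ℝ} (hσ : |σ| = 1) (ha : 0 ≤ a) (ha0 : a ≤ 1 / 40)
    (hT : 0 < T) (hR : R = 1 / (24 * (T + 1))) (hδ : δ = R / (112 * (T + 1))) {v : ℝ → ℂ}
    (h1 : Integrable v) (h2 : MemLp v 2 volume) (hM : ∫ ξ, ‖v ξ‖ ≤ δ)
    (hm : ‖(𝓕⁻ (toL2 v) : L2C)‖ ≤ δ) : ∃ z : ℝ → L2C, Decaying T z ∧ ∀ s ∈ Ioc 0 T,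
      MildOn σ s T (fun τ => nlin a τ (freeW (σ * a ^ 2) (𝓕⁻ (toL2 v)) τ + z τ))
        fun τ => freeW (σ * a ^ 2) (𝓕⁻ (toL2 v)) τ + z τ := by
  set M : ℝ := ∫ ξ, ‖v ξ‖ with hMdef
  have hM0 : 0 ≤ M := integral_nonneg fun _ => norm_nonneg _
  have hMe : ∫⁻ ξ, ‖v ξ‖ₑ = ENNReal.ofReal M := (ofReal_integral_norm_eq_lintegral_enorm h1).symm
  set P : L2C := 𝓕⁻ (toL2 v) with hP
  set m : ℝ := ‖P‖ with hmdef
  have hm0 : 0 ≤ m := norm_nonneg _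
  have hR0 : 0 < R := by rw [hR]; positivity
  have hR1 : R ≤ 1 / 24 := by
    rw [hR]; exact one_div_le_one_div_of_le (by norm_num) (by linarith)
  have hRT : R * (T + 1) = 1 / 24 := by rw [hR]; field_simp
  have hδT : δ * (T + 1) = R / 112 := by rw [hδ]; field_simp
  have hδ0 : 0 ≤ δ := hM0.trans hM
  have hδR : δ ≤ R / 112 := by nlinarith
  have ha2 : a ^ 2 ≤ 1 / 1600 := by nlinarith
  set W : ℝ → L2C := freeW (σ * a ^ 2) P with hW
  have hWs : ∀ s, supAv (W s) ≤ ENNReal.ofReal M := fun s => by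
    rw [← hMe]; exact supAv_freeW_le h1 h2 s
  have hWm : ∀ s, ‖W s‖ = m := fun s => norm_freeW _ P s
  have hWc : ContinuousOn W (Ioi 0) := continuousOn_freeW _ P
  have hcc : ContinuousOn (fun s => conjTerm a s (W s)) (Ioi 0) := continuousOn_conjTerm a _ h1 h2
  obtain ⟨Z, hZ1, hZ2, hZ⟩ := exists_response (a := a) hσ (by linarith) h1 h2
  have hIcc : ∀ s, 0 < s → Icc s T ⊆ Ioi 0 := fun s hs x hx => hs.trans_le hx.1
  have hint : ∀ {F : ℝ → L2C}, ContinuousOn F (Ioi 0) → ∀ s, 0 < s →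
      IntegrableOn F (Ioc s T) volume := fun hF s hs =>
    ((hF.mono (hIcc s hs)).integrableOn_compact isCompact_Icc).mono_set Ioc_subset_Icc_self
  have hZc : ContinuousOn Z (Ioc 0 T) := continuousOn_Ioc_of_Icc fun s hs =>
    (hZ s T hs).continuousOn (hint hcc s hs)
  have hRRT : R ^ 2 * T ≤ 1 / 576 := by nlinarith
  have hMT : M ^ 2 * T ≤ R ^ 2 * T := by
    have : M ≤ R := by linarith
    gcongr
  obtain ⟨z, hzmem, hz⟩ := exists_correction (T := T) (R := R) hσ ha hM0 hR0 hT hWs hWm hWc hcc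
    (fun t ht => (hZ1 t ht).trans (by
      have : 144 * a ^ 2 * M ≤ R / 2 := by nlinarith
      gcongr))
    (fun t ht => (hZ2 t ht).trans (ENNReal.ofReal_le_ofReal (by nlinarith))) hZc
    (by linarith) (by
      have q1 := rpow_le_add_one (r := 1 / 4) hT (by norm_num) (by norm_num)
      have q2 := rpow_le_add_one (r := 3 / 4) hT (by norm_num) (by norm_num)
      have q3 : 6 * a * M ≤ 6 := by nlinarith
      have q4 : M ^ 2 ≤ 1 := by nlinarith
      calc 6 * a * M * m * T ^ (1 / 4 : ℝ) + M ^ 2 * m * T ^ (3 / 4 : ℝ)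
          ≤ 6 * δ * (T + 1) + 1 * δ * (T + 1) := by gcongr
        _ = R / 16 := by linarith)
  refine ⟨z, Decaying.of_mem_decaySet hT hR0 hzmem, fun s hs => ?_⟩
  have hs0 : 0 < s := hs.1
  have hsrc : IntegrableOn (fun s => source a W s (z s)) (Ioc 0 T) volume :=
    integrableOn_source ha hM0 hR0 hT hWs hWm hWc hcc hzmem
  have hlin : ContinuousOn (fun τ => ((a ^ 2 / τ : ℝ) : ℂ) • W τ) (Ioi 0) :=
    (continuousOn_ofReal_div (a ^ 2)).smul hWc
  have key := MildOn.add ((hint hlin s hs0).add (hint hcc s hs0)) (hsrc.mono_set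
      (Ioc_subset_Ioc_left hs0.le))
    (MildOn.add (hint hlin s hs0) (hint hcc s hs0) (mildOn_freeW σ a P hs0 T) (hZ s T hs0))
    (mildOn_duhamel σ hsrc hs0.le)
  refine key.congr (fun τ hτ => ?_) fun τ hτ => ?_
  · change ((a ^ 2 / τ : ℝ) : ℂ) • W τ + conjTerm a τ (W τ) + source a W τ (z τ) = _
    unfold source; abel
  · rw [← hz τ ⟨hs0.trans_le hτ.1, hτ.2⟩]; abel

/-! ### Behaviour as `t → 0⁺` -/

theorem Decaying.tendsto_zero {T : ℝ} {g : ℝ → L2C} (h : Decaying T g) :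
    Tendsto g (𝓝[>] 0) (𝓝 0) := by
  obtain ⟨C, hC, t₀, ht₀, -, hd⟩ := h.decay
  have h4 : Continuous fun s : ℝ => C * s ^ (1 / 4 : ℝ) :=
    continuous_const.mul (Real.continuous_rpow_const (by norm_num))
  have h5 := h4.tendsto 0
  rw [Real.zero_rpow (by norm_num), mul_zero] at h5
  refine squeeze_zero_norm' ?_ (h5.mono_left nhdsWithin_le_nhds)
  filter_upwards [Ioc_mem_nhdsGT ht₀] with t ht using (hd t ht).1

/-- A nonzero state multiplied by the logarithmic phase has no limit as `t → 0⁺`, since the phase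
changes sign under a suitable dilation of the time. -/
theorem eq_zero_of_tendsto_logPhase_smul {α : ℝ} (hα : α ≠ 0) {P F : L2C}
    (h : Tendsto (fun t => logPhase α t • P) (𝓝[>] 0) (𝓝 F)) : P = 0 := by
  set k : ℝ := Real.exp (Real.pi / α) with hk
  have hk0 : 0 < k := Real.exp_pos _
  have hdil : Tendsto (fun t : ℝ => k * t) (𝓝[>] 0) (𝓝[>] 0) := by
    refine tendsto_nhdsWithin_of_tendsto_nhds_of_eventually_within _ ?_ ?_
    · have h1 : Continuous fun t : ℝ => k * t := continuous_const.mul continuous_id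
      have h2 := h1.tendsto 0
      rw [mul_zero] at h2
      exact h2.mono_left nhdsWithin_le_nhds
    · filter_upwards [self_mem_nhdsWithin] with t ht
      exact mul_pos hk0 ht
  have hflip : ∀ t ∈ Ioi (0 : ℝ), logPhase α (k * t) • P = -(logPhase α t • P) := by
    intro t ht
    have h1 : α * Real.log (k * t) = Real.pi + α * Real.log t := by
      rw [Real.log_mul hk0.ne' (ne_of_gt ht), hk, Real.log_exp]; field_simp
    have h2 : logPhase α (k * t) = -logPhase α t := by
      unfold logPhase
      rw [h1, Complex.ofReal_add, mul_add, Complex.exp_add, mul_comm Complex.I (Real.pi : ℂ),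
        Complex.exp_pi_mul_I]
      ring
    rw [h2, neg_smul]
  have h1 : Tendsto (fun t => -(logPhase α t • P)) (𝓝[>] 0) (𝓝 F) :=
    (h.comp hdil).congr' (by filter_upwards [self_mem_nhdsWithin] with t ht using hflip t ht)
  have h2 : F = -F := tendsto_nhds_unique h1 h.neg
  have h3 : F = 0 := by
    have h5 : (2 : ℂ) • F = 0 := by rw [two_smul]; nth_rewrite 2 [h2]; exact add_neg_cancel F
    exact (smul_eq_zero.1 h5).resolve_left two_ne_zero
  have h4 := h.norm
  simp only [norm_smul, norm_logPhase, one_mul, h3, norm_zero] at h4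
  exact norm_eq_zero.1 (tendsto_nhds_unique tendsto_const_nhds h4)

/-- The Cauchy–Schwarz inequality for `|w|² - |f|² = (|w| - |f|)(|w| + |f|)`. -/
theorem eLpNorm_sq_sub_sq_le {w f : ℝ → ℂ} (hw : AEStronglyMeasurable w volume)
    (hf : AEStronglyMeasurable f volume) : eLpNorm (fun x => ‖w x‖ ^ 2 - ‖f x‖ ^ 2) 1 volume
      ≤ eLpNorm (w - f) 2 volume * (eLpNorm w 2 volume + eLpNorm f 2 volume) := by
  calc eLpNorm (fun x => ‖w x‖ ^ 2 - ‖f x‖ ^ 2) 1 volume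
      ≤ eLpNorm ((w - f) • fun x => ((‖w x‖ + ‖f x‖ : ℝ) : ℂ)) 1 volume := by
        refine eLpNorm_mono fun x => ?_
        have h0 : 0 ≤ ‖w x‖ + ‖f x‖ := by positivity
        have h1 : ‖w x‖ ^ 2 - ‖f x‖ ^ 2 = (‖w x‖ - ‖f x‖) * (‖w x‖ + ‖f x‖) := by ring
        rw [Pi.smul_apply', smul_eq_mul, norm_mul, Complex.norm_real, Real.norm_of_nonneg h0, h1,
          norm_mul, Real.norm_of_nonneg h0]
        exact mul_le_mul_of_nonneg_right (abs_norm_sub_norm_le _ _) h0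
    _ ≤ eLpNorm (w - f) 2 volume * eLpNorm (fun x => ((‖w x‖ + ‖f x‖ : ℝ) : ℂ)) 2 volume :=
        eLpNorm_smul_le_mul_eLpNorm (p := 2) (q := 2) (r := 1)
          (Complex.continuous_ofReal.comp_aestronglyMeasurable (hw.norm.add hf.norm)) (hw.sub hf)
    _ ≤ _ := by
        gcongr
        have h1 : eLpNorm (fun x => ((‖w x‖ + ‖f x‖ : ℝ) : ℂ)) 2 volume
            = eLpNorm ((fun x => ‖w x‖) + fun x => ‖f x‖) 2 volume := by
          refine eLpNorm_congr_norm_ae (Eventually.of_forall fun x => ?_)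
          simp only [Complex.norm_real, Pi.add_apply]
        rw [h1]
        refine (eLpNorm_add_le hw.norm hf.norm (by norm_num)).trans (le_of_eq ?_)
        rw [eLpNorm_norm, eLpNorm_norm]

/-! ### Asymptotic solutions: existence, uniqueness and asymptotics -/

theorem toL2_perturbation (a t : ℝ) (W : L2C) :
    toL2 ((fun x => uSelf a t x + W x) - uSelf a t) = W := by
  rw [← toL2_coe W]
  congr 1
  ext x
  rw [Pi.sub_apply, add_sub_cancel_left, toL2_coe]

theorem exists_isAsymptoticSolution {σ a T R δ : ℝ} (hσ : |σ| = 1) (ha : 0 ≤ a) (ha0 : a ≤ 1 / 40)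
    (hT : 0 < T) (hR : R = 1 / (24 * (T + 1))) (hδ : δ = R / (112 * (T + 1))) {uP : ℝ → ℂ}
    (h1 : MemLp uP 1 volume) (h2 : MemLp uP 2 volume)
    (hsmall : eLpNorm uP 1 volume + eLpNorm uP 2 volume < ENNReal.ofReal δ)
    (hw : MemLp (fun x : ℝ => ((x ^ 2 : ℝ) : ℂ) * uP x) 2 volume) :
    ∃ u : ℝ → ℝ → ℂ, IsAsymptoticSolution σ a T uP u := by
  have hδ0 : 0 ≤ δ := by rw [hδ, hR]; positivity
  have hv1 : Integrable (profileFreq uP) :=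
    memLp_one_iff_integrable.1 (memLp_profileFreq (by norm_num) h1)
  have hv2 : MemLp (profileFreq uP) 2 volume := memLp_profileFreq (by norm_num) h2
  have hM : ∫ ξ, ‖profileFreq uP ξ‖ ≤ δ := by
    rw [← ENNReal.ofReal_le_ofReal_iff hδ0, ofReal_integral_norm_eq_lintegral_enorm hv1,
      ← eLpNorm_one_eq_lintegral_enorm]
    exact (eLpNorm_profileFreq_one_le uP).trans (le_self_add.trans hsmall.le)
  have hm : ‖profileState uP‖ ≤ δ := by
    rw [← ENNReal.ofReal_le_ofReal_iff hδ0, ofReal_norm, enorm_profileState h2]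
    exact le_add_self.trans hsmall.le
  obtain ⟨z, hz, hmild⟩ := exists_decaying_mildOn hσ ha ha0 hT hR hδ hv1 hv2 hM hm
  refine ⟨fun t x => uSelf a t x + (freeW (σ * a ^ 2) (profileState uP) t + z t : L2C) x,
    (isAsymptoticSolution_iff hT h1 h2 hw).2 ?_⟩
  simp only [toL2_perturbation, add_sub_cancel_left]
  refine ⟨fun t _ => ?_, hz, hmild⟩
  have e : ((fun x => uSelf a t x + (freeW (σ * a ^ 2) (profileState uP) t + z t : L2C) x)
      - uSelf a t) = (freeW (σ * a ^ 2) (profileState uP) t + z t : L2C) := by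
    ext x
    rw [Pi.sub_apply, add_sub_cancel_left]
  rw [e]
  exact Lp.memLp _

theorem IsAsymptoticSolution.unique {σ a T : ℝ} (hσ : |σ| = 1) (ha0 : 28 * a ^ 2 ≤ 1 / 16)
    (hT : 0 < T) {uP : ℝ → ℂ} (h1 : MemLp uP 1 volume) (h2 : MemLp uP 2 volume)
    (hw : MemLp (fun x : ℝ => ((x ^ 2 : ℝ) : ℂ) * uP x) 2 volume) {u u' : ℝ → ℝ → ℂ}
    (hu : IsAsymptoticSolution σ a T uP u) (hu' : IsAsymptoticSolution σ a T uP u') :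
    ∀ t ∈ Ioc 0 T, u' t =ᵐ[volume] u t := by
  have hv1 : Integrable (profileFreq uP) :=
    memLp_one_iff_integrable.1 (memLp_profileFreq (by norm_num) h1)
  have hv2 : MemLp (profileFreq uP) 2 volume := memLp_profileFreq (by norm_num) h2
  obtain ⟨m, hz, hE⟩ := (isAsymptoticSolution_iff hT h1 h2 hw).1 hu
  obtain ⟨m', hz', hE'⟩ := (isAsymptoticSolution_iff hT h1 h2 hw).1 hu'
  have key := eqOn_of_mildOn (a := a) (M := ∫ ξ, ‖profileFreq uP ξ‖) hσ
    (integral_nonneg fun _ => norm_nonneg _) ha0 (fun s => by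
      rw [ofReal_integral_norm_eq_lintegral_enorm hv1]
      exact supAv_freeW_le hv1 hv2 s) (continuousOn_freeW (σ * a ^ 2) (profileState uP)) hz hz'
    (by simpa only [add_sub_cancel] using hE) (by simpa only [add_sub_cancel] using hE')
  intro t ht
  have h := sub_left_inj.1 (key t ht)
  filter_upwards [coeFn_toL2 (m t ht), coeFn_toL2 (m' t ht)] with x e1 e2
  rw [h, e2] at e1
  exact sub_left_inj.1 e1

/-- The correction `u - u_a - e^{iσa² log t} P` to the profile is decaying. -/
theorem IsAsymptoticSolution.decaying {σ a T : ℝ} (hT : 0 < T) {uP : ℝ → ℂ}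
    (h1 : MemLp uP 1 volume) (h2 : MemLp uP 2 volume)
    (hw : MemLp (fun x : ℝ => ((x ^ 2 : ℝ) : ℂ) * uP x) 2 volume) {u : ℝ → ℝ → ℂ}
    (hu : IsAsymptoticSolution σ a T uP u) : (∀ t ∈ Ioc 0 T, MemLp (u t - uSelf a t) 2 volume) ∧
      Decaying T fun t => toL2 (u t - uSelf a t) - logPhase (σ * a ^ 2) t • profileState uP := by
  obtain ⟨m, hz, -⟩ := (isAsymptoticSolution_iff hT h1 h2 hw).1 hu
  have he : Decaying T fun t => freeW (σ * a ^ 2) (profileState uP) t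
      - logPhase (σ * a ^ 2) t • profileState uP :=
    decaying_freeW_sub hT _ (memLp_one_iff_integrable.1 (memLp_profileFreq (by norm_num) h1))
      (memLp_profileFreq (by norm_num) h2) (memLp_sq_mul_profileFreq hw)
  exact ⟨m, (hz.add he).congr fun t _ => sub_add_sub_cancel _ _ _⟩

theorem IsAsymptoticSolution.isBigOZero_norm {σ a T : ℝ} (hT : 0 < T) {uP : ℝ → ℂ}
    (h1 : MemLp uP 1 volume) (h2 : MemLp uP 2 volume)
    (hw : MemLp (fun x : ℝ => ((x ^ 2 : ℝ) : ℂ) * uP x) 2 volume) {u : ℝ → ℝ → ℂ}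
    (hu : IsAsymptoticSolution σ a T uP u) :
    IsBigOZero (fun t => eLpNorm (u t - uSelf a t) 2 volume) 0 := by
  obtain ⟨m, hd⟩ := hu.decaying hT h1 h2 hw
  obtain ⟨C, hC⟩ := hd.isBigOZero_norm
  refine ⟨C + ‖profileState uP‖₊, ?_⟩
  filter_upwards [hC, Ioc_mem_nhdsGT hT, Ioc_mem_nhdsGT one_pos] with t ht htT ht1
  have e1 : ENNReal.ofReal (t ^ (1 / 4 : ℝ)) ≤ 1 := by
    rw [ENNReal.ofReal_le_one]
    exact Real.rpow_le_one ht1.1.le ht1.2 (by norm_num)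
  have e2 : ‖logPhase (σ * a ^ 2) t • profileState uP‖ₑ = ‖profileState uP‖ₑ := by
    rw [← ofReal_norm, norm_smul, norm_logPhase, one_mul, ofReal_norm]
  rw [Real.rpow_zero, ENNReal.ofReal_one, mul_one, ← enorm_toL2 (m t htT), ENNReal.coe_add]
  calc ‖toL2 (u t - uSelf a t)‖ₑ
      = ‖(toL2 (u t - uSelf a t) - logPhase (σ * a ^ 2) t • profileState uP)
        + logPhase (σ * a ^ 2) t • profileState uP‖ₑ := by rw [sub_add_cancel]
    _ ≤ C * 1 + ‖profileState uP‖ₑ := by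
        refine (enorm_add_le _ _).trans (add_le_add (ht.trans ?_) e2.le)
        gcongr
    _ = _ := by rw [mul_one]; rfl

/-- The spatial density converges, although the perturbation itself does not: the logarithmic phase
has modulus one. -/
theorem IsAsymptoticSolution.isBigOZero_density {σ a T : ℝ} (hT : 0 < T) {uP : ℝ → ℂ}
    (h1 : MemLp uP 1 volume) (h2 : MemLp uP 2 volume)
    (hw : MemLp (fun x : ℝ => ((x ^ 2 : ℝ) : ℂ) * uP x) 2 volume) {u : ℝ → ℝ → ℂ}
    (hu : IsAsymptoticSolution σ a T uP u) :
    IsBigOZero (fun t => eLpNorm (fun x : ℝ => ‖u t x - uSelf a t x‖ ^ 2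
      - 1 / (4 * Real.pi) * ‖hat uP (-x / 2)‖ ^ 2) 1 volume) (1 / 4) := by
  obtain ⟨m, hd⟩ := hu.decaying hT h1 h2 hw
  obtain ⟨C, hC⟩ := hd.isBigOZero_norm
  obtain ⟨D, hD⟩ := hu.isBigOZero_norm hT h1 h2 hw
  refine ⟨C * (D + ‖profileState uP‖₊), ?_⟩
  filter_upwards [hC, hD, Ioc_mem_nhdsGT hT] with t ht ht' htT
  set f : L2C := logPhase (σ * a ^ 2) t • profileState uP with hf
  have e2 : ‖f‖ₑ = ‖profileState uP‖ₑ := by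
    rw [← ofReal_norm, hf, norm_smul, norm_logPhase, one_mul, ofReal_norm]
  have e3 : (fun x : ℝ => ‖u t x - uSelf a t x‖ ^ 2 - 1 / (4 * Real.pi) * ‖hat uP (-x / 2)‖ ^ 2)
      =ᵐ[volume] fun x => ‖(u t - uSelf a t) x‖ ^ 2 - ‖f x‖ ^ 2 := by
    filter_upwards [Lp.coeFn_smul (logPhase (σ * a ^ 2) t) (profileState uP),
      coeFn_profileState h1 h2] with x e1 e2
    rw [hf, e1, Pi.smul_apply, e2, norm_smul, norm_logPhase, one_mul, norm_mul, mul_pow,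
      norm_profileConst_sq, Pi.sub_apply]
  have e4 : eLpNorm (u t - uSelf a t - ⇑f) 2 volume = ‖toL2 (u t - uSelf a t) - f‖ₑ := by
    rw [← enorm_toL2_sub (m t htT) (Lp.memLp f), toL2_coe]
  rw [Real.rpow_zero, ENNReal.ofReal_one, mul_one] at ht'
  rw [eLpNorm_congr_ae e3]
  refine (eLpNorm_sq_sub_sq_le (m t htT).1 (Lp.aestronglyMeasurable f)).trans ?_
  rw [e4, enorm_coe, e2]
  calc _ ≤ (C * ENNReal.ofReal (t ^ (1 / 4 : ℝ))) * (D + ‖profileState uP‖ₑ) := by gcongr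
    _ = _ := by
      rw [ENNReal.coe_mul, ENNReal.coe_add]
      change _ = (C : ℝ≥0∞) * (D + ‖profileState uP‖ₑ) * _
      ring

/-- If the perturbation had a limit, so would `e^{iσa² log t} P`, which forces `P = 0`. -/
theorem IsAsymptoticSolution.ae_eq_zero_of_tendsto {σ a T : ℝ} (hα : σ * a ^ 2 ≠ 0) (hT : 0 < T)
    {uP : ℝ → ℂ} (h1 : MemLp uP 1 volume) (h2 : MemLp uP 2 volume)
    (hw : MemLp (fun x : ℝ => ((x ^ 2 : ℝ) : ℂ) * uP x) 2 volume) {u : ℝ → ℝ → ℂ}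
    (hu : IsAsymptoticSolution σ a T uP u) {f : ℝ → ℂ} (hf : MemLp f 2 volume)
    (h : Tendsto (fun t => eLpNorm (u t - uSelf a t - f) 2 volume) (𝓝[>] 0) (𝓝 0)) :
    uP =ᵐ[volume] 0 := by
  obtain ⟨m, hd⟩ := hu.decaying hT h1 h2 hw
  have hlim : Tendsto (fun t => toL2 (u t - uSelf a t)) (𝓝[>] 0) (𝓝 (toL2 f)) := by
    rw [tendsto_iff_edist_tendsto_0]
    refine h.congr' ?_
    filter_upwards [Ioc_mem_nhdsGT hT] with t ht
    rw [edist_eq_enorm_sub, enorm_toL2_sub (m t ht) hf]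
  have h3 : Tendsto (fun t => logPhase (σ * a ^ 2) t • profileState uP) (𝓝[>] 0) (𝓝 (toL2 f)) := by
    have := hlim.sub hd.tendsto_zero
    simpa only [sub_sub_cancel, sub_zero] using this
  have hP := eq_zero_of_tendsto_logPhase_smul hα h3
  have h4 := enorm_profileState h2
  rw [hP, enorm_zero] at h4
  exact (eLpNorm_eq_zero_iff h2.1 (by norm_num)).1 h4.symm

end NLSDelta

end

/-- The sign of the equation is `σ = ±1`, `T` is the final time, and `uP` is the asymptotic
state `u₊`. -/
theorem corollary1p3 (σ : ℝ) (hσ : σ = 1 ∨ σ = -1) (T : ℝ) (hT : 0 < T) :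
    ∃ a₀ : ℝ, 0 < a₀ ∧ ∃ δ : ℝ, 0 < δ ∧
      ∀ a : ℝ, 0 < a → a < a₀ →
      ∀ uP : ℝ → ℂ, MemLp uP 1 volume → MemLp uP 2 volume →
        eLpNorm uP 1 volume + eLpNorm uP 2 volume < ENNReal.ofReal δ →
        MemLp (fun x : ℝ => ((x ^ 2 : ℝ) : ℂ) * uP x) 2 volume →
        ∃ u : ℝ → ℝ → ℂ,
          NLSDelta.IsAsymptoticSolution σ a T uP u ∧
          (∀ u' : ℝ → ℝ → ℂ, NLSDelta.IsAsymptoticSolution σ a T uP u' →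
            ∀ t ∈ Ioc 0 T, u' t =ᵐ[volume] u t) ∧
          NLSDelta.IsBigOZero (fun t => eLpNorm (fun x : ℝ =>
            ‖u t x - NLSDelta.uSelf a t x‖ ^ 2
              - 1 / (4 * Real.pi) * ‖NLSDelta.hat uP (-x / 2)‖ ^ 2) 1 volume) (1 / 4) ∧
          NLSDelta.IsBigOZero (fun t => eLpNorm (u t - NLSDelta.uSelf a t) 2 volume) 0 ∧
          (¬ uP =ᵐ[volume] 0 →
            ¬ ∃ f : ℝ → ℂ, MemLp f 2 volume ∧
              Tendsto (fun t => eLpNorm (u t - NLSDelta.uSelf a t - f) 2 volume)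
                (𝓝[>] 0) (𝓝 0)) := by
  have hσ1 : |σ| = 1 := by rcases hσ with h | h <;> simp [h]
  have hσ0 : σ ≠ 0 := by rcases hσ with h | h <;> simp [h]
  obtain ⟨R, hR⟩ : ∃ R : ℝ, R = 1 / (24 * (T + 1)) := ⟨_, rfl⟩
  obtain ⟨δ, hδ⟩ : ∃ δ : ℝ, δ = R / (112 * (T + 1)) := ⟨_, rfl⟩
  refine ⟨1 / 40, by norm_num, δ, by rw [hδ, hR]; positivity,
    fun a ha ha0 uP h1 h2 hsmall hw => ?_⟩
  obtain ⟨u, hu⟩ := NLSDelta.exists_isAsymptoticSolution hσ1 ha.le ha0.le hT hR hδ h1 h2 hsmall hw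
  refine ⟨u, hu, fun u' hu' => hu.unique hσ1 (by nlinarith) hT h1 h2 hw hu',
    hu.isBigOZero_density hT h1 h2 hw, hu.isBigOZero_norm hT h1 h2 hw, ?_⟩
  rintro hne ⟨f, hf, hlim⟩
  exact hne (hu.ae_eq_zero_of_tendsto (mul_ne_zero hσ0 (by positivity)) hT h1 h2 hw hf hlim)
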